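/- Let $T$ be an oriented planar diagram of a 1-string link (one strand, running from the bottom to the top), and let $K$ be the knot diagram obtained by closing $T$, on either side, without new crossings. Regard $T$ as a planar graph whose vertices are the crossings. Put $t=q^{-2}$, $t^{1/2}=q^{-1}$ and $\bar q=q^{-1}$, $\bar t=t^{-1}$. Let $J(K)\in\mathbb Z[q^{\pm1}]$ be the Jones polynomial, normalized by $J(\text{unknot})=q+\bar q$ and $\bar t J(K_+)-tJ(K_-)=(\bar t^{1/2}-t^{1/2})J(K_0)$. *Random walks.* A ball travels along the edges of $T$ in their directions. In the jump-up model, a ball arriving at a crossing of sign $\epsilon$ on the under-crossing strand either stays on it (weight $t^{\epsilon}$) or jumps up to the outgoing over-crossing edge (weight $1-t^{\epsilon}$), and on the over-crossing strand it goes straight on (weight $1$). In the jump-down model the roles of the over- and under-crossing strands are exchanged. A simple family of cycles is a finite nonempty set of cycles of the walk such that no edge of $T$ is travelled more than once by the whole family. Let $\mathcal Q^t$ and $\mathcal Q^t_*$ be the (finite) sets of simple families in the jump-up and the jump-down model. (A cycle never contains the initial or the terminal edge of $T$.) For a simple family $c$ let $W(c)$ be the product of the weights of all its transitions; let $\mathrm{rot}(c)$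 be the sum of the rotation numbers (Whitney indices) of its cycles, where a counterclockwise circle has rotation number $1$; and let $\beta(c)$ be the sum of the signs of the crossings all of whose four incident edges are travelled by $c$. We write $\beta=\beta_1$ for the jump-up and $\beta=\beta_0$ for the jump-down model. Let $\omega(T)$ be the writhe of $T$, and $\mathrm{rot}(T)$ the sum of the rotation numbers of the circles (not of the arc) obtained by smoothing all crossings of $T$ compatibly with the orientation. **Theorem.** For every such $T$, $$\frac{J(K)}{q+\bar q}=t^{\frac{\omega(T)-\mathrm{rot}(T)}2}\Bigl(1+\sum_{c\in\mathcal Q^t}t^{\,\mathrm{rot}(c)-\beta_1(c)}W(c)\Bigr)=t^{\frac{\omega(T)+\mathrm{rot}(T)}2}\Bigl(1+\sum_{c\in\mathcal Q^t_*}\bar t^{\;\mathrm{rot}(c)+\beta_0(c)}W(c)\Bigr).$$ Suppose moreover that $\omega(T)=0$. For $m\ge0$ let $T^m$ and $K^m$ be the blackboard (hence zero-framing) $m$-cables, obtained by replacing every strand by $m$ parallel strands with parallel orientations, with $J(K^0)=1$. For $d\ge 0$ let $$J(K,V_{d+1})=\sum_{j=0}^{\lfloor d/2\rfloor}(-1)^j\binom{d-j}{j}J(K^{d-2j})$$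 be the colored Jones polynomial, and let $[d+1]=q^{d}+q^{d-2}+\dots+q^{-d}$. Define $\omega(T^d)$ (which is $0$), $\mathrm{rot}(T^d)$ (the $d$ arcs being left out), the random walks, and the sets $\mathcal Q^t(T^d)$, $\mathcal Q^t_*(T^d)$ of simple families of cycles on $T^d$ as above. Then for every $d\ge0$ $$\frac{J(K,V_{d+1})}{[d+1]}=t^{\frac{\omega(T^d)-\mathrm{rot}(T^d)}2}\Bigl(1+\sum_{c\in\mathcal Q^t(T^d)}t^{\,\mathrm{rot}(c)-\beta_1(c)}W(c)\Bigr)=t^{\frac{\omega(T^d)+\mathrm{rot}(T^d)}2}\Bigl(1+\sum_{c\in\mathcal Q^t_*(T^d)}\bar t^{\;\mathrm{rot}(c)+\beta_0(c)}W(c)\Bigr).$$ -/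

import Mathlib

/-!
Oriented link and tangle diagrams in the plane are presented in general position with respect
to the height function: a diagram is a word of horizontal layers, each containing exactly one
local minimum, local maximum or crossing, and vertical strands otherwise. Up to planar isotopy
every diagram is of this form. Strand directions are recorded by booleans, `true` meaning
"directed upwards". Crossings with all choices of directions are allowed.
-/

namespace KnotWalk

open LaurentPolynomial

/-- The elementary pieces. `cup o` is a local minimum whose left leg has direction `o`; `cap o` is
a local maximum whose left leg has direction `o`; `cross a b fwd` is a crossing of the strand from
bottom left to top right, with direction `a`, and the strand from bottom right to top left, with
direction `b`; the former is the over-crossing strand iff `fwd = true`. -/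
inductive Piece where
  | cup (o : Bool) : Piece
  | cap (o : Bool) : Piece
  | cross (a b fwd : Bool) : Piece

/-- Directions of the strands at the bottom of a piece, from left to right. -/
def Piece.dom : Piece → List Bool
  | .cup _ => []
  | .cap o => [o, !o]
  | .cross a b _ => [a, b]

/-- Directions of the strands at the top of a piece, from left to right. -/
def Piece.cod : Piece → List Bool
  | .cup o => [o, !o]
  | .cap _ => []
  | .cross a b _ => [b, a]

/-- A layer: vertical strands to the left, one piece, vertical strands to the right. -/
structure Layer where
  left : List Bool
  piece : Piece
  right : List Bool

def Layer.dom (L : Layer) : List Bool := L.left ++ L.piece.dom ++ L.right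

def Layer.cod (L : Layer) : List Bool := L.left ++ L.piece.cod ++ L.right

/-- A word of layers, listed from bottom to top, above a bottom boundary. -/
structure Diagram where
  bottom : List Bool
  layers : List Layer

/-- The layers can be stacked on each other, from the boundary `a` to the boundary `b`. -/
def Composable : List Bool → List Layer → List Bool → Prop
  | a, [], b => a = b
  | a, L :: Ls, b => L.dom = a ∧ Composable L.cod Ls b

/-- A point where a diagram meets one of the horizontal lines separating its layers: the number of
the line (counted from the bottom), the position on that line (counted from the left), and the
direction of the strand there. These points cut the edges of the diagram (regarded as a
4-valent planar graph with vertices the crossings) into segments; every edge carries at least one of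
them. -/
abbrev Pt := ℕ × ℕ × Bool

/-- The strand through `x` (below or to the left) and `y`, travelled from `x` to `y` iff `o`. -/
def orient (o : Bool) (x y : Pt) : Pt × Pt := if o then (x, y) else (y, x)

/-- A crossing, given by the points nearest to it on the incoming and outgoing ends of the over- and
under-crossing strand, and by its sign. -/
structure Crossing where
  overIn : Pt
  overOut : Pt
  underIn : Pt
  underOut : Pt
  positive : Bool

def Crossing.sign (c : Crossing) : ℤ := if c.positive then 1 else -1

/-- The crossing-free strands of the layer number `k`, as pairs (first point, last point). -/
def Layer.links (L : Layer) (k : ℕ) : List (Pt × Pt) :=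
  (L.left.zipIdx.map fun x => orient x.1 (k, x.2, x.1) (k + 1, x.2, x.1)) ++
  (L.right.zipIdx.map fun x =>
    orient x.1 (k, L.left.length + L.piece.dom.length + x.2, x.1)
      (k + 1, L.left.length + L.piece.cod.length + x.2, x.1)) ++
  match L.piece with
  | .cup o => [orient o (k + 1, L.left.length + 1, !o) (k + 1, L.left.length, o)]
  | .cap o => [orient o (k, L.left.length, o) (k, L.left.length + 1, !o)]
  | .cross _ _ _ => []

/-- The crossing of the layer number `k`, if there is one. -/
def Layer.crossings (L : Layer) (k : ℕ) : List Crossing :=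
  match L.piece with
  | .cross a b fwd =>
    let ne := orient a (k, L.left.length, a) (k + 1, L.left.length + 1, a)
    let nw := orient b (k, L.left.length + 1, b) (k + 1, L.left.length, b)
    let o := if fwd then ne else nw
    let u := if fwd then nw else ne
    [⟨o.1, o.2, u.1, u.2, fwd == (a == b)⟩]
  | _ => []

namespace Diagram

def links (D : Diagram) : List (Pt × Pt) := D.layers.zipIdx.flatMap fun x => x.1.links x.2

def crossings (D : Diagram) : List Crossing := D.layers.zipIdx.flatMap fun x => x.1.crossings x.2

/-- All points of the diagram on the horizontal lines. -/
def points (D : Diagram) : Finset Pt :=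
  ((D.bottom :: D.layers.map Layer.cod).zipIdx.flatMap fun x =>
    x.1.zipIdx.map fun y => ((x.2, y.2, y.1) : Pt)).toFinset

abbrev Point (D : Diagram) := {p : Pt // p ∈ D.points}

/-- Following the underlying curve of the diagram in its direction, straight through crossings. -/
def StrandStep (D : Diagram) (x y : Pt) : Prop :=
  (x, y) ∈ D.links ∨
  ∃ c ∈ D.crossings, (x, y) = (c.overIn, c.overOut) ∨ (x, y) = (c.underIn, c.underOut)

/-- `D` is a diagram of a 1-string link: it has one bottom and one top end, both directed upwards,
and consists of a single strand. -/
def IsStringLink (D : Diagram) : Prop :=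
  D.bottom = [true] ∧ Composable D.bottom D.layers [true] ∧
  ∀ p ∈ D.points, Relation.ReflTransGen D.StrandStep (0, 0, true) p

/-- The writhe `ω`. -/
def writhe (D : Diagram) : ℤ := (D.crossings.map Crossing.sign).sum

/-! ### Closed curves and rotation numbers -/

/-- Cyclic sequences of pairwise distinct points of a diagram. -/
abbrev ClosedCurve (D : Diagram) := {γ : Cycle D.Point // γ.Nodup}

/-- `γ` is nonempty and each of its points is followed by a point related to it by `r`. -/
def Follows {D : Diagram} (r : Pt → Pt → Prop) (γ : D.ClosedCurve) : Prop :=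
  γ.1 ≠ Cycle.nil ∧ γ.1.Chain fun x y => r x.1 y.1

/-- The number of counterclockwise half turns (`1`, `0` or `-1`) made by the tangent direction on the
way from the point `x` to the next point `y` inside one layer. There is no turn if `x` and `y` lie on
different lines. If they lie on the same line, then going up at `x` and coming back down to the right
of `x`, or going down and coming back up to the left of `x`, is a clockwise half turn; the two
other cases are counterclockwise. -/
def halfTurns (x y : Pt) : ℤ :=
  if x.1 ≠ y.1 then 0
  else if x.2.2 = decide (x.2.1 < y.2.1) then -1 else 1

/-- The rotation number (Whitney index) of a closed curve, counterclockwise circles having rotation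
number `1`. The number of half turns is even for the closed curves considered below. -/
def rotCurve {D : Diagram} (γ : D.ClosedCurve) : ℤ :=
  (∑ x : D.Point, if h : x ∈ γ.1 then halfTurns x.1 (γ.1.next γ.2 x h).1 else 0) / 2

/-- Travelling along the diagram after all its crossings have been smoothed according to the
directions of the strands. -/
def SmoothedStep (D : Diagram) (x y : Pt) : Prop :=
  (x, y) ∈ D.links ∨
  ∃ c ∈ D.crossings, (x, y) = (c.overIn, c.underOut) ∨ (x, y) = (c.underIn, c.overOut)

open Classical in
/-- `rot(D)`: the sum of the rotation numbers of the circles (not of the arcs) obtained by smoothing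
all crossings. -/
noncomputable def rot (D : Diagram) : ℤ :=
  ∑ γ ∈ Finset.univ.filter (fun γ : D.ClosedCurve => Follows D.SmoothedStep γ), rotCurve γ

/-! ### Powers of the variables -/

end Diagram

/-- `t ^ (n / 2)`, where `t = q⁻²` and `t ^ (1 / 2) = q⁻¹`, in `ℤ[q, q⁻¹]`. -/
noncomputable def tHalfPow (n : ℤ) : ℤ[T;T⁻¹] := T (-n)

/-- `t ^ n`, where `t = q⁻²`. -/
noncomputable def tPow (n : ℤ) : ℤ[T;T⁻¹] := T (-2 * n)

/-- The quantum integer `[n] = q ^ (n - 1) + q ^ (n - 3) + ⋯ + q ^ (1 - n)`. -/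
noncomputable def quantumInt (n : ℕ) : ℤ[T;T⁻¹] :=
  ∑ i ∈ Finset.range n, T ((n : ℤ) - 1 - 2 * (i : ℤ))

namespace Diagram

/-! ### The random walk -/

/-- The two models of random walk: jump-up and jump-down. -/
inductive Model where
  | up : Model
  | down : Model

/-- The transitions of the random walk with their weights. In the jump-up model, a ball arriving at
a crossing of sign `ε` on the under-crossing strand stays on it with weight `t ^ ε` or jumps up to the
over-crossing strand with weight `1 - t ^ ε`, while there is no choice on the over-crossing strand.
In the jump-down model the roles of the two strands are exchanged. -/
noncomputable def transitions (D : Diagram) (m : Model) : List (Pt × Pt × ℤ[T;T⁻¹]) :=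
  (D.links.map fun x => (x.1, x.2, 1)) ++
  D.crossings.flatMap fun c =>
    match m with
    | .up => [(c.overIn, c.overOut, 1), (c.underIn, c.underOut, tPow c.sign),
        (c.underIn, c.overOut, 1 - tPow c.sign)]
    | .down => [(c.underIn, c.underOut, 1), (c.overIn, c.overOut, tPow c.sign),
        (c.overIn, c.underOut, 1 - tPow c.sign)]

def WalkStep (D : Diagram) (m : Model) (x y : Pt) : Prop := ∃ w, (x, y, w) ∈ D.transitions m

/-- The weight of the transition from `x` to `y` (there is at most one). -/
noncomputable def stepWeight (D : Diagram) (m : Model) (x y : Pt) : ℤ[T;T⁻¹] :=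
  (((D.transitions m).filter fun z => z.1 = x ∧ z.2.1 = y).map fun z => z.2.2).sum

open Classical in
/-- The nonempty simple families of cycles of the random walk: no segment (equivalently, no edge) of
the diagram is travelled more than once by the cycles of the family. -/
noncomputable def simpleFamilies (D : Diagram) (m : Model) : Finset (Finset D.ClosedCurve) :=
  Finset.univ.filter fun c =>
    c.Nonempty ∧ (∀ γ ∈ c, Follows (D.WalkStep m) γ) ∧
    (c : Set D.ClosedCurve).PairwiseDisjoint fun γ => γ.1.toFinset

/-- The weight of a cycle: the product of the weights of its transitions. -/
noncomputable def curveWeight {D : Diagram} (m : Model) (γ : D.ClosedCurve) : ℤ[T;T⁻¹] :=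
  ∏ x : D.Point, if h : x ∈ γ.1 then D.stepWeight m x.1 (γ.1.next γ.2 x h).1 else 1

/-- `W(c)`. -/
noncomputable def weight {D : Diagram} (m : Model) (c : Finset D.ClosedCurve) : ℤ[T;T⁻¹] :=
  ∏ γ ∈ c, curveWeight m γ

/-- `rot(c)`. -/
def rotFamily {D : Diagram} (c : Finset D.ClosedCurve) : ℤ := ∑ γ ∈ c, rotCurve γ

/-- The point `p` is visited by the family `c`. -/
def Visits {D : Diagram} (c : Finset D.ClosedCurve) (p : Pt) : Prop :=
  ∃ γ ∈ c, ∃ x ∈ γ.1, x.1 = p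

open Classical in
/-- `β(c)`: the sum of the signs of the crossings all of whose four incident edges are travelled
by the family `c`. -/
noncomputable def beta {D : Diagram} (c : Finset D.ClosedCurve) : ℤ :=
  (D.crossings.map fun x =>
    if Visits c x.overIn ∧ Visits c x.overOut ∧ Visits c x.underIn ∧ Visits c x.underOut
    then x.sign else 0).sum

/-! ### The Jones polynomial -/

/-- Adjacency of points after every crossing has been smoothed, either compatibly with the directions
(`σ i = true`) or in the other way (`σ i = false`). -/
def SmoothingAdj (D : Diagram) (σ : Fin D.crossings.length → Bool) (x y : D.Point) : Prop :=
  (x.1, y.1) ∈ D.links ∨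
  ∃ i : Fin D.crossings.length,
    if σ i then
      (x.1, y.1) = ((D.crossings.get i).overIn, (D.crossings.get i).underOut) ∨
      (x.1, y.1) = ((D.crossings.get i).underIn, (D.crossings.get i).overOut)
    else
      (x.1, y.1) = ((D.crossings.get i).overIn, (D.crossings.get i).underIn) ∨
      (x.1, y.1) = ((D.crossings.get i).overOut, (D.crossings.get i).underOut)

/-- The number of circles after smoothing: the number of connected components, `Quot` being the
quotient by the equivalence relation generated by adjacency. -/
noncomputable def loops (D : Diagram) (σ : Fin D.crossings.length → Bool) : ℕ :=
  Nat.card (Quot (D.SmoothingAdj σ))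

/-- The Jones polynomial of a link diagram (no bottom, no top), with value `q + q⁻¹` on the unknot,
through the Kauffman bracket: it is `(-A³) ^ (-ω(D)) ⟨D⟩` with `A² = -q`, where the bracket has value
`-A² - A⁻² = q + q⁻¹` on a circle and `1` on the empty diagram. Including the writhe factor, a crossing
of sign `ε` contributes `q ^ (-ε)` to its smoothing compatible with the directions and
`-q ^ (-2ε)` to its other smoothing. The standard variable is `t = A⁻⁴ = q⁻²`. -/
noncomputable def jones (D : Diagram) : ℤ[T;T⁻¹] :=
  ∑ σ : Fin D.crossings.length → Bool,
    (∏ i, if σ i then T (-(D.crossings.get i).sign) else -T (-2 * (D.crossings.get i).sign)) *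
      (T 1 + T (-1)) ^ D.loops σ

/-! ### Closures and cables -/

/-- The two sides on which a 1-string link can be closed. -/
inductive Side where
  | left : Side
  | right : Side

/-- The closure of a diagram of a 1-string link, by an arc on the given side without crossings. -/
def closure (D : Diagram) : Side → Diagram
  | .right => ⟨[], ⟨[], .cup true, []⟩ ::
      (D.layers.map fun L => ⟨L.left, L.piece, L.right ++ [false]⟩) ++ [⟨[], .cap true, []⟩]⟩
  | .left => ⟨[], ⟨[], .cup false, []⟩ ::
      (D.layers.map fun L => ⟨false :: L.left, L.piece, L.right⟩) ++ [⟨[], .cap false, []⟩]⟩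

/-- Every strand is replaced by `d` parallel strands. -/
def cableBoundary (d : ℕ) (a : List Bool) : List Bool := a.flatMap (List.replicate d)

/-- The `d`-cable of a layer: a cup or cap becomes `d` nested cups or caps, a crossing becomes a grid
of `d ^ 2` crossings. -/
def cableLayer (d : ℕ) (L : Layer) : List Layer :=
  let l := cableBoundary d L.left
  let r := cableBoundary d L.right
  match L.piece with
  | .cup o => (List.range d).map fun k =>
      ⟨l ++ List.replicate k o, .cup o, List.replicate k (!o) ++ r⟩
  | .cap o => (List.range d).reverse.map fun k =>
      ⟨l ++ List.replicate k o, .cap o, List.replicate k (!o) ++ r⟩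
  | .cross a b fwd => (List.range d).reverse.flatMap fun i => (List.range d).map fun j =>
      ⟨l ++ List.replicate i a ++ List.replicate j b, .cross a b fwd,
        List.replicate (d - 1 - j) b ++ List.replicate (d - 1 - i) a ++ r⟩

/-- The blackboard `d`-cable: `d` parallel copies in the plane, with parallel directions. For a
diagram of writhe `0` this is the zero-framing cable. -/
def cable (d : ℕ) (D : Diagram) : Diagram :=
  ⟨cableBoundary d D.bottom, D.layers.flatMap (cableLayer d)⟩

/-- The colored Jones polynomial `J(K, V_{d+1})` of a knot given by a diagram `K` of writhe `0`, in
terms of the Jones polynomials of its zero-framing cables: the class of `V_{d+1}` in the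
representation ring of `sl(2)` is the alternating sum of `(d - j).choose j` times the classes of
the tensor powers `V_2 ^ (d - 2j)`. -/
noncomputable def coloredJones (d : ℕ) (K : Diagram) : ℤ[T;T⁻¹] :=
  ∑ j ∈ Finset.range (d / 2 + 1),
    (-1) ^ j * ((d - j).choose j : ℤ[T;T⁻¹]) * jones (cable (d - 2 * j) K)

end Diagram

end KnotWalk

/-! Let V be the two-dimensional space. Minima, maxima and crossings act on the tensor powers of V
through the Temperley–Lieb algebra, so a diagram from d to d points gives an operator `jonesOp` on
the d-th tensor power. The random walk sum turns out to be a single matrix element of this operator,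
written as a state sum, and the Jones polynomial of the closure is its weighted trace.

The scalar. The vectors of degree d killed by all contractions (`symm d`) play the role of the
symmetric power. After all crossings are expanded into smoothings, contractions can be pushed down
through the minima until they cancel, close a circle, or kill the vector. Hence every word of
generators from d to d strands acts on `symm d` as a scalar (`GenChain.exists_scalar`), and this
scalar can be read off at a constant word, with all spins down or all spins up.

The walk as a matrix element. Families of disjoint cycles are permutations of the points, and
because one strand of each crossing offers no choice, a family is determined by the set of points it
visits (`sum_allowed_eq`). Half turns make the rotation number local, and β removes the weight of
staying at a crossing whose four edges are all travelled, so the sum over families becomes a sum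
over sets (`walkSum_eq`). Being visited is translated into a spin: along the strand for jump-up,
against it for jump-down. A finite check (`pieceWalk_gauge`) compares the local weights with those
of `jonesOp`. They agree up to a gauge factor on horizontal lines, which cancels between consecutive
layers, and up to powers of q that add up to the writhe and to a shift coming from minima and
maxima. The ends are not visited, so the matrix element is the one at a constant word. The shift
equals ∓rot: the same comparison is made for the oriented smoothing, where passing to the
complementary set of circles relates the two models (`sum_layerShift_eq_rot`).

The closure. The Kauffman state sum of a closed diagram is a vacuum matrix element (`jones_eq`),
with the number of circles found by setting q = 1. Cutting a closure open turns this into a weighted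
trace (`jones_cable_closure`). For d = 1 the trace of a scalar is that scalar times q + q⁻¹.

Colors. By the Clebsch–Gordan rule the alternating sum of the traces over tensor powers is the trace
over the symmetric power (`sum_wordTrace`), provided that the operators of the cables commute with
contractions. For writhe zero they do (`cap_jonesOp_cable`): a contraction of two parallel strands
is slid along the whole string from bottom to top, and the factors picked up at the crossings
multiply to a power of q whose exponent is a multiple of the writhe. -/

namespace KnotWalk
open LaurentPolynomial

section

/-! ### Operators on spin vectors -/

/-- Vectors in the direct product of all tensor powers of the two-dimensional space: the coordinates
are indexed by words in the two spins. -/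
abbrev Vec := List Bool → ℤ[T;T⁻¹]

abbrev Op := Module.End ℤ[T;T⁻¹] Vec

/-- The coefficients of a local minimum. -/
noncomputable def cupCoef : Bool → Bool → ℤ[T;T⁻¹]
  | false, true => 1
  | true, false => T 1
  | _, _ => 0

/-- The contraction of the first two factors. -/
noncomputable def capZero : Op where
  toFun v w := T (-1) * v (false :: true :: w) + v (true :: false :: w)
  map_add' _ _ := by ext1; simp only [Pi.add_apply]; ring
  map_smul' _ _ := by ext1; simp only [Pi.smul_apply, smul_eq_mul, RingHom.id_apply]; ring

/-- The insertion of two factors at the beginning, as a function on words. -/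
noncomputable def cupFun (v : Vec) : Vec
  | x :: y :: w => cupCoef x y * v w
  | _ => 0

/-- The insertion of two factors at the beginning. -/
noncomputable def cupZero : Op where
  toFun := cupFun
  map_add' _ _ := by
    ext1 w; rcases w with _ | ⟨x, _ | ⟨y, w⟩⟩ <;> simp [cupFun, mul_add]
  map_smul' c _ := by
    ext1 w; rcases w with _ | ⟨x, _ | ⟨y, w⟩⟩ <;> simp [cupFun, mul_left_comm]

/-- Application of an operator to all factors but the first, as a function on words. -/
noncomputable def shiftFun (K : Op) (v : Vec) : Vec
  -- A word without a first letter is sent to 0. This is why planar relations between shifted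
  -- operators hold only up to the truncations `long`, not with the identity.
  | [] => 0
  | x :: w => K (fun w' => v (x :: w')) w

/-- Application of an operator to all factors but the first. -/
noncomputable def shift (K : Op) : Op where
  toFun := shiftFun K
  map_add' v v' := by
    ext1 w
    rcases w with _ | ⟨x, w⟩
    · simp [shiftFun]
    · exact congrFun (K.map_add (fun w' => v (x :: w')) (fun w' => v' (x :: w'))) w
  map_smul' c v := by
    ext1 w
    rcases w with _ | ⟨x, w⟩
    · simp [shiftFun]
    · exact congrFun (K.map_smul c (fun w' => v (x :: w'))) w

@[simp] theorem shift_nil (K : Op) (v : Vec) : shift K v [] = 0 := rfl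

@[simp] theorem shift_cons (K : Op) (v : Vec) (x : Bool) (w : List Bool) :
    shift K v (x :: w) = K (fun w' => v (x :: w')) w := rfl

@[simp] theorem cupZero_nil (v : Vec) : cupZero v [] = 0 := rfl

@[simp] theorem cupZero_singleton (v : Vec) (x : Bool) : cupZero v [x] = 0 := rfl

@[simp] theorem cupZero_cons (v : Vec) (x y : Bool) (w : List Bool) :
    cupZero v (x :: y :: w) = cupCoef x y * v w := rfl

@[simp] theorem capZero_apply (v : Vec) (w : List Bool) :
    capZero v w = T (-1) * v (false :: true :: w) + v (true :: false :: w) := rfl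

theorem shift_mul (A B : Op) : shift (A * B) = shift A * shift B := by
  ext v w : 2
  rcases w with _ | ⟨x, w⟩ <;> simp

theorem shift_smul (c : ℤ[T;T⁻¹]) (A : Op) : shift (c • A) = c • shift A := by
  ext v w : 2
  rcases w with _ | ⟨x, w⟩ <;> simp

/-! ### Temperley–Lieb generators and their relations -/

/-- Contraction of the factors `i` and `i + 1`. -/
noncomputable def cap : ℕ → Op
  | 0 => capZero
  | i + 1 => shift (cap i)

/-- Insertion of two factors at the positions `i` and `i + 1`. -/
noncomputable def cup : ℕ → Op
  | 0 => cupZero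
  | i + 1 => shift (cup i)

/-- The projection to words of length at least `i`. -/
noncomputable def long : ℕ → Op
  | 0 => 1
  | i + 1 => shift (long i)

/-- The value of a circle. -/
noncomputable def circ : ℤ[T;T⁻¹] := T 1 + T (-1)

/-- Only linearity of `K` is used. With `K` a contraction, an insertion or a truncation, this is the
far commutation relation at position 0, and `shift` carries it to all other positions. -/
theorem capZero_mul_shift_shift (K : Op) : capZero * shift (shift K) = K * capZero := by
  ext v w : 2
  have h : capZero v = (T (-1) : ℤ[T;T⁻¹]) • (fun w => v (false :: true :: w)) +
      fun w => v (true :: false :: w) := rfl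
  simp only [Module.End.mul_apply, h, map_add, map_smul]
  simp

theorem shift_shift_mul_cupZero (K : Op) : shift (shift K) * cupZero = cupZero * K := by
  ext v w : 2
  rcases w with _ | ⟨x, _ | ⟨y, w⟩⟩
  · simp
  · simp
  · have h : (fun w' => cupZero v (x :: y :: w')) = cupCoef x y • v := rfl
    simp only [Module.End.mul_apply, shift_cons, h, map_smul]
    simp

theorem cap_mul_cap {i j : ℕ} (h : i ≤ j) : cap i * cap (j + 2) = cap j * cap i := by
  induction i generalizing j with
  | zero => exact capZero_mul_shift_shift _
  | succ i ih =>
    obtain ⟨j, rfl⟩ : ∃ k, j = k + 1 := ⟨j - 1, by omega⟩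
    have := ih (j := j) (by omega)
    simp only [cap, ← shift_mul] at this ⊢
    rw [this]

theorem cap_mul_cup_of_le {i j : ℕ} (h : i ≤ j) : cap i * cup (j + 2) = cup j * cap i := by
  induction i generalizing j with
  | zero => exact capZero_mul_shift_shift _
  | succ i ih =>
    obtain ⟨j, rfl⟩ : ∃ k, j = k + 1 := ⟨j - 1, by omega⟩
    have := ih (j := j) (by omega)
    simp only [cap, cup, ← shift_mul] at this ⊢
    rw [this]

theorem cap_mul_cup_of_ge {i j : ℕ} (h : i ≤ j) : cap (j + 2) * cup i = cup i * cap j := by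
  induction i generalizing j with
  | zero => exact shift_shift_mul_cupZero _
  | succ i ih =>
    obtain ⟨j, rfl⟩ : ∃ k, j = k + 1 := ⟨j - 1, by omega⟩
    have := ih (j := j) (by omega)
    simp only [cap, cup, ← shift_mul] at this ⊢
    rw [this]

theorem cup_mul_cup {i j : ℕ} (h : i ≤ j) : cup (j + 2) * cup i = cup i * cup j := by
  induction i generalizing j with
  | zero => exact shift_shift_mul_cupZero _
  | succ i ih =>
    obtain ⟨j, rfl⟩ : ∃ k, j = k + 1 := ⟨j - 1, by omega⟩
    have := ih (j := j) (by omega)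
    simp only [cup, ← shift_mul] at this ⊢
    rw [this]

theorem cap_mul_long {i j : ℕ} (h : i ≤ j) : cap i * long (j + 2) = long j * cap i := by
  induction i generalizing j with
  | zero => exact capZero_mul_shift_shift _
  | succ i ih =>
    obtain ⟨j, rfl⟩ : ∃ k, j = k + 1 := ⟨j - 1, by omega⟩
    have := ih (j := j) (by omega)
    simp only [cap, long, ← shift_mul] at this ⊢
    rw [this]

theorem long_mul_cup {i j : ℕ} (h : i ≤ j) : long (j + 2) * cup i = cup i * long j := by
  induction i generalizing j with
  | zero => exact shift_shift_mul_cupZero _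
  | succ i ih =>
    obtain ⟨j, rfl⟩ : ∃ k, j = k + 1 := ⟨j - 1, by omega⟩
    have := ih (j := j) (by omega)
    simp only [cup, long, ← shift_mul] at this ⊢
    rw [this]

/-- A circle meets the two mixed spin pairs, with weights T (-1) * 1 and 1 * T 1. -/
theorem cap_mul_cup_self (i : ℕ) : cap i * cup i = circ • long i := by
  induction i with
  | zero =>
    ext v w : 2
    simp [cap, cup, long, cupCoef, circ]
    ring
  | succ i ih => simp only [cap, cup, long, ← shift_mul, ih, shift_smul]

/-- Along a zigzag the coefficients multiply to T (-1) * T 1 or 1 * 1. The weights of minima and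
maxima are balanced so that straightening a strand costs nothing. -/
theorem cap_mul_cup_succ (i : ℕ) : cap i * cup (i + 1) = long (i + 1) := by
  induction i with
  | zero =>
    ext v w : 2
    rcases w with _ | ⟨_ | _, w⟩ <;> simp [cap, cup, long, cupCoef, ← mul_assoc]
  | succ i ih =>
    simp only [cap, cup, long, ← shift_mul] at ih ⊢
    rw [ih]

theorem cap_succ_mul_cup (i : ℕ) : cap (i + 1) * cup i = long (i + 1) := by
  induction i with
  | zero =>
    ext v w : 2
    rcases w with _ | ⟨_ | _, w⟩ <;> simp [cap, cup, long, cupCoef, ← mul_assoc]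
  | succ i ih =>
    simp only [cap, cup, long, ← shift_mul] at ih ⊢
    rw [ih]

theorem long_mul_long {i j : ℕ} (h : i ≤ j) : long i * long j = long j := by
  induction i generalizing j with
  | zero => simp [long]
  | succ i ih =>
    obtain ⟨j, rfl⟩ : ∃ k, j = k + 1 := ⟨j - 1, by omega⟩
    simp only [long, ← shift_mul, ih (j := j) (by omega)]

theorem long_mul_long' {i j : ℕ} (h : i ≤ j) : long j * long i = long j := by
  induction i generalizing j with
  | zero => simp [long]
  | succ i ih =>
    obtain ⟨j, rfl⟩ : ∃ k, j = k + 1 := ⟨j - 1, by omega⟩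
    simp only [long, ← shift_mul, ih (j := j) (by omega)]

theorem long_mul_cap {i j : ℕ} (h : j ≤ i) : long j * cap i = cap i := by
  induction i generalizing j with
  | zero => obtain rfl : j = 0 := by omega
            simp [long]
  | succ i ih =>
    rcases j with _ | j
    · simp [long]
    · simp only [cap, long, ← shift_mul, ih (j := j) (by omega)]

theorem cup_mul_long {i j : ℕ} (h : j ≤ i) : cup i * long j = cup i := by
  induction i generalizing j with
  | zero => obtain rfl : j = 0 := by omega
            simp [long]
  | succ i ih =>
    rcases j with _ | j
    · simp [long]
    · simp only [cup, long, ← shift_mul, ih (j := j) (by omega)]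

theorem cap_mul_long_of_le {i j : ℕ} (h : j ≤ i + 2) : cap i * long j = cap i := by
  have h1 : cap i * long (i + 2) = cap i := by rw [cap_mul_long le_rfl, long_mul_cap le_rfl]
  rw [← h1, mul_assoc, long_mul_long' h]

theorem long_mul_cup_of_le {i j : ℕ} (h : j ≤ i + 2) : long j * cup i = cup i := by
  have h1 : long (i + 2) * cup i = cup i := by rw [long_mul_cup le_rfl, cup_mul_long le_rfl]
  rw [← h1, ← mul_assoc, long_mul_long h]

/-- The operator of a crossing of the factors `i` and `i + 1` with given coefficients of its two
smoothings. -/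
noncomputable def crossOp (x y : ℤ[T;T⁻¹]) (i : ℕ) : Op := x • long (i + 2) + y • (cup i * cap i)

/-! ### Crossings next to and far from an arc -/

section Cross

variable (x y : ℤ[T;T⁻¹])

theorem cap_mul_crossOp_of_le {i j : ℕ} (h : i ≤ j) :
    cap i * crossOp x y (j + 2) = crossOp x y j * cap i := by
  simp only [crossOp, mul_add, add_mul, mul_smul_comm, smul_mul_assoc]
  rw [cap_mul_long (by omega), ← mul_assoc, cap_mul_cup_of_le h, mul_assoc, cap_mul_cap h, mul_assoc]

theorem crossOp_mul_cup_of_le {i j : ℕ} (h : i ≤ j) :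
    crossOp x y (j + 2) * cup i = cup i * crossOp x y j := by
  simp only [crossOp, mul_add, add_mul, mul_smul_comm, smul_mul_assoc]
  rw [long_mul_cup (by omega), mul_assoc, cap_mul_cup_of_ge h, ← mul_assoc, cup_mul_cup h, mul_assoc]

theorem cap_mul_crossOp_of_ge {i j : ℕ} (h : i ≤ j) :
    cap (j + 2) * crossOp x y i = crossOp x y i * cap (j + 2) := by
  simp only [crossOp, mul_add, add_mul, mul_smul_comm, smul_mul_assoc]
  rw [cap_mul_long_of_le (by omega), long_mul_cap (by omega), ← mul_assoc, cap_mul_cup_of_ge h,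
    mul_assoc, ← cap_mul_cap h, mul_assoc]

theorem crossOp_mul_cup_of_ge {i j : ℕ} (h : i ≤ j) :
    crossOp x y i * cup (j + 2) = cup (j + 2) * crossOp x y i := by
  simp only [crossOp, mul_add, add_mul, mul_smul_comm, smul_mul_assoc]
  rw [cup_mul_long (by omega), long_mul_cup_of_le (by omega), mul_assoc, cap_mul_cup_of_le h,
    ← mul_assoc, ← cup_mul_cup h, mul_assoc]

variable {x y} (hxy : x * x + y * y + x * y * circ = 0)
include hxy

/-- Of the four ways to smooth the two crossings, three give the same planar diagram, with total
coefficient x² + y² + xy·circ, which vanishes by assumption. The fourth is the arc on the other side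
of the strand, with coefficient xy. This is the second Reidemeister move for an unnormalized
bracket; the three lemmas after it are its mirror images. -/
theorem cap_mul_crossOp_mul_crossOp (i : ℕ) :
    cap i * (crossOp x y (i + 1) * crossOp x y i) = (x * y) • cap (i + 1) := by
  have e1 : cap i * (cup (i + 1) * cap (i + 1)) = cap (i + 1) := by
    rw [← mul_assoc, cap_mul_cup_succ, long_mul_cap le_rfl]
  have e2 : cap i * long (i + 1 + 2) = long (i + 1) * cap i := cap_mul_long (by omega)
  have e3 : cap i * (cup i * cap i) = circ • cap i := by
    rw [← mul_assoc, cap_mul_cup_self, smul_mul_assoc, long_mul_cap le_rfl]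
  have e4 : cap (i + 1) * (cup i * cap i) = long (i + 1) * cap i := by
    rw [← mul_assoc, cap_succ_mul_cup]
  have e5 : long (i + 1) * cap i * long (i + 2) = long (i + 1) * cap i := by
    rw [mul_assoc, cap_mul_long_of_le (by omega)]
  have e6 : cap (i + 1) * long (i + 2) = cap (i + 1) := cap_mul_long_of_le (by omega)
  calc cap i * (crossOp x y (i + 1) * crossOp x y i)
      = (x • (cap i * long (i + 1 + 2)) + y • (cap i * (cup (i + 1) * cap (i + 1)))) *
          crossOp x y i := by
        rw [← mul_assoc]; congr 1; simp only [crossOp, mul_add, mul_smul_comm]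
    _ = (x * x + y * y + x * y * circ) • (long (i + 1) * cap i) + (x * y) • cap (i + 1) := by
        rw [e1, e2]
        simp only [crossOp, mul_add, add_mul, mul_smul_comm, smul_mul_assoc, smul_add, smul_smul,
          e4, e5, e6, mul_assoc (long (i + 1)), e3]
        module
    _ = _ := by rw [hxy, zero_smul, zero_add]

/-- The truncation on the right cannot be dropped: three strands enter on the left side, while `cap
i` alone also sees words with only two letters from position `i` on. -/
theorem cap_succ_mul_crossOp_mul_crossOp (i : ℕ) :
    cap (i + 1) * (crossOp x y i * crossOp x y (i + 1)) = (x * y) • (cap i * long (i + 3)) := by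
  have e1 : cap (i + 1) * (cup i * cap i) = cap i * long (i + 3) := by
    rw [← mul_assoc, cap_succ_mul_cup, cap_mul_long (by omega)]
  have e2 : cap (i + 1) * long (i + 2) = cap (i + 1) := cap_mul_long_of_le (by omega)
  have e3 : cap (i + 1) * (cup (i + 1) * cap (i + 1)) = circ • cap (i + 1) := by
    rw [← mul_assoc, cap_mul_cup_self, smul_mul_assoc, long_mul_cap le_rfl]
  have e4 : cap (i + 1) * long (i + 1 + 2) = cap (i + 1) := cap_mul_long_of_le (by omega)
  have e5 : cap i * long (i + 3) * (cup (i + 1) * cap (i + 1)) = cap (i + 1) := by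
    rw [mul_assoc, ← mul_assoc (long _), long_mul_cup_of_le (by omega), ← mul_assoc,
      cap_mul_cup_succ, long_mul_cap le_rfl]
  have e6 : cap i * long (i + 3) * long (i + 1 + 2) = cap i * long (i + 3) := by
    rw [mul_assoc, long_mul_long le_rfl]
  calc cap (i + 1) * (crossOp x y i * crossOp x y (i + 1))
      = (x • (cap (i + 1) * long (i + 2)) + y • (cap (i + 1) * (cup i * cap i))) *
          crossOp x y (i + 1) := by
        rw [← mul_assoc]; congr 1; simp only [crossOp, mul_add, mul_smul_comm]
    _ = (x * x + y * y + x * y * circ) • cap (i + 1) + (x * y) • (cap i * long (i + 3)) := by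
        rw [e1, e2]
        simp only [crossOp, mul_add, add_mul, mul_smul_comm, smul_mul_assoc, smul_add, smul_smul,
          e3, e4, e5, e6]
        module
    _ = _ := by rw [hxy, zero_smul, zero_add]

theorem crossOp_mul_crossOp_mul_cup (i : ℕ) :
    crossOp x y i * (crossOp x y (i + 1) * cup i) = (x * y) • cup (i + 1) := by
  have e1 : cup (i + 1) * cap (i + 1) * cup i = cup (i + 1) := by
    rw [mul_assoc, cap_succ_mul_cup, cup_mul_long le_rfl]
  have e2 : long (i + 1 + 2) * cup i = cup i * long (i + 1) := long_mul_cup (by omega)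
  have e3 : cup i * cap i * cup i = circ • cup i := by
    rw [mul_assoc, cap_mul_cup_self, mul_smul_comm, cup_mul_long le_rfl]
  have e4 : cup i * cap i * cup (i + 1) = cup i * long (i + 1) := by
    rw [mul_assoc, cap_mul_cup_succ]
  have e5 : long (i + 2) * (cup i * long (i + 1)) = cup i * long (i + 1) := by
    rw [← mul_assoc, long_mul_cup_of_le (by omega)]
  have e6 : long (i + 2) * cup (i + 1) = cup (i + 1) := long_mul_cup_of_le (by omega)
  calc crossOp x y i * (crossOp x y (i + 1) * cup i)
      = crossOp x y i * (x • (long (i + 1 + 2) * cup i) +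
          y • (cup (i + 1) * cap (i + 1) * cup i)) := by
        simp only [crossOp, add_mul, smul_mul_assoc]
    _ = (x * x + y * y + x * y * circ) • (cup i * long (i + 1)) + (x * y) • cup (i + 1) := by
        rw [e1, e2]
        simp only [crossOp, mul_add, add_mul, mul_smul_comm, smul_mul_assoc, smul_add, smul_smul,
          e4, e5, e6, ← mul_assoc (cup i * cap i), e3]
        module
    _ = _ := by rw [hxy, zero_smul, zero_add]

theorem crossOp_mul_crossOp_mul_cup_succ (i : ℕ) :
    crossOp x y (i + 1) * (crossOp x y i * cup (i + 1)) =
      (x * y) • (cup i * long (i + 1)) := by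
  have e1 : cup i * cap i * cup (i + 1) = cup i * long (i + 1) := by
    rw [mul_assoc, cap_mul_cup_succ]
  have e2 : long (i + 2) * cup (i + 1) = cup (i + 1) := long_mul_cup_of_le (by omega)
  have e3 : cup (i + 1) * cap (i + 1) * cup (i + 1) = circ • cup (i + 1) := by
    rw [mul_assoc, cap_mul_cup_self, mul_smul_comm, cup_mul_long le_rfl]
  have e4 : long (i + 1 + 2) * cup (i + 1) = cup (i + 1) := long_mul_cup_of_le (by omega)
  have e5 : cup (i + 1) * cap (i + 1) * (cup i * long (i + 1)) = cup (i + 1) := by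
    rw [mul_assoc, ← mul_assoc (cap _), cap_succ_mul_cup, long_mul_long le_rfl,
      cup_mul_long le_rfl]
  have e6 : long (i + 1 + 2) * (cup i * long (i + 1)) = cup i * long (i + 1) := by
    rw [← mul_assoc, long_mul_cup (by omega), mul_assoc, long_mul_long le_rfl]
  calc crossOp x y (i + 1) * (crossOp x y i * cup (i + 1))
      = crossOp x y (i + 1) * (x • (long (i + 2) * cup (i + 1)) +
          y • (cup i * cap i * cup (i + 1))) := by
        simp only [crossOp, add_mul, smul_mul_assoc]
    _ = (x * x + y * y + x * y * circ) • cup (i + 1) + (x * y) • (cup i * long (i + 1)) := by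
        rw [e1, e2]
        simp only [crossOp, mul_add, add_mul, mul_smul_comm, smul_mul_assoc, smul_add, smul_smul,
          e3, e4, e5, e6]
        module
    _ = _ := by rw [hxy, zero_smul, zero_add]

end Cross

theorem crossOp_mul_long (x y : ℤ[T;T⁻¹]) (i N : ℕ) :
    crossOp x y i * long N = long N * crossOp x y i := by
  have h : cup i * cap i * long N = long N * (cup i * cap i) := by
    rcases le_or_gt N (i + 2) with h | h
    · rw [mul_assoc, cap_mul_long_of_le h, ← mul_assoc, long_mul_cup_of_le h]
    · obtain ⟨N, rfl⟩ : ∃ k, N = k + 2 := ⟨N - 2, by omega⟩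
      rw [mul_assoc, cap_mul_long (by omega), ← mul_assoc, ← long_mul_cup (by omega), mul_assoc]
  have h' : long (i + 2) * long N = long N * long (i + 2) := by
    rcases le_total (i + 2) N with h | h
    · rw [long_mul_long h, long_mul_long' h]
    · rw [long_mul_long h, long_mul_long' h]
  simp only [crossOp, mul_add, add_mul, mul_smul_comm, smul_mul_assoc, h, h']

/-! ### Cables of crossings, minima and maxima -/

/-- One strand at position `t` passes `n` strands on its right. -/
noncomputable def rowOp (x y : ℤ[T;T⁻¹]) (t : ℕ) : ℕ → Op
  | 0 => 1
  | n + 1 => crossOp x y (t + n) * rowOp x y t n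

/-- A bundle of strands at position `t` passes `n` strands on its right. -/
noncomputable def blockOp (x y : ℤ[T;T⁻¹]) (n t : ℕ) : ℕ → Op
  | 0 => 1
  | m + 1 => blockOp x y n t m * rowOp x y (t + m) n

/-- Nested minima. -/
noncomputable def cupsOp (t : ℕ) : ℕ → Op
  | 0 => 1
  | d + 1 => cup (t + d) * cupsOp t d

/-- Nested maxima. -/
noncomputable def capsOp (t : ℕ) : ℕ → Op
  | 0 => 1
  | d + 1 => capsOp t d * cap (t + d)

/-! ### Rows and blocks of crossings commute with distant generators -/

section Far

variable (x y : ℤ[T;T⁻¹])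

theorem crossOp_comm {i j : ℕ} (h : i ≤ j) (n : ℕ) (hn : n = j + 2) :
    crossOp x y n * crossOp x y i = crossOp x y i * crossOp x y n := by
  subst hn
  have h1 : crossOp x y (j + 2) * (cup i * cap i) = cup i * cap i * crossOp x y (j + 2) := by
    rw [← mul_assoc, crossOp_mul_cup_of_le _ _ h, mul_assoc, ← cap_mul_crossOp_of_le _ _ h,
      mul_assoc]
  conv_lhs => rw [crossOp.eq_def x y i]
  conv_rhs => rw [crossOp.eq_def x y i]
  simp only [mul_add, add_mul, mul_smul_comm, smul_mul_assoc, h1, crossOp_mul_long]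

theorem crossOp_mul_rowOp {t n k : ℕ} (h : t + n + 1 ≤ k) :
    crossOp x y k * rowOp x y t n = rowOp x y t n * crossOp x y k := by
  induction n with
  | zero => simp [rowOp]
  | succ n ih =>
    rw [rowOp, ← mul_assoc, crossOp_comm x y (i := t + n) (j := k - 2) (by omega) k (by omega),
      mul_assoc, ih (by omega), mul_assoc]

theorem rowOp_mul_long (t n N : ℕ) : rowOp x y t n * long N = long N * rowOp x y t n := by
  induction n with
  | zero => simp [rowOp]
  | succ n ih => rw [rowOp, mul_assoc, ih, ← mul_assoc, crossOp_mul_long, mul_assoc]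

theorem cap_mul_rowOp_left {j t : ℕ} (n : ℕ) (h : j ≤ t) :
    cap j * rowOp x y (t + 2) n = rowOp x y t n * cap j := by
  induction n with
  | zero => simp [rowOp]
  | succ n ih =>
    rw [rowOp, ← mul_assoc, show t + 2 + n = t + n + 2 by omega,
      cap_mul_crossOp_of_le _ _ (by omega), mul_assoc, ih, rowOp, mul_assoc]

theorem cap_mul_rowOp_right {j t n : ℕ} (h : t + n + 1 ≤ j) :
    cap j * rowOp x y t n = rowOp x y t n * cap j := by
  induction n with
  | zero => simp [rowOp]
  | succ n ih =>
    obtain ⟨j, rfl⟩ : ∃ k, j = k + 2 := ⟨j - 2, by omega⟩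
    rw [rowOp, ← mul_assoc, cap_mul_crossOp_of_ge _ _ (by omega), mul_assoc, ih (by omega),
      mul_assoc]

theorem rowOp_mul_cup_left {j t : ℕ} (n : ℕ) (h : j ≤ t) :
    rowOp x y (t + 2) n * cup j = cup j * rowOp x y t n := by
  induction n with
  | zero => simp [rowOp]
  | succ n ih =>
    rw [rowOp, mul_assoc, ih, ← mul_assoc, show t + 2 + n = t + n + 2 by omega,
      crossOp_mul_cup_of_le _ _ (by omega), rowOp, mul_assoc]

theorem rowOp_mul_cup_right {j t n : ℕ} (h : t + n + 1 ≤ j) :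
    rowOp x y t n * cup j = cup j * rowOp x y t n := by
  induction n with
  | zero => simp [rowOp]
  | succ n ih =>
    obtain ⟨j, rfl⟩ : ∃ k, j = k + 2 := ⟨j - 2, by omega⟩
    rw [rowOp, mul_assoc, ih (by omega), ← mul_assoc, crossOp_mul_cup_of_ge _ _ (by omega),
      mul_assoc]

theorem cap_mul_blockOp_left {j t : ℕ} (n m : ℕ) (h : j ≤ t) :
    cap j * blockOp x y n (t + 2) m = blockOp x y n t m * cap j := by
  induction m with
  | zero => simp [blockOp]
  | succ m ih =>
    rw [blockOp, ← mul_assoc, ih, mul_assoc, show t + 2 + m = t + m + 2 by omega,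
      cap_mul_rowOp_left _ _ _ (by omega), blockOp, mul_assoc]

theorem cap_mul_blockOp_right {j t n m : ℕ} (h : t + m + n ≤ j) :
    cap j * blockOp x y n t m = blockOp x y n t m * cap j := by
  induction m with
  | zero => simp [blockOp]
  | succ m ih =>
    rw [blockOp, ← mul_assoc, ih (by omega), mul_assoc, cap_mul_rowOp_right _ _ (by omega),
      mul_assoc]

theorem blockOp_mul_cup_left {j t : ℕ} (n m : ℕ) (h : j ≤ t) :
    blockOp x y n (t + 2) m * cup j = cup j * blockOp x y n t m := by
  induction m with
  | zero => simp [blockOp]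
  | succ m ih =>
    rw [blockOp, mul_assoc, show t + 2 + m = t + m + 2 by omega,
      rowOp_mul_cup_left _ _ _ (by omega), ← mul_assoc, ih, blockOp, mul_assoc]

theorem blockOp_mul_cup_right {j t n m : ℕ} (h : t + m + n ≤ j) :
    blockOp x y n t m * cup j = cup j * blockOp x y n t m := by
  induction m with
  | zero => simp [blockOp]
  | succ m ih =>
    rw [blockOp, mul_assoc, rowOp_mul_cup_right _ _ (by omega), ← mul_assoc, ih (by omega),
      mul_assoc]

end Far

/-! ### Arcs slide through rows and blocks of crossings -/

section Slide

variable {x y : ℤ[T;T⁻¹]} (hxy : x * x + y * y + x * y * circ = 0)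
include hxy

/-- The two strands joined by the arc pass each of the `n` strands together, and each passage costs
xy. The factor `long N` absorbs the truncations that arise on the way. -/
theorem cap_mul_rowOp_mul_rowOp (t n : ℕ) {N : ℕ} (hN : t + n + 2 ≤ N) :
    cap (t + n) * (rowOp x y t n * rowOp x y (t + 1) n) * long N =
      (x * y) ^ n • (cap t * long N) := by
  induction n with
  | zero => simp [rowOp]
  | succ n ih =>
    -- The crossings with the last of the passed strands are far from the rest of the other row, so
    -- both can be brought to the top, next to the arc.
    have h1 : rowOp x y t (n + 1) * rowOp x y (t + 1) (n + 1) =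
        crossOp x y (t + n) * crossOp x y (t + n + 1) * (rowOp x y t n * rowOp x y (t + 1) n) := by
      rw [rowOp, rowOp, mul_assoc, ← mul_assoc (rowOp x y t n), show t + 1 + n = t + n + 1 by omega,
        ← crossOp_mul_rowOp x y (t := t) (n := n) (k := t + n + 1) (by omega)]
      simp only [mul_assoc]
    have h2 : long (t + n + 3) * (rowOp x y t n * rowOp x y (t + 1) n) =
        rowOp x y t n * rowOp x y (t + 1) n * long (t + n + 3) := by
      rw [← mul_assoc, ← rowOp_mul_long, mul_assoc, ← rowOp_mul_long, mul_assoc]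
    rw [h1, ← mul_assoc, ← add_assoc, cap_succ_mul_crossOp_mul_crossOp hxy, smul_mul_assoc,
      mul_assoc (cap _), h2, smul_mul_assoc, mul_assoc, mul_assoc (_ * _) (long _),
      long_mul_long (by omega), ← mul_assoc, ih (by omega), smul_smul, pow_succ']

theorem rowOp_mul_rowOp_mul_cup (t n : ℕ) :
    rowOp x y t n * (rowOp x y (t + 1) n * cup t) = (x * y) ^ n • cup (t + n) := by
  induction n with
  | zero => simp [rowOp]
  | succ n ih =>
    have h1 : rowOp x y t (n + 1) * (rowOp x y (t + 1) (n + 1) * cup t) =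
        crossOp x y (t + n) * (crossOp x y (t + n + 1) *
          (rowOp x y t n * (rowOp x y (t + 1) n * cup t))) := by
      rw [rowOp, rowOp, mul_assoc, mul_assoc, ← mul_assoc (rowOp x y t n),
        show t + 1 + n = t + n + 1 by omega,
        ← crossOp_mul_rowOp x y (t := t) (n := n) (k := t + n + 1) (by omega)]
      simp only [mul_assoc]
    rw [h1, ih, mul_smul_comm, mul_smul_comm, crossOp_mul_crossOp_mul_cup hxy, smul_smul, pow_succ,
      add_assoc]

/-- Here the arc joins two neighbours among the passed strands. Only the two crossings with these
neighbours matter, hence a single factor xy; the induction starts where they are the last two of the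
row, and later crossings are far from the arc. -/
theorem cap_mul_rowOp_inner {t c n : ℕ} (h : c ≤ n) :
    cap (t + c) * rowOp x y t (n + 2) = (x * y) • (rowOp x y t n * cap (t + 1 + c)) := by
  induction n, h using Nat.le_induction with
  | base =>
    rw [rowOp, rowOp, ← mul_assoc (crossOp _ _ _), ← mul_assoc, ← add_assoc,
      cap_mul_crossOp_mul_crossOp hxy, smul_mul_assoc, cap_mul_rowOp_right _ _ (by omega)]
    rw [add_right_comm]
  | succ n hn ih =>
    rw [rowOp, ← mul_assoc, show t + (n + 2) = t + n + 2 by omega,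
      cap_mul_crossOp_of_le _ _ (by omega), mul_assoc, ih, mul_smul_comm, rowOp, mul_assoc]

theorem rowOp_mul_cup_inner {t c n N : ℕ} (h : c ≤ n) (hN : t + n + 1 ≤ N) :
    rowOp x y t (n + 2) * (cup (t + 1 + c) * long N) =
      (x * y) • (cup (t + c) * (rowOp x y t n * long N)) := by
  induction n, h using Nat.le_induction with
  | base =>
    rw [rowOp, rowOp, add_right_comm t 1 c, mul_assoc, mul_assoc, ← mul_assoc (rowOp _ _ _ _),
      rowOp_mul_cup_right _ _ (by omega), mul_assoc (cup _), ← mul_assoc (crossOp x y (t + c)),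
      ← mul_assoc (crossOp x y (t + (c + 1))), ← add_assoc,
      crossOp_mul_crossOp_mul_cup_succ hxy, smul_mul_assoc, mul_assoc,
      rowOp_mul_long, ← mul_assoc (long _), long_mul_long (by omega)]
  | succ n hn ih =>
    rw [rowOp, mul_assoc, ih (by omega), mul_smul_comm, ← mul_assoc,
      show t + (n + 2) = t + n + 2 by omega,
      crossOp_mul_cup_of_le _ _ (by omega), mul_assoc, rowOp, mul_assoc (crossOp _ _ _)]

/-- A contraction slides along a bundle from bottom left to top right. -/
theorem cap_mul_blockOp_fst {t c m n N : ℕ} (h : c ≤ m) (hN : t + m + n + 2 ≤ N) :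
    cap (t + n + c) * blockOp x y n t (m + 2) * long N =
      (x * y) ^ n • (blockOp x y n t m * cap (t + c) * long N) := by
  induction m, h using Nat.le_induction with
  | base =>
    have := cap_mul_rowOp_mul_rowOp hxy (t + c) n (N := N) (by omega)
    rw [blockOp, blockOp, mul_assoc (blockOp _ _ _ _ _), ← mul_assoc,
      cap_mul_blockOp_right _ _ (by omega), mul_assoc, mul_assoc, ← mul_assoc (cap _),
      add_right_comm t n c, ← add_assoc, this, mul_smul_comm, mul_assoc]
  | succ m hm ih =>
    rw [blockOp, mul_assoc, mul_assoc, rowOp_mul_long, ← mul_assoc (blockOp _ _ _ _ _),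
      ← mul_assoc (cap _), ← mul_assoc (cap _), ih (by omega), smul_mul_assoc,
      mul_assoc, ← rowOp_mul_long, mul_assoc, ← mul_assoc (cap _),
      show t + (m + 2) = t + m + 2 by omega, cap_mul_rowOp_left _ _ _ (by omega), blockOp]
    simp only [mul_assoc]

/-- An insertion slides along a bundle from bottom left to top right. -/
theorem blockOp_mul_cup_fst {t c m n : ℕ} (h : c ≤ m) :
    blockOp x y n t (m + 2) * cup (t + c) = (x * y) ^ n • (cup (t + n + c) * blockOp x y n t m) := by
  induction m, h using Nat.le_induction with
  | base =>
    rw [blockOp, blockOp, mul_assoc, mul_assoc, ← add_assoc t c 1, rowOp_mul_rowOp_mul_cup hxy,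
      mul_smul_comm, blockOp_mul_cup_right _ _ (by omega), add_right_comm]
  | succ m hm ih =>
    rw [blockOp, mul_assoc, show t + (m + 2) = t + m + 2 by omega,
      rowOp_mul_cup_left _ _ _ (by omega), ← mul_assoc, ih, smul_mul_assoc, mul_assoc, blockOp]

/-- A contraction slides along a bundle from bottom right to top left. -/
theorem cap_mul_blockOp_snd {t c m n : ℕ} (h : c ≤ n) :
    cap (t + c) * blockOp x y (n + 2) t m =
      (x * y) ^ m • (blockOp x y n t m * cap (t + m + c)) := by
  induction m with
  | zero => simp [blockOp]
  | succ m ih =>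
    rw [blockOp, ← mul_assoc, ih, smul_mul_assoc, mul_assoc, cap_mul_rowOp_inner hxy h,
      mul_smul_comm, smul_smul, pow_succ, blockOp, mul_assoc, add_assoc t m 1]

/-- An insertion slides along a bundle from bottom right to top left. -/
theorem blockOp_mul_cup_snd {t c m n N : ℕ} (h : c ≤ n) (hN : t + m + n ≤ N) :
    blockOp x y (n + 2) t m * (cup (t + m + c) * long N) =
      (x * y) ^ m • (cup (t + c) * (blockOp x y n t m * long N)) := by
  induction m with
  | zero => simp [blockOp]
  | succ m ih =>
    rw [blockOp, mul_assoc, ← add_assoc, rowOp_mul_cup_inner hxy h (by omega), rowOp_mul_long,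
      mul_smul_comm, ← mul_assoc (cup _), ← mul_assoc (blockOp _ _ _ _ _), ih (by omega),
      smul_mul_assoc, smul_smul, pow_succ', blockOp]
    simp only [mul_assoc, rowOp_mul_long]

end Slide

/-! ### Arcs slide around nested minima and maxima -/

section Nested

theorem cap_mul_cupsOp_left {j t : ℕ} (d : ℕ) (h : j + 2 ≤ t) :
    cap j * cupsOp t d = cupsOp (t - 2) d * cap j := by
  obtain ⟨t, rfl⟩ : ∃ k, t = k + 2 := ⟨t - 2, by omega⟩
  induction d with
  | zero => simp [cupsOp]
  | succ d ih =>
    rw [cupsOp, ← mul_assoc, show t + 2 + d = t + d + 2 by omega, cap_mul_cup_of_le (by omega),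
      mul_assoc, ih, cupsOp, mul_assoc, Nat.add_sub_cancel]

theorem cap_mul_cupsOp_right {j t d : ℕ} (h : t ≤ j) :
    cap (j + 2 * d) * cupsOp t d = cupsOp t d * cap j := by
  induction d generalizing j with
  | zero => simp [cupsOp]
  | succ d ih =>
    rw [cupsOp, ← mul_assoc, show j + 2 * (d + 1) = j + 2 * d + 2 by omega,
      cap_mul_cup_of_ge (by omega), mul_assoc, ih h, mul_assoc]

theorem cupsOp_mul_cup_left {j t : ℕ} (d : ℕ) (h : j ≤ t) :
    cupsOp (t + 2) d * cup j = cup j * cupsOp t d := by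
  induction d with
  | zero => simp [cupsOp]
  | succ d ih =>
    rw [cupsOp, mul_assoc, ih, ← mul_assoc, show t + 2 + d = t + d + 2 by omega,
      cup_mul_cup (by omega), cupsOp, mul_assoc]

theorem cupsOp_mul_cup_right {j t d : ℕ} (h : t ≤ j) :
    cupsOp t d * cup j = cup (j + 2 * d) * cupsOp t d := by
  induction d generalizing j with
  | zero => simp [cupsOp]
  | succ d ih =>
    rw [cupsOp, mul_assoc, ih h, ← mul_assoc, ← cup_mul_cup (by omega), mul_assoc]
    rfl

theorem cap_mul_capsOp_left {j t : ℕ} (d : ℕ) (h : j ≤ t) :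
    cap j * capsOp (t + 2) d = capsOp t d * cap j := by
  induction d with
  | zero => simp [capsOp]
  | succ d ih =>
    rw [capsOp, ← mul_assoc, ih, mul_assoc, show t + 2 + d = t + d + 2 by omega,
      cap_mul_cap (by omega), capsOp, mul_assoc]

theorem cap_mul_capsOp_right {j t d : ℕ} (h : t ≤ j) :
    cap j * capsOp t d = capsOp t d * cap (j + 2 * d) := by
  induction d generalizing j with
  | zero => simp [capsOp]
  | succ d ih =>
    rw [capsOp, ← mul_assoc, ih h, mul_assoc, ← cap_mul_cap (by omega), mul_assoc]
    rfl

theorem capsOp_mul_cup_left {j t : ℕ} (d : ℕ) (h : j ≤ t) :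
    capsOp (t + 2) d * cup j = cup j * capsOp t d := by
  induction d with
  | zero => simp [capsOp]
  | succ d ih =>
    rw [capsOp, mul_assoc, show t + 2 + d = t + d + 2 by omega, cap_mul_cup_of_ge (by omega),
      ← mul_assoc, ih, capsOp, mul_assoc]

theorem capsOp_mul_cup_right {j t d : ℕ} (h : t ≤ j) :
    capsOp t d * cup (j + 2 * d) = cup j * capsOp t d := by
  induction d generalizing j with
  | zero => simp [capsOp]
  | succ d ih =>
    rw [capsOp, mul_assoc, show j + 2 * (d + 1) = j + 2 * d + 2 by omega,
      cap_mul_cup_of_le (by omega), ← mul_assoc, ih h, mul_assoc]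

/-- A contraction on the left legs of nested minima slides to the right legs. -/
theorem cap_mul_cupsOp_fst {t c d : ℕ} (h : c ≤ d) :
    cap (t + c) * cupsOp t (d + 2) = cup (t + d + (d - c)) * cupsOp t d := by
  induction d, h using Nat.le_induction with
  | base =>
    rw [cupsOp, cupsOp, ← mul_assoc, ← add_assoc, cap_mul_cup_succ, ← mul_assoc,
      long_mul_cup_of_le (by omega)]
    simp
  | succ d hd ih =>
    rw [cupsOp, ← mul_assoc, show t + (d + 2) = t + d + 2 by omega, cap_mul_cup_of_le (by omega),
      mul_assoc, ih, ← mul_assoc, ← cup_mul_cup (by omega), mul_assoc, cupsOp,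
      show t + d + (d - c) + 2 = t + (d + 1) + (d + 1 - c) by omega]

/-- A contraction on the right legs of nested minima slides to the left legs. -/
theorem cap_mul_cupsOp_snd {t c d : ℕ} (h : c ≤ d) :
    cap (t + (d + 2) + (d - c)) * cupsOp t (d + 2) = cup (t + c) * cupsOp t d := by
  induction d, h using Nat.le_induction with
  | base =>
    rw [cupsOp, cupsOp, ← mul_assoc, show t + (c + 2) + (c - c) = t + (c + 1) + 1 by omega,
      cap_succ_mul_cup, ← mul_assoc, long_mul_cup_of_le (by omega)]
  | succ d hd ih =>
    rw [cupsOp, ← mul_assoc,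
      show t + (d + 1 + 2) + (d + 1 - c) = t + (d + 2) + (d - c) + 2 by omega,
      cap_mul_cup_of_ge (by omega), mul_assoc, ih, ← mul_assoc,
      show t + (d + 2) = t + d + 2 by omega, cup_mul_cup (by omega), mul_assoc, cupsOp]

/-- The picture of `cap_mul_cupsOp_fst` upside down. Nesting reverses the order of the legs, so a
pair at distance `c` from the left end faces a pair at distance `d - c` among the right legs. -/
theorem capsOp_mul_cup_fst {t c d : ℕ} (h : c ≤ d) :
    capsOp t (d + 2) * cup (t + c) = capsOp t d * cap (t + d + (d - c)) := by
  induction d, h using Nat.le_induction with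
  | base =>
    rw [capsOp, capsOp, mul_assoc, ← add_assoc, cap_succ_mul_cup, mul_assoc,
      cap_mul_long_of_le (by omega)]
    simp
  | succ d hd ih =>
    rw [capsOp, mul_assoc, show t + (d + 2) = t + d + 2 by omega, cap_mul_cup_of_ge (by omega),
      ← mul_assoc, ih, mul_assoc, ← cap_mul_cap (by omega), ← mul_assoc, capsOp,
      show t + d + (d - c) + 2 = t + (d + 1) + (d + 1 - c) by omega]

theorem capsOp_mul_cup_snd {t c d : ℕ} (h : c ≤ d) :
    capsOp t (d + 2) * cup (t + (d + 2) + (d - c)) = capsOp t d * cap (t + c) := by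
  induction d, h using Nat.le_induction with
  | base =>
    rw [capsOp, capsOp, mul_assoc, show t + (c + 2) + (c - c) = t + (c + 1) + 1 by omega,
      cap_mul_cup_succ, mul_assoc, cap_mul_long_of_le (by omega)]
  | succ d hd ih =>
    rw [capsOp, mul_assoc,
      show t + (d + 1 + 2) + (d + 1 - c) = t + (d + 2) + (d - c) + 2 by omega,
      cap_mul_cup_of_le (by omega), ← mul_assoc, ih, mul_assoc,
      show t + (d + 2) = t + d + 2 by omega, cap_mul_cap (by omega), ← mul_assoc, capsOp]

end Nested

end

section

/-! ### Planar words and invariant vectors -/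

/-- The vectors that are homogeneous of degree `n`. -/
def homog (n : ℕ) : Submodule ℤ[T;T⁻¹] Vec where
  carrier := {v | ∀ w : List Bool, w.length ≠ n → v w = 0}
  add_mem' hv hv' w hw := by simp [hv w hw, hv' w hw]
  zero_mem' _ _ := rfl
  smul_mem' c v hv w hw := by simp [hv w hw]

theorem homog_cons {n : ℕ} {v : Vec} (hv : v ∈ homog (n + 1)) (x : Bool) :
    (fun w => v (x :: w)) ∈ homog n := fun w hw => hv _ (by simpa using hw)

theorem homog_zero_cons {v : Vec} (hv : v ∈ homog 0) (x : Bool) : (fun w => v (x :: w)) = 0 := by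
  ext1 w; exact hv _ (by simp)

theorem cap_apply_eq_zero {n : ℕ} {v : Vec} (hv : v ∈ homog n) (i : ℕ) {w : List Bool}
    (hw : w.length + 2 ≠ n) : cap i v w = 0 := by
  induction i generalizing n v w with
  | zero =>
    simp only [cap, capZero_apply]
    rw [hv _ (by simpa using hw), hv _ (by simpa using hw)]
    simp
  | succ i ih =>
    rcases w with _ | ⟨x, w⟩
    · rfl
    · rcases n with _ | n
      · simp [cap, homog_zero_cons hv]
      · exact ih (homog_cons hv x) (by simp at hw; omega)

theorem cap_mem_homog {n : ℕ} {v : Vec} (hv : v ∈ homog (n + 2)) (i : ℕ) : cap i v ∈ homog n :=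
  fun _ hw => cap_apply_eq_zero hv i (by omega)

theorem cup_mem_homog {n : ℕ} {v : Vec} (hv : v ∈ homog n) (i : ℕ) : cup i v ∈ homog (n + 2) := by
  induction i generalizing n v with
  | zero =>
    rintro (_ | ⟨x, _ | ⟨y, w⟩⟩) hw
    · rfl
    · rfl
    · simp only [cup, cupZero_cons]
      rw [hv _ (by simpa using hw), mul_zero]
  | succ i ih =>
    rintro (_ | ⟨x, w⟩) hw
    · rfl
    · rcases n with _ | n
      · simp [cup, homog_zero_cons hv]
      · exact ih (homog_cons hv x) _ (by simp at hw; omega)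

theorem long_apply (i : ℕ) (v : Vec) (w : List Bool) :
    long i v w = if i ≤ w.length then v w else 0 := by
  induction i generalizing v w with
  | zero => simp [long]
  | succ i ih =>
    rcases w with _ | ⟨x, w⟩
    · simp [long]
    · simp [long, ih]

theorem long_eq_self {n i : ℕ} {v : Vec} (hv : v ∈ homog n) (h : i ≤ n) : long i v = v := by
  ext1 w
  rw [long_apply]
  split_ifs with hi
  · rfl
  · exact (hv w (by omega)).symm

theorem crossOp_mem_homog {n : ℕ} {v : Vec} (hv : v ∈ homog n) {i : ℕ} (hi : i + 2 ≤ n)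
    (x y : ℤ[T;T⁻¹]) : crossOp x y i v ∈ homog n := by
  obtain ⟨n, rfl⟩ : ∃ k, n = k + 2 := ⟨n - 2, by omega⟩
  simp only [crossOp, LinearMap.add_apply, LinearMap.smul_apply, Module.End.mul_apply]
  rw [long_eq_self hv hi]
  exact add_mem (Submodule.smul_mem _ _ hv)
    (Submodule.smul_mem _ _ (cup_mem_homog (cap_mem_homog hv i) i))

/-- The homogeneous vectors of degree `n` that are killed by all contractions. -/
def symm (n : ℕ) : Submodule ℤ[T;T⁻¹] Vec where
  carrier := {v | v ∈ homog n ∧ ∀ i, i + 2 ≤ n → cap i v = 0}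
  add_mem' hv hv' := ⟨add_mem hv.1 hv'.1, fun i hi => by simp [hv.2 i hi, hv'.2 i hi]⟩
  zero_mem' := ⟨zero_mem _, fun i _ => by simp⟩
  smul_mem' c v hv := ⟨Submodule.smul_mem _ c hv.1, fun i hi => by simp [hv.2 i hi]⟩

/-- The elementary operators: minima, maxima, and crossings with given coefficients of the two
smoothings. -/
inductive Gen where
  | cup (i : ℕ) : Gen
  | cap (i : ℕ) : Gen
  | cross (x y : ℤ[T;T⁻¹]) (i : ℕ) : Gen

noncomputable def Gen.op : Gen → Op
  | .cup i => KnotWalk.cup i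
  | .cap i => KnotWalk.cap i
  | .cross x y i => crossOp x y i

/-- The generator can be applied to `n` strands, and `n'` strands result. -/
def Gen.Maps : Gen → ℕ → ℕ → Prop
  | .cup i, n, n' => i ≤ n ∧ n' = n + 2
  | .cap i, n, n' => i + 2 ≤ n ∧ n = n' + 2
  | .cross _ _ i, n, n' => i + 2 ≤ n ∧ n' = n

/-- The generators can be applied one after another, from `n` to `n'` strands. -/
def GenChain : ℕ → List Gen → ℕ → Prop
  | n, [], n' => n = n'
  | n, g :: gs, n' => ∃ m, g.Maps n m ∧ GenChain m gs n'

noncomputable def opList : List Gen → Op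
  | [] => 1
  | g :: gs => opList gs * g.op

theorem opList_append (gs gs' : List Gen) : opList (gs ++ gs') = opList gs' * opList gs := by
  induction gs with
  | nil => simp [opList]
  | cons g gs ih => simp [opList, ih, mul_assoc]

theorem Gen.Maps.mem_homog {g : Gen} {n n' : ℕ} (h : g.Maps n n') {v : Vec} (hv : v ∈ homog n) :
    g.op v ∈ homog n' := by
  cases g with
  | cup i => obtain ⟨-, rfl⟩ := h; exact cup_mem_homog hv i
  | cap i => obtain ⟨-, rfl⟩ := h; exact cap_mem_homog hv i
  | cross x y i => obtain ⟨hi, rfl⟩ := h; exact crossOp_mem_homog hv hi x y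

theorem GenChain.mem_homog {gs : List Gen} {n n' : ℕ} (h : GenChain n gs n') {v : Vec}
    (hv : v ∈ homog n) : opList gs v ∈ homog n' := by
  induction gs generalizing n v with
  | nil => cases h; exact hv
  | cons g gs ih =>
    obtain ⟨m, hm, h⟩ := h
    exact ih h (hm.mem_homog hv)

/-- A word of minima. -/
noncomputable def cupWord : List ℕ → Op
  | [] => 1
  | i :: C => cup i * cupWord C

/-- A word of minima above `d` strands. -/
def CupValid (d : ℕ) : List ℕ → Prop
  | [] => True
  | i :: C => i ≤ d + 2 * C.length ∧ CupValid d C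

theorem cupWord_mem_homog {d : ℕ} {v : Vec} (hv : v ∈ homog d) (C : List ℕ) :
    cupWord C v ∈ homog (d + 2 * C.length) := by
  induction C with
  | nil => simpa [cupWord] using hv
  | cons i C ih =>
    have := cup_mem_homog ih i
    simpa [cupWord, mul_add, ← add_assoc] using this

/-- The contraction is moved down through the minima. It passes distant ones, straightens a zigzag
with a neighbour, or closes a circle with a minimum at its own position; otherwise it reaches the
`d` bottom strands and annihilates `symm d`. That last case needs two strands, and the inequality `2
≤ d` is recorded so that it can be excluded for `d = 0`. -/
theorem cap_cupWord {d : ℕ} (C : List ℕ) (hC : CupValid d C) (i : ℕ)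
    (hi : i + 2 ≤ d + 2 * C.length) :
    (2 ≤ d ∧ ∀ v ∈ symm d, cap i (cupWord C v) = 0) ∨
    ∃ C' k, CupValid d C' ∧ C'.length + 1 = C.length ∧
      ∀ v ∈ homog d, cap i (cupWord C v) = circ ^ k • cupWord C' v := by
  induction C generalizing i with
  | nil =>
    simp only [List.length_nil, mul_zero, add_zero] at hi
    exact .inl ⟨by omega, fun v hv => hv.2 i hi⟩
  | cons j C ih =>
    obtain ⟨hj, hC⟩ := hC
    simp only [List.length_cons] at hi
    have key : ∀ (v : Vec), cap i (cupWord (j :: C) v) = (cap i * cup j) (cupWord C v) :=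
      fun _ => rfl
    have hlong : ∀ {k : ℕ} {v : Vec}, v ∈ homog d → k ≤ d + 2 * C.length →
        long k (cupWord C v) = cupWord C v := fun hv hk => long_eq_self (cupWord_mem_homog hv C) hk
    rcases lt_trichotomy i j with hij | rfl | hij
    · rcases Nat.eq_or_lt_of_le (Nat.succ_le_of_lt hij) with rfl | hij
      · refine .inr ⟨C, 0, hC, rfl, fun v hv => ?_⟩
        rw [key, Nat.succ_eq_add_one, cap_mul_cup_succ, hlong hv hj, pow_zero, one_smul]
      · obtain ⟨j, rfl⟩ : ∃ k, j = k + 2 := ⟨j - 2, by omega⟩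
        have hk : ∀ (v : Vec), cap i (cupWord ((j + 2) :: C) v) = cup j (cap i (cupWord C v)) :=
          fun v => by rw [key, cap_mul_cup_of_le (by omega)]; rfl
        rcases ih hC i (by omega) with ⟨hd, h⟩ | ⟨C', k, hC', hl, h⟩
        · exact .inl ⟨hd, fun v hv => by rw [hk, h v hv, map_zero]⟩
        · refine .inr ⟨j :: C', k, ⟨by omega, hC'⟩, by simp [hl], fun v hv => ?_⟩
          rw [hk, h v hv, map_smul]; rfl
    · refine .inr ⟨C, 1, hC, rfl, fun v hv => ?_⟩
      rw [key, cap_mul_cup_self, LinearMap.smul_apply, hlong hv hj, pow_one]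
    · rcases Nat.eq_or_lt_of_le (Nat.succ_le_of_lt hij) with rfl | hij
      · refine .inr ⟨C, 0, hC, rfl, fun v hv => ?_⟩
        rw [key, Nat.succ_eq_add_one, cap_succ_mul_cup, hlong hv (by omega), pow_zero, one_smul]
      · obtain ⟨i, rfl⟩ : ∃ k, i = k + 2 := ⟨i - 2, by omega⟩
        have hk : ∀ (v : Vec), cap (i + 2) (cupWord (j :: C) v) = cup j (cap i (cupWord C v)) :=
          fun v => by rw [key, cap_mul_cup_of_ge (by omega)]; rfl
        rcases ih hC i (by omega) with ⟨hd, h⟩ | ⟨C', k, hC', hl, h⟩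
        · exact .inl ⟨hd, fun v hv => by rw [hk, h v hv, map_zero]⟩
        · refine .inr ⟨j :: C', k, ⟨by omega, hC'⟩, by simp [hl], fun v hv => ?_⟩
          rw [hk, h v hv, map_smul]; rfl

/-- The span of the words of minima from `d` to `n` strands, restricted to `symm d`. -/
noncomputable def cupSpan (d n : ℕ) : Submodule ℤ[T;T⁻¹] (symm d →ₗ[ℤ[T;T⁻¹]] Vec) :=
  Submodule.span _ {F | ∃ C, CupValid d C ∧ d + 2 * C.length = n ∧
    F = cupWord C ∘ₗ (symm d).subtype}

theorem cup_comp_mem_cupSpan {d n i : ℕ} (hi : i ≤ n) {F : symm d →ₗ[ℤ[T;T⁻¹]] Vec}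
    (hF : F ∈ cupSpan d n) : cup i ∘ₗ F ∈ cupSpan d (n + 2) := by
  induction hF using Submodule.span_induction with
  | mem F hF =>
    obtain ⟨C, hC, hl, rfl⟩ := hF
    exact Submodule.subset_span ⟨i :: C, ⟨by omega, hC⟩, by simp; omega, rfl⟩
  | zero => simp
  | add F G _ _ hF hG => rw [LinearMap.comp_add]; exact add_mem hF hG
  | smul c F _ hF => rw [LinearMap.comp_smul]; exact Submodule.smul_mem _ _ hF

theorem cap_comp_mem_cupSpan {d n i : ℕ} (hi : i ≤ n) {F : symm d →ₗ[ℤ[T;T⁻¹]] Vec}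
    (hF : F ∈ cupSpan d (n + 2)) : cap i ∘ₗ F ∈ cupSpan d n := by
  induction hF using Submodule.span_induction with
  | mem F hF =>
    obtain ⟨C, hC, hl, rfl⟩ := hF
    rcases cap_cupWord C hC i (by omega) with ⟨-, h⟩ | ⟨C', k, hC', hl', h⟩
    · have : cap i ∘ₗ cupWord C ∘ₗ (symm d).subtype = 0 :=
        LinearMap.ext fun v => h v v.2
      rw [this]; exact zero_mem _
    · have : cap i ∘ₗ cupWord C ∘ₗ (symm d).subtype =
          circ ^ k • (cupWord C' ∘ₗ (symm d).subtype) := LinearMap.ext fun v => h v v.2.1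
      rw [this]
      exact Submodule.smul_mem _ _ (Submodule.subset_span ⟨C', hC', by omega, rfl⟩)
  | zero => simp
  | add F G _ _ hF hG => rw [LinearMap.comp_add]; exact add_mem hF hG
  | smul c F _ hF => rw [LinearMap.comp_smul]; exact Submodule.smul_mem _ _ hF

theorem apply_mem_homog_of_mem_cupSpan {d n : ℕ} {F : symm d →ₗ[ℤ[T;T⁻¹]] Vec}
    (hF : F ∈ cupSpan d n) (v : symm d) : F v ∈ homog n := by
  induction hF using Submodule.span_induction with
  | mem F hF =>
    obtain ⟨C, hC, rfl, rfl⟩ := hF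
    exact cupWord_mem_homog v.2.1 C
  | zero => exact zero_mem _
  | add F G _ _ hF hG => exact add_mem hF hG
  | smul c F _ hF => exact Submodule.smul_mem _ _ hF

theorem Gen.Maps.comp_mem_cupSpan {g : Gen} {d n n' : ℕ} (h : g.Maps n n')
    {F : symm d →ₗ[ℤ[T;T⁻¹]] Vec} (hF : F ∈ cupSpan d n) : g.op ∘ₗ F ∈ cupSpan d n' := by
  cases g with
  | cup i => obtain ⟨hi, rfl⟩ := h; exact cup_comp_mem_cupSpan hi hF
  | cap i => obtain ⟨hi, rfl⟩ := h; exact cap_comp_mem_cupSpan (by omega) hF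
  | cross x y i =>
    obtain ⟨hi, rfl⟩ := h
    obtain ⟨n, rfl⟩ : ∃ k, n' = k + 2 := ⟨n' - 2, by omega⟩
    have : crossOp x y i ∘ₗ F = x • F + y • (KnotWalk.cup i ∘ₗ KnotWalk.cap i ∘ₗ F) := by
      refine LinearMap.ext fun v => ?_
      have := long_eq_self (apply_mem_homog_of_mem_cupSpan hF v) hi
      simp [crossOp, this]
    rw [Gen.op, this]
    exact add_mem (Submodule.smul_mem _ _ hF) (Submodule.smul_mem _ _
      (cup_comp_mem_cupSpan (by omega) (cap_comp_mem_cupSpan (by omega) hF)))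

theorem GenChain.comp_mem_cupSpan {gs : List Gen} {d n n' : ℕ} (h : GenChain n gs n')
    {F : symm d →ₗ[ℤ[T;T⁻¹]] Vec} (hF : F ∈ cupSpan d n) : opList gs ∘ₗ F ∈ cupSpan d n' := by
  induction gs generalizing n F with
  | nil => cases h; exact hF
  | cons g gs ih =>
    obtain ⟨m, hm, h⟩ := h
    exact ih h (hm.comp_mem_cupSpan hF)

/-- A planar word from `d` to `d` strands acts on `symm d` as a scalar. -/
theorem GenChain.exists_scalar {gs : List Gen} {d : ℕ} (h : GenChain d gs d) :
    ∃ c : ℤ[T;T⁻¹], ∀ v ∈ symm d, opList gs v = c • v := by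
  have h0 : (symm d).subtype ∈ cupSpan d d :=
    Submodule.subset_span ⟨[], trivial, by simp, rfl⟩
  have h1 := h.comp_mem_cupSpan h0
  -- A word of minima from `d` to `d` strands has no letters, so the whole span consists of
  -- multiples of the inclusion.
  have h2 : {F | ∃ C, CupValid d C ∧ d + 2 * C.length = d ∧
      F = cupWord C ∘ₗ (symm d).subtype} ⊆ {(symm d).subtype} := by
    rintro F ⟨C, -, hl, rfl⟩
    obtain rfl : C = [] := List.length_eq_zero_iff.mp (by omega)
    rfl
  obtain ⟨c, hc⟩ := Submodule.mem_span_singleton.mp (Submodule.span_mono h2 h1)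
  exact ⟨c, fun v hv => (LinearMap.congr_fun hc ⟨v, hv⟩).symm⟩

/-- Crossings are smoothed. -/
def Gen.IsSmooth : Gen → Prop
  | .cross x y _ => (x = 1 ∧ y = 0) ∨ (x = 0 ∧ y = 1)
  | _ => True

/-- Without linear combinations at the crossings one stays with a single word of minima times a
power of `circ`, which is stronger than lying in the span. The exponent is found later by evaluating
at q = 1. -/
theorem Gen.Maps.exists_cupWord {g : Gen} {n n' : ℕ} (h : g.Maps n n') (hg : g.IsSmooth)
    {C : List ℕ} (hC : CupValid 0 C) (hn : 2 * C.length = n) :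
    ∃ C' k, CupValid 0 C' ∧ 2 * C'.length = n' ∧
      ∀ v ∈ homog 0, g.op (cupWord C v) = circ ^ k • cupWord C' v := by
  have hcap : ∀ i, i + 2 ≤ n → ∃ C' k, CupValid 0 C' ∧ C'.length + 1 = C.length ∧
      ∀ v ∈ homog 0, KnotWalk.cap i (cupWord C v) = circ ^ k • cupWord C' v := fun i hi =>
    (cap_cupWord C hC i (by omega)).resolve_left (by omega)
  cases g with
  | cup i =>
    obtain ⟨hi, rfl⟩ := h
    exact ⟨i :: C, 0, ⟨by omega, hC⟩, by simp; omega, fun v _ => by simp [Gen.op, cupWord]⟩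
  | cap i =>
    obtain ⟨hi, rfl⟩ := h
    obtain ⟨C', k, h1, h2, h3⟩ := hcap i hi
    exact ⟨C', k, h1, by omega, h3⟩
  | cross x y i =>
    obtain ⟨hi, rfl⟩ := h
    rcases hg with ⟨rfl, rfl⟩ | ⟨rfl, rfl⟩
    · refine ⟨C, 0, hC, hn, fun v hv => ?_⟩
      have := long_eq_self (cupWord_mem_homog hv C) (i := i + 2) (by omega)
      simp [Gen.op, crossOp, this]
    · obtain ⟨C', k, h1, h2, h3⟩ := hcap i hi
      refine ⟨i :: C', k, ⟨by omega, h1⟩, by simp; omega, fun v hv => ?_⟩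
      simp [Gen.op, crossOp, h3 v hv, cupWord]

/-- The value of a word without crossings on no strands is a power of the value of a circle. -/
theorem GenChain.exists_circ_pow {gs : List Gen} (h : GenChain 0 gs 0)
    (hgs : ∀ g ∈ gs, g.IsSmooth) : ∃ k : ℕ, ∀ v ∈ homog 0, opList gs v = circ ^ k • v := by
  have main : ∀ (gs : List Gen) (n n' : ℕ), GenChain n gs n' → (∀ g ∈ gs, g.IsSmooth) →
      ∀ C, CupValid 0 C → 2 * C.length = n → ∃ C' k, CupValid 0 C' ∧ 2 * C'.length = n' ∧
        ∀ v ∈ homog 0, opList gs (cupWord C v) = circ ^ k • cupWord C' v := by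
    intro gs
    induction gs with
    | nil =>
      rintro n n' ⟨⟩ - C hC hn
      exact ⟨C, 0, hC, hn, fun v _ => by simp [opList]⟩
    | cons g gs ih =>
      rintro n n' ⟨m, hm, h⟩ hgs C hC hn
      obtain ⟨C', k, h1, h2, h3⟩ := hm.exists_cupWord (hgs g (by simp)) hC hn
      obtain ⟨C'', l, h4, h5, h6⟩ := ih m n' h (fun g hg => hgs g (by simp [hg])) C' h1 h2
      refine ⟨C'', k + l, h4, h5, fun v hv => ?_⟩
      rw [opList, Module.End.mul_apply, h3 v hv, map_smul, h6 v hv, smul_smul, pow_add]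
  obtain ⟨C, k, -, hl, h⟩ := main gs 0 0 h hgs [] trivial rfl
  obtain rfl : C = [] := List.length_eq_zero_iff.mp (by omega)
  exact ⟨k, h⟩

end

section

/-! ### The trace on symmetric powers -/

theorem cap_apply_append (v : Vec) (l r : List Bool) :
    cap l.length v (l ++ r) =
      T (-1) * v (l ++ false :: true :: r) + v (l ++ true :: false :: r) := by
  induction l generalizing v with
  | nil => rfl
  | cons x l ih => exact ih (fun w => v (x :: w))

theorem cap_apply_of_lt {i : ℕ} (v : Vec) {w : List Bool} (h : w.length < i) :
    cap i v w = 0 := by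
  induction i generalizing v w with
  | zero => simp at h
  | succ i ih =>
    rcases w with _ | ⟨x, w⟩
    · rfl
    · exact ih _ (by simpa using h)

theorem swap_of_cap_eq_zero {v : Vec} {l : List Bool} (h : cap l.length v = 0) (r : List Bool) :
    v (l ++ true :: false :: r) = -T (-1) * v (l ++ false :: true :: r) := by
  have := cap_apply_append v l r
  rw [h, Pi.zero_apply] at this
  linear_combination -this

/-- Vanishing contractions turn an exchange of neighbouring unequal spins into the factor `-T (-1)`.
The spin down crosses `k` spins up. -/
theorem swap_replicate {v : Vec} {d : ℕ} (h : ∀ i, i + 2 ≤ d → cap i v = 0) (k : ℕ)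
    (l r : List Bool) (hl : l.length + k + 1 ≤ d) :
    v (l ++ (List.replicate k true ++ false :: r)) =
      (-T (-1)) ^ k * v (l ++ false :: (List.replicate k true ++ r)) := by
  induction k generalizing l with
  | zero => simp
  | succ k ih =>
    have h1 := ih (l ++ [true]) (by simp; omega)
    have h2 := swap_of_cap_eq_zero (h l.length (by omega)) (List.replicate k true ++ r)
    simp only [List.append_assoc, List.singleton_append] at h1
    rw [List.replicate_succ, List.cons_append, h1, h2, pow_succ]
    simp only [List.cons_append]
    ring

/-- The number of inversions of a word. -/
def inversions : List Bool → ℕ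
  | [] => 0
  | true :: w => inversions w + w.count false
  | false :: w => inversions w

theorem inversions_append (u w : List Bool) :
    inversions (u ++ w) = inversions u + inversions w + u.count true * w.count false := by
  induction u with
  | nil => simp [inversions]
  | cons x u ih => cases x <;> simp [inversions, ih] <;> ring

/-- The symmetric vector of degree `d` with `a` spins up, tensored with a basis vector. -/
noncomputable def symVec (d a : ℕ) (w : List Bool) : Vec := fun x =>
  if d ≤ x.length ∧ x.drop d = w ∧ (x.take d).count true = a then
    (-T (-1)) ^ inversions (x.take d) else 0

theorem symVec_append (a : ℕ) (w u y : List Bool) : symVec u.length a w (u ++ y) =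
    if y = w ∧ u.count true = a then (-T (-1)) ^ inversions u else 0 := by
  simp [symVec]

theorem symVec_of_lt {d a : ℕ} {w x : List Bool} (h : x.length < d) : symVec d a w x = 0 := by
  rw [symVec, if_neg (by omega)]

theorem symVec_mem_homog (d a : ℕ) (w : List Bool) : symVec d a w ∈ homog (d + w.length) := by
  intro x hx
  rw [symVec, if_neg]
  rintro ⟨h, rfl, -⟩
  simp at hx; omega

/-- Replacing `false, true` by `true, false` at neighbouring places adds exactly one inversion, so
the two terms of the contraction cancel. Words too short to contain the symmetric part are treated
separately. -/
theorem cap_symVec {d a i : ℕ} (w : List Bool) (hi : i + 2 ≤ d) : cap i (symVec d a w) = 0 := by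
  ext1 z
  rcases lt_or_ge z.length (d - 2) with hz | hz
  · rcases lt_or_ge z.length i with hz' | hz'
    · exact cap_apply_of_lt _ hz'
    · obtain ⟨l, r, rfl, rfl⟩ : ∃ l r : List Bool, z = l ++ r ∧ l.length = i :=
        ⟨z.take i, z.drop i, by simp, by simpa⟩
      rw [cap_apply_append, symVec_of_lt, symVec_of_lt]
      · simp
      all_goals simp at hz ⊢; omega
  · obtain ⟨l, m, r, rfl, rfl, hm⟩ : ∃ l m r : List Bool, z = l ++ (m ++ r) ∧ l.length = i ∧
        m.length = d - 2 - i :=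
      ⟨z.take i, (z.drop i).take (d - 2 - i), (z.drop i).drop (d - 2 - i), by simp, by simp; omega,
        by simp; omega⟩
    have h1 := symVec_append a w (l ++ false :: true :: m) r
    have h2 := symVec_append a w (l ++ true :: false :: m) r
    have hd : l.length + (m.length + 1 + 1) = d := by omega
    simp only [List.length_append, List.length_cons, hd, List.append_assoc, List.cons_append]
      at h1 h2
    rw [cap_apply_append, h1, h2]
    have hc : (l ++ false :: true :: m).count true = (l ++ true :: false :: m).count true := by
      simp
    rw [hc]
    split_ifs
    · simp only [inversions_append, inversions, List.count_cons]
      simp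
      ring
    · simp

theorem exists_eq_append_cons {α : Type*} {x : List α} {d : ℕ} (h : d < x.length) :
    ∃ (u : List α) (b : α) (r : List α), x = u ++ b :: r ∧ u.length = d :=
  ⟨x.take d, x[d], x.drop (d + 1), by simp, by simp; omega⟩

theorem symVec_succ_append (a : ℕ) (w u : List Bool) (b : Bool) (r : List Bool) :
    symVec (u.length + 1) a w (u ++ b :: r) = if r = w ∧ u.count true + [b].count true = a then
      (-T (-1)) ^ (inversions u + u.count true * [b].count false) else 0 := by
  have h1 := symVec_append a w (u ++ [b]) r
  have h2 : inversions [b] = 0 := by cases b <;> rfl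
  simp only [List.length_append, List.length_singleton, List.append_assoc,
    List.singleton_append, List.count_append, inversions_append, h2, add_zero] at h1
  exact h1

theorem symVec_cons_of_length {d a : ℕ} {w x : List Bool} {b : Bool} (h : x.length < d + 1) :
    symVec d a (b :: w) x = 0 := by
  rw [symVec, if_neg]
  rintro ⟨-, h', -⟩
  rw [List.drop_eq_nil_of_le (by omega)] at h'
  simp at h'

theorem symVec_succ_zero (d : ℕ) (w : List Bool) :
    symVec (d + 1) 0 w = symVec d 0 (false :: w) := by
  ext1 x
  rcases lt_or_ge x.length (d + 1) with hx | hx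
  · rw [symVec_of_lt hx, symVec_cons_of_length hx]
  · obtain ⟨u, b, r, rfl, rfl⟩ := exists_eq_append_cons hx
    rw [symVec_succ_append, symVec_append]
    cases b
    · by_cases h : r = w <;> by_cases h' : u.count true = 0 <;> simp [h, h']
    · simp

/-- Split by the last spin of the symmetric part. If it is down, it forms an inversion with each of
the `a + 1` spins up before it. -/
theorem symVec_succ_succ (d a : ℕ) (w : List Bool) :
    symVec (d + 1) (a + 1) w = symVec d a (true :: w) +
      ((-T (-1)) ^ (a + 1) : ℤ[T;T⁻¹]) • symVec d (a + 1) (false :: w) := by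
  ext1 x
  rw [Pi.add_apply, Pi.smul_apply, smul_eq_mul]
  rcases lt_or_ge x.length (d + 1) with hx | hx
  · rw [symVec_of_lt hx, symVec_cons_of_length hx, symVec_cons_of_length hx, mul_zero, add_zero]
  · obtain ⟨u, b, r, rfl, rfl⟩ := exists_eq_append_cons hx
    rw [symVec_succ_append, symVec_append, symVec_append]
    cases b
    · by_cases h : r = w <;> by_cases h' : u.count true = a + 1 <;> simp [h, h', pow_add]
      ring
    · simp

/-- The free factor next to the symmetric part is down, so only the words whose last symmetric spin
is up survive the contraction. Removing that final spin up removes no inversion. -/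
theorem cap_symVec_last (n a : ℕ) (w : List Bool) :
    cap n (symVec (n + 1) (a + 1) (false :: w)) = symVec n a w := by
  ext1 x
  rcases lt_or_ge x.length n with hx | hx
  · rw [symVec_of_lt hx, cap_apply_of_lt _ hx]
  · obtain ⟨u, r, rfl, rfl⟩ : ∃ u r : List Bool, x = u ++ r ∧ u.length = n :=
      ⟨x.take n, x.drop n, by simp, by simpa⟩
    rw [cap_apply_append, symVec_succ_append, symVec_succ_append, symVec_append]
    simp

theorem symVec_zero_succ (a : ℕ) (w : List Bool) : symVec 0 (a + 1) w = 0 := by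
  ext1 x; simp [symVec]

/-- The words of length `k`. -/
def words : ℕ → Finset (List Bool)
  | 0 => {[]}
  | k + 1 => (words k).image (List.cons false) ∪ (words k).image (List.cons true)

theorem mem_words {k : ℕ} {w : List Bool} : w ∈ words k ↔ w.length = k := by
  induction k generalizing w with
  | zero => simp [words]
  | succ k ih =>
    rcases w with _ | ⟨_ | _, w⟩ <;> simp [words, ih]

theorem sum_words_succ {A : Type*} [AddCommMonoid A] (k : ℕ) (g : List Bool → A) :
    ∑ w ∈ words (k + 1), g w = ∑ w ∈ words k, (g (false :: w) + g (true :: w)) := by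
  rw [words, Finset.sum_union, Finset.sum_image, Finset.sum_image, Finset.sum_add_distrib]
  · intro; simp
  · intro; simp
  · rw [Finset.disjoint_left]
    intro w; simp only [Finset.mem_image]
    rintro ⟨_, _, rfl⟩ ⟨_, _, h⟩
    simp at h

/-- The weight of a word. -/
def wt (w : List Bool) : ℤ := w.count true - w.count false

/-- The word of length `d` with `a` spins up at the end. -/
def sorted (d a : ℕ) : List Bool := List.replicate (d - a) false ++ List.replicate a true

theorem wt_append (u w : List Bool) : wt (u ++ w) = wt u + wt w := by simp [wt]; ring

theorem wt_sorted {d a : ℕ} (h : a ≤ d) : wt (sorted d a) = 2 * a - d := by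
  simp [wt, sorted, List.count_replicate]
  omega

theorem length_sorted {d a : ℕ} (h : a ≤ d) : (sorted d a).length = d := by
  simp [sorted, h]

theorem count_sorted (d a : ℕ) : (sorted d a).count true = a := by
  simp [sorted, List.count_replicate]

theorem inversions_replicate (n : ℕ) (b : Bool) : inversions (List.replicate n b) = 0 := by
  induction n with
  | zero => rfl
  | succ n ih => cases b <;> simp [List.replicate_succ, inversions, ih, List.count_replicate]

theorem inversions_sorted (d a : ℕ) : inversions (sorted d a) = 0 := by
  simp [sorted, inversions_append, inversions_replicate, List.count_replicate]

theorem sorted_succ_append (d a : ℕ) (w : List Bool) :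
    sorted (d + 1) (a + 1) ++ w = sorted d a ++ true :: w := by
  have : List.replicate (a + 1) true ++ w = List.replicate a true ++ true :: w := by
    rw [List.replicate_succ', List.append_assoc]; rfl
  simp only [sorted, List.append_assoc, Nat.add_sub_add_right, this]

theorem sorted_zero_append (d : ℕ) (w : List Bool) :
    sorted (d + 1) 0 ++ w = sorted d 0 ++ false :: w := by
  simp [sorted, List.replicate_succ']

/-- The weighted trace of an operator on the tensor product of a symmetric power with a tensor
power. -/
noncomputable def symTrace (e : ℤ) (K : Op) (d k : ℕ) : ℤ[T;T⁻¹] :=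
  ∑ w ∈ words k, ∑ a ∈ Finset.range (d + 1),
    T (e * wt (sorted d a ++ w)) * K (symVec d a w) (sorted d a ++ w)

/-! ### Clebsch–Gordan recursion for weighted traces -/

section Trace

variable {M : ℕ → Op} (hM : ∀ n i, i ≤ n → ∀ v ∈ homog (n + 2), cap i (M (n + 2) v) = M n (cap i v))

theorem symTrace_zero_succ (e : ℤ) (K : Op) (k : ℕ) :
    symTrace e K 0 (k + 1) = symTrace e K 1 k := by
  rw [symTrace, symTrace, sum_words_succ]
  refine Finset.sum_congr rfl fun w _ => ?_
  have h1 := symVec_succ_zero 0 w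
  have h2 := symVec_succ_succ 0 0 w
  rw [symVec_zero_succ, smul_zero, add_zero] at h2
  simp only [zero_add] at h1 h2
  simp [Finset.sum_range_succ, h1, h2, sorted]

include hM

/-- In the product of the symmetric power of degree n + 1 with one more factor V, the symmetric
power of degree n + 2 is a subspace and contraction maps onto the symmetric power of degree n. The
operators respect both because they commute with contractions. In coordinates the two traces on the
right contain the same correction terms `D` with opposite signs. -/
theorem symTrace_succ_succ (e : ℤ) (n k : ℕ) :
    symTrace e (M (n + 1 + (k + 1))) (n + 1) (k + 1) =
      symTrace e (M (n + 2 + k)) (n + 2) k + symTrace e (M (n + k)) n k := by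
  have hK : n + 1 + (k + 1) = n + k + 2 := by omega
  have hK' : n + 2 + k = n + k + 2 := by omega
  rw [symTrace, symTrace, symTrace, sum_words_succ, ← Finset.sum_add_distrib, hK, hK']
  refine Finset.sum_congr rfl fun w hw => ?_
  rw [mem_words] at hw
  set K := M (n + k + 2)
  -- the summand that is added to the trace on the longer symmetric power
  let D : ℕ → ℤ[T;T⁻¹] := fun a => T (e * wt (sorted (n + 2) a ++ w)) * ((-T (-1)) ^ a *
    K (symVec (n + 1) a (false :: w)) (sorted (n + 2) a ++ w))
  -- There are n + 3 weights in degree n + 2, but the contraction accounts for only n + 1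
  -- corrections. The one left over vanishes: n + 2 spins up do not fit into n + 1 places.
  have hD : D (n + 2) = 0 := by
    have : symVec (n + 1) (n + 2) (false :: w) = 0 := by
      ext1 x
      rw [symVec, if_neg, Pi.zero_apply]
      rintro ⟨-, -, h⟩
      have h1 := List.count_le_length (a := true) (l := x.take (n + 1))
      rw [h, List.length_take] at h1
      omega
    simp [D, this]
  have hB0 : T (e * wt (sorted (n + 2) 0 ++ w)) * K (symVec (n + 2) 0 w) (sorted (n + 2) 0 ++ w) =
      T (e * wt (sorted (n + 1) 0 ++ false :: w)) *
        K (symVec (n + 1) 0 (false :: w)) (sorted (n + 1) 0 ++ false :: w) := by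
    rw [symVec_succ_zero, sorted_zero_append]
  have hB : ∀ a, T (e * wt (sorted (n + 2) (a + 1) ++ w)) *
      K (symVec (n + 2) (a + 1) w) (sorted (n + 2) (a + 1) ++ w) =
      T (e * wt (sorted (n + 1) a ++ true :: w)) *
        K (symVec (n + 1) a (true :: w)) (sorted (n + 1) a ++ true :: w) + D (a + 1) := by
    intro a
    simp only [D]
    rw [symVec_succ_succ, map_add, map_smul, sorted_succ_append, Pi.add_apply, Pi.smul_apply,
      smul_eq_mul, mul_add]
  -- Contract at the junction and read the result at a sorted word. One of the two terms is the
  -- wanted coordinate; in the other a spin down stands behind `a` spins up, and `swap_replicate`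
  -- brings that word back to sorted form, producing `D (a + 1)`.
  have hC : ∀ a ∈ Finset.range (n + 1), T (e * wt (sorted (n + 1) (a + 1) ++ false :: w)) *
      K (symVec (n + 1) (a + 1) (false :: w)) (sorted (n + 1) (a + 1) ++ false :: w) =
      D (a + 1) + T (e * wt (sorted n a ++ w)) * M (n + k) (symVec n a w) (sorted n a ++ w) := by
    intro a ha
    have ha' : a ≤ n := by simpa [Nat.lt_succ_iff] using ha
    have hv : symVec (n + 1) (a + 1) (false :: w) ∈ homog (n + k + 2) := by
      have := symVec_mem_homog (n + 1) (a + 1) (false :: w)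
      rwa [List.length_cons, hw, show n + 1 + (k + 1) = n + k + 2 by omega] at this
    have h1 : ∀ i, i + 2 ≤ n + 1 → cap i (K (symVec (n + 1) (a + 1) (false :: w))) = 0 := by
      intro i hi
      rw [hM _ _ (by omega) _ hv, cap_symVec _ hi, map_zero]
    have h2 := congrFun (hM (n + k) n (by omega) _ hv) (sorted n a ++ w)
    have h3 := cap_apply_append (K (symVec (n + 1) (a + 1) (false :: w))) (sorted n a) w
    have h4 := swap_replicate h1 a (List.replicate (n - a) false) (true :: w) (by simp; omega)
    rw [length_sorted ha'] at h3
    rw [cap_symVec_last, h3] at h2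
    have h5 : sorted n a ++ false :: true :: w = List.replicate (n - a) false ++
        (List.replicate a true ++ false :: true :: w) := by simp [sorted]
    have h6 : sorted (n + 2) (a + 1) ++ w = List.replicate (n - a) false ++
        false :: (List.replicate a true ++ true :: w) := by
      rw [sorted_succ_append]
      have : n + 1 - a = n - a + 1 := by omega
      simp [sorted, this, List.replicate_succ']
    have h7 : wt (sorted (n + 1) (a + 1) ++ false :: w) = wt (sorted (n + 2) (a + 1) ++ w) := by
      rw [h6, sorted_succ_append]
      simp [sorted, wt]; ring
    have h8 : wt (sorted n a ++ w) = wt (sorted (n + 2) (a + 1) ++ w) := by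
      rw [h6]
      simp [sorted, wt]; ring
    simp only [D]
    rw [h5, h4, ← h6, ← sorted_succ_append] at h2
    rw [h7, h8, ← h2]
    ring
  rw [Finset.sum_range_succ' _ (n + 2), Finset.sum_congr rfl fun a _ => hB a, hB0,
    Finset.sum_range_succ' _ (n + 1), Finset.sum_congr rfl hC,
    Finset.sum_add_distrib, Finset.sum_add_distrib, Finset.sum_range_succ (fun a => D (a + 1)) (n + 1), hD]
  ring

/-- Unrolls the recursion V_{n+2} = V_{n+1}·V − V_n, simultaneously for all numbers `k` of free
factors. The coefficients agree by Pascal's rule. -/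
theorem symTrace_eq_sum (e : ℤ) (d k : ℕ) :
    symTrace e (M (d + k)) d k = ∑ j ∈ Finset.range (d + 1),
      (-1) ^ j * ((d - j).choose j : ℤ[T;T⁻¹]) *
        symTrace e (M (d - 2 * j + k)) 0 (d - 2 * j + k) := by
  induction d using Nat.twoStepInduction generalizing k with
  | zero => simp
  | one =>
    rw [Finset.sum_range_succ, Finset.sum_range_one, add_comm 1 k, ← symTrace_zero_succ]
    simp [add_comm]
  | more n ih1 ih2 =>
    have h := symTrace_succ_succ hM e n k
    rw [ih2, ih1, Finset.sum_range_succ'] at h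
    rw [Finset.sum_range_succ', Finset.sum_range_succ, eq_sub_of_add_eq h.symm]
    have h1 : (n + 2 - (n + 1 + 1)).choose (n + 1 + 1) = 0 := by
      rw [Nat.sub_self]; rfl
    have h2 : ∀ j ∈ Finset.range (n + 1),
        (-1) ^ (j + 1) * ((n + 2 - (j + 1)).choose (j + 1) : ℤ[T;T⁻¹]) *
          symTrace e (M (n + 2 - 2 * (j + 1) + k)) 0 (n + 2 - 2 * (j + 1) + k) =
        (-1) ^ (j + 1) * ((n + 1 - (j + 1)).choose (j + 1) : ℤ[T;T⁻¹]) *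
          symTrace e (M (n + 1 - 2 * (j + 1) + (k + 1))) 0 (n + 1 - 2 * (j + 1) + (k + 1)) -
        (-1) ^ j * ((n - j).choose j : ℤ[T;T⁻¹]) *
          symTrace e (M (n - 2 * j + k)) 0 (n - 2 * j + k) := by
      intro j hj
      have hj' : j ≤ n := by simpa [Nat.lt_succ_iff] using hj
      rw [show n + 2 - (j + 1) = n - j + 1 by omega, Nat.choose_succ_succ,
        show n + 1 - (j + 1) = n - j by omega,
        show n + 2 - 2 * (j + 1) = n - 2 * j by omega]
      -- If the binomial coefficient vanishes, the truncated differences in the indices need not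
      -- match, but then they do not matter.
      rcases Nat.lt_or_ge (n - j) (j + 1) with hlt | hge
      · rw [Nat.choose_eq_zero_of_lt hlt]
        push_cast; ring
      · rw [show n + 1 - 2 * (j + 1) + (k + 1) = n - 2 * j + k by omega]
        push_cast; ring
    rw [Finset.sum_congr rfl h2, Finset.sum_sub_distrib, h1]
    simp only [mul_zero, Nat.sub_zero, pow_zero, Nat.choose_zero_right]
    rw [show n + 1 + (k + 1) = n + 2 + k by omega]
    push_cast
    ring

/-- The basis vector of a word. -/
noncomputable def basisVec (w : List Bool) : Vec := fun x => if x = w then 1 else 0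

/-- The weighted trace of an operator on the tensor power of degree `n`. -/
noncomputable def wordTrace (e : ℤ) (K : Op) (n : ℕ) : ℤ[T;T⁻¹] :=
  ∑ w ∈ words n, T (e * wt w) * K (basisVec w) w

omit hM in
theorem symTrace_zero (e : ℤ) (K : Op) (n : ℕ) : symTrace e K 0 n = wordTrace e K n := by
  refine Finset.sum_congr rfl fun w _ => ?_
  have : symVec 0 0 w = basisVec w := by ext1 x; simp [symVec, basisVec, inversions]
  simp [sorted, this]

/-- The alternating sum of the traces on tensor powers is the trace on a symmetric power. -/
theorem sum_wordTrace (e : ℤ) (d : ℕ) {c : ℤ[T;T⁻¹]} (hc : ∀ v ∈ symm d, M d v = c • v) :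
    ∑ j ∈ Finset.range (d / 2 + 1), (-1) ^ j * ((d - j).choose j : ℤ[T;T⁻¹]) *
      wordTrace e (M (d - 2 * j)) (d - 2 * j) =
    c * ∑ a ∈ Finset.range (d + 1), T (e * (2 * a - d)) := by
  have h1 := symTrace_eq_sum hM e d 0
  have h2 : symTrace e (M d) d 0 = c * ∑ a ∈ Finset.range (d + 1), T (e * (2 * a - d)) := by
    simp only [symTrace, words, Finset.sum_singleton, List.append_nil, Finset.mul_sum]
    refine Finset.sum_congr rfl fun a ha => ?_
    have ha' : a ≤ d := by simpa [Nat.lt_succ_iff] using ha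
    -- The sorted word has no inversions, so reading the scalar multiple there gives exactly the
    -- scalar.
    have hs : symVec d a [] (sorted d a) = 1 := by
      have := symVec_append a [] (sorted d a) []
      rw [length_sorted ha', List.append_nil] at this
      simp [this, count_sorted, inversions_sorted]
    rw [hc, Pi.smul_apply, hs, wt_sorted ha', smul_eq_mul, mul_one, mul_comm]
    exact ⟨by simpa using symVec_mem_homog d a [], fun i hi => cap_symVec [] hi⟩
  rw [add_zero, h2] at h1
  rw [h1]
  simp only [add_zero, symTrace_zero]
  -- For 2j > d the binomial coefficient is zero, so extending the range to `d + 1` changes nothing.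
  refine Finset.sum_subset (Finset.range_mono (by omega)) fun j _ hj => ?_
  rw [Nat.choose_eq_zero_of_lt (by simp at hj; omega)]
  simp

end Trace

theorem sum_T_eq_quantumInt (d : ℕ) {e : ℤ} (he : e = 1 ∨ e = -1) :
    ∑ a ∈ Finset.range (d + 1), T (e * (2 * a - d)) = quantumInt (d + 1) := by
  rcases he with rfl | rfl
  · rw [quantumInt, ← Finset.sum_range_reflect]
    refine Finset.sum_congr rfl fun a ha => ?_
    have ha' : a ≤ d := by simpa [Nat.lt_succ_iff] using ha
    congr 1
    simp only [Nat.add_sub_cancel, Nat.cast_sub ha']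
    push_cast
    ring
  · refine Finset.sum_congr rfl fun a _ => ?_
    congr 1
    push_cast
    ring

end

section

/-! ### State sums -/

/-- The points of a horizontal line, from the position `j` on. -/
def linePts (k j : ℕ) (a : List Bool) : List Pt := (a.zipIdx j).map fun y => (k, y.2, y.1)

/-- The word of the labels along a horizontal line. -/
def lineWord (g : Pt → Bool) (k j : ℕ) (a : List Bool) : List Bool := (linePts k j a).map g

/-- The points on the lines from number `k` on. -/
def ptsFrom : ℕ → List (List Bool) → List Pt
  | _, [] => []
  | k, a :: ls => linePts k 0 a ++ ptsFrom (k + 1) ls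

theorem linePts_cons (k j : ℕ) (o : Bool) (a : List Bool) :
    linePts k j (o :: a) = (k, j, o) :: linePts k (j + 1) a := rfl

theorem linePts_append (k j : ℕ) (a b : List Bool) :
    linePts k j (a ++ b) = linePts k j a ++ linePts k (j + a.length) b := by
  simp [linePts, List.zipIdx_append]

theorem lineWord_append (g : Pt → Bool) (k j : ℕ) (a b : List Bool) :
    lineWord g k j (a ++ b) = lineWord g k j a ++ lineWord g k (j + a.length) b := by
  simp [lineWord, linePts_append]

@[simp] theorem length_lineWord (g : Pt → Bool) (k j : ℕ) (a : List Bool) :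
    (lineWord g k j a).length = a.length := by simp [lineWord, linePts]

theorem fst_of_mem_linePts {k j : ℕ} {a : List Bool} {p : Pt} (h : p ∈ linePts k j a) :
    p.1 = k := by
  simp only [linePts, List.mem_map] at h
  obtain ⟨y, -, rfl⟩ := h
  rfl

theorem snd_of_mem_linePts {k j : ℕ} {a : List Bool} {p : Pt} (h : p ∈ linePts k j a) :
    j ≤ p.2.1 := by
  induction a generalizing j with
  | nil => simp [linePts] at h
  | cons o a ih =>
    rw [linePts_cons, List.mem_cons] at h
    rcases h with rfl | h
    · exact le_rfl
    · exact (Nat.le_succ j).trans (ih h)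

theorem nodup_linePts (k j : ℕ) (a : List Bool) : (linePts k j a).Nodup := by
  induction a generalizing j with
  | nil => simp [linePts]
  | cons o a ih =>
    rw [linePts_cons, List.nodup_cons]
    exact ⟨fun h => absurd (snd_of_mem_linePts h) (by simp), ih _⟩

theorem fst_of_mem_ptsFrom {k : ℕ} {ls : List (List Bool)} {p : Pt} (h : p ∈ ptsFrom k ls) :
    k ≤ p.1 := by
  induction ls generalizing k with
  | nil => simp [ptsFrom] at h
  | cons a ls ih =>
    rw [ptsFrom, List.mem_append] at h
    rcases h with h | h
    · exact (fst_of_mem_linePts h).ge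
    · exact (Nat.le_succ k).trans (ih h)

theorem nodup_ptsFrom (k : ℕ) (ls : List (List Bool)) : (ptsFrom k ls).Nodup := by
  induction ls generalizing k with
  | nil => simp [ptsFrom]
  | cons a ls ih =>
    refine (nodup_linePts k 0 a).append (ih _) fun p h h' => ?_
    have := fst_of_mem_linePts h
    have := fst_of_mem_ptsFrom h'
    omega

theorem zipIdx_flatMap_eq_ptsFrom (k : ℕ) (ls : List (List Bool)) :
    ((ls.zipIdx k).flatMap fun x => x.1.zipIdx.map fun y => ((x.2, y.2, y.1) : Pt)) =
      ptsFrom k ls := by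
  induction ls generalizing k with
  | nil => rfl
  | cons a ls ih => rw [List.zipIdx_cons, List.flatMap_cons, ih]; rfl

theorem points_eq (D : Diagram) :
    D.points = (ptsFrom 0 (D.bottom :: D.layers.map Layer.cod)).toFinset := by
  rw [Diagram.points, zipIdx_flatMap_eq_ptsFrom]

/-- The labelling by membership. -/
def memLabel (S : Finset Pt) (p : Pt) : Bool := decide (p ∈ S)

theorem lineWord_congr {g g' : Pt → Bool} {k j : ℕ} {a : List Bool}
    (h : ∀ p ∈ linePts k j a, g p = g' p) : lineWord g k j a = lineWord g' k j a :=
  List.map_congr_left h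

/-- A labelling is encoded by the set of its true points, so that later the same sets can be read as
sets of visited points. -/
theorem sum_powerset_linePts {A : Type*} [AddCommMonoid A] (G : List Bool → A) (k j : ℕ)
    (a : List Bool) :
    ∑ S ∈ (linePts k j a).toFinset.powerset, G (lineWord (memLabel S) k j a) =
      ∑ w ∈ words a.length, G w := by
  induction a generalizing j G with
  | nil => simp [linePts, lineWord, words]
  | cons o a ih =>
    have hp : ((k, j, o) : Pt) ∉ (linePts k (j + 1) a).toFinset := fun h =>
      absurd (snd_of_mem_linePts (List.mem_toFinset.mp h)) (by simp)
    have h1 : ∀ S ∈ (linePts k (j + 1) a).toFinset.powerset,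
        lineWord (memLabel S) k j (o :: a) = false :: lineWord (memLabel S) k (j + 1) a := by
      intro S hS
      have : ((k, j, o) : Pt) ∉ S := fun h => hp (Finset.mem_powerset.mp hS h)
      simp [lineWord, linePts_cons, memLabel, this]
    have h2 : ∀ S ∈ (linePts k (j + 1) a).toFinset.powerset,
        lineWord (memLabel (insert (k, j, o) S)) k j (o :: a) =
          true :: lineWord (memLabel S) k (j + 1) a := by
      intro S hS
      rw [lineWord, linePts_cons, List.map_cons]
      congr 1
      · simp [memLabel]
      · refine lineWord_congr fun p hp' => ?_
        have : p ≠ (k, j, o) := by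
          rintro rfl
          exact hp (List.mem_toFinset.mpr hp')
        simp [memLabel, this]
    rw [linePts_cons, List.toFinset_cons, Finset.sum_powerset_insert hp, List.length_cons,
      sum_words_succ, Finset.sum_add_distrib, ← ih (fun w => G (false :: w)) (j + 1),
      ← ih (fun w => G (true :: w)) (j + 1)]
    exact congrArg₂ _ (Finset.sum_congr rfl fun S hS => by rw [h1 S hS])
      (Finset.sum_congr rfl fun S hS => by rw [h2 S hS])

theorem sum_powerset_union {α A : Type*} [DecidableEq α] [AddCommMonoid A] {s t : Finset α}
    (h : Disjoint s t) (f : Finset α → A) :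
    ∑ S ∈ (s ∪ t).powerset, f S = ∑ S ∈ t.powerset, ∑ S' ∈ s.powerset, f (S' ∪ S) := by
  induction s using Finset.induction_on generalizing f with
  | empty => simp
  | insert a s ha ih =>
    rw [Finset.disjoint_insert_left] at h
    rw [Finset.insert_union, Finset.sum_powerset_insert (by simp [ha, h.1]), ih h.2, ih h.2,
      ← Finset.sum_add_distrib]
    refine Finset.sum_congr rfl fun S _ => ?_
    rw [Finset.sum_powerset_insert ha]
    simp [Finset.insert_union]

theorem eq_sum_basisVec {n : ℕ} {v : Vec} (hv : v ∈ homog n) :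
    v = ∑ w ∈ words n, v w • basisVec w := by
  ext1 x
  rw [Finset.sum_apply]
  simp only [Pi.smul_apply, basisVec, smul_eq_mul, mul_ite, mul_one, mul_zero,
    Finset.sum_ite_eq, mem_words]
  split_ifs with h
  · rfl
  · exact hv x h

theorem basisVec_mem_homog (w : List Bool) : basisVec w ∈ homog w.length := by
  intro x hx
  rw [basisVec, if_neg]
  rintro rfl
  exact hx rfl

/-- The product of the matrix elements of the operators between the words on consecutive lines. -/
noncomputable def stateWeight (g : Pt → Bool) :
    ℕ → List Bool → List (Op × List Bool) → (List Bool → ℤ[T;T⁻¹]) → ℤ[T;T⁻¹]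
  | k, a, [], F => F (lineWord g k 0 a)
  | k, a, (K, b) :: r, F =>
    K (basisVec (lineWord g k 0 a)) (lineWord g (k + 1) 0 b) * stateWeight g (k + 1) b r F

theorem stateWeight_congr {g g' : Pt → Bool} {k : ℕ} (h : ∀ p : Pt, k ≤ p.1 → g p = g' p)
    (a : List Bool) (r : List (Op × List Bool)) (F : List Bool → ℤ[T;T⁻¹]) :
    stateWeight g k a r F = stateWeight g' k a r F := by
  have hw : ∀ {l : ℕ} (b : List Bool), k ≤ l → lineWord g l 0 b = lineWord g' l 0 b :=
    fun b hl => lineWord_congr fun p hp => h p (by rwa [fst_of_mem_linePts hp])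
  induction r generalizing k a with
  | nil => rw [stateWeight, stateWeight, hw a le_rfl]
  | cons x r ih =>
    rw [stateWeight, stateWeight, hw a le_rfl, hw x.2 (Nat.le_succ k),
      ih (fun p hp => h p (by omega)) _ fun b hl => hw b (by omega)]

/-- The operators map the words on each line to the words on the next one. -/
def OpChain : List Bool → List (Op × List Bool) → Prop
  | _, [] => True
  | a, (K, b) :: r => (∀ v ∈ homog a.length, K v ∈ homog b.length) ∧ OpChain b r

/-- A state sum is a matrix element of a product of operators. -/
theorem sum_stateWeight (k : ℕ) (a : List Bool) (r : List (Op × List Bool)) (hr : OpChain a r)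
    (F : List Bool → ℤ[T;T⁻¹]) {v : Vec} (hv : v ∈ homog a.length) :
    ∑ S ∈ (ptsFrom k (a :: r.map Prod.snd)).toFinset.powerset,
      v (lineWord (memLabel S) k 0 a) * stateWeight (memLabel S) k a r F =
    ∑ w ∈ words ((a :: r.map Prod.snd).getLast (by simp)).length,
      F w * (r.foldl (fun v x => x.1 v) v) w := by
  induction r generalizing k a v with
  | nil =>
    have h := sum_powerset_linePts (fun w => v w * F w) k 0 a
    simp only [List.map_nil, ptsFrom, List.append_nil, stateWeight, List.getLast_singleton,
      List.foldl_nil] at h ⊢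
    rw [h]
    exact Finset.sum_congr rfl fun w _ => mul_comm _ _
  | cons x r ih =>
    obtain ⟨K, b⟩ := x
    obtain ⟨hK, hr⟩ := hr
    have hdis : Disjoint (linePts k 0 a).toFinset (ptsFrom (k + 1) (b :: r.map Prod.snd)).toFinset := by
      rw [Finset.disjoint_left]
      intro p h h'
      have := fst_of_mem_linePts (List.mem_toFinset.mp h)
      have := fst_of_mem_ptsFrom (List.mem_toFinset.mp h')
      omega
    have h1 := ih (k + 1) b hr (hK v hv)
    rw [List.map_cons, ptsFrom, List.toFinset_append, sum_powerset_union hdis]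
    simp only [List.foldl_cons, List.getLast_cons_cons] at h1 ⊢
    rw [← h1]
    refine Finset.sum_congr rfl fun S hS => ?_
    rw [Finset.mem_powerset] at hS
    have h2 : ∀ S' ∈ (linePts k 0 a).toFinset.powerset,
        v (lineWord (memLabel (S' ∪ S)) k 0 a) *
          stateWeight (memLabel (S' ∪ S)) k a ((K, b) :: r) F =
        (v (lineWord (memLabel S') k 0 a) * K (basisVec (lineWord (memLabel S') k 0 a))
          (lineWord (memLabel S) (k + 1) 0 b)) * stateWeight (memLabel S) (k + 1) b r F := by
      intro S' hS'
      rw [Finset.mem_powerset] at hS'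
      have e1 : lineWord (memLabel (S' ∪ S)) k 0 a = lineWord (memLabel S') k 0 a := by
        refine lineWord_congr fun p hp => ?_
        have : p ∉ S := fun h =>
          Finset.disjoint_left.mp hdis (List.mem_toFinset.mpr hp) (hS h)
        simp [memLabel, this]
      have e2 : ∀ p : Pt, k + 1 ≤ p.1 → memLabel (S' ∪ S) p = memLabel S p := by
        intro p hp
        have : p ∉ S' := fun h => by
          have := fst_of_mem_linePts (List.mem_toFinset.mp (hS' h))
          omega
        simp [memLabel, this]
      have e3 : lineWord (memLabel (S' ∪ S)) (k + 1) 0 b = lineWord (memLabel S) (k + 1) 0 b :=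
        lineWord_congr fun p hp => e2 p (fst_of_mem_linePts hp).ge
      rw [stateWeight, e1, e3, stateWeight_congr e2, mul_assoc]
    -- Only `v` and the matrix element of `K` depend on the labels of the lowest line. Summing over
    -- them replaces `v` by `K v`.
    rw [Finset.sum_congr rfl h2, ← Finset.sum_mul]
    congr 1
    have h3 := sum_powerset_linePts
      (fun w => v w * K (basisVec w) (lineWord (memLabel S) (k + 1) 0 b)) k 0 a
    rw [h3]
    conv_rhs => rw [eq_sum_basisVec hv, map_sum, Finset.sum_apply]
    exact Finset.sum_congr rfl fun w _ => by rw [map_smul]; rfl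

end

section

/-! ### The operator of a layer -/

/-- The coefficients of a local maximum. -/
noncomputable def capCoef : Bool → Bool → ℤ[T;T⁻¹]
  | false, true => T (-1)
  | true, false => 1
  | _, _ => 0

theorem lineWord_cons (g : Pt → Bool) (k j : ℕ) (o : Bool) (a : List Bool) :
    lineWord g k j (o :: a) = g (k, j, o) :: lineWord g k (j + 1) a := rfl

/-- The generator of a layer, `X` being the coefficients of the two smoothings of a crossing (the
first one consists of vertical strands). -/
noncomputable def Layer.gen (X : ℤ[T;T⁻¹] × ℤ[T;T⁻¹]) (L : Layer) : Gen :=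
  match L.piece with
  | .cup _ => .cup L.left.length
  | .cap _ => .cap L.left.length
  | .cross _ _ _ => .cross X.1 X.2 L.left.length

theorem Layer.gen_maps (X : ℤ[T;T⁻¹] × ℤ[T;T⁻¹]) (L : Layer) :
    (L.gen X).Maps L.dom.length L.cod.length := by
  obtain ⟨l, p, r⟩ := L
  cases p <;> simp [Layer.gen, Gen.Maps, Layer.dom, Layer.cod, Piece.dom, Piece.cod] <;> omega

theorem cup_apply_append (v : Vec) (l r : List Bool) (x y : Bool) :
    cup l.length v (l ++ x :: y :: r) = cupCoef x y * v (l ++ r) := by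
  induction l generalizing v with
  | nil => rfl
  | cons z l ih => exact ih (fun w => v (z :: w))

theorem cap_basisVec_append {l l' : List Bool} (h : l.length = l'.length) (x y : Bool)
    (r r' : List Bool) :
    cap l.length (basisVec (l ++ x :: y :: r)) (l' ++ r') =
      if l = l' ∧ r = r' then capCoef x y else 0 := by
  rw [h, cap_apply_append]
  by_cases hl : l = l'
  · subst hl
    by_cases hr : r = r'
    · subst hr
      cases x <;> cases y <;> simp [basisVec, capCoef]
    · simp [basisVec, hr, Ne.symm hr]
  · simp only [basisVec]
    rw [if_neg, if_neg, if_neg]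
    · simp
    all_goals
      intro h'
      first
        | exact hl h'.1
        | exact hl (List.append_inj h' (by simp [h])).1.symm

theorem cup_basisVec_append {l l' : List Bool} (h : l.length = l'.length) (x y : Bool)
    (r r' : List Bool) :
    cup l.length (basisVec (l ++ r)) (l' ++ x :: y :: r') =
      if l = l' ∧ r = r' then cupCoef x y else 0 := by
  rw [h, cup_apply_append, basisVec]
  by_cases hl : l = l'
  · subst hl
    by_cases hr : r = r'
    · simp [hr]
    · simp [hr, Ne.symm hr]
  · rw [if_neg, if_neg]
    · simp
    · exact fun h' => hl h'.1
    · exact fun h' => hl (List.append_inj h' (by simp [h])).1.symm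

theorem crossOp_basisVec_append (X Y : ℤ[T;T⁻¹]) {l l' : List Bool} (h : l.length = l'.length)
    (x y x' y' : Bool) (r r' : List Bool) :
    crossOp X Y l.length (basisVec (l ++ x :: y :: r)) (l' ++ x' :: y' :: r') =
      if l = l' ∧ r = r' then X * (if x = x' ∧ y = y' then 1 else 0) +
        Y * (capCoef x y * cupCoef x' y') else 0 := by
  have h1 : long (l.length + 2) (basisVec (l ++ x :: y :: r)) (l' ++ x' :: y' :: r') =
      if l = l' ∧ r = r' then (if x = x' ∧ y = y' then 1 else 0) else 0 := by
    rw [long_apply, if_pos (by simp [h]), basisVec]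
    by_cases hl : l = l'
    · subst hl
      simp only [List.append_cancel_left_eq, List.cons.injEq, true_and, eq_comm (a := x'),
        eq_comm (a := y'), eq_comm (a := r')]
      rw [← ite_and]
      exact if_congr (by tauto) rfl rfl
    · rw [if_neg, if_neg]
      · exact fun h' => hl h'.1
      · exact fun h' => hl (List.append_inj h' (by simp [h])).1.symm
  have h2 := cap_basisVec_append h x y r r'
  have h3 : cup l.length (cap l.length (basisVec (l ++ x :: y :: r))) (l' ++ x' :: y' :: r') =
      cupCoef x' y' * if l = l' ∧ r = r' then capCoef x y else 0 := by
    rw [← h2, h, cup_apply_append]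
  rw [crossOp, LinearMap.add_apply, Pi.add_apply, LinearMap.smul_apply, LinearMap.smul_apply,
    Pi.smul_apply, Pi.smul_apply, Module.End.mul_apply, h1, h3]
  split_ifs <;> simp [mul_comm]

/-- The labels on the two ends of each vertical strand of a layer agree. -/
def Layer.Sides (L : Layer) (k : ℕ) (g : Pt → Bool) : Prop :=
  lineWord g k 0 L.left = lineWord g (k + 1) 0 L.left ∧
  lineWord g k (L.left.length + L.piece.dom.length) L.right =
    lineWord g (k + 1) (L.left.length + L.piece.cod.length) L.right

instance (L : Layer) (k : ℕ) (g : Pt → Bool) : Decidable (L.Sides k g) := by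
  unfold Layer.Sides; infer_instance

/-- The matrix elements of a piece whose first leg is at the position `i`. -/
noncomputable def Piece.kern (X : ℤ[T;T⁻¹] × ℤ[T;T⁻¹]) (k i : ℕ) (g : Pt → Bool) :
    Piece → ℤ[T;T⁻¹]
  | .cup o => cupCoef (g (k + 1, i, o)) (g (k + 1, i + 1, !o))
  | .cap o => capCoef (g (k, i, o)) (g (k, i + 1, !o))
  | .cross a b _ =>
    X.1 * (if g (k, i, a) = g (k + 1, i, b) ∧ g (k, i + 1, b) = g (k + 1, i + 1, a) then 1 else 0) +
    X.2 * (capCoef (g (k, i, a)) (g (k, i + 1, b)) *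
      cupCoef (g (k + 1, i, b)) (g (k + 1, i + 1, a)))

/-- The generator acts on the factors of its piece only, so the spins on the vertical strands must
be unchanged; this is the condition `Sides`. -/
theorem Layer.gen_basisVec (X : ℤ[T;T⁻¹] × ℤ[T;T⁻¹]) (L : Layer) (k : ℕ) (g : Pt → Bool) :
    (L.gen X).op (basisVec (lineWord g k 0 L.dom)) (lineWord g (k + 1) 0 L.cod) =
      if L.Sides k g then L.piece.kern X k L.left.length g else 0 := by
  obtain ⟨l, p, r⟩ := L
  have hl := length_lineWord g k 0 l
  have h := hl.trans (length_lineWord g (k + 1) 0 l).symm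
  cases p with
  | cup o =>
    have := cup_basisVec_append h (g (k + 1, l.length, o)) (g (k + 1, l.length + 1, !o))
      (lineWord g k l.length r) (lineWord g (k + 1) (l.length + 2) r)
    rw [hl] at this
    simpa [Layer.gen, Gen.op, Layer.dom, Layer.cod, Piece.dom, Piece.cod, lineWord_append,
      Layer.Sides, Piece.kern, lineWord_cons] using this
  | cap o =>
    have := cap_basisVec_append h (g (k, l.length, o)) (g (k, l.length + 1, !o))
      (lineWord g k (l.length + 2) r) (lineWord g (k + 1) l.length r)
    rw [hl] at this
    simpa [Layer.gen, Gen.op, Layer.dom, Layer.cod, Piece.dom, Piece.cod, lineWord_append,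
      Layer.Sides, Piece.kern, lineWord_cons] using this
  | cross a b f =>
    have := crossOp_basisVec_append X.1 X.2 h (g (k, l.length, a)) (g (k, l.length + 1, b))
      (g (k + 1, l.length, b)) (g (k + 1, l.length + 1, a))
      (lineWord g k (l.length + 2) r) (lineWord g (k + 1) (l.length + 2) r)
    rw [hl] at this
    simpa [Layer.gen, Gen.op, Layer.dom, Layer.cod, Piece.dom, Piece.cod, lineWord_append,
      Layer.Sides, Piece.kern, lineWord_cons] using this

/-- The generators of a word of layers, with given coefficients of the smoothings. -/
noncomputable def gensOf : List (ℤ[T;T⁻¹] × ℤ[T;T⁻¹]) → List Layer → List Gen :=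
  List.zipWith Layer.gen

theorem genChain_of_composable {a b : List Bool} {Ls : List Layer} (h : Composable a Ls b)
    {Xs : List (ℤ[T;T⁻¹] × ℤ[T;T⁻¹])} (hX : Xs.length = Ls.length) :
    GenChain a.length (gensOf Xs Ls) b.length := by
  induction Ls generalizing a Xs with
  | nil =>
    obtain rfl : a = b := h
    simp [gensOf, GenChain]
  | cons L Ls ih =>
    obtain ⟨rfl, h⟩ := h
    rcases Xs with _ | ⟨X, Xs⟩
    · simp at hX
    · exact ⟨L.cod.length, L.gen_maps X, ih h (by simpa using hX)⟩

/-- The product of the matrix elements of the layers. -/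
noncomputable def layersWeight (g : Pt → Bool) :
    ℕ → List (ℤ[T;T⁻¹] × ℤ[T;T⁻¹]) → List Layer → ℤ[T;T⁻¹]
  | k, X :: Xs, L :: Ls =>
    (if L.Sides k g then L.piece.kern X k L.left.length g else 0) * layersWeight g (k + 1) Xs Ls
  | _, _, _ => 1

/-- The bridge between both languages: sums over subsets of the points, used by walks and
smoothings, and matrix elements of operators, where planar algebra applies. `v` and `F` are the
boundary conditions below and above. -/
theorem sum_layersWeight {D : Diagram} {b : List Bool} (h : Composable D.bottom D.layers b)
    {Xs : List (ℤ[T;T⁻¹] × ℤ[T;T⁻¹])} (hX : Xs.length = D.layers.length)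
    (F : List Bool → ℤ[T;T⁻¹]) {v : Vec} (hv : v ∈ homog D.bottom.length) :
    ∑ S ∈ D.points.powerset, v (lineWord (memLabel S) 0 0 D.bottom) *
      (layersWeight (memLabel S) 0 Xs D.layers *
        F (lineWord (memLabel S) D.layers.length 0 b)) =
    ∑ w ∈ words b.length, F w * opList (gensOf Xs D.layers) v w := by
  obtain ⟨a, Ls⟩ := D
  simp only at h hX hv ⊢
  set r : List (Op × List Bool) := List.zipWith (fun X L => ((Layer.gen X L).op, L.cod)) Xs Ls
    with hr
  have key : ∀ (Ls : List Layer) (Xs : List (ℤ[T;T⁻¹] × ℤ[T;T⁻¹])) (a : List Bool) (k : ℕ)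
      (g : Pt → Bool), Composable a Ls b → Xs.length = Ls.length →
      let r : List (Op × List Bool) := List.zipWith (fun X L => ((Layer.gen X L).op, L.cod)) Xs Ls
      OpChain a r ∧ r.map Prod.snd = Ls.map Layer.cod ∧ (a :: r.map Prod.snd).getLast (by simp) = b ∧
      (∀ v, r.foldl (fun v x => x.1 v) v = opList (gensOf Xs Ls) v) ∧
      stateWeight g k a r F =
        layersWeight g k Xs Ls * F (lineWord g (k + Ls.length) 0 b) := by
    intro Ls
    induction Ls with
    | nil =>
      rintro Xs a k g h hX
      obtain rfl : Xs = [] := by simpa using hX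
      obtain rfl : a = b := h
      simp [OpChain, gensOf, opList, stateWeight, layersWeight]
    | cons L Ls ih =>
      rintro (_ | ⟨X, Xs⟩) a k g ⟨rfl, h⟩ hX
      · simp at hX
      · obtain ⟨h1, h2, h3, h4, h5⟩ := ih Xs L.cod (k + 1) g h (by simpa using hX)
        refine ⟨⟨fun v hv => (L.gen_maps X).mem_homog hv, h1⟩, ?_, ?_, ?_, ?_⟩
        · simp only [List.zipWith_cons_cons, List.map_cons, h2]
        · exact (List.getLast_cons_cons ..).trans h3
        · exact fun v => h4 _
        · simp only [List.zipWith_cons_cons, stateWeight, h5, Layer.gen_basisVec, layersWeight,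
            mul_assoc, List.length_cons]
          rw [show k + 1 + Ls.length = k + (Ls.length + 1) by omega]
  have h1 := key Ls Xs a 0 (memLabel ∅) h hX
  have h2 := sum_stateWeight 0 a r h1.1 F hv
  have h3 : (a :: r.map Prod.snd).getLast (by simp) = b := h1.2.2.1
  simp only [h3, show ∀ v, r.foldl (fun v x => x.1 v) v = _ from h1.2.2.2.1] at h2
  rw [← h2, points_eq, show r.map Prod.snd = Ls.map Layer.cod from h1.2.1]
  refine Finset.sum_congr rfl fun S _ => ?_
  have h4 := (key Ls Xs a 0 (memLabel S) h hX).2.2.2.2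
  rw [zero_add] at h4
  rw [show stateWeight (memLabel S) 0 a r F = _ from h4]

end

section

/-! ### Sources and targets -/

/-- The vertical strands with directions `a`. -/
def vert (k j j' : ℕ) (a : List Bool) : List (Pt × Pt) :=
  a.zipIdx.map fun x => orient x.1 (k, j + x.2, x.1) (k + 1, j' + x.2, x.1)

theorem zipIdx_succ_map {α β : Type*} (a : List α) (f : α × ℕ → β) :
    (a.zipIdx 1).map f = a.zipIdx.map fun x => f (x.1, x.2 + 1) := by
  rw [List.zipIdx_succ, List.map_map]; rfl

theorem vert_cons (k j j' : ℕ) (o : Bool) (a : List Bool) :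
    vert k j j' (o :: a) = orient o (k, j, o) (k + 1, j', o) :: vert k (j + 1) (j' + 1) a := by
  simp only [vert, List.zipIdx_cons, List.map_cons, add_zero, zero_add, zipIdx_succ_map]
  simp only [add_assoc, add_comm 1]

/-- The strand of a local minimum or maximum. -/
def Layer.pieceLinks (L : Layer) (k : ℕ) : List (Pt × Pt) :=
  match L.piece with
  | .cup o => [orient o (k + 1, L.left.length + 1, !o) (k + 1, L.left.length, o)]
  | .cap o => [orient o (k, L.left.length, o) (k, L.left.length + 1, !o)]
  | .cross _ _ _ => []

theorem Layer.links_eq (L : Layer) (k : ℕ) : L.links k = vert k 0 0 L.left ++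
    vert k (L.left.length + L.piece.dom.length) (L.left.length + L.piece.cod.length) L.right ++
    L.pieceLinks k := by
  obtain ⟨l, p, r⟩ := L
  cases p <;> simp [Layer.links, vert, Layer.pieceLinks]

/-- The strands of the layers from number `k` on. -/
def linksFrom (k : ℕ) (Ls : List Layer) : List (Pt × Pt) :=
  (Ls.zipIdx k).flatMap fun x => x.1.links x.2

/-- The crossings of the layers from number `k` on. -/
def crossingsFrom (k : ℕ) (Ls : List Layer) : List Crossing :=
  (Ls.zipIdx k).flatMap fun x => x.1.crossings x.2

@[simp] theorem linksFrom_cons (k : ℕ) (L : Layer) (Ls : List Layer) :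
    linksFrom k (L :: Ls) = L.links k ++ linksFrom (k + 1) Ls := by
  simp [linksFrom, List.zipIdx_cons]

@[simp] theorem crossingsFrom_cons (k : ℕ) (L : Layer) (Ls : List Layer) :
    crossingsFrom k (L :: Ls) = L.crossings k ++ crossingsFrom (k + 1) Ls := by
  simp [crossingsFrom, List.zipIdx_cons]

/-- The sources of strands. -/
def insOf (l : List (Pt × Pt)) (c : List Crossing) : List Pt :=
  l.map Prod.fst ++ c.flatMap fun x => [x.overIn, x.underIn]

/-- The targets of strands. -/
def outsOf (l : List (Pt × Pt)) (c : List Crossing) : List Pt :=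
  l.map Prod.snd ++ c.flatMap fun x => [x.overOut, x.underOut]

theorem insOf_append (l l' : List (Pt × Pt)) (c c' : List Crossing) :
    (insOf (l ++ l') (c ++ c') : Multiset Pt) = insOf l c + insOf l' c' := by
  simp only [insOf, List.map_append, List.flatMap_append, ← Multiset.coe_add]
  abel

theorem outsOf_append (l l' : List (Pt × Pt)) (c c' : List Crossing) :
    (outsOf (l ++ l') (c ++ c') : Multiset Pt) = outsOf l c + outsOf l' c' := by
  simp only [outsOf, List.map_append, List.flatMap_append, ← Multiset.coe_add]
  abel

/-- The points on upward strands. -/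
def ups (l : List Pt) : List Pt := l.filter fun p => p.2.2

/-- The points on downward strands. -/
def downs (l : List Pt) : List Pt := l.filter fun p => !p.2.2

theorem ups_append (l l' : List Pt) : ups (l ++ l') = ups l ++ ups l' := List.filter_append ..

theorem downs_append (l l' : List Pt) : downs (l ++ l') = downs l ++ downs l' :=
  List.filter_append ..

theorem ups_add_downs (l : List Pt) : (ups l + downs l : Multiset Pt) = l := by
  rw [Multiset.coe_add, Multiset.coe_eq_coe]
  exact List.filter_append_perm _ _

theorem vert_fst (k j j' : ℕ) (a : List Bool) : ((vert k j j' a).map Prod.fst : Multiset Pt) =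
    ups (linePts k j a) + downs (linePts (k + 1) j' a) := by
  induction a generalizing j j' with
  | nil => rfl
  | cons o a ih =>
    have := ih (j + 1) (j' + 1)
    rw [vert_cons, List.map_cons, ← Multiset.cons_coe, this]
    cases o <;> simp [orient, linePts_cons, ups, downs, List.perm_middle.symm]

theorem vert_snd (k j j' : ℕ) (a : List Bool) : ((vert k j j' a).map Prod.snd : Multiset Pt) =
    ups (linePts (k + 1) j' a) + downs (linePts k j a) := by
  induction a generalizing j j' with
  | nil => rfl
  | cons o a ih =>
    have := ih (j + 1) (j' + 1)
    rw [vert_cons, List.map_cons, ← Multiset.cons_coe, this]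
    cases o <;> simp [orient, linePts_cons, ups, downs, List.perm_middle.symm]

theorem Layer.linePts_dom (L : Layer) (k : ℕ) : linePts k 0 L.dom = linePts k 0 L.left ++
    linePts k L.left.length L.piece.dom ++
    linePts k (L.left.length + L.piece.dom.length) L.right := by
  simp [Layer.dom, linePts_append]

theorem Layer.linePts_cod (L : Layer) (k : ℕ) : linePts k 0 L.cod = linePts k 0 L.left ++
    linePts k L.left.length L.piece.cod ++
    linePts k (L.left.length + L.piece.cod.length) L.right := by
  simp [Layer.cod, linePts_append]

theorem linePts_nil (k j : ℕ) : linePts k j [] = [] := rfl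

/-- A strand enters a layer through an upward point of the lower line or a downward point of the
upper line. -/
theorem Layer.insOf_eq (L : Layer) (k : ℕ) : (insOf (L.links k) (L.crossings k) : Multiset Pt) =
    ups (linePts k 0 L.dom) + downs (linePts (k + 1) 0 L.cod) := by
  have h : (insOf (L.pieceLinks k) (L.crossings k) : Multiset Pt) =
      ups (linePts k L.left.length L.piece.dom) +
        downs (linePts (k + 1) L.left.length L.piece.cod) := by
    obtain ⟨l, p, r⟩ := L
    rw [Multiset.coe_add, Multiset.coe_eq_coe]
    rcases p with (_ | _) | (_ | _) | ⟨_ | _, _ | _, _ | _⟩ <;>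
      simp [insOf, Layer.pieceLinks, Layer.crossings, orient, ups, downs, Piece.dom, Piece.cod,
        linePts_cons, linePts_nil, List.Perm.swap]
  have h' : (insOf (L.links k) (L.crossings k) : Multiset Pt) =
      ((vert k 0 0 L.left).map Prod.fst : Multiset Pt) + ((vert k (L.left.length +
        L.piece.dom.length) (L.left.length + L.piece.cod.length) L.right).map Prod.fst :
        Multiset Pt) + (insOf (L.pieceLinks k) (L.crossings k) : Multiset Pt) := by
    simp only [insOf, L.links_eq, List.map_append, ← Multiset.coe_add]
    abel
  rw [h', h, vert_fst, vert_fst, L.linePts_dom, L.linePts_cod]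
  simp only [ups_append, downs_append, ← Multiset.coe_add]
  abel

theorem Layer.outsOf_eq (L : Layer) (k : ℕ) : (outsOf (L.links k) (L.crossings k) : Multiset Pt) =
    ups (linePts (k + 1) 0 L.cod) + downs (linePts k 0 L.dom) := by
  have h : (outsOf (L.pieceLinks k) (L.crossings k) : Multiset Pt) =
      ups (linePts (k + 1) L.left.length L.piece.cod) +
        downs (linePts k L.left.length L.piece.dom) := by
    obtain ⟨l, p, r⟩ := L
    rw [Multiset.coe_add, Multiset.coe_eq_coe]
    rcases p with (_ | _) | (_ | _) | ⟨_ | _, _ | _, _ | _⟩ <;>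
      simp [outsOf, Layer.pieceLinks, Layer.crossings, orient, ups, downs, Piece.dom, Piece.cod,
        linePts_cons, linePts_nil, List.Perm.swap]
  have h' : (outsOf (L.links k) (L.crossings k) : Multiset Pt) =
      ((vert k 0 0 L.left).map Prod.snd : Multiset Pt) + ((vert k (L.left.length +
        L.piece.dom.length) (L.left.length + L.piece.cod.length) L.right).map Prod.snd :
        Multiset Pt) + (outsOf (L.pieceLinks k) (L.crossings k) : Multiset Pt) := by
    simp only [outsOf, L.links_eq, List.map_append, ← Multiset.coe_add]
    abel
  rw [h', h, vert_snd, vert_snd, L.linePts_dom, L.linePts_cod]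
  simp only [ups_append, downs_append, ← Multiset.coe_add]
  abel

/-- On an interior line an upward point is a source for the layer above and a downward point for the
layer below, so each point is counted once. Stated for multisets, this gives at the same time that
sources are distinct and that only ends of the diagram are not sources. -/
theorem insOf_from {a b : List Bool} {Ls : List Layer} (h : Composable a Ls b) (k : ℕ) :
    (insOf (linksFrom k Ls) (crossingsFrom k Ls) + ups (linePts (k + Ls.length) 0 b) +
      downs (linePts k 0 a) : Multiset Pt) = ptsFrom k (a :: Ls.map Layer.cod) := by
  induction Ls generalizing a k with
  | nil =>
    obtain rfl : a = b := h
    have := ups_add_downs (linePts k 0 a)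
    simpa [linksFrom, crossingsFrom, insOf, ptsFrom] using this
  | cons L Ls ih =>
    obtain ⟨rfl, h⟩ := h
    have h1 := ih h (k + 1)
    have h2 := ups_add_downs (linePts k 0 L.dom)
    have h3 : ptsFrom k (L.dom :: (L :: Ls).map Layer.cod) = linePts k 0 L.dom ++
        ptsFrom (k + 1) (L.cod :: Ls.map Layer.cod) := rfl
    rw [h3, ← Multiset.coe_add, ← h1, ← h2, linksFrom_cons, crossingsFrom_cons, insOf_append,
      L.insOf_eq, List.length_cons, show k + 1 + Ls.length = k + (Ls.length + 1) by omega]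
    abel

theorem outsOf_from {a b : List Bool} {Ls : List Layer} (h : Composable a Ls b) (k : ℕ) :
    (outsOf (linksFrom k Ls) (crossingsFrom k Ls) + downs (linePts (k + Ls.length) 0 b) +
      ups (linePts k 0 a) : Multiset Pt) = ptsFrom k (a :: Ls.map Layer.cod) := by
  induction Ls generalizing a k with
  | nil =>
    obtain rfl : a = b := h
    have := ups_add_downs (linePts k 0 a)
    rw [add_comm] at this
    simpa [linksFrom, crossingsFrom, outsOf, ptsFrom] using this
  | cons L Ls ih =>
    obtain ⟨rfl, h⟩ := h
    have h1 := ih h (k + 1)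
    have h2 := ups_add_downs (linePts k 0 L.dom)
    have h3 : ptsFrom k (L.dom :: (L :: Ls).map Layer.cod) = linePts k 0 L.dom ++
        ptsFrom (k + 1) (L.cod :: Ls.map Layer.cod) := rfl
    rw [h3, ← Multiset.coe_add, ← h1, ← h2, linksFrom_cons, crossingsFrom_cons, outsOf_append,
      L.outsOf_eq, List.length_cons, show k + 1 + Ls.length = k + (Ls.length + 1) by omega]
    abel

/-! ### Sources and targets are distinct points of the diagram -/

section Diagram

variable {D : Diagram} {b : List Bool} (h : Composable D.bottom D.layers b)
include h

theorem ins_le_pts : (insOf D.links D.crossings : Multiset Pt) ≤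
    ptsFrom 0 (D.bottom :: D.layers.map Layer.cod) := by
  rw [← insOf_from h 0, add_assoc]; exact Multiset.le_add_right _ _

theorem outs_le_pts : (outsOf D.links D.crossings : Multiset Pt) ≤
    ptsFrom 0 (D.bottom :: D.layers.map Layer.cod) := by
  rw [← outsOf_from h 0, add_assoc]; exact Multiset.le_add_right _ _

theorem nodup_ins : (insOf D.links D.crossings).Nodup :=
  Multiset.coe_nodup.mp (Multiset.nodup_of_le (ins_le_pts h) (Multiset.coe_nodup.mpr (nodup_ptsFrom _ _)))

theorem nodup_outs : (outsOf D.links D.crossings).Nodup :=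
  Multiset.coe_nodup.mp (Multiset.nodup_of_le (outs_le_pts h) (Multiset.coe_nodup.mpr (nodup_ptsFrom _ _)))

theorem mem_points_of_mem_ins {p : Pt} (hp : p ∈ insOf D.links D.crossings) : p ∈ D.points := by
  rw [points_eq, List.mem_toFinset]
  exact Multiset.mem_coe.mp (Multiset.mem_of_le (ins_le_pts h) (Multiset.mem_coe.mpr hp))

theorem mem_points_of_mem_outs {p : Pt} (hp : p ∈ outsOf D.links D.crossings) : p ∈ D.points := by
  rw [points_eq, List.mem_toFinset]
  exact Multiset.mem_coe.mp (Multiset.mem_of_le (outs_le_pts h) (Multiset.mem_coe.mpr hp))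

theorem mem_points_of_mem_links {z : Pt × Pt} (hz : z ∈ D.links) :
    z.1 ∈ D.points ∧ z.2 ∈ D.points :=
  ⟨mem_points_of_mem_ins h (List.mem_append_left _ (List.mem_map_of_mem hz)),
    mem_points_of_mem_outs h (List.mem_append_left _ (List.mem_map_of_mem hz))⟩

theorem mem_points_of_mem_crossings {c : Crossing} (hc : c ∈ D.crossings) :
    c.overIn ∈ D.points ∧ c.overOut ∈ D.points ∧ c.underIn ∈ D.points ∧ c.underOut ∈ D.points := by
  have hi : ∀ p ∈ [c.overIn, c.underIn], p ∈ D.points := fun p hp =>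
    mem_points_of_mem_ins h (List.mem_append_right _ (List.mem_flatMap.mpr ⟨c, hc, hp⟩))
  have ho : ∀ p ∈ [c.overOut, c.underOut], p ∈ D.points := fun p hp =>
    mem_points_of_mem_outs h (List.mem_append_right _ (List.mem_flatMap.mpr ⟨c, hc, hp⟩))
  exact ⟨hi _ (by simp), ho _ (by simp), hi _ (by simp), ho _ (by simp)⟩

end Diagram

theorem forall_vert_iff (g : Pt → Bool) (k j j' : ℕ) (a : List Bool) :
    (∀ z ∈ vert k j j' a, g z.1 = g z.2) ↔ lineWord g k j a = lineWord g (k + 1) j' a := by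
  induction a generalizing j j' with
  | nil => simp [vert, lineWord, linePts]
  | cons o a ih =>
    rw [vert_cons, lineWord_cons, lineWord_cons, List.forall_mem_cons, ih, List.cons.injEq]
    cases o <;> simp [orient, eq_comm]

theorem fst_ne_of_mem_vert {k j j' : ℕ} {a : List Bool} {z : Pt × Pt} (h : z ∈ vert k j j' a) :
    z.1.1 ≠ z.2.1 ∧ z.1.2.2 = z.2.2.2 := by
  simp only [vert, List.mem_map] at h
  obtain ⟨⟨o, i⟩, -, rfl⟩ := h
  cases o <;> simp [orient]

theorem Layer.sides_iff (L : Layer) (k : ℕ) (g : Pt → Bool) : L.Sides k g ↔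
    (∀ z ∈ vert k 0 0 L.left, g z.1 = g z.2) ∧ ∀ z ∈ vert k (L.left.length + L.piece.dom.length)
      (L.left.length + L.piece.cod.length) L.right, g z.1 = g z.2 := by
  rw [forall_vert_iff, forall_vert_iff, Layer.Sides]

end

section

/-! ### The Jones polynomial as an operator -/

/-- The coefficients of the smoothings with and without orientation, given whether the vertical
smoothing is the oriented one. -/
def sortCoefs {α : Type*} (vertical : Bool) (x y : α) : α × α := if vertical then (x, y) else (y, x)

/-- The coefficients of the two smoothings in the Jones polynomial. -/
noncomputable def jonesCoef (L : Layer) : ℤ[T;T⁻¹] × ℤ[T;T⁻¹] :=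
  match L.piece with
  | .cross a b f =>
    let ε : ℤ := if f == (a == b) then 1 else -1
    sortCoefs (a == b) (T (-ε)) (-T (-2 * ε))
  | _ => (0, 0)

/-- The operator of a word of layers in the normalization of the Jones polynomial. -/
noncomputable def jonesOp (Ls : List Layer) : Op := opList (gensOf (Ls.map jonesCoef) Ls)

/-- The coefficients that describe the choice of one smoothing at each crossing. -/
noncomputable def smoothCoefs : List Bool → List Layer → List (ℤ[T;T⁻¹] × ℤ[T;T⁻¹])
  | _, [] => []
  | bs, L :: Ls =>
    match L.piece with
    | .cross a b _ => sortCoefs ((a == b) == bs.headD true) 1 0 :: smoothCoefs bs.tail Ls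
    | _ => (0, 0) :: smoothCoefs bs Ls

/-- The coefficient of a choice of smoothings. -/
noncomputable def bitsWeight (cs : List Crossing) (bs : List Bool) : ℤ[T;T⁻¹] :=
  ((cs.zip bs).map fun p => if p.2 then T (-p.1.sign) else -T (-2 * p.1.sign)).prod

theorem crossOp_eq (x y : ℤ[T;T⁻¹]) (i : ℕ) :
    crossOp x y i = x • crossOp 1 0 i + y • crossOp 0 1 i := by
  simp [crossOp]

/-- Multilinear expansion of the crossings. The bit `true` is the oriented smoothing, which is
vertical exactly if both strands have the same direction. -/
theorem jonesOp_eq_sum (k : ℕ) (Ls : List Layer) :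
    jonesOp Ls = ∑ bs ∈ words (crossingsFrom k Ls).length,
      bitsWeight (crossingsFrom k Ls) bs • opList (gensOf (smoothCoefs bs Ls) Ls) := by
  induction Ls generalizing k with
  | nil => simp [jonesOp, crossingsFrom, words, bitsWeight, gensOf, opList]
  | cons L Ls ih =>
    have h0 : jonesOp (L :: Ls) = jonesOp Ls * (L.gen (jonesCoef L)).op := rfl
    obtain ⟨l, p, r⟩ := L
    rcases p with o | o | ⟨a, b, f⟩
    · have hc : Layer.crossings ⟨l, .cup o, r⟩ k = [] := rfl
      rw [h0, ih (k + 1), crossingsFrom_cons, hc, List.nil_append, Finset.sum_mul]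
      refine Finset.sum_congr rfl fun bs _ => ?_
      rw [smul_mul_assoc]; rfl
    · have hc : Layer.crossings ⟨l, .cap o, r⟩ k = [] := rfl
      rw [h0, ih (k + 1), crossingsFrom_cons, hc, List.nil_append, Finset.sum_mul]
      refine Finset.sum_congr rfl fun bs _ => ?_
      rw [smul_mul_assoc]; rfl
    · obtain ⟨c, hc, hs⟩ : ∃ c, Layer.crossings ⟨l, .cross a b f, r⟩ k = [c] ∧
          c.sign = if f == (a == b) then 1 else -1 := ⟨_, rfl, rfl⟩
      rw [h0, ih (k + 1), crossingsFrom_cons, hc, List.singleton_append, List.length_cons,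
        sum_words_succ, Finset.sum_mul]
      refine Finset.sum_congr rfl fun bs _ => ?_
      have hg : (Layer.gen (jonesCoef ⟨l, .cross a b f, r⟩) ⟨l, .cross a b f, r⟩).op =
          (T (-c.sign) : ℤ[T;T⁻¹]) • (Layer.gen (sortCoefs (a == b) 1 0) ⟨l, .cross a b f, r⟩).op +
          (-T (-2 * c.sign) : ℤ[T;T⁻¹]) • (Layer.gen (sortCoefs (!(a == b)) 1 0) ⟨l, .cross a b f, r⟩).op := by
        rw [hs]
        simp only [Layer.gen, Gen.op, jonesCoef]
        cases a == b
        · simp only [sortCoefs]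
          rw [crossOp_eq, add_comm]
          simp
        · simp only [sortCoefs]
          rw [crossOp_eq]
          simp
      have e1 : bitsWeight (c :: crossingsFrom (k + 1) Ls) (true :: bs) =
          T (-c.sign) * bitsWeight (crossingsFrom (k + 1) Ls) bs := by
        simp [bitsWeight]
      have e2 : bitsWeight (c :: crossingsFrom (k + 1) Ls) (false :: bs) =
          -T (-2 * c.sign) * bitsWeight (crossingsFrom (k + 1) Ls) bs := by
        simp [bitsWeight]
      have e3 : ∀ x, opList (gensOf (smoothCoefs (x :: bs) (⟨l, .cross a b f, r⟩ :: Ls))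
          (⟨l, .cross a b f, r⟩ :: Ls)) = opList (gensOf (smoothCoefs bs Ls) Ls) *
            (Layer.gen (sortCoefs ((a == b) == x) 1 0) ⟨l, .cross a b f, r⟩).op := fun x => rfl
      rw [hg, e1, e2, e3, e3]
      simp only [mul_add, mul_smul_comm, smul_mul_assoc, smul_smul]
      rw [add_comm, mul_comm]
      cases a == b <;> rfl

theorem length_smoothCoefs (bs : List Bool) (Ls : List Layer) :
    (smoothCoefs bs Ls).length = Ls.length := by
  induction Ls generalizing bs with
  | nil => rfl
  | cons L Ls ih =>
    obtain ⟨l, p, r⟩ := L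
    cases p <;> simp [smoothCoefs, ih]

theorem isSmooth_of_mem_gensOf (bs : List Bool) (Ls : List Layer) :
    ∀ g ∈ gensOf (smoothCoefs bs Ls) Ls, g.IsSmooth := by
  induction Ls generalizing bs with
  | nil => simp [gensOf, smoothCoefs]
  | cons L Ls ih =>
    obtain ⟨l, p, r⟩ := L
    cases p with
    | cup o => exact List.forall_mem_cons.mpr ⟨trivial, ih bs⟩
    | cap o => exact List.forall_mem_cons.mpr ⟨trivial, ih bs⟩
    | cross a b f =>
      refine List.forall_mem_cons.mpr ⟨?_, ih bs.tail⟩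
      simp only [Layer.gen, Gen.IsSmooth]
      cases ((a == b) == bs.headD true) <;> simp [sortCoefs]

/-- Evaluation at `q = 1`. -/
noncomputable def evalOne : ℤ[T;T⁻¹] →+* ℤ := eval₂ (RingHom.id ℤ) (1 : ℤˣ)

@[simp] theorem evalOne_T (n : ℤ) : evalOne (T n) = 1 := by simp [evalOne]

theorem evalOne_cupCoef (x y : Bool) : evalOne (cupCoef x y) = if x ≠ y then 1 else 0 := by
  cases x <;> cases y <;> simp [cupCoef]

theorem evalOne_capCoef (x y : Bool) : evalOne (capCoef x y) = if x ≠ y then 1 else 0 := by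
  cases x <;> cases y <;> simp [capCoef]

/-- Adjacency at a crossing after smoothing. -/
def Crossing.Adj (c : Crossing) (x : Bool) (p q : Pt) : Prop :=
  if x then (p, q) = (c.overIn, c.underOut) ∨ (p, q) = (c.underIn, c.overOut)
  else (p, q) = (c.overIn, c.underIn) ∨ (p, q) = (c.overOut, c.underOut)

/-- The labels of two adjacent points agree iff the strand between them is vertical. -/
def Agree (g : Pt → Bool) (p q : Pt) : Prop := g p = g q ↔ p.1 ≠ q.1

/-- Adjacency in a word of layers after smoothing. -/
def BitsAdj (ls : List (Pt × Pt)) (cs : List Crossing) (bs : List Bool) (p q : Pt) : Prop :=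
  (p, q) ∈ ls ∨ ∃ z ∈ cs.zip bs, z.1.Adj z.2 p q

theorem forall_bitsAdj_append {ls ls' : List (Pt × Pt)} {cs cs' : List Crossing}
    {bs bs' : List Bool} (h : cs.length = bs.length) (P : Pt → Pt → Prop) :
    (∀ p q, BitsAdj (ls ++ ls') (cs ++ cs') (bs ++ bs') p q → P p q) ↔
      (∀ p q, BitsAdj ls cs bs p q → P p q) ∧ ∀ p q, BitsAdj ls' cs' bs' p q → P p q := by
  simp only [BitsAdj, List.zip_append h, List.mem_append, or_and_right, exists_or]
  constructor
  · exact fun H => ⟨fun p q h => H p q (h.elim (fun h => .inl (.inl h)) fun h => .inr (.inl h)),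
      fun p q h => H p q (h.elim (fun h => .inl (.inr h)) fun h => .inr (.inr h))⟩
  · rintro ⟨H1, H2⟩ p q h
    rcases h with (h | h) | h | h
    exacts [H1 p q (.inl h), H2 p q (.inl h), H1 p q (.inr h), H2 p q (.inr h)]

theorem Layer.forall_bitsAdj_iff (L : Layer) (k : ℕ) (g : Pt → Bool) (bs : List Bool) :
    (∀ p q, BitsAdj (L.links k) (L.crossings k) bs p q → Agree g p q) ↔
      L.Sides k g ∧ ∀ p q, BitsAdj (L.pieceLinks k) (L.crossings k) bs p q → Agree g p q := by
  have hv : ∀ k j j' a, (∀ z ∈ vert k j j' a, g z.1 = g z.2) ↔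
      ∀ p q, (p, q) ∈ vert k j j' a → Agree g p q := by
    intro k j j' a
    refine ⟨fun H p q h => ?_, fun H z h => ?_⟩
    · have := fst_ne_of_mem_vert h
      simpa [Agree, this.1] using H _ h
    · have := fst_ne_of_mem_vert h
      simpa [Agree, this.1] using H _ _ h
  rw [L.sides_iff, hv, hv]
  simp only [BitsAdj, L.links_eq, List.mem_append]
  constructor
  · exact fun H => ⟨⟨fun p q h => H p q (by tauto), fun p q h => H p q (by tauto)⟩,
      fun p q h => H p q (by tauto)⟩
  · rintro ⟨⟨H1, H2⟩, H3⟩ p q (((h | h) | h) | h)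
    exacts [H1 p q h, H2 p q h, H3 p q (.inl h), H3 p q (.inr h)]

open Classical in
-- At q = 1 the coefficients of a minimum or a maximum only ask for opposite spins at its two legs,
-- and vertical strands ask for equal spins. So the weight is the indicator of the labellings that
-- obey `Agree` along every smoothed strand.
theorem evalOne_layersWeight (g : Pt → Bool) (k : ℕ) (bs : List Bool) (Ls : List Layer)
    (hb : bs.length = (crossingsFrom k Ls).length) :
    evalOne (layersWeight g k (smoothCoefs bs Ls) Ls) =
      if ∀ p q, BitsAdj (linksFrom k Ls) (crossingsFrom k Ls) bs p q → Agree g p q then 1 else 0 := by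
  induction Ls generalizing k bs with
  | nil => simp [smoothCoefs, layersWeight, linksFrom, crossingsFrom, BitsAdj]
  | cons L Ls ih =>
    rw [linksFrom_cons, crossingsFrom_cons]
    rw [crossingsFrom_cons, List.length_append] at hb
    obtain ⟨bs, bs', rfl, hbs, hbs'⟩ : ∃ b b', bs = b ++ b' ∧ (L.crossings k).length = b.length ∧
        b'.length = (crossingsFrom (k + 1) Ls).length :=
      ⟨bs.take (L.crossings k).length, bs.drop (L.crossings k).length, by simp, by simp; omega,
        by simp; omega⟩
    rw [forall_bitsAdj_append hbs, L.forall_bitsAdj_iff]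
    have step : ∃ X, smoothCoefs (bs ++ bs') (L :: Ls) = X :: smoothCoefs bs' Ls ∧
        evalOne (L.piece.kern X k L.left.length g) =
          if ∀ p q, BitsAdj (L.pieceLinks k) (L.crossings k) bs p q → Agree g p q
            then 1 else 0 := by
      obtain ⟨l, p, r⟩ := L
      rcases p with o | o | ⟨a, b, f⟩
      · obtain rfl : bs = [] := List.length_eq_zero_iff.mp hbs.symm
        refine ⟨(0, 0), rfl, ?_⟩
        have : (∀ p q, BitsAdj (Layer.pieceLinks ⟨l, .cup o, r⟩ k)
            (Layer.crossings ⟨l, .cup o, r⟩ k) [] p q → Agree g p q) ↔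
            g (k + 1, l.length, o) ≠ g (k + 1, l.length + 1, !o) := by
          cases o <;>
            simp [BitsAdj, Layer.pieceLinks, Layer.crossings, orient, Agree, ne_comm]
        rw [if_congr this rfl rfl]
        simp only [Piece.kern]
        rw [evalOne_cupCoef]
      · obtain rfl : bs = [] := List.length_eq_zero_iff.mp hbs.symm
        refine ⟨(0, 0), rfl, ?_⟩
        have : (∀ p q, BitsAdj (Layer.pieceLinks ⟨l, .cap o, r⟩ k)
            (Layer.crossings ⟨l, .cap o, r⟩ k) [] p q → Agree g p q) ↔
            g (k, l.length, o) ≠ g (k, l.length + 1, !o) := by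
          cases o <;>
            simp [BitsAdj, Layer.pieceLinks, Layer.crossings, orient, Agree, ne_comm]
        rw [if_congr this rfl rfl]
        simp only [Piece.kern]
        rw [evalOne_capCoef]
      · obtain ⟨x, rfl⟩ : ∃ x, bs = [x] := List.length_eq_one_iff.mp hbs.symm
        refine ⟨sortCoefs ((a == b) == x) 1 0, rfl, ?_⟩
        have : (∀ p q, BitsAdj (Layer.pieceLinks ⟨l, .cross a b f, r⟩ k)
            (Layer.crossings ⟨l, .cross a b f, r⟩ k) [x] p q → Agree g p q) ↔
            if (a == b) == x then g (k, l.length, a) = g (k + 1, l.length, b) ∧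
                g (k, l.length + 1, b) = g (k + 1, l.length + 1, a)
              else g (k, l.length, a) ≠ g (k, l.length + 1, b) ∧
                g (k + 1, l.length, b) ≠ g (k + 1, l.length + 1, a) := by
          rcases a <;> rcases b <;> rcases f <;> rcases x <;>
            simp [BitsAdj, Layer.pieceLinks, Layer.crossings, Crossing.Adj, orient, Agree] <;>
            grind
        rw [if_congr this rfl rfl]
        simp only [Piece.kern]
        cases (a == b) == x
        · simp only [sortCoefs, Bool.false_eq_true, if_false, zero_mul, one_mul, zero_add]
          rw [map_mul, evalOne_capCoef, evalOne_cupCoef]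
          split_ifs <;> first | rfl | tauto
        · simp [sortCoefs, apply_ite evalOne]
    obtain ⟨X, hX, hX'⟩ := step
    rw [hX, layersWeight, map_mul, ih _ _ hbs', apply_ite evalOne, hX', map_zero]
    simp only [← ite_and, mul_ite, mul_one, mul_zero]
    congr 1
    exact propext (by tauto)

end

section

/-! ### The Jones polynomial of a closed diagram -/

/-- The parity of the position of a point. -/
def posParity (p : Pt) : Bool := p.2.1.bodd

theorem agree_posParity_of_mem_vert {k j j' : ℕ} (hj : j.bodd = j'.bodd) {a : List Bool} {z : Pt × Pt}
    (h : z ∈ vert k j j' a) : Agree posParity z.1 z.2 := by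
  have := fst_ne_of_mem_vert h
  simp only [vert, List.mem_map] at h
  obtain ⟨⟨o, i⟩, -, rfl⟩ := h
  cases o <;> simp_all [orient, Agree, posParity]

/-- Strands between two lines keep their position or move it by two, while strands that return to
the same line join neighbouring positions. -/
theorem Layer.agree_posParity (L : Layer) (k : ℕ) (bs : List Bool) (p q : Pt)
    (h : BitsAdj (L.links k) (L.crossings k) bs p q) : Agree posParity p q := by
  rcases h with h | ⟨⟨c, x⟩, hz, h⟩
  · rw [L.links_eq, List.mem_append, List.mem_append] at h
    rcases h with (h | h) | h
    · exact agree_posParity_of_mem_vert rfl h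
    · refine agree_posParity_of_mem_vert ?_ h
      obtain ⟨l, _ | _ | _, r⟩ := L <;> simp [Piece.dom, Piece.cod]
    · obtain ⟨l, (_ | _) | (_ | _) | _, r⟩ := L <;>
        simp [Layer.pieceLinks, orient] at h <;> simp [h, Agree, posParity]
  · obtain ⟨l, _ | _ | ⟨a, b, f⟩, r⟩ := L
    · simp [Layer.crossings] at hz
    · simp [Layer.crossings] at hz
    · have hc := (List.of_mem_zip hz).1
      simp only [Layer.crossings, List.mem_singleton] at hc
      subst hc
      rcases a <;> rcases b <;> rcases f <;> rcases x <;>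
        simp [Crossing.Adj, orient] at h <;> rcases h with ⟨rfl, rfl⟩ | ⟨rfl, rfl⟩ <;>
        simp [Agree, posParity]

theorem agree_posParity (k : ℕ) (Ls : List Layer) (bs : List Bool)
    (hb : bs.length = (crossingsFrom k Ls).length) :
    ∀ p q, BitsAdj (linksFrom k Ls) (crossingsFrom k Ls) bs p q → Agree posParity p q := by
  induction Ls generalizing k bs with
  | nil => simp [linksFrom, crossingsFrom, BitsAdj]
  | cons L Ls ih =>
    rw [linksFrom_cons, crossingsFrom_cons]
    rw [crossingsFrom_cons, List.length_append] at hb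
    obtain ⟨bs, bs', rfl, hbs, hbs'⟩ : ∃ b b', bs = b ++ b' ∧ (L.crossings k).length = b.length ∧
        b'.length = (crossingsFrom (k + 1) Ls).length :=
      ⟨bs.take (L.crossings k).length, bs.drop (L.crossings k).length, by simp, by simp; omega,
        by simp; omega⟩
    rw [forall_bitsAdj_append hbs]
    exact ⟨L.agree_posParity k bs, ih _ _ hbs'⟩

/-- Relative to one fixed admissible labelling, admissible labellings are those whose difference is
constant along each strand. -/
theorem agree_iff_of_agree {g g₀ : Pt → Bool} {p q : Pt} (h : Agree g₀ p q) :
    Agree g p q ↔ xor (g p) (g₀ p) = xor (g q) (g₀ q) := by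
  unfold Agree at *
  rw [← h]
  cases g p <;> cases g q <;> cases g₀ p <;> cases g₀ q <;> simp

/-! ### Counting circles at q = 1 -/

section Closed

variable (D : Diagram)

theorem Diagram.crossings_eq : D.crossings = crossingsFrom 0 D.layers := rfl

theorem Diagram.links_eq : D.links = linksFrom 0 D.layers := rfl

theorem zip_ofFn {α β : Type*} (l : List α) (σ : Fin l.length → β) :
    l.zip (List.ofFn σ) = List.ofFn fun i => (l.get i, σ i) := by
  apply List.ext_getElem <;> simp

theorem bitsAdj_ofFn_iff (σ : Fin D.crossings.length → Bool) (p q : Pt) :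
    BitsAdj D.links D.crossings (List.ofFn σ) p q ↔
      (p, q) ∈ D.links ∨ ∃ i, (D.crossings.get i).Adj (σ i) p q := by
  rw [BitsAdj, zip_ofFn]
  simp [List.mem_ofFn]

theorem smoothingAdj_iff (σ : Fin D.crossings.length → Bool) (x y : D.Point) :
    D.SmoothingAdj σ x y ↔ BitsAdj D.links D.crossings (List.ofFn σ) x.1 y.1 := by
  rw [bitsAdj_ofFn_iff]; rfl

theorem bitsWeight_ofFn (σ : Fin D.crossings.length → Bool) :
    bitsWeight D.crossings (List.ofFn σ) = ∏ i, if σ i then T (-(D.crossings.get i).sign)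
      else -T (-2 * (D.crossings.get i).sign) := by
  rw [bitsWeight, zip_ofFn, List.map_ofFn, List.prod_ofFn]
  rfl

variable {D} {b : List Bool} (h : Composable D.bottom D.layers b)
include h

theorem mem_points_of_bitsAdj {bs : List Bool} {p q : Pt}
    (hpq : BitsAdj D.links D.crossings bs p q) : p ∈ D.points ∧ q ∈ D.points := by
  rcases hpq with hpq | ⟨⟨c, x⟩, hz, hpq⟩
  · exact mem_points_of_mem_links h hpq
  · have := mem_points_of_mem_crossings h (List.of_mem_zip hz).1
    simp only [Crossing.Adj] at hpq
    split_ifs at hpq <;> rcases hpq with hpq | hpq <;> simp only [Prod.mk.injEq] at hpq <;>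
      obtain ⟨rfl, rfl⟩ := hpq <;> tauto

open Classical in
-- After subtraction of the position parity, an admissible labelling is an arbitrary function on the
-- set of circles.
theorem card_agree (σ : Fin D.crossings.length → Bool) :
    (D.points.powerset.filter fun S => ∀ p q,
      BitsAdj D.links D.crossings (List.ofFn σ) p q → Agree (memLabel S) p q).card =
      2 ^ D.loops σ := by
  have h0 := agree_posParity 0 D.layers (List.ofFn σ) (List.length_ofFn ..)
  rw [← D.crossings_eq, ← D.links_eq] at h0
  have : Finite (Quot (D.SmoothingAdj σ)) := Quot.finite _
  have : Fintype (Quot (D.SmoothingAdj σ)) := Fintype.ofFinite _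
  have hcard : Fintype.card (Quot (D.SmoothingAdj σ) → Bool) = 2 ^ D.loops σ := by
    rw [Fintype.card_fun, Fintype.card_bool, Diagram.loops, Nat.card_eq_fintype_card]
  rw [← hcard, ← Finset.card_univ]
  symm
  let F : (Quot (D.SmoothingAdj σ) → Bool) → Pt → Bool := fun f p =>
    if hp : p ∈ D.points then xor (f (Quot.mk _ ⟨p, hp⟩)) (posParity p) else false
  have hF : ∀ f (x : D.Point), xor (memLabel (D.points.filter fun p => F f p) x.1) (posParity x.1) =
      f (Quot.mk _ x) := by
    intro f x
    simp only [memLabel, F, x.2, Finset.mem_filter, true_and, dif_pos]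
    cases f (Quot.mk _ x) <;> cases posParity x.1 <;> rfl
  refine Finset.card_bij (fun f _ => D.points.filter fun p => F f p) ?_ ?_ ?_
  · intro f _
    refine Finset.mem_filter.mpr ⟨Finset.mem_powerset.mpr (Finset.filter_subset _ _), ?_⟩
    intro p q hpq
    obtain ⟨hp, hq⟩ := mem_points_of_bitsAdj h hpq
    rw [agree_iff_of_agree (h0 p q hpq), hF f ⟨p, hp⟩, hF f ⟨q, hq⟩]
    exact congrArg f (Quot.sound ((smoothingAdj_iff D σ ⟨p, hp⟩ ⟨q, hq⟩).mpr hpq))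
  · intro f _ f' _ hff
    funext z
    induction z using Quot.ind with
    | mk x => rw [← hF f, ← hF f', hff]
  · intro S hS
    obtain ⟨hS, hS'⟩ := Finset.mem_filter.mp hS
    rw [Finset.mem_powerset] at hS
    refine ⟨Quot.lift (fun x => xor (memLabel S x.1) (posParity x.1)) fun x y hxy => ?_,
      Finset.mem_univ _, ?_⟩
    · have := (smoothingAdj_iff D σ x y).mp hxy
      exact (agree_iff_of_agree (h0 _ _ this)).mp (hS' _ _ this)
    · ext p
      rw [Finset.mem_filter]
      constructor
      · rintro ⟨hp, hp'⟩
        simpa [F, hp, memLabel] using hp'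
      · intro hp
        refine ⟨hS hp, ?_⟩
        simp [F, hS hp, memLabel, hp]

end Closed

theorem mem_homog_basisVec_nil : basisVec [] ∈ homog 0 := basisVec_mem_homog []

/-- The value is some power of `circ`. At q = 1 it becomes a power of 2, and the state sum then
counts admissible labellings, of which there are 2 to the number of circles; hence the exponent. -/
theorem opList_smoothCoefs {D : Diagram} (hb : D.bottom = []) (h : Composable D.bottom D.layers [])
    (σ : Fin D.crossings.length → Bool) :
    opList (gensOf (smoothCoefs (List.ofFn σ) D.layers) D.layers) (basisVec []) [] =
      circ ^ D.loops σ := by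
  have hlen := length_smoothCoefs (List.ofFn σ) D.layers
  obtain ⟨K, hK⟩ := GenChain.exists_circ_pow
    (by simpa [hb] using genChain_of_composable h hlen)
    (isSmooth_of_mem_gensOf (List.ofFn σ) D.layers)
  have h1 : opList (gensOf (smoothCoefs (List.ofFn σ) D.layers) D.layers) (basisVec []) [] =
      circ ^ K := by
    rw [hK _ mem_homog_basisVec_nil]
    simp [basisVec]
  have h2 := sum_layersWeight h hlen (fun _ => 1) (v := basisVec [])
    (by rw [hb]; exact mem_homog_basisVec_nil)
  have h3 := congrArg evalOne h2
  simp only [List.length_nil, words, Finset.sum_singleton, one_mul, h1, mul_one, hb, map_sum,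
    map_mul, lineWord, linePts, List.zipIdx_nil, List.map_nil] at h3
  have h4 := card_agree h σ
  classical
  have h5 : ∀ S, evalOne (layersWeight (memLabel S) 0 (smoothCoefs (List.ofFn σ) D.layers) D.layers)
      = if ∀ p q, BitsAdj D.links D.crossings (List.ofFn σ) p q → Agree (memLabel S) p q
        then 1 else 0 := fun S =>
    evalOne_layersWeight (memLabel S) 0 (List.ofFn σ) D.layers (List.length_ofFn ..)
  have h6 : evalOne (basisVec [] []) = 1 := by simp [basisVec]
  simp only [h6, h5, one_mul] at h3
  rw [← Finset.sum_filter, Finset.sum_const, nsmul_eq_mul, mul_one] at h3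
  have h7 : evalOne (circ ^ K) = 2 ^ K := by simp [circ]
  rw [h7] at h3
  have h8 : K = D.loops σ := by
    refine Nat.pow_right_injective (le_refl 2) ?_
    have h9 : ((2 ^ D.loops σ : ℕ) : ℤ) = 2 ^ K := by
      rw [← h4, ← h3]
    exact_mod_cast h9.symm
  rw [h1, h8]

/-- Both sides expand over the smoothings; a choice function on the crossings is matched with its
list of values. -/
theorem jones_eq {D : Diagram} (hb : D.bottom = []) (h : Composable D.bottom D.layers []) :
    D.jones = jonesOp D.layers (basisVec []) [] := by
  rw [jonesOp_eq_sum 0, LinearMap.sum_apply, Finset.sum_apply, Diagram.jones, ← D.crossings_eq]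
  refine Finset.sum_bij (fun σ _ => List.ofFn σ) (fun σ _ => by simp [mem_words])
    (fun σ _ σ' _ e => List.ofFn_injective e) (fun w hw => ?_) fun σ _ => ?_
  · rw [mem_words] at hw
    refine ⟨fun i => w[i.1]'(by rw [hw]; exact i.2), Finset.mem_univ _, ?_⟩
    apply List.ext_getElem <;> simp [hw]
  · rw [← bitsWeight_ofFn, LinearMap.smul_apply, Pi.smul_apply, opList_smoothCoefs hb h]
    rfl

end

section

/-! ### Families of disjoint cycles and permutations -/

/-- Cycles of length one would be invisible in a permutation; an irreflexive relation excludes them.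
-/
theorem nontrivial_of_chain {α : Type*} {r : α → α → Prop} (hr : ∀ x, ¬ r x x) {γ : Cycle α} (hγ : γ.Nodup)
    (h0 : γ ≠ Cycle.nil) (h : γ.Chain r) : γ.Nontrivial := by
  rw [hγ.nontrivial_iff, Cycle.length_subsingleton_iff]
  induction γ using Quotient.inductionOn' with
  | h l =>
    intro hl
    rcases l with _ | ⟨a, _ | ⟨b, l⟩⟩
    · exact h0 rfl
    · exact hr a ((Cycle.chain_singleton r a).mp h)
    · simp at hl

section Families

variable {α : Type*} [DecidableEq α]

theorem chain_iff_forall_next (r : α → α → Prop) (γ : Cycle α) (hγ : γ.Nodup) :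
    γ.Chain r ↔ ∀ x (h : x ∈ γ), r x (γ.next hγ x h) := by
  induction γ using Quotient.inductionOn' with
  | h l =>
    have hl : l.Nodup := hγ
    have key : Cycle.Chain r (l : Cycle α) ↔ ∀ x (h : x ∈ l), r x (l.next x h) := by
      have h2 : (∀ x (h : x ∈ l), r x (l.next x h)) ↔
          ∀ (i : ℕ) (hi : i < l.length), r l[i] (l[(i + 1) % l.length]'(Nat.mod_lt _ (by omega))) := by
        constructor
        · intro H i hi
          rw [← List.next_getElem l hl i hi]
          exact H _ _
        · intro H x hx
          obtain ⟨i, hi, rfl⟩ := List.getElem_of_mem hx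
          rw [List.next_getElem l hl i hi]
          exact H i hi
      rw [h2]
      rcases l with _ | ⟨a, l⟩
      · simp
      · rw [Cycle.chain_coe_cons, ← List.cons_append, List.isChain_iff_getElem]
        constructor
        · intro H i hi
          have := H i (by simpa using hi)
          rw [List.getElem_append_left hi] at this
          rcases Nat.lt_or_ge (i + 1) (a :: l).length with h | h
          · rw [List.getElem_append_left h] at this
            simpa only [Nat.mod_eq_of_lt h] using this
          · have h3 : i + 1 = (a :: l).length := by omega
            rw [List.getElem_append_right h] at this
            simp only [h3, Nat.mod_self]
            simpa using this
        · intro H i hi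
          have hi' : i < (a :: l).length := by simpa using hi
          have := H i hi'
          rw [List.getElem_append_left hi']
          rcases Nat.lt_or_ge (i + 1) (a :: l).length with h | h
          · rw [List.getElem_append_left h]
            simpa only [Nat.mod_eq_of_lt h] using this
          · have h3 : i + 1 = (a :: l).length := by omega
            rw [List.getElem_append_right h]
            simp only [h3, Nat.mod_self] at this
            simpa using this
    exact key

theorem mem_toFinset_cycle {γ : Cycle α} {x : α} : x ∈ γ.toFinset ↔ x ∈ γ := by
  induction γ using Quotient.inductionOn' with
  | h l => exact List.mem_toFinset

variable [Fintype α]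

theorem next_ne {γ : Cycle α} (hγ : γ.Nodup) (h : γ.Nontrivial) (x : α) (hx : x ∈ γ) :
    γ.next hγ x hx ≠ x := by
  rw [← Cycle.formPerm_apply_mem_eq_next, ← Equiv.Perm.mem_support, Cycle.support_formPerm _ hγ h]
  exact mem_toFinset_cycle.mpr hx

open Classical in
/-- The set of the cycles of a permutation. -/
noncomputable def familyOf (σ : Equiv.Perm α) : Finset {γ : Cycle α // γ.Nodup} :=
  Finset.univ.filter fun γ => γ.1.Nontrivial ∧ ∀ x (h : x ∈ γ.1), γ.1.next γ.2 x h = σ x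

theorem mem_familyOf {σ : Equiv.Perm α} {γ : {γ : Cycle α // γ.Nodup}} :
    γ ∈ familyOf σ ↔ γ.1.Nontrivial ∧ ∀ x (h : x ∈ γ.1), γ.1.next γ.2 x h = σ x := by
  simp [familyOf]

theorem formPerm_eq_cycleOf {σ : Equiv.Perm α} {γ : {γ : Cycle α // γ.Nodup}} (h : γ ∈ familyOf σ)
    {x : α} (hx : x ∈ γ.1) : γ.1.formPerm γ.2 = σ.cycleOf x := by
  obtain ⟨h1, h2⟩ := mem_familyOf.mp h
  have hs := Cycle.support_formPerm _ γ.2 h1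
  refine Equiv.Perm.cycle_is_cycleOf (by rw [hs, mem_toFinset_cycle]; exact hx)
    (Equiv.Perm.mem_cycleFactorsFinset_iff.mpr ⟨Cycle.isCycle_formPerm _ γ.2 h1, fun a ha => ?_⟩)
  rw [hs] at ha
  have ha : a ∈ γ.1 := mem_toFinset_cycle.mp ha
  rw [Cycle.formPerm_apply_mem_eq_next _ _ _ ha, h2]

theorem eq_of_mem_familyOf {σ : Equiv.Perm α} {γ γ' : {γ : Cycle α // γ.Nodup}}
    (h : γ ∈ familyOf σ) (h' : γ' ∈ familyOf σ) {x : α} (hx : x ∈ γ.1) (hx' : x ∈ γ'.1) :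
    γ = γ' := by
  have := (formPerm_eq_cycleOf h hx).trans (formPerm_eq_cycleOf h' hx').symm
  rcases Cycle.formPerm_eq_formPerm_iff.mp this with e | ⟨e, -⟩
  · exact Subtype.ext e
  · exact absurd e ((γ.2.nontrivial_iff).mp (mem_familyOf.mp h).1)

theorem exists_mem_familyOf (σ : Equiv.Perm α) {x : α} (hx : σ x ≠ x) :
    ∃ γ ∈ familyOf σ, x ∈ γ.1 := by
  have hx' := Equiv.Perm.mem_support.mpr hx
  refine ⟨⟨(σ.toList x : Cycle α), σ.nodup_toList x⟩, mem_familyOf.mpr ⟨?_, ?_⟩, ?_⟩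
  · exact (Cycle.nontrivial_coe_nodup_iff (σ.nodup_toList x)).mpr
      (Equiv.Perm.two_le_length_toList_iff_mem_support.mpr hx')
  · intro y hy
    exact Equiv.Perm.next_toList_eq_apply σ x y hy
  · exact Equiv.Perm.mem_toList_iff.mpr ⟨Equiv.Perm.SameCycle.refl .., hx'⟩

theorem exists_mem_familyOf_iff (σ : Equiv.Perm α) (x : α) :
    (∃ γ ∈ familyOf σ, x ∈ γ.1) ↔ x ∈ σ.support := by
  rw [Equiv.Perm.mem_support]
  refine ⟨fun ⟨γ, h, hx⟩ => ?_, exists_mem_familyOf σ⟩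
  rw [← (mem_familyOf.mp h).2 x hx]
  exact next_ne _ (mem_familyOf.mp h).1 _ _

theorem familyOf_injective : Function.Injective (familyOf (α := α)) := by
  intro σ τ h
  ext x
  by_cases hx : σ x = x
  · by_cases hx' : τ x = x
    · rw [hx, hx']
    · obtain ⟨γ, hγ, hxγ⟩ := exists_mem_familyOf τ hx'
      rw [← (mem_familyOf.mp hγ).2 x hxγ, ← (mem_familyOf.mp (h ▸ hγ)).2 x hxγ]
  · obtain ⟨γ, hγ, hxγ⟩ := exists_mem_familyOf σ hx
    rw [← (mem_familyOf.mp hγ).2 x hxγ, ← (mem_familyOf.mp (h ▸ hγ)).2 x hxγ]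

/-- Each moved point lies on exactly one cycle of the family, and the next point on that cycle is
its image. -/
theorem prod_familyOf {M : Type*} [CommMonoid M] (σ : Equiv.Perm α) (f : α → α → M) :
    ∏ γ ∈ familyOf σ, ∏ x, (if h : x ∈ γ.1 then f x (γ.1.next γ.2 x h) else 1) =
      ∏ x ∈ σ.support, f x (σ x) := by
  classical
  rw [Finset.prod_comm, ← Finset.prod_subset (Finset.subset_univ σ.support)]
  · refine Finset.prod_congr rfl fun x hx => ?_
    obtain ⟨γ, hγ, hxγ⟩ := (exists_mem_familyOf_iff σ x).mpr hx
    rw [Finset.prod_eq_single γ]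
    · rw [dif_pos hxγ, (mem_familyOf.mp hγ).2 x hxγ]
    · intro γ' hγ' hne
      exact dif_neg fun h => hne (eq_of_mem_familyOf hγ' hγ h hxγ)
    · exact fun h => absurd hγ h
  · intro x _ hx
    refine Finset.prod_eq_one fun γ hγ => dif_neg fun h => hx ?_
    exact (exists_mem_familyOf_iff σ x).mp ⟨γ, hγ, h⟩

/-- Families of disjoint cycles that follow the relation `r`. -/
def IsFamily (r : α → α → Prop) (c : Finset {γ : Cycle α // γ.Nodup}) : Prop :=
  (∀ γ ∈ c, γ.1 ≠ Cycle.nil ∧ γ.1.Chain r) ∧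
    (c : Set {γ : Cycle α // γ.Nodup}).PairwiseDisjoint fun γ => γ.1.toFinset

theorem isFamily_familyOf {r : α → α → Prop} {σ : Equiv.Perm α} (h : ∀ x, σ x ≠ x → r x (σ x)) :
    IsFamily r (familyOf σ) := by
  refine ⟨fun γ hγ => ⟨?_, ?_⟩, fun γ hγ γ' hγ' hne => ?_⟩
  · rintro e
    have := (mem_familyOf.mp hγ).1
    rw [e] at this
    obtain ⟨x, -, -, hx, -⟩ := this
    exact Cycle.notMem_nil x hx
  · rw [chain_iff_forall_next _ _ γ.2]
    intro x hx
    have e := (mem_familyOf.mp hγ).2 x hx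
    have := next_ne γ.2 (mem_familyOf.mp hγ).1 x hx
    rw [e] at this ⊢
    exact h x this
  · rw [Function.onFun, Finset.disjoint_left]
    intro x hx hx'
    exact hne (eq_of_mem_familyOf hγ hγ' (mem_toFinset_cycle.mp hx) (mem_toFinset_cycle.mp hx'))

/-- The permutation sends each point to its successor on the unique cycle through it and fixes the
points off the family. Disjointness makes this well defined and injective. -/
theorem IsFamily.exists_perm {r : α → α → Prop} (hr : ∀ x, ¬ r x x)
    {c : Finset {γ : Cycle α // γ.Nodup}} (hc : IsFamily r c) :
    ∃ σ : Equiv.Perm α, (∀ x, σ x ≠ x → r x (σ x)) ∧ familyOf σ = c := by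
  classical
  have huniq : ∀ γ ∈ c, ∀ γ' ∈ c, ∀ x, x ∈ γ.1 → x ∈ γ'.1 → γ = γ' := by
    intro γ hγ γ' hγ' x hx hx'
    by_contra hne
    exact Finset.disjoint_left.mp (hc.2 hγ hγ' hne) (mem_toFinset_cycle.mpr hx)
      (mem_toFinset_cycle.mpr hx')
  let f : α → α := fun x => if h : ∃ γ ∈ c, x ∈ γ.1 then
    h.choose.1.next h.choose.2 x h.choose_spec.2 else x
  have hf : ∀ γ ∈ c, ∀ x (hx : x ∈ γ.1), f x = γ.1.next γ.2 x hx := by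
    intro γ hγ x hx
    have h : ∃ γ ∈ c, x ∈ γ.1 := ⟨γ, hγ, hx⟩
    have e := huniq _ h.choose_spec.1 γ hγ x h.choose_spec.2 hx
    simp only [f, dif_pos h]
    congr!
  have hf' : ∀ x, (¬ ∃ γ ∈ c, x ∈ γ.1) → f x = x := fun x h => dif_neg h
  have hmem : ∀ γ ∈ c, ∀ x, x ∈ γ.1 ↔ f x ∈ γ.1 := by
    intro γ hγ x
    refine ⟨fun hx => by rw [hf γ hγ x hx]; exact Cycle.next_mem .., fun hx => ?_⟩
    by_cases h : ∃ γ ∈ c, x ∈ γ.1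
    · obtain ⟨γ', hγ', hx'⟩ := h
      have : f x ∈ γ'.1 := by rw [hf γ' hγ' x hx']; exact Cycle.next_mem ..
      rwa [huniq γ hγ γ' hγ' _ hx this]
    · rwa [hf' x h] at hx
  have hinj : Function.Injective f := by
    intro x y hxy
    by_cases h : ∃ γ ∈ c, x ∈ γ.1
    · obtain ⟨γ, hγ, hx⟩ := h
      have hy : y ∈ γ.1 := by rw [hmem γ hγ, ← hxy, ← hmem γ hγ]; exact hx
      rw [hf γ hγ x hx, hf γ hγ y hy] at hxy
      rw [← Cycle.prev_next γ.1 γ.2 x hx, ← Cycle.prev_next γ.1 γ.2 y hy]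
      congr!
    · have h' : ¬ ∃ γ ∈ c, y ∈ γ.1 := by
        rintro ⟨γ, hγ, hy⟩
        exact h ⟨γ, hγ, by rwa [hmem γ hγ, hxy, ← hmem γ hγ]⟩
      rwa [hf' x h, hf' y h'] at hxy
  let σ : Equiv.Perm α := Equiv.ofBijective f (Finite.injective_iff_bijective.mp hinj)
  have hσ : ∀ x, σ x = f x := fun x => rfl
  have hsub : ∀ γ ∈ c, γ ∈ familyOf σ := fun γ hγ => mem_familyOf.mpr
    ⟨nontrivial_of_chain hr γ.2 (hc.1 γ hγ).1 (hc.1 γ hγ).2, fun x hx => (hf γ hγ x hx).symm⟩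
  have hex : ∀ x, σ x ≠ x → ∃ γ ∈ c, x ∈ γ.1 := fun x hx => by
    by_contra h
    exact hx (hf' x h)
  refine ⟨σ, fun x hx => ?_, ?_⟩
  · obtain ⟨γ, hγ, hxγ⟩ := hex x hx
    rw [hσ, hf γ hγ x hxγ]
    exact (chain_iff_forall_next r γ.1 γ.2).mp (hc.1 γ hγ).2 x hxγ
  · ext γ
    refine ⟨fun hγ => ?_, hsub γ⟩
    have := mem_familyOf.mp hγ
    obtain ⟨x, -, -, hx, -⟩ := this.1
    have hne := next_ne γ.2 this.1 x hx
    rw [this.2 x hx] at hne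
    obtain ⟨γ', hγ', hx'⟩ := hex x hne
    rwa [eq_of_mem_familyOf hγ (hsub γ' hγ') hx hx']

open Classical in
/-- A sum over families is a sum over permutations. -/
theorem sum_isFamily {A : Type*} [AddCommMonoid A] {r : α → α → Prop} (hr : ∀ x, ¬ r x x)
    (G : Finset {γ : Cycle α // γ.Nodup} → A) :
    ∑ c ∈ Finset.univ.filter (IsFamily r), G c =
      ∑ σ ∈ Finset.univ.filter (fun σ : Equiv.Perm α => ∀ x, σ x ≠ x → r x (σ x)),
        G (familyOf σ) := by
  symm
  refine Finset.sum_bij (fun σ _ => familyOf σ) (fun σ h => ?_)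
    (fun σ _ τ _ h => familyOf_injective h) (fun c hc => ?_) fun σ _ => rfl
  · exact Finset.mem_filter.mpr ⟨Finset.mem_univ _, isFamily_familyOf (Finset.mem_filter.mp h).2⟩
  · obtain ⟨σ, h, rfl⟩ := (Finset.mem_filter.mp hc).2.exists_perm hr
    exact ⟨σ, Finset.mem_filter.mpr ⟨Finset.mem_univ _, h⟩, rfl⟩

/-- A relation that is a bijection of a set with itself is given by a permutation. -/
theorem exists_perm_of_relation (S : Finset α) (R : α → α → Prop) (h : ∀ x ∈ S, ∃ y ∈ S, R x y)
    (hinj : ∀ x ∈ S, ∀ x' ∈ S, ∀ y, R x y → R x' y → x = x') (hirr : ∀ x, ¬ R x x) :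
    ∃ σ : Equiv.Perm α, σ.support = S ∧ ∀ x ∈ S, R x (σ x) := by
  choose! f hf hR using h
  let g : α → α := fun x => if x ∈ S then f x else x
  have hg : ∀ x ∈ S, g x = f x := fun x hx => if_pos hx
  have hg' : ∀ x ∉ S, g x = x := fun x hx => if_neg hx
  have hinj : Function.Injective g := by
    intro x y hxy
    by_cases hx : x ∈ S
    · by_cases hy : y ∈ S
      · rw [hg x hx, hg y hy] at hxy
        exact hinj x hx y hy _ (hR x hx) (hxy ▸ hR y hy)
      · rw [hg x hx, hg' y hy] at hxy
        exact absurd (hxy ▸ hf x hx) hy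
    · by_cases hy : y ∈ S
      · rw [hg' x hx, hg y hy] at hxy
        exact absurd (hxy ▸ hf y hy) hx
      · rwa [hg' x hx, hg' y hy] at hxy
  let σ : Equiv.Perm α := Equiv.ofBijective g (Finite.injective_iff_bijective.mp hinj)
  have hσ : ∀ x, σ x = g x := fun x => rfl
  refine ⟨σ, ?_, fun x hx => by rw [hσ, hg x hx]; exact hR x hx⟩
  ext x
  rw [Equiv.Perm.mem_support, hσ]
  by_cases hx : x ∈ S
  · simp only [hx, iff_true]
    intro e
    have := hR x hx
    rw [← hg x hx, e] at this
    exact hirr x this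
  · simp [hx, hg' x hx]

end Families

end

section

/-! ### Transitions with local choices -/

/-- A node with two sources and two targets. -/
structure Fork where
  fstIn : Pt
  fstOut : Pt
  sndIn : Pt
  sndOut : Pt

/-- The steps along links and through forks, where `J` tells whether one can change from the second to
the first strand of a fork. -/
def ForkStep (ls : List (Pt × Pt)) (cs : List Fork) (J : Prop) (x y : Pt) : Prop :=
  (x, y) ∈ ls ∨ ∃ c ∈ cs, (x, y) = (c.fstIn, c.fstOut) ∨ (x, y) = (c.sndIn, c.sndOut) ∨
    J ∧ (x, y) = (c.sndIn, c.fstOut)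

def forkIns (ls : List (Pt × Pt)) (cs : List Fork) : List Pt :=
  ls.map Prod.fst ++ cs.flatMap fun c => [c.fstIn, c.sndIn]

def forkOuts (ls : List (Pt × Pt)) (cs : List Fork) : List Pt :=
  ls.map Prod.snd ++ cs.flatMap fun c => [c.fstOut, c.sndOut]

/-- Used once for sources and once for targets: a point determines the strand that starts, or ends,
there. -/
theorem unique_of_nodup {β : Type*} {ls : List (Pt × Pt)} {cs : List β} {f : Pt × Pt → Pt}
    {u v : β → Pt} (h : (ls.map f ++ cs.flatMap fun c => [u c, v c]).Nodup) :
    (∀ z ∈ ls, ∀ z' ∈ ls, f z = f z' → z = z') ∧ (∀ z ∈ ls, ∀ c ∈ cs, f z ≠ u c ∧ f z ≠ v c) ∧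
    ∀ c ∈ cs, ∀ c' ∈ cs, (u c = u c' → c = c') ∧ (v c = v c' → c = c') ∧ u c ≠ v c' := by
  rw [List.nodup_append, List.nodup_flatMap] at h
  obtain ⟨h1, ⟨h2, h3⟩, h4⟩ := h
  refine ⟨fun z hz z' hz' e => List.inj_on_of_nodup_map h1 hz hz' e, fun z hz c hc => ⟨?_, ?_⟩, ?_⟩
  · exact h4 _ (List.mem_map_of_mem hz) _ (List.mem_flatMap.mpr ⟨c, hc, by simp⟩)
  · exact h4 _ (List.mem_map_of_mem hz) _ (List.mem_flatMap.mpr ⟨c, hc, by simp⟩)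
  · have h5 : ∀ c ∈ cs, ∀ c' ∈ cs, c ≠ c' → List.Disjoint [u c, v c] [u c', v c'] := by
      have h6 : cs.Pairwise fun c c' => c ≠ c' → List.Disjoint [u c, v c] [u c', v c'] :=
        h3.imp (by intro a b h _; exact h)
      have h7 : cs.Pairwise (flip fun c c' => c ≠ c' → List.Disjoint [u c, v c] [u c', v c']) :=
        h3.imp (by intro a b h _; exact List.Disjoint.symm h)
      exact fun c hc c' hc' =>
        List.Pairwise.forall_of_forall_of_flip (fun _ _ h => absurd rfl h) h6 h7 hc hc'
    intro c hc c' hc'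
    refine ⟨fun e => ?_, fun e => ?_, fun e => ?_⟩
    · by_contra hne
      exact h5 c hc c' hc' hne (List.mem_cons_self ..) (by simp [e])
    · by_contra hne
      exact h5 c hc c' hc' hne (a := v c) (by simp) (by simp [e])
    · by_cases hne : c = c'
      · subst hne
        have := h2 c hc
        simp [e] at this
      · exact h5 c hc c' hc' hne (List.mem_cons_self ..) (by simp [e])

/-- The set `S` is locally the set of points visited by a family of cycles. -/
def ForkGood (ls : List (Pt × Pt)) (cs : List Fork) (J : Prop) (S : Finset Pt) : Prop :=
  (∀ z ∈ ls, z.1 ∈ S ↔ z.2 ∈ S) ∧ ∀ c ∈ cs,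
    (c.fstIn ∈ S ∧ c.sndIn ∈ S ↔ c.fstOut ∈ S ∧ c.sndOut ∈ S) ∧
    (c.fstIn ∈ S ∨ c.sndIn ∈ S ↔ c.fstOut ∈ S ∨ c.sndOut ∈ S) ∧
    (c.fstIn ∈ S → c.fstOut ∈ S) ∧ (¬ J → c.fstOut ∈ S → c.fstIn ∈ S)

/-- The contribution of a fork to the weight of a family of cycles. -/
def forkWeight {M : Type*} [CommMonoid M] (f : Pt → Pt → M) (S : Finset Pt) (c : Fork) : M :=
  (if c.fstIn ∈ S then f c.fstIn c.fstOut else 1) *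
    if c.sndIn ∈ S then (if c.sndOut ∈ S then f c.sndIn c.sndOut else f c.sndIn c.fstOut) else 1

section

variable {ls : List (Pt × Pt)} {cs : List Fork} {J : Prop} {P : Finset Pt}

theorem mem_forkIns {x : Pt} : x ∈ forkIns ls cs ↔
    (∃ y, (x, y) ∈ ls) ∨ ∃ c ∈ cs, x = c.fstIn ∨ x = c.sndIn := by
  simp [forkIns]

theorem mem_forkOuts {x : Pt} : x ∈ forkOuts ls cs ↔
    (∃ y, (y, x) ∈ ls) ∨ ∃ c ∈ cs, x = c.fstOut ∨ x = c.sndOut := by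
  simp [forkOuts]

theorem ForkStep.mem_ins {x y : Pt} (h : ForkStep ls cs J x y) : x ∈ forkIns ls cs := by
  rw [mem_forkIns]
  rcases h with h | ⟨c, hc, h | h | ⟨-, h⟩⟩
  · exact .inl ⟨y, h⟩
  all_goals
    rw [Prod.mk.injEq] at h
    exact .inr ⟨c, hc, by tauto⟩

theorem ForkStep.mem_outs {x y : Pt} (h : ForkStep ls cs J x y) : y ∈ forkOuts ls cs := by
  rw [mem_forkOuts]
  rcases h with h | ⟨c, hc, h | h | ⟨-, h⟩⟩
  · exact .inl ⟨x, h⟩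
  all_goals
    rw [Prod.mk.injEq] at h
    exact .inr ⟨c, hc, by tauto⟩

section

variable (hi : (forkIns ls cs).Nodup)
include hi

theorem ForkStep.of_link {z : Pt × Pt} (hz : z ∈ ls) {y : Pt} (h : ForkStep ls cs J z.1 y) :
    y = z.2 := by
  obtain ⟨h1, h2, -⟩ := unique_of_nodup hi
  rcases h with h | ⟨c, hc, h⟩
  · exact (congrArg Prod.snd (h1 _ hz _ h rfl)).symm
  · have := h2 z hz c hc
    simp only [Prod.mk.injEq] at h
    tauto

theorem ForkStep.of_fst {c : Fork} (hc : c ∈ cs) {y : Pt} (h : ForkStep ls cs J c.fstIn y) :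
    y = c.fstOut := by
  obtain ⟨h1, h2, h3⟩ := unique_of_nodup hi
  rcases h with h | ⟨c', hc', h⟩
  · exact absurd rfl (h2 _ h c hc).1
  · have e := h3 c hc c' hc'
    simp only [Prod.mk.injEq] at h
    rcases h with h | h | h
    · rw [e.1 h.1, h.2]
    · exact absurd h.1 e.2.2
    · exact absurd h.2.1 e.2.2

theorem ForkStep.of_snd {c : Fork} (hc : c ∈ cs) {y : Pt} (h : ForkStep ls cs J c.sndIn y) :
    y = c.sndOut ∨ J ∧ y = c.fstOut := by
  obtain ⟨h1, h2, h3⟩ := unique_of_nodup hi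
  rcases h with h | ⟨c', hc', h⟩
  · exact absurd rfl (h2 _ h c hc).2
  · have e := h3 c hc c' hc'
    have e' := h3 c' hc' c hc
    simp only [Prod.mk.injEq] at h
    rcases h with h | h | h
    · exact absurd h.1.symm e'.2.2
    · rw [e.2.1 h.1]; exact .inl h.2
    · rw [e.2.1 h.2.1]; exact .inr ⟨h.1, h.2.2⟩

end

section

variable (ho : (forkOuts ls cs).Nodup)
include ho

theorem ForkStep.to_link {z : Pt × Pt} (hz : z ∈ ls) {x : Pt} (h : ForkStep ls cs J x z.2) :
    x = z.1 := by
  obtain ⟨h1, h2, -⟩ := unique_of_nodup ho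
  rcases h with h | ⟨c, hc, h⟩
  · exact (congrArg Prod.fst (h1 _ hz _ h rfl)).symm
  · have := h2 z hz c hc
    simp only [Prod.mk.injEq] at h
    tauto

theorem ForkStep.to_snd {c : Fork} (hc : c ∈ cs) {x : Pt} (h : ForkStep ls cs J x c.sndOut) :
    x = c.sndIn := by
  obtain ⟨h1, h2, h3⟩ := unique_of_nodup ho
  rcases h with h | ⟨c', hc', h⟩
  · exact absurd rfl (h2 _ h c hc).2
  · have e := h3 c hc c' hc'
    have e' := h3 c' hc' c hc
    simp only [Prod.mk.injEq] at h
    rcases h with h | h | h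
    · exact absurd h.2.symm e'.2.2
    · rw [e.2.1 h.2, h.1]
    · exact absurd h.2.2.symm e'.2.2

theorem ForkStep.to_fst {c : Fork} (hc : c ∈ cs) {x : Pt} (h : ForkStep ls cs J x c.fstOut) :
    x = c.fstIn ∨ J ∧ x = c.sndIn := by
  obtain ⟨h1, h2, h3⟩ := unique_of_nodup ho
  rcases h with h | ⟨c', hc', h⟩
  · exact absurd rfl (h2 _ h c hc).1
  · have e := h3 c hc c' hc'
    have e' := h3 c' hc' c hc
    simp only [Prod.mk.injEq] at h
    rcases h with h | h | h
    · rw [e.1 h.2]; exact .inl h.1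
    · exact absurd h.2 e.2.2
    · rw [e.1 h.2.2]; exact .inr ⟨h.1, h.2.1⟩

open Classical in
-- The family is recovered from the set of visited points. Only the second strand of a fork has a
-- choice, and it jumps precisely if its own continuation is not visited. If both incoming points
-- are visited, the first strand occupies `fstOut`, so the second must stay.
theorem exists_perm_of_forkGood (hne : ∀ x y, ForkStep ls cs J x y → x ≠ y) {S : Finset Pt} (hS : S ⊆ P)
    (hSi : ∀ p ∈ S, p ∈ forkIns ls cs) (h : ForkGood ls cs J S) :
    ∃ σ : Equiv.Perm {p // p ∈ P}, (∀ x, σ x ≠ x → ForkStep ls cs J x.1 (σ x).1) ∧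
      σ.support.map (Function.Embedding.subtype _) = S := by
  obtain ⟨h1, h2⟩ := h
  let R : {p // p ∈ P} → {p // p ∈ P} → Prop := fun x y => (x.1, y.1) ∈ ls ∨ ∃ c ∈ cs,
    (x.1, y.1) = (c.fstIn, c.fstOut) ∨ (c.sndOut ∈ S ∧ (x.1, y.1) = (c.sndIn, c.sndOut)) ∨
      (c.sndOut ∉ S ∧ J ∧ (x.1, y.1) = (c.sndIn, c.fstOut))
  have hR : ∀ x y, R x y → ForkStep ls cs J x.1 y.1 := by
    rintro x y (h | ⟨c, hc, h⟩)
    · exact .inl h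
    · exact .inr ⟨c, hc, by tauto⟩
  suffices hS' : (∀ x ∈ S.subtype (· ∈ P), ∃ y ∈ S.subtype (· ∈ P), R x y) ∧
      ∀ x ∈ S.subtype (· ∈ P), ∀ x' ∈ S.subtype (· ∈ P), ∀ y, R x y → R x' y → x = x' by
    obtain ⟨σ, hσ, hσR⟩ := exists_perm_of_relation (S.subtype (· ∈ P)) R hS'.1 hS'.2
      fun x hx => hne _ _ (hR x x hx) rfl
    refine ⟨σ, fun x hx => hR _ _ (hσR x ?_), ?_⟩
    · rw [← hσ]; exact Equiv.Perm.mem_support.mpr hx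
    · rw [hσ, Finset.subtype_map]
      exact Finset.filter_eq_self.mpr hS
  constructor
  · intro x hx
    rw [Finset.mem_subtype] at hx
    have key : ∀ y ∈ S, (hy : y ∈ P) → R x ⟨y, hy⟩ → ∃ y ∈ S.subtype (· ∈ P), R x y :=
      fun y hy hyP h => ⟨⟨y, hyP⟩, Finset.mem_subtype.mpr hy, h⟩
    rcases mem_forkIns.mp (hSi _ hx) with ⟨y, hy⟩ | ⟨c, hc, e | e⟩
    · have := (h1 _ hy).mp hx
      exact key y this (hS this) (.inl hy)
    · have := (h2 c hc).2.2.1 (e ▸ hx)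
      exact key _ this (hS this) (.inr ⟨c, hc, .inl (by rw [e])⟩)
    · by_cases h3 : c.sndOut ∈ S
      · exact key _ h3 (hS h3) (.inr ⟨c, hc, .inr (.inl ⟨h3, by rw [e]⟩)⟩)
      · have h4 := h2 c hc
        rw [e] at hx
        have h5 : c.fstOut ∈ S := by tauto
        have h6 : J := by
          by_contra hJ
          tauto
        exact key _ h5 (hS h5) (.inr ⟨c, hc, .inr (.inr ⟨h3, h6, by rw [e]⟩)⟩)
  · intro x hx x' hx' y h h'
    rw [Finset.mem_subtype] at hx hx'
    apply Subtype.ext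
    rcases h with h | ⟨c, hc, h⟩
    · exact (ForkStep.to_link ho h (hR _ _ h')).symm
    · rcases h' with h' | ⟨c', hc', h'⟩
      · exact ForkStep.to_link ho h' (hR x y (.inr ⟨c, hc, h⟩))
      · obtain ⟨-, -, h3⟩ := unique_of_nodup ho
        have e := h3 c hc c' hc'
        have e' := h3 c' hc' c hc
        simp only [Prod.mk.injEq] at h h'
        have h4 := h2 c hc
        rcases h with h | h | h <;> rcases h' with h' | h' | h'
        · obtain rfl := e.1 (h.2.symm.trans h'.2); rw [h.1, h'.1]
        · exact absurd (h.2.symm.trans h'.2.2) e.2.2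
        · obtain rfl := e.1 (h.2.symm.trans h'.2.2.2)
          rw [h.1] at hx; rw [h'.2.2.1] at hx'
          exact absurd (h4.1.mp ⟨hx, hx'⟩).2 h'.1
        · exact absurd (h'.2.symm.trans h.2.2) e'.2.2
        · obtain rfl := e.2.1 (h.2.2.symm.trans h'.2.2); rw [h.2.1, h'.2.1]
        · exact absurd (h'.2.2.2.symm.trans h.2.2) e'.2.2
        · obtain rfl := e.1 (h.2.2.2.symm.trans h'.2)
          rw [h'.1] at hx'; rw [h.2.2.1] at hx
          exact absurd (h4.1.mp ⟨hx', hx⟩).2 h.1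
        · exact absurd (h.2.2.2.symm.trans h'.2.2) e.2.2
        · obtain rfl := e.1 (h.2.2.2.symm.trans h'.2.2.2); rw [h.2.2.1, h'.2.2.1]

end

variable (hi : (forkIns ls cs).Nodup) (ho : (forkOuts ls cs).Nodup)
include hi ho

open Classical in
-- A point is moved iff its image is, and iff its preimage is. Following the steps forwards and
-- backwards gives the local conditions.
theorem forkGood_support {σ : Equiv.Perm {p // p ∈ P}}
    (hσ : ∀ x, σ x ≠ x → ForkStep ls cs J x.1 (σ x).1) :
    (∀ p ∈ σ.support.map (Function.Embedding.subtype _),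
      p ∈ forkIns ls cs ∧ p ∈ forkOuts ls cs) ∧
    ForkGood ls cs J (σ.support.map (Function.Embedding.subtype _)) := by
  set S := σ.support.map (Function.Embedding.subtype _) with hS
  have hmem : ∀ p, p ∈ S ↔ ∃ hp : p ∈ P, σ ⟨p, hp⟩ ≠ ⟨p, hp⟩ := by
    intro p
    simp [hS]
  have hnext : ∀ p ∈ S, ∃ q ∈ S, ForkStep ls cs J p q := by
    intro p hp
    obtain ⟨hpP, hp⟩ := (hmem p).mp hp
    refine ⟨(σ ⟨p, hpP⟩).1, (hmem _).mpr ⟨(σ ⟨p, hpP⟩).2, fun e => hp (σ.injective e)⟩, hσ _ hp⟩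
  have hprev : ∀ p ∈ S, ∃ q ∈ S, ForkStep ls cs J q p := by
    intro p hp
    obtain ⟨hpP, hp⟩ := (hmem p).mp hp
    have h1 : σ (σ.symm ⟨p, hpP⟩) ≠ σ.symm ⟨p, hpP⟩ := by
      rw [Equiv.apply_symm_apply]
      intro e
      exact hp ((congrArg σ e).trans (Equiv.apply_symm_apply ..))
    refine ⟨(σ.symm ⟨p, hpP⟩).1, (hmem _).mpr ⟨_, h1⟩, ?_⟩
    have := hσ _ h1
    rwa [Equiv.apply_symm_apply] at this
  refine ⟨fun p hp => ⟨?_, ?_⟩, fun z hz => ⟨fun h => ?_, fun h => ?_⟩, fun c hc => ?_⟩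
  · obtain ⟨q, -, h⟩ := hnext p hp
    exact h.mem_ins
  · obtain ⟨q, -, h⟩ := hprev p hp
    exact h.mem_outs
  · obtain ⟨q, hq, h⟩ := hnext _ h
    rwa [ForkStep.of_link hi hz h] at hq
  · obtain ⟨q, hq, h⟩ := hprev _ h
    rwa [ForkStep.to_link ho hz h] at hq
  · have h1 : c.fstIn ∈ S → c.fstOut ∈ S := fun h => by
      obtain ⟨q, hq, h⟩ := hnext _ h
      rwa [ForkStep.of_fst hi hc h] at hq
    have h2 : c.sndOut ∈ S → c.sndIn ∈ S := fun h => by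
      obtain ⟨q, hq, h⟩ := hprev _ h
      rwa [ForkStep.to_snd ho hc h] at hq
    have h3 : c.sndIn ∈ S → c.sndOut ∈ S ∨ J ∧ c.fstOut ∈ S := fun h => by
      obtain ⟨q, hq, h⟩ := hnext _ h
      rcases ForkStep.of_snd hi hc h with rfl | ⟨hJ, rfl⟩
      · exact .inl hq
      · exact .inr ⟨hJ, hq⟩
    have h4 : c.fstOut ∈ S → c.fstIn ∈ S ∨ J ∧ c.sndIn ∈ S := fun h => by
      obtain ⟨q, hq, h⟩ := hprev _ h
      rcases ForkStep.to_fst ho hc h with rfl | ⟨hJ, rfl⟩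
      · exact .inl hq
      · exact .inr ⟨hJ, hq⟩
    -- If the second strand jumped, it and the first strand would have the same image, against
    -- injectivity. The next claim is the same argument for the inverse permutation.
    have h5 : c.fstIn ∈ S → c.sndIn ∈ S → c.sndOut ∈ S := fun ha hb => by
      obtain ⟨haP, ha⟩ := (hmem _).mp ha
      obtain ⟨hbP, hb⟩ := (hmem _).mp hb
      rcases ForkStep.of_snd hi hc (hσ _ hb) with e | ⟨-, e⟩
      · rw [← e, hmem]
        exact ⟨(σ ⟨_, hbP⟩).2, fun e' => hb (σ.injective e')⟩
      · have e' := ForkStep.of_fst hi hc (hσ _ ha)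
        have := congrArg Subtype.val (σ.injective (Subtype.ext (e'.trans e.symm)))
        exact absurd this ((unique_of_nodup hi).2.2 c hc c hc).2.2
    have h6 : c.fstOut ∈ S → c.sndOut ∈ S → c.fstIn ∈ S := fun ha hb => by
      obtain ⟨p, hp, h⟩ := hprev _ ha
      rcases ForkStep.to_fst ho hc h with rfl | ⟨-, rfl⟩
      · exact hp
      · obtain ⟨haP, haS⟩ := (hmem _).mp ha
        have hs1 : σ (σ.symm ⟨c.fstOut, haP⟩) ≠ σ.symm ⟨c.fstOut, haP⟩ := by
          rw [Equiv.apply_symm_apply]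
          intro e
          exact haS ((congrArg σ e).trans (Equiv.apply_symm_apply ..))
        have hs2 := hσ _ hs1
        rw [Equiv.apply_symm_apply] at hs2
        rcases ForkStep.to_fst ho hc hs2 with e | ⟨-, e⟩
        · rw [← e, hmem]
          exact ⟨(σ.symm ⟨c.fstOut, haP⟩).2, hs1⟩
        · obtain ⟨hbP, hbS⟩ := (hmem _).mp hb
          have hs3 : σ (σ.symm ⟨c.sndOut, hbP⟩) ≠ σ.symm ⟨c.sndOut, hbP⟩ := by
            rw [Equiv.apply_symm_apply]
            intro e
            exact hbS ((congrArg σ e).trans (Equiv.apply_symm_apply ..))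
          have hs4 := hσ _ hs3
          rw [Equiv.apply_symm_apply] at hs4
          have e' := ForkStep.to_snd ho hc hs4
          have := congrArg Subtype.val (σ.symm.injective (Subtype.ext (e.trans e'.symm)))
          exact absurd this ((unique_of_nodup ho).2.2 c hc c hc).2.2
    refine ⟨⟨fun h => ⟨h1 h.1, h5 h.1 h.2⟩, fun h => ⟨h6 h.1 h.2, h2 h.2⟩⟩,
      ⟨fun h => h.elim (fun h => .inl (h1 h)) fun h => (h3 h).symm.imp_left And.right,
        fun h => h.elim (fun h => (h4 h).imp_right And.right) fun h => .inr (h2 h)⟩, h1,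
      fun hJ h => (h4 h).resolve_right fun h => hJ h.1⟩

open Classical in
-- Sort the moved points by the link or fork at which they are sources; every source occurs once.
theorem prod_support_eq {M : Type*} [CommMonoid M] {σ : Equiv.Perm {p // p ∈ P}}
    (hσ : ∀ x, σ x ≠ x → ForkStep ls cs J x.1 (σ x).1) (f : Pt → Pt → M) :
    ∏ x ∈ σ.support, f x.1 (σ x).1 =
      (ls.map fun z => if z.1 ∈ σ.support.map (Function.Embedding.subtype _)
        then f z.1 z.2 else 1).prod *
      (cs.map (forkWeight f (σ.support.map (Function.Embedding.subtype _)))).prod := by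
  obtain ⟨hS1, hS2, hS3⟩ := forkGood_support hi ho hσ
  set S := σ.support.map (Function.Embedding.subtype _) with hS
  have hmem : ∀ p, p ∈ S ↔ ∃ hp : p ∈ P, σ ⟨p, hp⟩ ≠ ⟨p, hp⟩ := by
    intro p
    simp [hS]
  let nx : Pt → Pt := fun p => if h : p ∈ P then (σ ⟨p, h⟩).1 else p
  have hnx : ∀ p ∈ S, ForkStep ls cs J p (nx p) ∧ nx p ∈ S := by
    intro p hp
    obtain ⟨hpP, hp⟩ := (hmem p).mp hp
    simp only [nx, dif_pos hpP]
    exact ⟨hσ _ hp, (hmem _).mpr ⟨(σ ⟨p, hpP⟩).2, fun e => hp (σ.injective e)⟩⟩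
  have h1 : ∏ x ∈ σ.support, f x.1 (σ x).1 = ∏ p ∈ S, f p (nx p) := by
    rw [hS, Finset.prod_map]
    refine Finset.prod_congr rfl fun x _ => ?_
    simp [nx, x.2]
  have h2 : ∏ p ∈ S, f p (nx p) = ((forkIns ls cs).map fun p =>
      if p ∈ S then f p (nx p) else 1).prod := by
    rw [← List.prod_toFinset _ hi, Finset.prod_ite_mem, Finset.inter_eq_right.mpr]
    exact fun p hp => List.mem_toFinset.mpr (hS1 p hp).1
  have h3 : ∀ (g : Pt → M) (l : List Fork), ((l.flatMap fun c => [c.fstIn, c.sndIn]).map g).prod =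
      (l.map fun c => g c.fstIn * g c.sndIn).prod := by
    intro g l
    induction l with
    | nil => rfl
    | cons c l ih => simp only [List.flatMap_cons, List.map_append, List.prod_append, ih,
        List.map_cons, List.prod_cons, List.map_nil, List.prod_nil, mul_one]
  rw [h1, h2, forkIns, List.map_append, List.prod_append, h3, List.map_map]
  congr 2
  · refine List.map_congr_left fun z hz => ?_
    simp only [Function.comp]
    refine if_ctx_congr Iff.rfl (fun h => ?_) fun _ => rfl
    rw [ForkStep.of_link hi hz (hnx _ h).1]
  · refine List.map_congr_left fun c hc => ?_
    rw [forkWeight]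
    congr 1
    · refine if_ctx_congr Iff.rfl (fun h => ?_) fun _ => rfl
      rw [ForkStep.of_fst hi hc (hnx _ h).1]
    · refine if_ctx_congr Iff.rfl (fun h => ?_) fun _ => rfl
      have h4 := hnx _ h
      rcases ForkStep.of_snd hi hc h4.1 with e | ⟨hJ, e⟩
      · rw [e] at h4 ⊢
        rw [if_pos h4.2]
      · have h5 : c.sndOut ∉ S := by
          intro h5
          rw [e] at h4
          have h6 := (hS3 c hc).1.mpr ⟨h4.2, h5⟩
          have h7 := hnx _ h6.1
          have h8 := ForkStep.of_fst hi hc h7.1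
          obtain ⟨hp, -⟩ := (hmem _).mp h6.1
          obtain ⟨hp', -⟩ := (hmem _).mp h6.2
          simp only [nx, dif_pos hp] at h8
          simp only [nx, dif_pos hp'] at e
          have := congrArg Subtype.val (σ.injective (Subtype.ext (h8.trans e.symm)))
          exact ((unique_of_nodup hi).2.2 c hc c hc).2.2 this
        rw [e, if_neg h5]

open Classical in
/-- A sum over families of cycles of a system of forks is a sum over the sets of visited points. -/
theorem sum_allowed_eq {A : Type*} [CommRing A] (hne : ∀ x y, ForkStep ls cs J x y → x ≠ y)
    (f : Pt → Pt → A) (B : Finset Pt → A) :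
    ∑ σ ∈ Finset.univ.filter (fun σ : Equiv.Perm {p // p ∈ P} =>
        ∀ x, σ x ≠ x → ForkStep ls cs J x.1 (σ x).1),
      B (σ.support.map (Function.Embedding.subtype _)) * ∏ x ∈ σ.support, f x.1 (σ x).1 =
    ∑ S ∈ P.powerset, if (∀ p ∈ S, p ∈ forkIns ls cs ∧ p ∈ forkOuts ls cs) ∧ ForkGood ls cs J S
      then B S * ((ls.map fun z => if z.1 ∈ S then f z.1 z.2 else 1).prod *
        (cs.map (forkWeight f S)).prod) else 0 := by
  rw [← Finset.sum_filter]
  refine Finset.sum_bij (fun σ _ => σ.support.map (Function.Embedding.subtype _)) ?_ ?_ ?_ ?_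
  · intro σ h
    refine Finset.mem_filter.mpr ⟨Finset.mem_powerset.mpr fun p hp => ?_,
      forkGood_support hi ho (Finset.mem_filter.mp h).2⟩
    simp only [Finset.mem_map, Function.Embedding.subtype_apply] at hp
    obtain ⟨x, -, rfl⟩ := hp
    exact x.2
  · intro σ hσ τ hτ e
    replace hσ := (Finset.mem_filter.mp hσ).2
    replace hτ := (Finset.mem_filter.mp hτ).2
    have e' : σ.support = τ.support := Finset.map_injective _ e
    have hg := forkGood_support hi ho hσ
    have hmem : ∀ τ : Equiv.Perm {p // p ∈ P}, ∀ p, p ∈ τ.support.map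
        (Function.Embedding.subtype _) ↔ ∃ hp : p ∈ P, τ ⟨p, hp⟩ ≠ ⟨p, hp⟩ := by
      intro τ p
      simp
    ext1 x
    by_cases hx : x ∈ σ.support
    · have hx1 := Equiv.Perm.mem_support.mp hx
      have hx2 := Equiv.Perm.mem_support.mp (e' ▸ hx)
      have s1 := hσ x hx1
      have s2 := hτ x hx2
      apply Subtype.ext
      rcases mem_forkIns.mp s1.mem_ins with ⟨y, hy⟩ | ⟨c, hc, hh | hh⟩
      · rw [ForkStep.of_link hi hy s1, ForkStep.of_link hi hy s2]
      · rw [hh] at s1 s2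
        rw [ForkStep.of_fst hi hc s1, ForkStep.of_fst hi hc s2]
      -- The support alone decides whether the second strand jumps, so two permutations with equal
      -- supports have equal images here.
      · have key : ∀ τ : Equiv.Perm {p // p ∈ P}, (∀ x, τ x ≠ x → ForkStep ls cs J x.1 (τ x).1) →
            τ x ≠ x → (τ x).1 = if c.sndOut ∈ τ.support.map (Function.Embedding.subtype _) then
              c.sndOut else c.fstOut := by
          intro τ hτ hx
          have s := hτ x hx
          rw [hh] at s
          have hm : (τ x).1 ∈ τ.support.map (Function.Embedding.subtype _) :=
            (hmem _ _).mpr ⟨(τ x).2, fun e => hx (τ.injective e)⟩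
          rcases ForkStep.of_snd hi hc s with e | ⟨-, e⟩
          · rw [e] at hm
            rw [if_pos hm, e]
          · rw [if_neg, e]
            intro h5
            rw [e] at hm
            have hg := (forkGood_support hi ho hτ).2.2 c hc
            have h6 := hg.1.mpr ⟨hm, h5⟩
            obtain ⟨hp, hp'⟩ := (hmem _ _).mp h6.1
            have h8 := ForkStep.of_fst hi hc (hτ _ hp')
            have := congrArg Subtype.val (τ.injective (Subtype.ext (h8.trans e.symm)))
            exact ((unique_of_nodup hi).2.2 c hc c hc).2.2 (this.trans hh)
        rw [key σ hσ hx1, key τ hτ hx2, e']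
    · have hx' : x ∉ τ.support := e' ▸ hx
      rw [Equiv.Perm.notMem_support.mp hx, Equiv.Perm.notMem_support.mp hx']
  · intro S hS
    obtain ⟨hS, h1, h2⟩ := Finset.mem_filter.mp hS
    obtain ⟨σ, hσ, rfl⟩ := exists_perm_of_forkGood ho hne (Finset.mem_powerset.mp hS)
      (fun p hp => (h1 p hp).1) h2
    exact ⟨σ, Finset.mem_filter.mpr ⟨Finset.mem_univ _, hσ⟩, rfl⟩
  · intro σ h
    rw [prod_support_eq hi ho (Finset.mem_filter.mp h).2]

end

end

section
open Diagram

/-! ### Families of cycles on a diagram -/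

/-- The direction of the strand changes on the way from `x` to `y` iff they lie on the same line. -/
def DirStep (x y : Pt) : Prop := x.1 ≠ y.1 ↔ x.2.2 = y.2.2

theorem DirStep.ne {x y : Pt} (h : DirStep x y) : x ≠ y := by
  rintro rfl
  simp [DirStep] at h

/-- A half turn occurs exactly where the direction bit changes, so the two agree modulo 2. -/
theorem DirStep.even {x y : Pt} (h : DirStep x y) :
    Even (halfTurns x y - ((if y.2.2 then 1 else 0) - if x.2.2 then 1 else 0)) := by
  unfold DirStep at h
  unfold halfTurns
  by_cases h1 : x.1 ≠ y.1
  · rw [if_pos h1, h.mp h1]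
    simp
  · rw [if_neg h1]
    have h2 := mt h.mpr h1
    cases hx : x.2.2 <;> cases hy : y.2.2 <;> simp_all <;> split_ifs <;> decide

theorem Layer.dirStep_of_mem_links {L : Layer} {k : ℕ} {z : Pt × Pt} (hz : z ∈ L.links k) :
    DirStep z.1 z.2 := by
  rw [L.links_eq, List.mem_append, List.mem_append] at hz
  rcases hz with (hz | hz) | hz
  · exact iff_of_true (fst_ne_of_mem_vert hz).1 (fst_ne_of_mem_vert hz).2
  · exact iff_of_true (fst_ne_of_mem_vert hz).1 (fst_ne_of_mem_vert hz).2
  · obtain ⟨l, (_ | _) | (_ | _) | _, r⟩ := L <;>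
      simp [Layer.pieceLinks, orient] at hz <;> simp [hz, DirStep]

theorem Layer.dirStep_of_mem_crossings {L : Layer} {k : ℕ} {c : Crossing} (hc : c ∈ L.crossings k) :
    DirStep c.overIn c.overOut ∧ DirStep c.overIn c.underOut ∧ DirStep c.underIn c.overOut ∧
      DirStep c.underIn c.underOut := by
  obtain ⟨l, _ | _ | ⟨_ | _, _ | _, _ | _⟩, r⟩ := L <;>
    simp [Layer.crossings, orient] at hc <;> simp [hc, DirStep]

variable {D : Diagram}

theorem dirStep_of_mem_links {z : Pt × Pt} (hz : z ∈ D.links) : DirStep z.1 z.2 := by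
  obtain ⟨x, -, h⟩ := List.mem_flatMap.mp hz
  exact Layer.dirStep_of_mem_links h

theorem dirStep_of_mem_crossings {c : Crossing} (hc : c ∈ D.crossings) :
    DirStep c.overIn c.overOut ∧ DirStep c.overIn c.underOut ∧ DirStep c.underIn c.overOut ∧
      DirStep c.underIn c.underOut := by
  obtain ⟨x, -, h⟩ := List.mem_flatMap.mp hc
  exact Layer.dirStep_of_mem_crossings h

/-- The division by 2 in the definition is exact: modulo 2 the half turns are changes of the
direction bit, and these cancel around a closed curve. -/
theorem two_mul_rotCurve {r : Pt → Pt → Prop} (hr : ∀ x y, r x y → DirStep x y) {γ : D.ClosedCurve}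
    (h : γ.1.Chain fun x y => r x.1 y.1) : 2 * rotCurve γ =
      ∑ x : D.Point, if h : x ∈ γ.1 then halfTurns x.1 (γ.1.next γ.2 x h).1 else 0 := by
  rw [rotCurve]
  refine Int.mul_ediv_cancel' (even_iff_two_dvd.mp ?_)
  -- The direction bit as an integer. Its changes along the permutation of the cycle sum to zero
  -- because a permutation preserves the sum.
  let d : D.Point → ℤ := fun x => if x.1.2.2 then 1 else 0
  have h1 : ∑ x : D.Point, (d (γ.1.formPerm γ.2 x) - d x) = 0 := by
    rw [Finset.sum_sub_distrib, Equiv.sum_comp, sub_self]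
  have h2 : ∀ f : D.Point → ℤ, ∑ x, f x = ∑ x, (f x - (d (γ.1.formPerm γ.2 x) - d x)) := fun f => by
    rw [Finset.sum_sub_distrib f, h1, sub_zero]
  rw [h2]
  refine Finset.even_sum _ fun x _ => ?_
  by_cases hx : x ∈ γ.1
  · rw [dif_pos hx, Cycle.formPerm_apply_mem_eq_next _ _ _ hx]
    exact (hr _ _ ((chain_iff_forall_next _ _ γ.2).mp h x hx)).even
  · rw [dif_neg hx, Cycle.formPerm_eq_self_of_notMem _ _ _ hx]
    simp

theorem T_sum {ι : Type*} (s : Finset ι) (f : ι → ℤ) : (T (∑ i ∈ s, f i) : ℤ[T;T⁻¹]) = ∏ i ∈ s, T (f i) := by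
  classical
  induction s using Finset.induction_on with
  | empty => simp
  | insert a s ha ih => rw [Finset.sum_insert ha, Finset.prod_insert ha, T_add, ih]

/-- Makes the rotation number a product of local weights. Since t = q⁻², a full turn has an even
exponent and each half turn still gives an integral power of q. -/
theorem T_mul_two_mul_rotFamily {r : Pt → Pt → Prop} (hr : ∀ x y, r x y → DirStep x y)
    {c : Finset D.ClosedCurve} (h : IsFamily (fun x y : D.Point => r x.1 y.1) c) (e : ℤ) :
    (T (e * (2 * rotFamily c)) : ℤ[T;T⁻¹]) = ∏ γ ∈ c, ∏ x : D.Point,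
      if h : x ∈ γ.1 then T (e * halfTurns x.1 (γ.1.next γ.2 x h).1) else 1 := by
  rw [rotFamily, Finset.mul_sum, Finset.mul_sum, T_sum]
  refine Finset.prod_congr rfl fun γ hγ => ?_
  rw [two_mul_rotCurve hr (h.1 γ hγ).2, Finset.mul_sum, T_sum]
  refine Finset.prod_congr rfl fun x _ => ?_
  split_ifs <;> simp

theorem visits_familyOf (σ : Equiv.Perm D.Point) (p : Pt) :
    Visits (familyOf σ) p ↔ p ∈ σ.support.map (Function.Embedding.subtype _) := by
  simp only [Visits, Finset.mem_map, Function.Embedding.subtype_apply, ← exists_mem_familyOf_iff]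
  constructor
  · rintro ⟨γ, hγ, x, hx, rfl⟩
    exact ⟨x, ⟨γ, hγ, hx⟩, rfl⟩
  · rintro ⟨x, ⟨γ, hγ, hx⟩, rfl⟩
    exact ⟨γ, hγ, x, hx, rfl⟩

open Classical in
/-- A sum over families of cycles as a sum over the sets of visited points. -/
theorem sum_families {ls : List (Pt × Pt)} {cs : List Fork} {J : Prop}
    (hi : (forkIns ls cs).Nodup) (ho : (forkOuts ls cs).Nodup)
    (hd : ∀ x y, ForkStep ls cs J x y → DirStep x y) (w : Pt → Pt → ℤ[T;T⁻¹]) (e : ℤ)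
    (B : Finset Pt → ℤ[T;T⁻¹]) (G : Finset D.ClosedCurve → ℤ[T;T⁻¹])
    (hG : ∀ σ : Equiv.Perm D.Point,
      G (familyOf σ) = B (σ.support.map (Function.Embedding.subtype _))) :
    ∑ c ∈ Finset.univ.filter (IsFamily fun x y : D.Point => ForkStep ls cs J x.1 y.1),
      G c * (T (e * (2 * rotFamily c)) * ∏ γ ∈ c, ∏ x : D.Point,
        if h : x ∈ γ.1 then w x.1 (γ.1.next γ.2 x h).1 else 1) =
    ∑ S ∈ D.points.powerset,
      if (∀ p ∈ S, p ∈ forkIns ls cs ∧ p ∈ forkOuts ls cs) ∧ ForkGood ls cs J S then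
        B S * ((ls.map fun z => if z.1 ∈ S then T (e * halfTurns z.1 z.2) * w z.1 z.2 else 1).prod *
        (cs.map (forkWeight (fun x y => T (e * halfTurns x y) * w x y) S)).prod) else 0 := by
  rw [← sum_allowed_eq hi ho (fun x y h => (hd x y h).ne)
      (fun x y => T (e * halfTurns x y) * w x y) B,
    sum_isFamily (r := fun x y : D.Point => ForkStep ls cs J x.1 y.1)
      (fun x h => (hd _ _ h).ne rfl)]
  refine Finset.sum_congr rfl fun σ hσ => ?_
  have hσ' := isFamily_familyOf (r := fun x y : D.Point => ForkStep ls cs J x.1 y.1)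
    (Finset.mem_filter.mp hσ).2
  have h1 := T_mul_two_mul_rotFamily hd hσ' e
  have h2 := prod_familyOf σ (fun x y : D.Point => T (e * halfTurns x.1 y.1) * w x.1 y.1)
  rw [hG, h1, ← h2, ← Finset.prod_mul_distrib]
  refine congrArg _ (Finset.prod_congr rfl fun γ _ => ?_)
  rw [← Finset.prod_mul_distrib]
  refine Finset.prod_congr rfl fun x _ => ?_
  by_cases hx : x ∈ γ.1
  · rw [dif_pos hx, dif_pos hx, dif_pos hx]
  · rw [dif_neg hx, dif_neg hx, dif_neg hx, one_mul]

/-! ### The forks of the random walks and of the smoothing -/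

/-- The over-crossing (jump-up model) or the under-crossing (jump-down model) strand comes first. -/
def forkOf : Model → Crossing → Fork
  | .up, c => ⟨c.overIn, c.overOut, c.underIn, c.underOut⟩
  | .down, c => ⟨c.underIn, c.underOut, c.overIn, c.overOut⟩

/-- With jumps forbidden a fork is just a pair of strands, so the oriented smoothing falls under the
same theory as the walks. -/
def smoothFork (c : Crossing) : Fork := ⟨c.overIn, c.underOut, c.underIn, c.overOut⟩

theorem forkIns_map (ls : List (Pt × Pt)) (cs : List Crossing) {g : Crossing → Fork}
    (hg : ∀ c, [(g c).fstIn, (g c).sndIn].Perm [c.overIn, c.underIn]) :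
    (forkIns ls (cs.map g)).Perm (insOf ls cs) := by
  rw [forkIns, insOf, List.flatMap_map]
  exact (List.Perm.refl _).append (List.Perm.flatMap_left _ fun c _ => hg c)

theorem forkOuts_map (ls : List (Pt × Pt)) (cs : List Crossing) {g : Crossing → Fork}
    (hg : ∀ c, [(g c).fstOut, (g c).sndOut].Perm [c.overOut, c.underOut]) :
    (forkOuts ls (cs.map g)).Perm (outsOf ls cs) := by
  rw [forkOuts, outsOf, List.flatMap_map]
  exact (List.Perm.refl _).append (List.Perm.flatMap_left _ fun c _ => hg c)

theorem forkOf_ins (m : Model) (c : Crossing) :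
    [(forkOf m c).fstIn, (forkOf m c).sndIn].Perm [c.overIn, c.underIn] := by
  cases m <;> simp [forkOf, List.Perm.swap]

theorem forkOf_outs (m : Model) (c : Crossing) :
    [(forkOf m c).fstOut, (forkOf m c).sndOut].Perm [c.overOut, c.underOut] := by
  cases m <;> simp [forkOf, List.Perm.swap]

theorem smoothFork_ins (c : Crossing) :
    [(smoothFork c).fstIn, (smoothFork c).sndIn].Perm [c.overIn, c.underIn] := .refl _

theorem smoothFork_outs (c : Crossing) :
    [(smoothFork c).fstOut, (smoothFork c).sndOut].Perm [c.overOut, c.underOut] := .swap ..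

theorem transitions_eq (m : Model) : D.transitions m = (D.links.map fun x => (x.1, x.2, 1)) ++
    D.crossings.flatMap fun c => [((forkOf m c).fstIn, (forkOf m c).fstOut, 1),
      ((forkOf m c).sndIn, (forkOf m c).sndOut, tPow c.sign),
      ((forkOf m c).sndIn, (forkOf m c).fstOut, 1 - tPow c.sign)] := by
  cases m <;> rfl

theorem walkStep_iff (m : Model) (x y : Pt) :
    D.WalkStep m x y ↔ ForkStep D.links (D.crossings.map (forkOf m)) True x y := by
  rw [WalkStep, transitions_eq, ForkStep]
  simp only [List.mem_append, List.mem_map, List.mem_flatMap, exists_or, List.mem_cons,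
    List.not_mem_nil, or_false, true_and, Prod.mk.injEq]
  refine or_congr ⟨?_, fun h => ⟨1, (x, y), h, rfl, rfl, rfl⟩⟩ ⟨?_, ?_⟩
  · rintro ⟨w, z, hz, rfl, rfl, -⟩
    exact hz
  · rintro ⟨w, c, hc, h⟩
    exact ⟨_, ⟨c, hc, rfl⟩, by tauto⟩
  · rintro ⟨_, ⟨c, hc, rfl⟩, h | h | h⟩
    exacts [⟨_, c, hc, .inl ⟨h.1, h.2, rfl⟩⟩, ⟨_, c, hc, .inr (.inl ⟨h.1, h.2, rfl⟩)⟩,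
      ⟨_, c, hc, .inr (.inr ⟨h.1, h.2, rfl⟩)⟩]

theorem smoothedStep_iff (x y : Pt) :
    D.SmoothedStep x y ↔ ForkStep D.links (D.crossings.map smoothFork) False x y := by
  simp [SmoothedStep, ForkStep, smoothFork]

theorem dirStep_of_forkStep {g : Crossing → Fork} {J : Prop}
    (hg : ∀ c ∈ D.crossings, DirStep (g c).fstIn (g c).fstOut ∧ DirStep (g c).sndIn (g c).sndOut ∧
      (J → DirStep (g c).sndIn (g c).fstOut)) {x y : Pt}
    (h : ForkStep D.links (D.crossings.map g) J x y) : DirStep x y := by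
  rcases h with h | ⟨c, hc, h⟩
  · exact dirStep_of_mem_links h
  · obtain ⟨c, hc', rfl⟩ := List.mem_map.mp hc
    have := hg c hc'
    simp only [Prod.mk.injEq] at h
    rcases h with ⟨rfl, rfl⟩ | ⟨rfl, rfl⟩ | ⟨hJ, rfl, rfl⟩
    exacts [this.1, this.2.1, this.2.2 hJ]

theorem forkOf_dirStep (m : Model) {c : Crossing} (hc : c ∈ D.crossings) :
    DirStep (forkOf m c).fstIn (forkOf m c).fstOut ∧ DirStep (forkOf m c).sndIn (forkOf m c).sndOut ∧
      (True → DirStep (forkOf m c).sndIn (forkOf m c).fstOut) := by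
  have := dirStep_of_mem_crossings hc
  cases m <;> simp only [forkOf] <;> tauto

theorem smoothFork_dirStep {c : Crossing} (hc : c ∈ D.crossings) :
    DirStep (smoothFork c).fstIn (smoothFork c).fstOut ∧
      DirStep (smoothFork c).sndIn (smoothFork c).sndOut ∧
      (False → DirStep (smoothFork c).sndIn (smoothFork c).fstOut) := by
  have := dirStep_of_mem_crossings hc
  simp only [smoothFork]
  tauto

end

section
open Diagram

/-! ### State sums for the random walks and for the smoothing -/

/-- The sign with which the rotation number enters the random walk sum. -/
def modelSign : Model → ℤ
  | .up => 1
  | .down => -1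

/-- The contribution of a step without choice, `g` telling which points are visited. -/
noncomputable def linkWeight (e : ℤ) (g : Pt → Bool) (z : Pt × Pt) : ℤ[T;T⁻¹] :=
  if g z.1 = g z.2 then (if g z.1 then T (e * halfTurns z.1 z.2) else 1) else 0

/-- The contribution of a crossing to the random walk sum. -/
noncomputable def crossWeight (e : ℤ) (g : Pt → Bool) (ε : ℤ) (c : Fork) : ℤ[T;T⁻¹] :=
  match g c.fstIn, g c.fstOut, g c.sndIn, g c.sndOut with
  | false, false, false, false => 1
  | true, true, false, false => T (e * halfTurns c.fstIn c.fstOut)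
  | false, false, true, true => T (e * halfTurns c.sndIn c.sndOut) * tPow ε
  | false, true, true, false => T (e * halfTurns c.sndIn c.fstOut) * (1 - tPow ε)
  | true, true, true, true =>
    T (e * halfTurns c.fstIn c.fstOut) * T (e * halfTurns c.sndIn c.sndOut)
  | _, _, _, _ => 0

theorem prod_map_ite {α M : Type*} [CommMonoidWithZero M] (l : List α) (p : α → Prop)
    [DecidablePred p] [Decidable (∀ z ∈ l, p z)] (f : α → M) :
    (l.map fun z => if p z then f z else 0).prod = if ∀ z ∈ l, p z then (l.map f).prod else 0 := by
  split_ifs with h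
  · exact congrArg List.prod (List.map_congr_left fun z hz => if_pos (h z hz))
  · push Not at h
    obtain ⟨z, hz, hp⟩ := h
    exact List.prod_eq_zero (List.mem_map.mpr ⟨z, hz, if_neg hp⟩)

theorem prod_map_mul_list {α M : Type*} [CommMonoid M] (l : List α) (f f' : α → M) :
    (l.map fun z => f z * f' z).prod = (l.map f).prod * (l.map f').prod := by
  induction l with
  | nil => simp
  | cons a l ih => simp [ih, mul_mul_mul_comm]

variable {D : Diagram}

theorem stepWeight_eq_of_mem {m : Model} (hn : (D.transitions m).Nodup) {x y : Pt}
    {w : ℤ[T;T⁻¹]} (h : (x, y, w) ∈ D.transitions m)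
    (hu : ∀ w', (x, y, w') ∈ D.transitions m → w' = w) : D.stepWeight m x y = w := by
  classical
  have : (D.transitions m).filter (fun z => z.1 = x ∧ z.2.1 = y) = [(x, y, w)] := by
    refine List.perm_singleton.mp ((List.perm_ext_iff_of_nodup (hn.filter _)
      (List.nodup_singleton _)).mpr ?_)
    rintro ⟨x', y', w'⟩
    simp only [List.mem_filter, decide_eq_true_eq, List.mem_singleton, Prod.mk.injEq]
    constructor
    · rintro ⟨h', rfl, rfl⟩
      exact ⟨rfl, rfl, hu w' h'⟩
    · rintro ⟨rfl, rfl, rfl⟩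
      exact ⟨h, rfl, rfl⟩
  have h2 : D.stepWeight m x y =
      (((D.transitions m).filter fun z => z.1 = x ∧ z.2.1 = y).map fun z => z.2.2).sum := by
    unfold Diagram.stepWeight
    congr!
  rw [h2, this]
  simp

theorem memLabel_eq_true {S : Finset Pt} {p : Pt} : memLabel S p = true ↔ p ∈ S := by
  simp [memLabel]

theorem forkOf_forall (m : Model) (c : Crossing) (p : Pt → Prop) :
    (p c.overIn ∧ p c.overOut ∧ p c.underIn ∧ p c.underOut) ↔
      (p (forkOf m c).fstIn ∧ p (forkOf m c).fstOut ∧ p (forkOf m c).sndIn ∧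
        p (forkOf m c).sndOut) := by
  cases m <;> simp only [forkOf]
  tauto

open Classical in
-- The only role of β: if all four edges are travelled, the second strand stays with weight t^ε, and
-- the factor t^(-ε) cancels it. In every other state β contributes nothing.
theorem crossWeight_eq {e ε : ℤ} (S : Finset Pt) {c : Fork} {w : Pt → Pt → ℤ[T;T⁻¹]}
    (s1 : w c.fstIn c.fstOut = 1) (s2 : w c.sndIn c.sndOut = tPow ε)
    (s3 : w c.sndIn c.fstOut = 1 - tPow ε) :
    crossWeight e (memLabel S) ε c =
      if (c.fstIn ∈ S ∧ c.sndIn ∈ S ↔ c.fstOut ∈ S ∧ c.sndOut ∈ S) ∧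
      (c.fstIn ∈ S ∨ c.sndIn ∈ S ↔ c.fstOut ∈ S ∨ c.sndOut ∈ S) ∧
      (c.fstIn ∈ S → c.fstOut ∈ S) ∧ (¬ True → c.fstOut ∈ S → c.fstIn ∈ S) then
      T (2 * if c.fstIn ∈ S ∧ c.fstOut ∈ S ∧ c.sndIn ∈ S ∧ c.sndOut ∈ S then ε else 0) *
        forkWeight (fun x y => T (e * halfTurns x y) * w x y) S c else 0 := by
  rw [forkWeight, s1, s2, s3, crossWeight]
  have e8 : (T (2 * ε) * tPow ε : ℤ[T;T⁻¹]) = 1 := by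
    rw [tPow, ← T_add]; simp
  simp only [← memLabel_eq_true]
  generalize memLabel S c.fstIn = b1, memLabel S c.fstOut = b2, memLabel S c.sndIn = b3,
    memLabel S c.sndOut = b4
  cases b1 <;> cases b2 <;> cases b3 <;> cases b4 <;>
    simp only [Bool.false_eq_true, and_self, and_true, and_false, or_self, or_true, or_false,
      iff_self, iff_true, iff_false, not_true, not_false_eq_true, implies_true,
      if_true, if_false, mul_zero, one_mul, mul_one, T_zero, forall_const, imp_false]
  rw [mul_left_comm (T (2 * ε)), mul_left_comm (T (2 * ε)), e8, mul_one]

open Classical in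
-- The leading 1 is the contribution of the empty family.
theorem sum_simpleFamilies (m : Model) : 1 + ∑ c ∈ D.simpleFamilies m,
      tPow (modelSign m * rotFamily c - beta c) * weight m c =
      ∑ c ∈ Finset.univ.filter (IsFamily fun x y : D.Point =>
        ForkStep D.links (D.crossings.map (forkOf m)) True x.1 y.1),
        T (2 * beta c) * (T (-modelSign m * (2 * rotFamily c)) * ∏ γ ∈ c, ∏ x : D.Point,
        if h : x ∈ γ.1 then D.stepWeight m x.1 (γ.1.next γ.2 x h).1 else 1) := by
  have hr : ∀ x y : D.Point, D.WalkStep m x.1 y.1 ↔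
      ForkStep D.links (D.crossings.map (forkOf m)) True x.1 y.1 := fun x y => walkStep_iff m x.1 y.1
  have e2 : Finset.univ.filter (IsFamily fun x y : D.Point =>
      ForkStep D.links (D.crossings.map (forkOf m)) True x.1 y.1) =
      insert ∅ (D.simpleFamilies m) := by
    ext c
    simp only [Finset.mem_filter, Finset.mem_univ, true_and, Finset.mem_insert, simpleFamilies,
      IsFamily, Follows, ← hr]
    rcases c.eq_empty_or_nonempty with rfl | hc
    · simp
    · simp [hc, hc.ne_empty]
  rw [e2, Finset.sum_insert (by simp [simpleFamilies])]
  refine congrArg₂ (· + ·) ?_ (Finset.sum_congr rfl fun c _ => ?_)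
  · simp [beta, rotFamily, Visits]
  · rw [← mul_assoc, ← T_add, tPow]
    exact congrArg₂ (· * ·) (congrArg T (by ring)) rfl

/-! ### Local weights of a composable diagram -/

section Walk

variable {b : List Bool} (h : Composable D.bottom D.layers b)
include h

theorem nodup_forkIns {g : Crossing → Fork}
    (hg : ∀ c, [(g c).fstIn, (g c).sndIn].Perm [c.overIn, c.underIn]) :
    (forkIns D.links (D.crossings.map g)).Nodup :=
  (forkIns_map _ _ hg).nodup_iff.mpr (nodup_ins h)

theorem nodup_forkOuts {g : Crossing → Fork}
    (hg : ∀ c, [(g c).fstOut, (g c).sndOut].Perm [c.overOut, c.underOut]) :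
    (forkOuts D.links (D.crossings.map g)).Nodup :=
  (forkOuts_map _ _ hg).nodup_iff.mpr (nodup_outs h)

theorem unique_ins (m : Model) :
    (∀ z ∈ D.links, ∀ z' ∈ D.links, z.1 = z'.1 → z = z') ∧
    (∀ z ∈ D.links, ∀ c ∈ D.crossings,
      z.1 ≠ (forkOf m c).fstIn ∧ z.1 ≠ (forkOf m c).sndIn) ∧
    ∀ c ∈ D.crossings, ∀ c' ∈ D.crossings, ((forkOf m c).fstIn = (forkOf m c').fstIn → c = c') ∧
      ((forkOf m c).sndIn = (forkOf m c').sndIn → c = c') ∧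
      (forkOf m c).fstIn ≠ (forkOf m c').sndIn := by
  have := nodup_forkIns h (forkOf_ins m)
  rw [forkIns, List.flatMap_map] at this
  exact unique_of_nodup this

theorem unique_outs (m : Model) :
    ∀ c ∈ D.crossings, ∀ c' ∈ D.crossings, (forkOf m c).fstOut ≠ (forkOf m c').sndOut := by
  have := nodup_forkOuts h (forkOf_outs m)
  rw [forkOuts, List.flatMap_map] at this
  exact fun c hc c' hc' => ((unique_of_nodup this).2.2 c hc c' hc').2.2

/-- Step weights are sums over a list, so repeated entries would spoil them. Distinct sources and
targets exclude repetitions. -/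
theorem nodup_transitions (m : Model) : (D.transitions m).Nodup := by
  obtain ⟨h1, h2, h3⟩ := unique_ins h m
  have h4 := unique_outs h m
  have hi := nodup_forkIns h (forkOf_ins m)
  rw [forkIns, List.flatMap_map, List.nodup_append] at hi
  have hl : D.links.Nodup := List.Nodup.of_map _ hi.1
  have hc : D.crossings.Nodup := by
    have h5 := hi.2.1
    rw [List.nodup_flatMap] at h5
    refine h5.2.imp_of_mem fun {c c'} _ _ hd e => ?_
    subst e
    exact hd (a := (forkOf m c).fstIn) (by simp) (by simp)
  rw [transitions_eq, List.nodup_append]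
  refine ⟨hl.map fun z z' e => ?_, List.nodup_flatMap.mpr ⟨fun c hc => ?_, ?_⟩, ?_⟩
  · simp only [Prod.mk.injEq, and_true] at e
    exact Prod.ext e.1 e.2
  · have := h4 c hc c hc
    have h5 := (h3 c hc c hc).2.2
    simp [h5, this.symm]
  · refine hc.imp_of_mem fun {c c'} hc hc' hne => ?_
    have e := h3 c hc c' hc'
    have e' := h3 c' hc' c hc
    have e1 := mt e.1 hne
    have e2 := mt e.2.1 hne
    simp [Function.onFun, Ne.symm e1, Ne.symm e2, e.2.2.symm, e'.2.2]
  · intro z hz z' hz' e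
    subst e
    obtain ⟨x, hx, rfl⟩ := List.mem_map.mp hz
    obtain ⟨c, hc, hz'⟩ := List.mem_flatMap.mp hz'
    have := h2 x hx c hc
    simp only [List.mem_cons, Prod.mk.injEq, List.not_mem_nil, or_false] at hz'
    tauto

theorem stepWeight_link (m : Model) {z : Pt × Pt} (hz : z ∈ D.links) :
    D.stepWeight m z.1 z.2 = 1 := by
  obtain ⟨h1, h2, h3⟩ := unique_ins h m
  refine stepWeight_eq_of_mem (nodup_transitions h m) ?_ fun w' hw => ?_
  · rw [transitions_eq]
    exact List.mem_append_left _ (List.mem_map.mpr ⟨z, hz, rfl⟩)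
  · rw [transitions_eq, List.mem_append, List.mem_map, List.mem_flatMap] at hw
    rcases hw with ⟨x, -, hx⟩ | ⟨c, hc, hw⟩
    · simp only [Prod.mk.injEq] at hx
      exact hx.2.2.symm
    · have := h2 z hz c hc
      simp only [List.mem_cons, Prod.mk.injEq, List.not_mem_nil, or_false] at hw
      tauto

theorem stepWeight_fork (m : Model) {c : Crossing} (hc : c ∈ D.crossings) :
    D.stepWeight m (forkOf m c).fstIn (forkOf m c).fstOut = 1 ∧
    D.stepWeight m (forkOf m c).sndIn (forkOf m c).sndOut = tPow c.sign ∧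
    D.stepWeight m (forkOf m c).sndIn (forkOf m c).fstOut = 1 - tPow c.sign := by
  obtain ⟨h1, h2, h3⟩ := unique_ins h m
  have h4 := unique_outs h m
  have key : ∀ x y w, (x, y, w) ∈ [((forkOf m c).fstIn, (forkOf m c).fstOut, (1 : ℤ[T;T⁻¹])),
      ((forkOf m c).sndIn, (forkOf m c).sndOut, tPow c.sign),
      ((forkOf m c).sndIn, (forkOf m c).fstOut, 1 - tPow c.sign)] → D.stepWeight m x y = w := by
    intro x y w hw
    refine stepWeight_eq_of_mem (nodup_transitions h m) ?_ fun w' hw' => ?_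
    · rw [transitions_eq]
      exact List.mem_append_right _ (List.mem_flatMap.mpr ⟨c, hc, hw⟩)
    · rw [transitions_eq, List.mem_append, List.mem_map, List.mem_flatMap] at hw'
      simp only [List.mem_cons, Prod.mk.injEq, List.not_mem_nil, or_false] at hw
      rcases hw' with ⟨z, hz, hx⟩ | ⟨c', hc', hw'⟩
      · have := h2 z hz c hc
        simp only [Prod.mk.injEq] at hx
        obtain ⟨rfl, -, -⟩ := hx
        tauto
      · simp only [List.mem_cons, Prod.mk.injEq, List.not_mem_nil, or_false] at hw'
        have e := h3 c hc c' hc'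
        have e' := h3 c' hc' c hc
        have e'' := h4 c hc c hc
        rcases hw with ⟨rfl, rfl, rfl⟩ | ⟨rfl, rfl, rfl⟩ | ⟨rfl, rfl, rfl⟩ <;>
          rcases hw' with ⟨h5, h6, rfl⟩ | ⟨h5, h6, rfl⟩ | ⟨h5, h6, rfl⟩
        · rfl
        · exact absurd h5 e.2.2
        · exact absurd h5 e.2.2
        · exact absurd h5.symm e'.2.2
        · rw [e.2.1 h5]
        · obtain rfl := e.2.1 h5
          exact absurd h6.symm e''
        · exact absurd h5.symm e'.2.2
        · obtain rfl := e.2.1 h5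
          exact absurd h6 e''
        · rw [e.2.1 h5]
  exact ⟨key _ _ _ (by simp), key _ _ _ (by simp), key _ _ _ (by simp)⟩

open Classical in
theorem prod_linkWeight_eq (m : Model) (S : Finset Pt) : (D.links.map (linkWeight (-modelSign m) (memLabel S))).prod = if ∀ z ∈ D.links,
      (z.1 ∈ S ↔ z.2 ∈ S) then (D.links.map fun z => if z.1 ∈ S then
        T (-modelSign m * halfTurns z.1 z.2) * D.stepWeight m z.1 z.2 else 1).prod else 0 := by
  rw [← prod_map_ite]
  refine congrArg List.prod (List.map_congr_left fun z hz => ?_)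
  rw [linkWeight, stepWeight_link h m hz]
  simp [memLabel]

open Classical in
theorem prod_crossWeight_eq (m : Model) (S : Finset Pt) : (D.crossings.map fun c =>
      crossWeight (-modelSign m) (memLabel S) c.sign (forkOf m c)).prod = if ∀ c ∈ D.crossings,
      ((forkOf m c).fstIn ∈ S ∧ (forkOf m c).sndIn ∈ S ↔
        (forkOf m c).fstOut ∈ S ∧ (forkOf m c).sndOut ∈ S) ∧
      ((forkOf m c).fstIn ∈ S ∨ (forkOf m c).sndIn ∈ S ↔
        (forkOf m c).fstOut ∈ S ∨ (forkOf m c).sndOut ∈ S) ∧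
      ((forkOf m c).fstIn ∈ S → (forkOf m c).fstOut ∈ S) ∧
      (¬ True → (forkOf m c).fstOut ∈ S → (forkOf m c).fstIn ∈ S) then
      (D.crossings.map fun x => T (2 * if x.overIn ∈ S ∧ x.overOut ∈ S ∧
      x.underIn ∈ S ∧ x.underOut ∈ S then x.sign else 0)).prod *
      (D.crossings.map fun c => forkWeight (fun x y => T (-modelSign m * halfTurns x y) *
        D.stepWeight m x y) S (forkOf m c)).prod else 0 := by
  rw [← prod_map_mul_list, ← prod_map_ite]
  refine congrArg List.prod (List.map_congr_left fun c hc => ?_)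
  obtain ⟨s1, s2, s3⟩ := stepWeight_fork h m hc
  rw [crossWeight_eq S s1 s2 s3, if_congr (forkOf_forall m c fun p => p ∈ S) rfl rfl]

open Classical in
/-- The sum over the simple families of the random walk as a state sum. -/
theorem walkSum_eq (m : Model) :
    1 + ∑ c ∈ D.simpleFamilies m, tPow (modelSign m * rotFamily c - beta c) * weight m c =
    ∑ S ∈ D.points.powerset,
      if ∀ p ∈ S, p ∈ insOf D.links D.crossings ∧ p ∈ outsOf D.links D.crossings then
        (D.links.map (linkWeight (-modelSign m) (memLabel S))).prod *
        (D.crossings.map fun c =>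
          crossWeight (-modelSign m) (memLabel S) c.sign (forkOf m c)).prod else 0 := by
  have hi := nodup_forkIns h (forkOf_ins m)
  have ho := nodup_forkOuts h (forkOf_outs m)
  have hd := fun x y => dirStep_of_forkStep (D := D) (J := True) (g := forkOf m) (x := x) (y := y)
    (fun c hc => forkOf_dirStep m hc)
  rw [sum_simpleFamilies, sum_families hi ho hd (D.stepWeight m) (-modelSign m) (fun S => T (2 * (D.crossings.map
    fun x => if x.overIn ∈ S ∧ x.overOut ∈ S ∧ x.underIn ∈ S ∧ x.underOut ∈ S
    then x.sign else 0).sum)) (fun c => T (2 * beta c)) (fun σ => by simp only [beta, visits_familyOf])]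
  refine Finset.sum_congr rfl fun S _ => ?_
  have e3 : (∀ p ∈ S, p ∈ forkIns D.links (D.crossings.map (forkOf m)) ∧
      p ∈ forkOuts D.links (D.crossings.map (forkOf m))) ↔
      ∀ p ∈ S, p ∈ insOf D.links D.crossings ∧ p ∈ outsOf D.links D.crossings := by
    simp only [(forkIns_map D.links D.crossings (forkOf_ins m)).mem_iff,
      (forkOuts_map D.links D.crossings (forkOf_outs m)).mem_iff]
  have e4 : ∀ l : List Crossing, (T (2 * (l.map fun x => if x.overIn ∈ S ∧ x.overOut ∈ S ∧
      x.underIn ∈ S ∧ x.underOut ∈ S then x.sign else 0).sum) : ℤ[T;T⁻¹]) =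
      (l.map fun x => T (2 * if x.overIn ∈ S ∧ x.overOut ∈ S ∧
      x.underIn ∈ S ∧ x.underOut ∈ S then x.sign else 0)).prod := by
    intro l
    induction l with
    | nil => simp
    | cons c l ih => rw [List.map_cons, List.sum_cons, List.map_cons, List.prod_cons, mul_add,
        T_add, ih]
  rw [if_congr (and_congr_left' e3) rfl rfl, ite_and]
  refine if_congr Iff.rfl ?_ rfl
  rw [e4, prod_linkWeight_eq h, prod_crossWeight_eq h, List.map_map]
  simp only [ForkGood, List.forall_mem_map]
  split_ifs with h1 h2 h3 h3
  · exact mul_left_comm _ _ _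
  · exact absurd h1.2 h3
  · exact absurd h1.1 h2
  · exact absurd h1.1 h2
  · exact absurd ⟨‹_›, ‹_›⟩ h1
  · rw [mul_zero]
  · rw [zero_mul]
  · rw [zero_mul]

open Classical in
/-- The sum over the families of circles of the smoothed diagram as a state sum. -/
theorem smoothSum_eq (e : ℤ) :
    ∑ c ∈ Finset.univ.filter (IsFamily fun x y : D.Point => D.SmoothedStep x.1 y.1),
      (T (e * (2 * rotFamily c)) : ℤ[T;T⁻¹]) =
    ∑ S ∈ D.points.powerset,
      if ∀ p ∈ S, p ∈ insOf D.links D.crossings ∧ p ∈ outsOf D.links D.crossings then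
        (D.links.map (linkWeight e (memLabel S))).prod *
        (D.crossings.map fun c => linkWeight e (memLabel S) (c.overIn, c.underOut) *
          linkWeight e (memLabel S) (c.underIn, c.overOut)).prod else 0 := by
  have hi := nodup_forkIns h smoothFork_ins
  have ho := nodup_forkOuts h smoothFork_outs
  have hd := fun x y => dirStep_of_forkStep (D := D) (J := False) (g := smoothFork) (x := x) (y := y)
    (fun c hc => smoothFork_dirStep hc)
  have hr : (fun x y : D.Point => D.SmoothedStep x.1 y.1) = fun x y : D.Point =>
      ForkStep D.links (D.crossings.map smoothFork) False x.1 y.1 := by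
    funext x y
    exact propext (smoothedStep_iff x.1 y.1)
  have e1 := sum_families (D := D) hi ho hd (fun _ _ => 1) e (fun _ => 1) (fun _ => 1) fun _ => rfl
  simp only [one_mul, mul_one, dite_eq_ite, ite_self, Finset.prod_const_one] at e1
  rw [hr, e1]
  refine Finset.sum_congr rfl fun S _ => ?_
  have e3 : (∀ p ∈ S, p ∈ forkIns D.links (D.crossings.map smoothFork) ∧
      p ∈ forkOuts D.links (D.crossings.map smoothFork)) ↔
      ∀ p ∈ S, p ∈ insOf D.links D.crossings ∧ p ∈ outsOf D.links D.crossings := by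
    simp only [(forkIns_map D.links D.crossings smoothFork_ins).mem_iff,
      (forkOuts_map D.links D.crossings smoothFork_outs).mem_iff]
  rw [if_congr (and_congr_left' e3) rfl rfl, ite_and]
  refine if_congr Iff.rfl ?_ rfl
  have e5 : (D.links.map (linkWeight e (memLabel S))).prod = if ∀ z ∈ D.links,
      (z.1 ∈ S ↔ z.2 ∈ S) then (D.links.map fun z => if z.1 ∈ S then
        T (e * halfTurns z.1 z.2) else 1).prod else 0 := by
    rw [← prod_map_ite]
    refine congrArg List.prod (List.map_congr_left fun z hz => ?_)
    rw [linkWeight]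
    simp [memLabel]
  have e6 : (D.crossings.map fun c => linkWeight e (memLabel S) (c.overIn, c.underOut) *
      linkWeight e (memLabel S) (c.underIn, c.overOut)).prod = if ∀ c ∈ D.crossings,
      ((smoothFork c).fstIn ∈ S ∧ (smoothFork c).sndIn ∈ S ↔
        (smoothFork c).fstOut ∈ S ∧ (smoothFork c).sndOut ∈ S) ∧
      ((smoothFork c).fstIn ∈ S ∨ (smoothFork c).sndIn ∈ S ↔
        (smoothFork c).fstOut ∈ S ∨ (smoothFork c).sndOut ∈ S) ∧
      ((smoothFork c).fstIn ∈ S → (smoothFork c).fstOut ∈ S) ∧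
      (¬ False → (smoothFork c).fstOut ∈ S → (smoothFork c).fstIn ∈ S) then
      (D.crossings.map fun c => forkWeight (fun x y => T (e * halfTurns x y))
        S (smoothFork c)).prod else 0 := by
    rw [← prod_map_ite]
    refine congrArg List.prod (List.map_congr_left fun c hc => ?_)
    simp only [forkWeight, linkWeight, smoothFork, ← memLabel_eq_true]
    generalize memLabel S c.overIn = b1, memLabel S c.underOut = b2, memLabel S c.underIn = b3,
      memLabel S c.overOut = b4
    cases b1 <;> cases b2 <;> cases b3 <;> cases b4 <;>
    simp only [Bool.false_eq_true, and_self, and_true, and_false, or_self, or_true, or_false,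
      iff_self, iff_true, iff_false, not_true, not_false_eq_true, implies_true,
      if_true, if_false, mul_zero, one_mul, mul_one, forall_const, imp_false,
      reduceCtorEq, zero_mul]
  rw [e5, e6, List.map_map]
  simp only [ForkGood, List.forall_mem_map, ite_and]
  split_ifs <;> simp [Function.comp_def]

end Walk

end

section
open Diagram

/-! ### The gauge transformation between the random walk and the Jones polynomial -/

/-- The unit `-q`. -/
noncomputable def negT : ℤ[T;T⁻¹]ˣ where
  val := -T 1
  inv := -T (-1)
  val_inv := by rw [neg_mul_neg, ← T_add]; simp
  inv_val := by rw [neg_mul_neg, ← T_add]; simp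

/-- The labels of the points that correspond to the visited points in the two models. -/
def visited (m : Model) (h : Pt → Bool) (p : Pt) : Bool :=
  match m with
  | .up => h p == p.2.2
  | .down => h p != p.2.2

def dirSign (d : Bool) : ℤ := if d then 1 else -1

/-- The flux of the visited strands in a word of pairs (visited, direction). -/
def fluxVisited : List (Bool × Bool) → ℤ
  | [] => 0
  | (v, d) :: l => (if v then dirSign d else 0) + fluxVisited l

/-- The flux of the strands that are not visited. -/
def fluxRest : List (Bool × Bool) → ℤ
  | [] => 0
  | (v, d) :: l => (if v then 0 else dirSign d) + fluxRest l

/-- The exponent of the gauge factor of a line. -/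
def gaugeExp : List (Bool × Bool) → ℤ
  | [] => 0
  | (v, d) :: l => (if v then dirSign d * fluxRest l else 0) + gaugeExp l

theorem fluxVisited_append (l l' : List (Bool × Bool)) :
    fluxVisited (l ++ l') = fluxVisited l + fluxVisited l' := by
  induction l with
  | nil => simp [fluxVisited]
  | cons x l ih => obtain ⟨v, d⟩ := x; simp only [List.cons_append, fluxVisited, ih, add_assoc]

theorem fluxRest_append (l l' : List (Bool × Bool)) :
    fluxRest (l ++ l') = fluxRest l + fluxRest l' := by
  induction l with
  | nil => simp [fluxRest]
  | cons x l ih => obtain ⟨v, d⟩ := x; simp only [List.cons_append, fluxRest, ih, add_assoc]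

/-- The exponent counts, with signs, the pairs of a visited strand to the left of one that is not
visited. Pairs split between the two halves enter only through the fluxes, which makes the gauge
factor local. -/
theorem gaugeExp_append (l l' : List (Bool × Bool)) :
    gaugeExp (l ++ l') = gaugeExp l + gaugeExp l' + fluxVisited l * fluxRest l' := by
  induction l with
  | nil => simp [gaugeExp, fluxVisited]
  | cons x l ih =>
    obtain ⟨v, d⟩ := x
    cases v <;> simp only [List.cons_append, gaugeExp, fluxVisited, ih, fluxRest_append,
      Bool.false_eq_true, if_true, if_false] <;> ring

/-- The pairs (visited, direction) along a part of a line. -/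
def visitedLine (m : Model) (h : Pt → Bool) (k j : ℕ) (a : List Bool) : List (Bool × Bool) :=
  (linePts k j a).map fun p => (visited m h p, p.2.2)

theorem visitedLine_append (m : Model) (h : Pt → Bool) (k j : ℕ) (a b : List Bool) :
    visitedLine m h k j (a ++ b) = visitedLine m h k j a ++ visitedLine m h k (j + a.length) b := by
  simp [visitedLine, linePts_append]

/-- The exponent by which the weights of a layer in the random walk and in the Jones polynomial
differ, apart from the gauge factors. -/
def layerShift (m : Model) (L : Layer) : ℤ :=
  match m, L.piece with
  | .up, .cup o => if o then 0 else -1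
  | .down, .cup o => if o then -1 else 0
  | .up, .cap o => if o then 1 else 0
  | .down, .cap o => if o then 0 else 1
  | _, .cross _ _ _ => 0

/-- The weight of the piece of a layer in the random walk. -/
noncomputable def pieceWalk (m : Model) (L : Layer) (k : ℕ) (g : Pt → Bool) : ℤ[T;T⁻¹] :=
  ((L.pieceLinks k).map (linkWeight (-modelSign m) g)).prod *
    ((L.crossings k).map fun c =>
      crossWeight (-modelSign m) g c.sign (forkOf m c) * T (-c.sign)).prod

theorem halfTurns_up (k i j : ℕ) (a b : Bool) : halfTurns (k, i, a) (k + 1, j, b) = 0 := by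
  simp [halfTurns]

theorem halfTurns_down (k i j : ℕ) (a b : Bool) : halfTurns (k + 1, i, a) (k, j, b) = 0 := by
  simp [halfTurns]

theorem halfTurns_right (k i : ℕ) (a b : Bool) :
    halfTurns (k, i, a) (k, i + 1, b) = if a then -1 else 1 := by
  simp [halfTurns]

theorem halfTurns_left (k i : ℕ) (a b : Bool) :
    halfTurns (k, i + 1, a) (k, i, b) = if a then 1 else -1 := by
  cases a <;> simp [halfTurns]

theorem gaugeExp_pair (v d v' d' : Bool) : gaugeExp [(v, d), (v', d')] =
    if v && !v' then dirSign d * dirSign d' else 0 := by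
  cases v <;> cases v' <;> simp [gaugeExp, fluxRest]

theorem negT_zpow_one : ((negT ^ (1 : ℤ) : ℤ[T;T⁻¹]ˣ) : ℤ[T;T⁻¹]) = -T 1 := by
  rw [zpow_one]; rfl

theorem negT_zpow_neg_one : ((negT ^ (-1 : ℤ) : ℤ[T;T⁻¹]ˣ) : ℤ[T;T⁻¹]) = -T (-1) := by
  rw [zpow_neg_one]; rfl

theorem negT_zpow_zero : ((negT ^ (0 : ℤ) : ℤ[T;T⁻¹]ˣ) : ℤ[T;T⁻¹]) = 1 := by
  rw [zpow_zero]; rfl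

/-- A finite verification over two models, eight kinds of crossing and sixteen spin states. Where
the weights do not vanish the fluxes are preserved, and the off-diagonal entries differ only by
powers of -q, accounted for by the change of `gaugeExp`. -/
theorem pieceWalk_cross (m : Model) (l r : List Bool) (a b f : Bool) (k : ℕ) (h : Pt → Bool) :
    ((fluxVisited (visitedLine m h (k + 1) l.length [b, a]) =
        fluxVisited (visitedLine m h k l.length [a, b]) ∧
      fluxRest (visitedLine m h (k + 1) l.length [b, a]) =
        fluxRest (visitedLine m h k l.length [a, b])) ∧
      pieceWalk m ⟨l, .cross a b f, r⟩ k (visited m h) *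
        ((negT ^ (modelSign m * gaugeExp (visitedLine m h (k + 1) l.length [b, a])) :
          ℤ[T;T⁻¹]ˣ) : ℤ[T;T⁻¹]) =
      Piece.kern (jonesCoef ⟨l, .cross a b f, r⟩) k l.length h (.cross a b f) *
        ((negT ^ (modelSign m * gaugeExp (visitedLine m h k l.length [a, b])) :
          ℤ[T;T⁻¹]ˣ) : ℤ[T;T⁻¹])) ∨
    (pieceWalk m ⟨l, .cross a b f, r⟩ k (visited m h) = 0 ∧
      Piece.kern (jonesCoef ⟨l, .cross a b f, r⟩) k l.length h (.cross a b f) = 0) := by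
  cases m <;> cases a <;> cases b <;> cases f <;>
    simp only [pieceWalk, Layer.pieceLinks, Layer.crossings, visitedLine, linePts_cons, linePts_nil,
      visited, orient, forkOf, List.map_cons, List.map_nil, List.prod_cons, List.prod_nil, one_mul,
      mul_one, Bool.false_eq_true, if_true, if_false, crossWeight, Piece.kern, jonesCoef] <;>
    generalize h (k, l.length, _) = b1, h (k, l.length + 1, _) = b2,
      h (k + 1, l.length, _) = b3, h (k + 1, l.length + 1, _) = b4 <;>
    cases b1 <;> cases b2 <;> cases b3 <;> cases b4 <;>
    simp only [beq_self_eq_true, Bool.beq_eq_decide_eq, decide_false, bne, Bool.not_true,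
      Bool.not_false, Crossing.sign, if_true, if_false, Bool.false_eq_true, modelSign, halfTurns_up,
      halfTurns_down, halfTurns_right, halfTurns_left, sortCoefs, capCoef, cupCoef, and_self,
      and_true, and_false, gaugeExp_pair, fluxVisited, fluxRest, dirSign, mul_zero, mul_one, zero_mul,
      one_mul, add_zero, zero_add, T_zero, tPow, neg_neg, mul_neg, neg_mul, neg_zero,
      Bool.and_true, Bool.and_false, Bool.and_self, negT_zpow_one,
      negT_zpow_zero, negT_zpow_neg_one, true_and, or_true, true_or, reduceCtorEq, and_self,
      mul_sub, sub_mul, ← T_add, neg_add_cancel, add_neg_cancel]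
  all_goals
    left
    simp only [add_mul, neg_mul, ← T_add, Int.reduceAdd, Int.reduceNeg, T_zero]
    try ring

theorem linkWeight_eq_cond (e : ℤ) (g : Pt → Bool) (z : Pt × Pt) : linkWeight e g z =
    bif g z.1 == g z.2 then bif g z.1 then T (e * halfTurns z.1 z.2) else 1 else 0 := by
  unfold linkWeight
  cases g z.1 <;> cases g z.2 <;> rfl

/-- For minima and maxima the half-turn weights differ from the coefficients of the operators by a
monomial depending on model and direction alone, namely the one recorded in `layerShift`. -/
theorem pieceWalk_gauge (m : Model) (L : Layer) (k : ℕ) (h : Pt → Bool) :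
    ((fluxVisited (visitedLine m h (k + 1) L.left.length L.piece.cod) =
        fluxVisited (visitedLine m h k L.left.length L.piece.dom) ∧
      fluxRest (visitedLine m h (k + 1) L.left.length L.piece.cod) =
        fluxRest (visitedLine m h k L.left.length L.piece.dom)) ∧
      pieceWalk m L k (visited m h) *
        ((negT ^ (modelSign m * gaugeExp (visitedLine m h (k + 1) L.left.length L.piece.cod)) :
          ℤ[T;T⁻¹]ˣ) : ℤ[T;T⁻¹]) =
      Piece.kern (jonesCoef L) k L.left.length h L.piece *
        ((negT ^ (modelSign m * gaugeExp (visitedLine m h k L.left.length L.piece.dom)) :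
          ℤ[T;T⁻¹]ˣ) : ℤ[T;T⁻¹]) * T (layerShift m L)) ∨
    (pieceWalk m L k (visited m h) = 0 ∧ Piece.kern (jonesCoef L) k L.left.length h L.piece = 0) := by
  obtain ⟨l, p, r⟩ := L
  rcases p with o | o | ⟨a, b, f⟩
  · cases m <;> cases o <;>
      simp only [pieceWalk, Layer.pieceLinks, Layer.crossings, visitedLine, linePts_cons, linePts_nil,
        visited, orient, List.map_cons, List.map_nil, List.prod_cons, List.prod_nil, Piece.dom,
        Piece.cod, mul_one, Bool.false_eq_true, if_true, if_false, Piece.kern,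
        linkWeight_eq_cond, Bool.not_true, Bool.not_false] <;>
      generalize h (k + 1, l.length, _) = b1, h (k + 1, l.length + 1, _) = b2 <;>
      cases b1 <;> cases b2 <;>
      simp only [beq_self_eq_true, cond_true, cond_false, Bool.beq_eq_decide_eq, decide_false, bne,
        Bool.not_true, Bool.not_false, if_true, if_false, Bool.false_eq_true, modelSign,
        halfTurns_right, halfTurns_left, cupCoef, and_self, and_true, and_false,
        fluxVisited, fluxRest, dirSign, mul_zero, mul_one, zero_mul, one_mul, add_zero, zero_add,
        neg_neg, mul_neg,
        gaugeExp, layerShift, negT_zpow_zero,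
        or_true, true_or, reduceCtorEq, neg_add_cancel, add_neg_cancel, T_zero, ← T_add]
  · cases m <;> cases o <;>
      simp only [pieceWalk, Layer.pieceLinks, Layer.crossings, visitedLine, linePts_cons, linePts_nil,
        visited, orient, List.map_cons, List.map_nil, List.prod_cons, List.prod_nil, Piece.dom,
        Piece.cod, mul_one, Bool.false_eq_true, if_true, if_false, Piece.kern,
        linkWeight_eq_cond, Bool.not_true, Bool.not_false] <;>
      generalize h (k, l.length, _) = b1, h (k, l.length + 1, _) = b2 <;>
      cases b1 <;> cases b2 <;>
      simp only [beq_self_eq_true, cond_true, cond_false, Bool.beq_eq_decide_eq, decide_false, bne,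
        Bool.not_true, Bool.not_false, if_true, if_false, Bool.false_eq_true, modelSign,
        halfTurns_right, halfTurns_left, capCoef, and_self, and_true, and_false,
        fluxVisited, fluxRest, dirSign, mul_zero, mul_one, zero_mul, one_mul, add_zero, zero_add,
        neg_neg, mul_neg,
        gaugeExp, layerShift, negT_zpow_zero,
        or_true, true_or, reduceCtorEq, neg_add_cancel, add_neg_cancel, T_zero, ← T_add]
  · have := pieceWalk_cross m l r a b f k h
    have e : layerShift m ⟨l, .cross a b f, r⟩ = 0 := by cases m <;> rfl
    rw [e, T_zero, mul_one]
    exact this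

end

section
open Diagram

/-! ### State sums of tangles as matrix elements -/

theorem visited_visited (m : Model) (h : Pt → Bool) (p : Pt) :
    visited m (visited m h) p = h p := by
  cases m <;> simp only [visited] <;> cases h p <;> cases p.2.2 <;> rfl

theorem visited_eq_iff (m : Model) (h : Pt → Bool) {p p' : Pt} (e : p.2.2 = p'.2.2) :
    visited m h p = visited m h p' ↔ h p = h p' := by
  cases m <;> simp only [visited, e] <;> cases h p <;> cases h p' <;> cases p'.2.2 <;> decide

/-- The label of an unvisited point on an upward strand. -/
def restLabel : Model → Bool
  | .up => false
  | .down => true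

theorem visited_eq_false_iff (m : Model) (h : Pt → Bool) {p : Pt} (e : p.2.2 = true) :
    visited m h p = false ↔ h p = restLabel m := by
  cases m <;> simp only [visited, e, restLabel] <;> cases h p <;> decide

theorem lineWord_visited_eq_iff (m : Model) (h : Pt → Bool) (k j j' : ℕ) (a : List Bool) :
    lineWord (visited m h) k j a = lineWord (visited m h) (k + 1) j' a ↔
      lineWord h k j a = lineWord h (k + 1) j' a := by
  rw [← forall_vert_iff, ← forall_vert_iff]
  exact forall₂_congr fun z hz => visited_eq_iff m h (fst_ne_of_mem_vert hz).2

theorem prod_linkWeight_vert (e : ℤ) (g : Pt → Bool) (k j j' : ℕ) (a : List Bool) :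
    ((vert k j j' a).map (linkWeight e g)).prod =
      if lineWord g k j a = lineWord g (k + 1) j' a then 1 else 0 := by
  classical
  have h : ∀ z ∈ vert k j j' a, linkWeight e g z = if g z.1 = g z.2 then 1 else 0 := by
    intro z hz
    simp only [linkWeight, halfTurns, if_pos (fst_ne_of_mem_vert hz).1, mul_zero, T_zero, ite_self]
  rw [List.map_congr_left h, prod_map_ite]
  simp only [forall_vert_iff, List.map_const', List.prod_replicate, one_pow]

theorem visitedLine_congr (m : Model) {h : Pt → Bool} {k k' j j' : ℕ} {a : List Bool}
    (e : lineWord h k j a = lineWord h k' j' a) :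
    visitedLine m h k j a = visitedLine m h k' j' a := by
  induction a generalizing j j' with
  | nil => rfl
  | cons o a ih =>
    rw [lineWord_cons, lineWord_cons, List.cons.injEq] at e
    simp only [visitedLine, linePts_cons, List.map_cons, List.cons.injEq]
    exact ⟨by cases m <;> simp [visited, e.1], ih e.2⟩

/-- The weight of a list of strands and crossings. -/
noncomputable def stateProd (e : ℤ) (f : (Pt → Bool) → Crossing → ℤ[T;T⁻¹])
    (ls : List (Pt × Pt)) (cs : List Crossing) (g : Pt → Bool) : ℤ[T;T⁻¹] :=
  (ls.map (linkWeight e g)).prod * (cs.map (f g)).prod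

theorem stateProd_append (e : ℤ) (f : (Pt → Bool) → Crossing → ℤ[T;T⁻¹])
    (ls ls' : List (Pt × Pt)) (cs cs' : List Crossing) (g : Pt → Bool) :
    stateProd e f (ls ++ ls') (cs ++ cs') g = stateProd e f ls cs g * stateProd e f ls' cs' g := by
  simp only [stateProd, List.map_append, List.prod_append]
  exact mul_mul_mul_comm ..

theorem Layer.stateProd_eq (e : ℤ) (f : (Pt → Bool) → Crossing → ℤ[T;T⁻¹]) (m : Model) (L : Layer)
    (k : ℕ) (h : Pt → Bool) : stateProd e f (L.links k) (L.crossings k) (visited m h) =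
      if L.Sides k h then stateProd e f (L.pieceLinks k) (L.crossings k) (visited m h) else 0 := by
  rw [L.links_eq, stateProd, List.map_append, List.map_append, List.prod_append, List.prod_append,
    prod_linkWeight_vert, prod_linkWeight_vert]
  simp only [lineWord_visited_eq_iff, Layer.Sides, stateProd]
  by_cases h1 : lineWord h k 0 L.left = lineWord h (k + 1) 0 L.left
  · simp only [h1, true_and, if_true, one_mul]
    split_ifs <;> simp only [one_mul, zero_mul]
  · simp only [h1, false_and, if_false, zero_mul]

/-- The gauge factor of a line. -/
noncomputable def gauge (n : ℤ) (m : Model) (h : Pt → Bool) (k j : ℕ) (a : List Bool) : ℤ[T;T⁻¹] :=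
  ((negT ^ (n * gaugeExp (visitedLine m h k j a)) : ℤ[T;T⁻¹]ˣ) : ℤ[T;T⁻¹])

/-- The weights of strands and crossings agree, up to a gauge transformation and an exponent for
each layer, with the matrix elements of operators. -/
def IsGauge (e : ℤ) (f : (Pt → Bool) → Crossing → ℤ[T;T⁻¹]) (m : Model) (n : ℤ)
    (X : Layer → ℤ[T;T⁻¹] × ℤ[T;T⁻¹]) : Prop :=
  ∀ (L : Layer) (k : ℕ) (h : Pt → Bool),
    ((fluxVisited (visitedLine m h (k + 1) L.left.length L.piece.cod) =
        fluxVisited (visitedLine m h k L.left.length L.piece.dom) ∧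
      fluxRest (visitedLine m h (k + 1) L.left.length L.piece.cod) =
        fluxRest (visitedLine m h k L.left.length L.piece.dom)) ∧
      stateProd e f (L.pieceLinks k) (L.crossings k) (visited m h) *
        gauge n m h (k + 1) L.left.length L.piece.cod =
      Piece.kern (X L) k L.left.length h L.piece *
        gauge n m h k L.left.length L.piece.dom * T (layerShift m L)) ∨
    (stateProd e f (L.pieceLinks k) (L.crossings k) (visited m h) = 0 ∧
      Piece.kern (X L) k L.left.length h L.piece = 0)

variable {e : ℤ} {f : (Pt → Bool) → Crossing → ℤ[T;T⁻¹]} {m : Model} {n : ℤ}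
  {X : Layer → ℤ[T;T⁻¹] × ℤ[T;T⁻¹]}

/-- The strands beside the piece keep their labels and see the piece only through its two fluxes,
which it preserves. So the gauge exponent of the full line changes by that of the piece. -/
theorem IsGauge.layer (H : IsGauge e f m n X) (L : Layer) (k : ℕ) (h : Pt → Bool) :
    stateProd e f (L.links k) (L.crossings k) (visited m h) * gauge n m h (k + 1) 0 L.cod =
      (if L.Sides k h then L.piece.kern (X L) k L.left.length h else 0) *
        gauge n m h k 0 L.dom * T (layerShift m L) := by
  rw [L.stateProd_eq]
  by_cases hs : L.Sides k h
  · rw [if_pos hs, if_pos hs]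
    rcases H L k h with ⟨⟨h1, h2⟩, h3⟩ | ⟨h1, h2⟩
    · have e1 := visitedLine_congr m hs.1
      have e2 := visitedLine_congr m hs.2
      have key : ∃ r : ℤ, gaugeExp (visitedLine m h (k + 1) 0 L.cod) =
          r + gaugeExp (visitedLine m h (k + 1) L.left.length L.piece.cod) ∧
          gaugeExp (visitedLine m h k 0 L.dom) =
          r + gaugeExp (visitedLine m h k L.left.length L.piece.dom) := by
        refine ⟨gaugeExp (visitedLine m h (k + 1) 0 L.cod) -
          gaugeExp (visitedLine m h (k + 1) L.left.length L.piece.cod), by ring, ?_⟩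
        simp only [Layer.cod, Layer.dom, visitedLine_append, gaugeExp_append, fluxVisited_append,
          List.length_append, zero_add, h1, h2, e1, e2]
        ring
      obtain ⟨r, hr1, hr2⟩ := key
      simp only [gauge] at h3 ⊢
      rw [hr1, hr2, mul_add, mul_add, zpow_add, zpow_add, Units.val_mul, Units.val_mul,
        mul_left_comm, h3]
      ring
    · rw [h1, h2, zero_mul, zero_mul, zero_mul]
  · rw [if_neg hs, if_neg hs, zero_mul, zero_mul, zero_mul]

/-- Telescoping: the gauge factor of each intermediate line occurs once on either side and cancels.
-/
theorem IsGauge.layers (H : IsGauge e f m n X) {a b : List Bool} {Ls : List Layer}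
    (hL : Composable a Ls b) (k : ℕ) (h : Pt → Bool) :
    stateProd e f (linksFrom k Ls) (crossingsFrom k Ls) (visited m h) *
        gauge n m h (k + Ls.length) 0 b =
      layersWeight h k (Ls.map X) Ls * gauge n m h k 0 a * T (Ls.map (layerShift m)).sum := by
  induction Ls generalizing a k with
  | nil =>
    obtain rfl : a = b := hL
    simp [stateProd, linksFrom, crossingsFrom, layersWeight]
  | cons L Ls ih =>
    obtain ⟨rfl, hL⟩ := hL
    have h1 := ih hL (k + 1)
    rw [show k + 1 + Ls.length = k + (L :: Ls).length by simp only [List.length_cons]; omega] at h1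
    rw [linksFrom_cons, crossingsFrom_cons, stateProd_append, mul_assoc, h1, List.map_cons,
      layersWeight, List.map_cons, List.sum_cons, T_add, mul_assoc _ (gauge _ _ _ _ _ _),
      mul_left_comm, ← mul_assoc (stateProd _ _ _ _ _), H.layer]
    ring

theorem dir_of_mem_linePts {k j d : ℕ} {p : Pt} (hp : p ∈ linePts k j (List.replicate d true)) :
    p.2.2 = true := by
  obtain ⟨y, hy, rfl⟩ := List.mem_map.mp hp
  exact List.eq_of_mem_replicate (List.fst_mem_of_mem_zipIdx hy)

theorem downs_linePts_replicate (k j d : ℕ) : downs (linePts k j (List.replicate d true)) = [] :=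
  List.filter_eq_nil_iff.mpr fun p hp => by rw [dir_of_mem_linePts hp]; decide

theorem ups_linePts_replicate (k j d : ℕ) : ups (linePts k j (List.replicate d true)) =
    linePts k j (List.replicate d true) :=
  List.filter_eq_self.mpr fun p hp => by rw [dir_of_mem_linePts hp]

/-! ### The ends of a string link -/

section Boundary

variable {D : Diagram} {d d' : ℕ} (ha : D.bottom = List.replicate d true)
  (hL : Composable D.bottom D.layers (List.replicate d' true))
include ha hL

/-- All ends are directed upwards, so in `insOf_from` only the top line is missing from the sources;
for targets it is the bottom line. Closed cycles therefore avoid all ends. -/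
theorem mem_ins_iff {p : Pt} (hp : p ∈ D.points) : p ∈ insOf D.links D.crossings ↔
    p ∉ linePts D.layers.length 0 (List.replicate d' true) := by
  have h := insOf_from hL 0
  rw [zero_add, ups_linePts_replicate, ha, downs_linePts_replicate, ← ha, Multiset.coe_nil,
    add_zero] at h
  have hn := Multiset.coe_nodup.mpr (nodup_ptsFrom 0 (D.bottom :: D.layers.map Layer.cod))
  rw [← h] at hn
  rw [points_eq, List.mem_toFinset, ← Multiset.mem_coe, ← h, Multiset.mem_add] at hp
  have hd := (Multiset.nodup_add.mp hn).2.2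
  exact ⟨fun h1 h2 => Multiset.disjoint_left.mp hd h1 h2, fun h' => hp.resolve_right h'⟩

theorem mem_outs_iff {p : Pt} (hp : p ∈ D.points) : p ∈ outsOf D.links D.crossings ↔
    p ∉ linePts 0 0 D.bottom := by
  have h := outsOf_from hL 0
  rw [zero_add, downs_linePts_replicate, ha, ups_linePts_replicate, ← ha, Multiset.coe_nil,
    add_zero] at h
  have hn := Multiset.coe_nodup.mpr (nodup_ptsFrom 0 (D.bottom :: D.layers.map Layer.cod))
  rw [← h] at hn
  rw [points_eq, List.mem_toFinset, ← Multiset.mem_coe, ← h, Multiset.mem_add] at hp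
  have hd := (Multiset.nodup_add.mp hn).2.2
  exact ⟨fun h1 h2 => Multiset.disjoint_left.mp hd h1 h2, fun h' => hp.resolve_right h'⟩

theorem linePts_subset_points {p : Pt} (hp : p ∈ linePts 0 0 D.bottom ∨
    p ∈ linePts D.layers.length 0 (List.replicate d' true)) : p ∈ D.points := by
  rw [points_eq, List.mem_toFinset, ← Multiset.mem_coe]
  rcases hp with hp | hp
  · rw [← outsOf_from hL 0, Multiset.mem_add, ha, ups_linePts_replicate, ← ha]
    exact Or.inr hp
  · rw [← insOf_from hL 0, Multiset.mem_add, Multiset.mem_add, ups_linePts_replicate, zero_add]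
    exact Or.inl (Or.inr hp)

end Boundary

theorem lineWord_eq_replicate_iff (g : Pt → Bool) (k j : ℕ) (a : List Bool) (c : Bool) :
    lineWord g k j a = List.replicate a.length c ↔ ∀ p ∈ linePts k j a, g p = c := by
  rw [List.eq_replicate_iff, length_lineWord]
  simp only [lineWord, List.forall_mem_map, true_and]

theorem gauge_eq_one {h : Pt → Bool} {k j : ℕ} {a : List Bool}
    (H : ∀ p ∈ linePts k j a, visited m h p = false) : gauge n m h k j a = 1 := by
  have : ∀ l : List (Bool × Bool), (∀ x ∈ l, x.1 = false) → gaugeExp l = 0 := by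
    intro l
    induction l with
    | nil => intro _; rfl
    | cons x l ih =>
      intro hl
      obtain ⟨v, o⟩ := x
      have h1 : v = false := hl _ List.mem_cons_self
      rw [gaugeExp, ih fun x hx => hl x (List.mem_cons_of_mem _ hx), h1]
      rfl
  rw [gauge, this (visitedLine m h k j a) (List.forall_mem_map.mpr H), mul_zero, zpow_zero]
  rfl

open Classical in
/-- A state sum over sets of points off the ends is a matrix element of an operator. -/
theorem IsGauge.sum_eq (H : IsGauge e f m n X) {D : Diagram} {d : ℕ}
    (ha : D.bottom = List.replicate d true)
    (hL : Composable D.bottom D.layers (List.replicate d true))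
    (hf : ∀ g g' : Pt → Bool, (∀ p ∈ D.points, g p = g' p) → ∀ c ∈ D.crossings, f g c = f g' c) :
    (∑ S ∈ D.points.powerset, if ∀ p ∈ S, p ∈ insOf D.links D.crossings ∧
        p ∈ outsOf D.links D.crossings then stateProd e f D.links D.crossings (memLabel S) else 0) =
      opList (gensOf (D.layers.map X) D.layers) (basisVec (List.replicate d (restLabel m)))
        (List.replicate d (restLabel m)) * T (D.layers.map (layerShift m)).sum := by
  have hw : List.replicate d (restLabel m) ∈ words (List.replicate d true).length := by
    rw [mem_words]; simp
  have h1 := sum_layersWeight hL (Xs := D.layers.map X) (by simp)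
    (basisVec (List.replicate d (restLabel m))) (v := basisVec (List.replicate d (restLabel m)))
    (by rw [ha]; simpa using basisVec_mem_homog (List.replicate d (restLabel m)))
  rw [Finset.sum_eq_single_of_mem _ hw fun w _ hne => by rw [basisVec, if_neg hne, zero_mul],
    basisVec, if_pos rfl, one_mul] at h1
  rw [← h1, Finset.sum_mul]
  -- Translation between spins and visited points. It is an involution, so it reindexes the sum over
  -- all subsets.
  let φ : Finset Pt → Finset Pt := fun S => D.points.filter fun p => visited m (memLabel S) p = true
  have hφ : ∀ S, ∀ p ∈ D.points, memLabel (φ S) p = visited m (memLabel S) p := by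
    intro S p hp
    simp only [φ, memLabel, Finset.mem_filter, hp, true_and]
    cases visited m (memLabel S) p <;> simp
  have hφφ : ∀ S ∈ D.points.powerset, φ (φ S) = S := by
    intro S hS
    ext p
    by_cases hp : p ∈ D.points
    · have : memLabel (φ (φ S)) p = memLabel S p := by
        rw [hφ _ p hp, ← visited_visited m (memLabel S) p]
        have := hφ S p hp
        cases m <;> simp only [visited] at this ⊢ <;> rw [this]
      simpa [memLabel] using this
    · exact iff_of_false (fun h => hp (Finset.mem_filter.mp h).1)
        fun h => hp (Finset.mem_powerset.mp hS h)
  have hφm : ∀ S, φ S ∈ D.points.powerset := fun S =>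
    Finset.mem_powerset.mpr (Finset.filter_subset _ _)
  refine Finset.sum_nbij' φ φ (fun S _ => hφm S) (fun S _ => hφm S) hφφ hφφ fun S hS => ?_
  have hS' : ∀ p ∈ D.points, memLabel S p = visited m (memLabel (φ S)) p := fun p hp => by
    rw [← hφ _ p hp, hφφ S hS]
  have hup : ∀ (k d : ℕ), ∀ p ∈ linePts k 0 (List.replicate d true), p.2.2 = true :=
    fun k d p hp => dir_of_mem_linePts hp
  have hw1 := lineWord_eq_replicate_iff (memLabel (φ S)) 0 0 D.bottom (restLabel m)
  have hw2 := lineWord_eq_replicate_iff (memLabel (φ S)) D.layers.length 0 (List.replicate d true)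
    (restLabel m)
  rw [List.length_replicate] at hw2
  rw [show D.bottom.length = d by rw [ha, List.length_replicate]] at hw1
  have hv1 : ∀ p ∈ linePts 0 0 D.bottom,
      (visited m (memLabel (φ S)) p = false ↔ memLabel (φ S) p = restLabel m) := fun p hp =>
    visited_eq_false_iff m _ (hup 0 d p (ha ▸ hp))
  have hv2 : ∀ p ∈ linePts D.layers.length 0 (List.replicate d true),
      (visited m (memLabel (φ S)) p = false ↔ memLabel (φ S) p = restLabel m) := fun p hp =>
    visited_eq_false_iff m _ (hup _ d p hp)
  -- Avoiding the ends means that every end carries the spin of a strand that is not visited, so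
  -- both boundary words are the constant word.
  have hcond : (∀ p ∈ S, p ∈ insOf D.links D.crossings ∧ p ∈ outsOf D.links D.crossings) ↔
      lineWord (memLabel (φ S)) 0 0 D.bottom = List.replicate d (restLabel m) ∧
      lineWord (memLabel (φ S)) D.layers.length 0 (List.replicate d true) =
        List.replicate d (restLabel m) := by
    rw [hw1, hw2]
    constructor
    · intro h
      refine ⟨fun p hp => (hv1 p hp).mp ?_, fun p hp => (hv2 p hp).mp ?_⟩
      · have hpp := linePts_subset_points ha hL (Or.inl hp)
        rw [← hS' p hpp, memLabel, decide_eq_false_iff_not]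
        exact fun hpS => (mem_outs_iff ha hL hpp).mp (h p hpS).2 hp
      · have hpp := linePts_subset_points ha hL (Or.inr hp)
        rw [← hS' p hpp, memLabel, decide_eq_false_iff_not]
        exact fun hpS => (mem_ins_iff ha hL hpp).mp (h p hpS).1 hp
    · rintro ⟨h, h'⟩ p hpS
      have hpp := Finset.mem_powerset.mp hS hpS
      have ht : memLabel S p = true := by simpa [memLabel] using hpS
      rw [hS' p hpp] at ht
      rw [mem_ins_iff ha hL hpp, mem_outs_iff ha hL hpp]
      refine ⟨fun hp => ?_, fun hp => ?_⟩
      · rw [(hv2 p hp).mpr (h' p hp)] at ht; simp at ht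
      · rw [(hv1 p hp).mpr (h p hp)] at ht; simp at ht
  by_cases hc : ∀ p ∈ S, p ∈ insOf D.links D.crossings ∧ p ∈ outsOf D.links D.crossings
  · rw [if_pos hc]
    obtain ⟨c1, c2⟩ := hcond.mp hc
    rw [c1, c2, basisVec, if_pos rfl, one_mul, mul_one]
    have h2 := H.layers hL 0 (memLabel (φ S))
    rw [zero_add, gauge_eq_one fun p hp => (hv1 p hp).mpr (hw1.mp c1 p hp),
      gauge_eq_one fun p hp => (hv2 p hp).mpr (hw2.mp c2 p hp), mul_one, mul_one] at h2
    rw [← h2, ← Diagram.links_eq, ← Diagram.crossings_eq, stateProd, stateProd]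
    refine congrArg₂ _ (congrArg List.prod (List.map_congr_left fun z hz => ?_))
      (congrArg List.prod (List.map_congr_left fun c hc' => hf _ _ hS' c hc'))
    have := mem_points_of_mem_links hL hz
    simp only [linkWeight, hS' _ this.1, hS' _ this.2]
  · rw [if_neg hc]
    rw [hcond, not_and_or] at hc
    rcases hc with hc | hc
    · rw [basisVec, if_neg hc, zero_mul, zero_mul]
    · simp only [basisVec, if_neg hc, mul_zero, zero_mul]

end

section
open Diagram

/-! ### The random walk as a matrix element -/

theorem jonesCoef_isGauge (m : Model) : IsGauge (-modelSign m) (fun g c =>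
    crossWeight (-modelSign m) g c.sign (forkOf m c) * T (-c.sign)) m (modelSign m) jonesCoef :=
  pieceWalk_gauge m

/-- The coefficients of the oriented smoothing. -/
noncomputable def smoothCoef (L : Layer) : ℤ[T;T⁻¹] × ℤ[T;T⁻¹] :=
  match L.piece with
  | .cross a b _ => sortCoefs (a == b) 1 0
  | _ => (1, 0)

/-- Smoothed strands do not interact, so no gauge factor is needed (`n = 0`), while minima and
maxima contribute the same `layerShift` as for the walks. This is what makes the shift computable.
-/
theorem smoothCoef_isGauge (m : Model) : IsGauge (-modelSign m) (fun g c =>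
    linkWeight (-modelSign m) g (c.overIn, c.underOut) *
      linkWeight (-modelSign m) g (c.underIn, c.overOut)) m 0 smoothCoef := by
  rintro ⟨l, p, r⟩ k h
  rcases p with o | o | ⟨a, b, f⟩
  · cases m <;> cases o <;>
      simp only [stateProd, Layer.pieceLinks, Layer.crossings, visitedLine, linePts_cons, linePts_nil,
        visited, orient, List.map_cons, List.map_nil, List.prod_cons, List.prod_nil, Piece.dom,
        Piece.cod, mul_one, Bool.false_eq_true, if_true, if_false, Piece.kern, linkWeight_eq_cond,
        Bool.not_true, Bool.not_false, gauge, zero_mul, zpow_zero, Units.val_one] <;>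
      generalize h (k + 1, l.length, _) = b1, h (k + 1, l.length + 1, _) = b2 <;>
      cases b1 <;> cases b2 <;>
      simp only [beq_self_eq_true, cond_true, cond_false, Bool.beq_eq_decide_eq,
        decide_false, bne, Bool.not_true, Bool.not_false, if_true, if_false, Bool.false_eq_true,
        modelSign, halfTurns_right, halfTurns_left, cupCoef, and_self, and_true, and_false,
        fluxVisited, fluxRest, dirSign, mul_one, zero_mul, one_mul, add_zero, zero_add,
        neg_neg, mul_neg,
        layerShift, or_true, true_or, reduceCtorEq, neg_add_cancel,
        add_neg_cancel, T_zero, ← T_add]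
  · cases m <;> cases o <;>
      simp only [stateProd, Layer.pieceLinks, Layer.crossings, visitedLine, linePts_cons, linePts_nil,
        visited, orient, List.map_cons, List.map_nil, List.prod_cons, List.prod_nil, Piece.dom,
        Piece.cod, mul_one, Bool.false_eq_true, if_true, if_false, Piece.kern, linkWeight_eq_cond,
        Bool.not_true, Bool.not_false, gauge, zero_mul, zpow_zero, Units.val_one] <;>
      generalize h (k, l.length, _) = b1, h (k, l.length + 1, _) = b2 <;>
      cases b1 <;> cases b2 <;>
      simp only [beq_self_eq_true, cond_true, cond_false, Bool.beq_eq_decide_eq,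
        decide_false, bne, Bool.not_true, Bool.not_false, if_true, if_false, Bool.false_eq_true,
        modelSign, halfTurns_right, halfTurns_left, capCoef, and_self, and_true, and_false,
        fluxVisited, fluxRest, dirSign, mul_one, zero_mul, one_mul, add_zero, zero_add,
        neg_neg, mul_neg,
        layerShift, or_true, true_or, reduceCtorEq, neg_add_cancel,
        add_neg_cancel, T_zero, ← T_add]
  · cases m <;> cases a <;> cases b <;> cases f <;>
      simp only [stateProd, Layer.pieceLinks, Layer.crossings, visitedLine, linePts_cons, linePts_nil,
        visited, orient, List.map_cons, List.map_nil, List.prod_cons, List.prod_nil, one_mul,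
        mul_one, Bool.false_eq_true, if_true, if_false, linkWeight_eq_cond, Piece.kern, smoothCoef,
        gauge, zero_mul, zpow_zero, Units.val_one, Piece.dom, Piece.cod, layerShift, T_zero] <;>
      generalize h (k, l.length, _) = b1, h (k, l.length + 1, _) = b2,
        h (k + 1, l.length, _) = b3, h (k + 1, l.length + 1, _) = b4 <;>
      cases b1 <;> cases b2 <;> cases b3 <;> cases b4 <;>
      simp only [beq_self_eq_true, Bool.beq_eq_decide_eq, decide_false, bne,
        Bool.not_true, cond_true, cond_false,
        Bool.not_false, if_true, if_false, Bool.false_eq_true, modelSign, halfTurns_up,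
        halfTurns_down, halfTurns_right, halfTurns_left, sortCoefs, capCoef, cupCoef, and_self,
        and_true, and_false, fluxVisited, fluxRest, dirSign, mul_zero, mul_one, zero_mul,
        one_mul, add_zero, zero_add, T_zero, neg_neg, mul_neg,
        or_true, true_or, reduceCtorEq,
        neg_add_cancel, add_neg_cancel, ← T_add]

/-- The two models together give -1 for each minimum and +1 for each maximum. For equal numbers of
ends their shifts are opposite. -/
theorem sum_layerShift {a b : List Bool} {Ls : List Layer} (h : Composable a Ls b) :
    2 * ((Ls.map (layerShift .up)).sum + (Ls.map (layerShift .down)).sum) =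
      (a.length : ℤ) - b.length := by
  induction Ls generalizing a with
  | nil =>
    obtain rfl : a = b := h
    simp
  | cons L Ls ih =>
    obtain ⟨rfl, h⟩ := h
    have h1 := ih h
    have h2 : 2 * (layerShift .up L + layerShift .down L) = (L.dom.length : ℤ) - L.cod.length := by
      obtain ⟨l, p, r⟩ := L
      rcases p with (_ | _) | (_ | _) | _ <;>
        simp [layerShift, Layer.dom, Layer.cod, Piece.dom, Piece.cod] <;> ring
    simp only [List.map_cons, List.sum_cons]
    linarith

theorem T_list_sum {α : Type*} (l : List α) (f : α → ℤ) :
    (T (l.map f).sum : ℤ[T;T⁻¹]) = (l.map fun x => T (f x)).prod := by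
  induction l with
  | nil => simp
  | cons a l ih => rw [List.map_cons, List.sum_cons, T_add, ih, List.map_cons, List.prod_cons]

theorem crossWeight_congr {e ε : ℤ} {g g' : Pt → Bool} {c : Fork} (h1 : g c.fstIn = g' c.fstIn)
    (h2 : g c.fstOut = g' c.fstOut) (h3 : g c.sndIn = g' c.sndIn) (h4 : g c.sndOut = g' c.sndOut) :
    crossWeight e g ε c = crossWeight e g' ε c := by
  unfold crossWeight
  rw [h1, h2, h3, h4]

theorem linkWeight_congr {e : ℤ} {g g' : Pt → Bool} {z : Pt × Pt} (h1 : g z.1 = g' z.1)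
    (h2 : g z.2 = g' z.2) : linkWeight e g z = linkWeight e g' z := by
  unfold linkWeight
  rw [h1, h2]

section String

variable {D : Diagram} {d : ℕ} (ha : D.bottom = List.replicate d true)
  (hL : Composable D.bottom D.layers (List.replicate d true))
include ha hL

/-- The writhe appears because the Jones weights contain the factor `T (-c.sign)` at every crossing,
which the walk weights lack. -/
theorem walkSum_eq_jonesOp (m : Model) :
    1 + ∑ c ∈ D.simpleFamilies m, tPow (modelSign m * rotFamily c - beta c) * weight m c =
      T (D.writhe + (D.layers.map (layerShift m)).sum) *
        jonesOp D.layers (basisVec (List.replicate d (restLabel m)))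
          (List.replicate d (restLabel m)) := by
  classical
  have h1 := (jonesCoef_isGauge m).sum_eq ha hL fun g g' hg c hc => by
    obtain ⟨h1, h2, h3, h4⟩ := mem_points_of_mem_crossings hL hc
    rw [crossWeight_congr] <;> cases m <;> simp only [forkOf] <;> apply hg <;> assumption
  rw [walkSum_eq hL, T_add, mul_assoc, mul_comm (T (List.sum _)), jonesOp, ← h1, Finset.mul_sum]
  refine Finset.sum_congr rfl fun S _ => ?_
  split_ifs
  · rw [stateProd, prod_map_mul_list, ← T_list_sum, writhe]
    have : (T (D.crossings.map Crossing.sign).sum *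
        T (D.crossings.map fun c => -c.sign).sum : ℤ[T;T⁻¹]) = 1 := by
      rw [← T_add, ← List.sum_map_add]
      simp
    rw [mul_left_comm, mul_left_comm (T _), this, mul_one]
  · rw [mul_zero]

open Classical in
theorem smoothSum_eq_opList (m : Model) :
    ∑ c ∈ Finset.univ.filter (IsFamily fun x y : D.Point => D.SmoothedStep x.1 y.1),
      (T (-modelSign m * (2 * rotFamily c)) : ℤ[T;T⁻¹]) =
      opList (gensOf (D.layers.map smoothCoef) D.layers) (basisVec (List.replicate d (restLabel m)))
          (List.replicate d (restLabel m)) * T (D.layers.map (layerShift m)).sum := by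
  have h1 := (smoothCoef_isGauge m).sum_eq ha hL fun g g' hg c hc => by
    obtain ⟨h1, h2, h3, h4⟩ := mem_points_of_mem_crossings hL hc
    rw [linkWeight_congr (hg _ h1) (hg _ h4), linkWeight_congr (hg _ h3) (hg _ h2)]
  rw [← h1, smoothSum_eq hL]
  rfl

end String

theorem evalOne_ne {Z : ℤ[T;T⁻¹]} (h : evalOne Z ≠ 0) : Z ≠ 0 := by
  rintro rfl; simp at h

theorem T_injective : Function.Injective (T : ℤ → ℤ[T;T⁻¹]) :=
  fun a b h => by
  have h1 : (Finsupp.single a (1 : ℤ)) = Finsupp.single b 1 := congrArg AddMonoidAlgebra.coeff h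
  exact Finsupp.single_left_injective one_ne_zero h1

theorem eq_zero_of_T_mul_eq {n : ℤ} {Z : ℤ[T;T⁻¹]} (hZ : Z ≠ 0) (h : T n * Z = Z) : n = 0 := by
  have hd : NoZeroDivisors ℤ[T;T⁻¹] := inferInstanceAs (NoZeroDivisors (AddMonoidAlgebra ℤ ℤ))
  have h1 : (T n - T 0 : ℤ[T;T⁻¹]) * Z = 0 := by rw [sub_mul, h, T_zero, one_mul, sub_self]
  rcases eq_zero_or_eq_zero_of_mul_eq_zero h1 with h2 | h2
  · exact T_injective (sub_eq_zero.mp h2)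
  · exact absurd h2 hZ

section Families

variable {α : Type*} [Fintype α] [DecidableEq α] {r : α → α → Prop}

/-- If every point has at most one successor, two cycles through a common point follow the same
orbit. -/
theorem eq_of_chain (hr : ∀ x, ¬ r x x) (hu : ∀ x y y', r x y → r x y' → y = y')
    {γ γ' : {γ : Cycle α // γ.Nodup}} (h : γ.1 ≠ Cycle.nil ∧ γ.1.Chain r)
    (h' : γ'.1 ≠ Cycle.nil ∧ γ'.1.Chain r) {x : α} (hx : x ∈ γ.1) (hx' : x ∈ γ'.1) : γ = γ' := by
  have key : ∀ γ : {γ : Cycle α // γ.Nodup}, γ.1 ≠ Cycle.nil ∧ γ.1.Chain r → x ∈ γ.1 →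
      ∃ σ : Equiv.Perm α, (∀ x, σ x ≠ x → r x (σ x)) ∧ γ.1.formPerm γ.2 = σ.cycleOf x ∧ σ x ≠ x ∧
        γ.1.Nontrivial := by
    intro γ h hx
    have hf : IsFamily r {γ} := ⟨by simpa using h, by simp⟩
    obtain ⟨σ, h1, h2⟩ := hf.exists_perm hr
    have hm : γ ∈ familyOf σ := h2 ▸ Finset.mem_singleton_self γ
    refine ⟨σ, h1, formPerm_eq_cycleOf hm hx, ?_, (mem_familyOf.mp hm).1⟩
    exact Equiv.Perm.mem_support.mp ((exists_mem_familyOf_iff σ x).mp ⟨γ, hm, hx⟩)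
  obtain ⟨σ, h1, h2, h3, h4⟩ := key γ h hx
  obtain ⟨τ, h1', h2', h3', h4'⟩ := key γ' h' hx'
  have hpow : ∀ n : ℕ, (σ ^ n) x = (τ ^ n) x := by
    intro n
    induction n with
    | zero => rfl
    | succ n ih =>
      have e1 : σ ((σ ^ n) x) ≠ (σ ^ n) x := fun e => h3 (by
        rw [← Equiv.Perm.mul_apply, ← pow_succ', pow_succ, Equiv.Perm.mul_apply] at e
        exact (σ ^ n).injective e)
      have e2 : τ ((τ ^ n) x) ≠ (τ ^ n) x := fun e => h3' (by
        rw [← Equiv.Perm.mul_apply, ← pow_succ', pow_succ, Equiv.Perm.mul_apply] at e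
        exact (τ ^ n).injective e)
      rw [pow_succ', pow_succ', Equiv.Perm.mul_apply, Equiv.Perm.mul_apply]
      have := h1' _ e2
      rw [← ih] at this ⊢
      exact hu _ _ _ (h1 _ e1) this
  have hc : σ.cycleOf x = τ.cycleOf x := by
    ext y
    by_cases hy : σ.SameCycle x y
    · obtain ⟨n, -, -, rfl⟩ := hy.exists_pow_eq''
      have hy' : τ.SameCycle x ((σ ^ n) x) := by
        rw [hpow]; exact ⟨n, by simp⟩
      rw [hy.cycleOf_apply, hy'.cycleOf_apply, ← Equiv.Perm.mul_apply, ← pow_succ', hpow, hpow,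
        pow_succ', Equiv.Perm.mul_apply]
    · have hy' : ¬ τ.SameCycle x y := by
        intro h5
        obtain ⟨n, -, -, rfl⟩ := h5.exists_pow_eq''
        exact hy (by rw [← hpow]; exact ⟨n, by simp⟩)
      rw [Equiv.Perm.cycleOf_apply_of_not_sameCycle hy, Equiv.Perm.cycleOf_apply_of_not_sameCycle hy']
  have := (h2.trans hc).trans h2'.symm
  rcases Cycle.formPerm_eq_formPerm_iff.mp this with e | ⟨e, -⟩
  · exact Subtype.ext e
  · exact absurd e ((γ.2.nontrivial_iff).mp h4)

open Classical in
-- For a relation with unique successors disjointness is automatic, so families are arbitrary sets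
-- of circles.
theorem filter_isFamily_eq_powerset (hr : ∀ x, ¬ r x x) (hu : ∀ x y y', r x y → r x y' → y = y') :
    Finset.univ.filter (IsFamily r) =
      (Finset.univ.filter fun γ : {γ : Cycle α // γ.Nodup} => γ.1 ≠ Cycle.nil ∧ γ.1.Chain r).powerset := by
  ext c
  simp only [Finset.mem_filter, Finset.mem_univ, true_and, Finset.mem_powerset, IsFamily,
    Finset.subset_iff]
  refine ⟨fun h => h.1, fun h => ⟨h, fun γ hγ γ' hγ' hne => ?_⟩⟩
  refine Finset.disjoint_left.mpr fun x hx hx' => hne ?_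
  exact eq_of_chain hr hu (h γ hγ) (h γ' hγ') (mem_toFinset_cycle.mp hx) (mem_toFinset_cycle.mp hx')

end Families

/-- Pass to complements. -/
theorem sum_powerset_T {ι : Type*} [DecidableEq ι] (s : Finset ι) (f : ι → ℤ) :
    ∑ c ∈ s.powerset, (T (∑ i ∈ c, f i) : ℤ[T;T⁻¹]) =
      T (∑ i ∈ s, f i) * ∑ c ∈ s.powerset, T (-∑ i ∈ c, f i) := by
  rw [Finset.mul_sum]
  refine Finset.sum_nbij' (s \ ·) (s \ ·) ?_ ?_ ?_ ?_ ?_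
  · exact fun c _ => Finset.mem_powerset.mpr Finset.sdiff_subset
  · exact fun c _ => Finset.mem_powerset.mpr Finset.sdiff_subset
  · exact fun c hc => Finset.sdiff_sdiff_eq_self (Finset.mem_powerset.mp hc)
  · exact fun c hc => Finset.sdiff_sdiff_eq_self (Finset.mem_powerset.mp hc)
  · intro c hc
    rw [← T_add]
    congr 1
    rw [← Finset.sum_sdiff (Finset.mem_powerset.mp hc)]
    ring

/-- A contraction sees only neighbouring unequal spins, and a constant word has none. These are the
highest and lowest weight vectors. -/
theorem basisVec_replicate_mem_symm (d : ℕ) (o : Bool) :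
    basisVec (List.replicate d o) ∈ symm d := by
  have hh : basisVec (List.replicate d o) ∈ homog d := by
    simpa using basisVec_mem_homog (List.replicate d o)
  refine ⟨hh, fun i hi => ?_⟩
  have hn : ∀ l r : List Bool, ∀ x y : Bool, x ≠ y →
      basisVec (List.replicate d o) (l ++ x :: y :: r) = 0 := by
    intro l r x y hxy
    rw [basisVec, if_neg]
    intro e
    have h1 := List.eq_replicate_iff.mp e
    exact hxy ((h1.2 x (by simp)).trans (h1.2 y (by simp)).symm)
  funext w
  by_cases hw : i ≤ w.length
  · obtain ⟨l, r, rfl, rfl⟩ : ∃ l r, w = l ++ r ∧ i = l.length :=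
      ⟨w.take i, w.drop i, (List.take_append_drop i w).symm, by simp [hw]⟩
    rw [cap_apply_append, hn _ _ _ _ (by decide), hn _ _ _ _ (by decide), mul_zero, add_zero]
    rfl
  · have : cap i (basisVec (List.replicate d o)) ∈ homog (d - 2) := by
      obtain ⟨n, rfl⟩ : ∃ n, d = n + 2 := ⟨d - 2, by omega⟩
      exact cap_mem_homog hh i
    exact this w (by omega)

section Rot

variable {D : Diagram}

theorem smoothedStep_unique {b : List Bool} (hL : Composable D.bottom D.layers b) {x y y' : Pt}
    (h : D.SmoothedStep x y) (h' : D.SmoothedStep x y') : y = y' := by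
  obtain ⟨h1, h2, h3⟩ := unique_of_nodup (nodup_ins hL)
  rcases h with h | ⟨c, hc, h | h⟩ <;> rcases h' with h' | ⟨c', hc', h' | h'⟩
  all_goals try simp only [Prod.mk.injEq] at h
  all_goals try simp only [Prod.mk.injEq] at h'
  · exact congrArg Prod.snd (h1 _ h _ h' rfl)
  · exact absurd h'.1 (h2 _ h _ hc').1
  · exact absurd h'.1 (h2 _ h _ hc').2
  · exact absurd h.1 (h2 _ h' _ hc).1
  · rw [h.2, h'.2, (h3 c hc c' hc').1 (h.1.symm.trans h'.1)]
  · exact absurd (h.1.symm.trans h'.1) (h3 c hc c' hc').2.2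
  · exact absurd h.1 (h2 _ h' _ hc).2
  · exact absurd (h'.1.symm.trans h.1) (h3 c' hc' c hc).2.2
  · rw [h.2, h'.2, (h3 c hc c' hc').2.1 (h.1.symm.trans h'.1)]

variable {d : ℕ} (ha : D.bottom = List.replicate d true)
  (hL : Composable D.bottom D.layers (List.replicate d true))
include ha hL

/-- Let u and w be the shifts of the two models. The sums of q^(∓2 rot(c)) over all sets c of
smoothing circles equal γq^u and γq^w with one scalar γ, and complementation says that they differ
by the factor q^(2 rot). So w - u = 2 rot, while u + w = 0. -/
theorem sum_layerShift_eq_rot (m : Model) :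
    (D.layers.map (layerShift m)).sum = -(modelSign m * D.rot) := by
  classical
  have hr : ∀ x : D.Point, ¬ D.SmoothedStep x.1 x.1 := fun x hx =>
    (dirStep_of_forkStep (fun c hc => smoothFork_dirStep hc) ((smoothedStep_iff _ _).mp hx)).ne rfl
  have hF := filter_isFamily_eq_powerset (r := fun x y : D.Point => D.SmoothedStep x.1 y.1) hr
    fun x y y' h h' => Subtype.ext (smoothedStep_unique hL h h')
  have hrot : D.rot = ∑ γ ∈ Finset.univ.filter (fun γ : D.ClosedCurve => γ.1 ≠ Cycle.nil ∧
      γ.1.Chain fun x y : D.Point => D.SmoothedStep x.1 y.1), rotCurve γ := by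
    unfold rot Follows
    exact Finset.sum_congr (Finset.filter_congr_decidable ..) fun _ _ => rfl
  have h1 := smoothSum_eq_opList ha hL .up
  have h2 := smoothSum_eq_opList ha hL .down
  -- One scalar serves both models: the words with all spins down and with all spins up both lie in
  -- `symm d`.
  obtain ⟨c, hc⟩ := GenChain.exists_scalar (d := d) (by
    simpa [ha] using genChain_of_composable hL (Xs := D.layers.map smoothCoef) (by simp))
  have h3 := sum_layerShift hL
  rw [ha, sub_self, mul_eq_zero, or_iff_right two_ne_zero] at h3
  rw [hF, hc _ (basisVec_replicate_mem_symm d _), Pi.smul_apply, basisVec, if_pos rfl, smul_eq_mul,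
    mul_one] at h1 h2
  have h4 := sum_powerset_T (Finset.univ.filter (fun γ : D.ClosedCurve => γ.1 ≠ Cycle.nil ∧
      γ.1.Chain fun x y : D.Point => D.SmoothedStep x.1 y.1)) fun γ => 2 * rotCurve γ
  simp only [← Finset.mul_sum, ← hrot] at h4
  simp only [modelSign, neg_neg, one_mul, neg_mul, rotFamily] at h1 h2
  rw [h2, h1] at h4
  generalize hu : (D.layers.map (layerShift .up)).sum = u at *
  generalize hw : (D.layers.map (layerShift .down)).sum = w at *
  have h5 : u + D.rot = 0 := by
    have h6 : (T (2 * (u + D.rot)) * (c * T u) : ℤ[T;T⁻¹]) = c * T u := by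
      have : 2 * (u + D.rot) = (u - w) + 2 * D.rot := by linarith
      rw [this, T_add, mul_assoc, ← h4, mul_left_comm, ← T_add, sub_add_cancel]
    -- The sum may be cancelled because at q = 1 it counts the sets of circles, and this number is a
    -- power of 2.
    have h7 := eq_zero_of_T_mul_eq ?_ h6
    · linarith
    · rw [← h1]
      apply evalOne_ne
      rw [map_sum, Finset.sum_congr rfl fun _ _ => evalOne_T _, Finset.sum_const,
        Finset.card_powerset, nsmul_eq_mul, mul_one]
      exact_mod_cast (Nat.two_pow_pos _).ne'
  cases m
  · rw [hu, modelSign]; linarith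
  · rw [hw, modelSign]; linarith

/-- The normalization in the theorem is exactly the inverse of the monomial relating the walk sum to
the matrix element. -/
theorem tHalfPow_mul_walkSum (m : Model) :
    tHalfPow (D.writhe - modelSign m * D.rot) *
      (1 + ∑ c ∈ D.simpleFamilies m, tPow (modelSign m * rotFamily c - beta c) * weight m c) =
      jonesOp D.layers (basisVec (List.replicate d (restLabel m)))
        (List.replicate d (restLabel m)) := by
  rw [walkSum_eq_jonesOp ha hL, sum_layerShift_eq_rot ha hL, tHalfPow, ← mul_assoc, ← T_add,
    ← sub_eq_add_neg, neg_add_cancel, T_zero, one_mul]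

end Rot

end

section
open Diagram

/-! ### Cables -/

theorem Composable.append {a b c : List Bool} {Ls Ls' : List Layer} (h : Composable a Ls b)
    (h' : Composable b Ls' c) : Composable a (Ls ++ Ls') c := by
  induction Ls generalizing a with
  | nil =>
    obtain rfl : a = b := h
    exact h'
  | cons L Ls ih => exact ⟨h.1, ih h.2⟩

theorem composable_map_range {n : ℕ} {f : ℕ → Layer} {w : ℕ → List Bool}
    (h : ∀ k < n, (f k).dom = w k ∧ (f k).cod = w (k + 1)) :
    Composable (w 0) ((List.range n).map f) (w n) := by
  induction n with
  | zero => rfl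
  | succ n ih =>
    rw [List.range_succ, List.map_append]
    refine (ih fun k hk => h k (by omega)).append ?_
    exact ⟨(h n (by omega)).1, (h n (by omega)).2⟩

theorem composable_map_range_reverse {n : ℕ} {f : ℕ → List Layer} {w : ℕ → List Bool}
    (h : ∀ k < n, Composable (w (k + 1)) (f k) (w k)) :
    Composable (w n) ((List.range n).reverse.flatMap f) (w 0) := by
  induction n with
  | zero => rfl
  | succ n ih =>
    rw [List.range_succ, List.reverse_append]
    exact (h n (by omega)).append (ih fun k hk => h k (by omega))

theorem cableBoundary_append (d : ℕ) (a b : List Bool) :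
    cableBoundary d (a ++ b) = cableBoundary d a ++ cableBoundary d b := by
  simp [cableBoundary]

theorem length_cableBoundary (d : ℕ) (a : List Bool) : (cableBoundary d a).length = d * a.length := by
  simp [cableBoundary, mul_comm]

theorem replicate_append_cons (n : ℕ) (o : Bool) (r : List Bool) :
    List.replicate n o ++ o :: r = List.replicate (n + 1) o ++ r := by
  rw [List.replicate_succ', List.append_assoc]; rfl

theorem composable_cableLayer (d : ℕ) (L : Layer) :
    Composable (cableBoundary d L.dom) (cableLayer d L) (cableBoundary d L.cod) := by
  obtain ⟨l, p, r⟩ := L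
  rcases p with o | o | ⟨a, b, f⟩
  · have := composable_map_range (n := d) (f := fun k => ⟨cableBoundary d l ++ List.replicate k o,
      .cup o, List.replicate k (!o) ++ cableBoundary d r⟩) (w := fun k => cableBoundary d l ++
      List.replicate k o ++ (List.replicate k (!o) ++ cableBoundary d r)) fun k _ => by
        simp [Layer.dom, Layer.cod, Piece.dom, Piece.cod, replicate_append_cons,
          List.replicate_succ]
    simpa [cableLayer, Layer.dom, Layer.cod, Piece.dom, Piece.cod, cableBoundary] using this
  · have := composable_map_range_reverse (n := d) (f := fun k => [⟨cableBoundary d l ++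
      List.replicate k o, .cap o, List.replicate k (!o) ++ cableBoundary d r⟩]) (w := fun k =>
      cableBoundary d l ++ List.replicate k o ++ (List.replicate k (!o) ++ cableBoundary d r))
      fun k _ => by
        simp [Layer.dom, Layer.cod, Piece.dom, Piece.cod, replicate_append_cons,
          List.replicate_succ, Composable]
    have e : cableLayer d ⟨l, .cap o, r⟩ = (List.range d).reverse.flatMap fun k =>
        [⟨cableBoundary d l ++ List.replicate k o, .cap o,
          List.replicate k (!o) ++ cableBoundary d r⟩] := List.map_eq_flatMap ..
    rw [e]
    simpa [Layer.dom, Layer.cod, Piece.dom, Piece.cod, cableBoundary] using this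
  · have := composable_map_range_reverse (n := d) (f := fun i => (List.range d).map fun j =>
      ⟨cableBoundary d l ++ List.replicate i a ++ List.replicate j b, .cross a b f,
        List.replicate (d - 1 - j) b ++ List.replicate (d - 1 - i) a ++ cableBoundary d r⟩)
      -- The line at which `i` strands of the first bundle still have to pass the second bundle and
      -- the other `d - i` have passed it.
      (w := fun i => cableBoundary d l ++ List.replicate i a ++ List.replicate d b ++
        List.replicate (d - i) a ++ cableBoundary d r) fun i hi => by
        have h2 := composable_map_range (n := d) (f := fun j =>
          ⟨cableBoundary d l ++ List.replicate i a ++ List.replicate j b, .cross a b f,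
          List.replicate (d - 1 - j) b ++ List.replicate (d - 1 - i) a ++ cableBoundary d r⟩)
          (w := fun j => cableBoundary d l ++ List.replicate i a ++ List.replicate j b ++ a ::
            (List.replicate (d - j) b ++ List.replicate (d - 1 - i) a ++ cableBoundary d r))
          fun j hj => by
            have e1 : d - j = d - 1 - j + 1 := by omega
            have e2 : d - (j + 1) = d - 1 - j := by omega
            simp [Layer.dom, Layer.cod, Piece.dom, Piece.cod, e1, e2, List.replicate_succ,
              replicate_append_cons]
        have e1 : d - (i + 1) = d - 1 - i := by omega
        have e2 : d - i = d - 1 - i + 1 := by omega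
        simpa [e1, e2, List.replicate_succ, replicate_append_cons] using h2
    simpa [cableLayer, Layer.dom, Layer.cod, Piece.dom, Piece.cod, cableBoundary] using this

theorem Composable.cable {a b : List Bool} {Ls : List Layer} (h : Composable a Ls b) (d : ℕ) :
    Composable (cableBoundary d a) (Ls.flatMap (cableLayer d)) (cableBoundary d b) := by
  induction Ls generalizing a with
  | nil =>
    obtain rfl : a = b := h
    rfl
  | cons L Ls ih =>
    obtain ⟨rfl, h⟩ := h
    exact (composable_cableLayer d L).append (ih h)

theorem flatMap_replicate_one (a : List Bool) : cableBoundary 1 a = a := by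
  induction a with
  | nil => rfl
  | cons o a ih => exact congrArg (o :: ·) ih

theorem cable_one (D : Diagram) : cable 1 D = D := by
  have h : ∀ L, cableLayer 1 L = [L] := by
    rintro ⟨l, p, r⟩
    cases p <;> simp [cableLayer, flatMap_replicate_one]
  obtain ⟨a, Ls⟩ := D
  simp only [cable, flatMap_replicate_one, funext h, List.flatMap_singleton']

/-- The operator of a cabled piece, with `m` strands parallel to the first strand and `n` strands
parallel to the second strand of a crossing. -/
noncomputable def Piece.cableOp (X : ℤ[T;T⁻¹] × ℤ[T;T⁻¹]) (m n t : ℕ) : Piece → Op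
  | .cup _ => cupsOp t m
  | .cap _ => capsOp t m
  | .cross _ _ _ => blockOp X.1 X.2 n t m

theorem jonesOp_append (Ls Ls' : List Layer) : jonesOp (Ls ++ Ls') = jonesOp Ls' * jonesOp Ls := by
  rw [jonesOp, jonesOp, jonesOp, ← opList_append, List.map_append]
  simp only [gensOf]
  rw [List.zipWith_append (by simp)]

theorem jonesOp_nil : jonesOp [] = 1 := rfl

theorem jonesOp_singleton (L : Layer) : jonesOp [L] = (L.gen (jonesCoef L)).op := one_mul _

theorem jonesOp_cups (l : List Bool) (o : Bool) (R : ℕ → List Bool) (m : ℕ) :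
    jonesOp ((List.range m).map fun k => ⟨l ++ List.replicate k o, .cup o, R k⟩) =
      cupsOp l.length m := by
  induction m with
  | zero => rfl
  | succ m ih =>
    rw [List.range_succ, List.map_append, jonesOp_append, ih, List.map_singleton, jonesOp_singleton]
    simp [Layer.gen, Gen.op, cupsOp]

theorem jonesOp_caps (l : List Bool) (o : Bool) (R : ℕ → List Bool) (m : ℕ) :
    jonesOp ((List.range m).reverse.map fun k => ⟨l ++ List.replicate k o, .cap o, R k⟩) =
      capsOp l.length m := by
  induction m with
  | zero => rfl
  | succ m ih =>
    rw [List.range_succ, List.reverse_append, List.map_append, jonesOp_append, ih,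
      List.reverse_singleton, List.map_singleton, jonesOp_singleton]
    simp [Layer.gen, Gen.op, capsOp]

theorem jonesOp_row (l l' r' : List Bool) (a b f : Bool) (R : ℕ → List Bool) (n : ℕ) :
    jonesOp ((List.range n).map fun j => ⟨l ++ List.replicate j b, .cross a b f, R j⟩) =
      rowOp (jonesCoef ⟨l', .cross a b f, r'⟩).1 (jonesCoef ⟨l', .cross a b f, r'⟩).2 l.length n := by
  induction n with
  | zero => rfl
  | succ n ih =>
    rw [List.range_succ, List.map_append, jonesOp_append, ih, List.map_singleton, jonesOp_singleton]
    simp [Layer.gen, Gen.op, rowOp, jonesCoef]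

theorem jonesOp_block (l l' r' : List Bool) (a b f : Bool) (R : ℕ → ℕ → List Bool) (m n : ℕ) :
    jonesOp ((List.range m).reverse.flatMap fun i => (List.range n).map fun j =>
      ⟨l ++ List.replicate i a ++ List.replicate j b, .cross a b f, R i j⟩) =
      blockOp (jonesCoef ⟨l', .cross a b f, r'⟩).1 (jonesCoef ⟨l', .cross a b f, r'⟩).2 n
        l.length m := by
  induction m with
  | zero => rfl
  | succ m ih =>
    rw [List.range_succ, List.reverse_append, List.flatMap_append, jonesOp_append, ih,
      List.reverse_singleton, List.flatMap_singleton, jonesOp_row _ l' r', blockOp,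
      List.length_append, List.length_replicate]

theorem jonesOp_cableLayer (d : ℕ) (L : Layer) :
    jonesOp (cableLayer d L) = L.piece.cableOp (jonesCoef L) d d (d * L.left.length) := by
  obtain ⟨l, p, r⟩ := L
  simp only [← length_cableBoundary]
  cases p
  · exact jonesOp_cups ..
  · exact jonesOp_caps ..
  · exact jonesOp_block ..

end

section
open Diagram

/-! ### Sliding a coupon along a strand of a layer -/

/-- The number of parallel strands. -/
def mb (b : ℕ) (x : Bool) : ℕ := if x then b + 2 else b

/-- The exponent of the normalization of a block of crossings. -/
def normExp (b : ℕ) : Bool → Bool → ℕ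
  | true, true => 2 * b + 2
  | false, false => 0
  | _, _ => b

/-- The inverse of the product of the coefficients of a crossing. -/
noncomputable def jonesNorm (L : Layer) : ℤ[T;T⁻¹] :=
  match L.piece with
  | .cross a b f => -T (3 * if f == (a == b) then 1 else -1)
  | _ => 1

theorem jonesCoef_mul_jonesNorm (l r : List Bool) (a b f : Bool) :
    (jonesCoef ⟨l, .cross a b f, r⟩).1 * (jonesCoef ⟨l, .cross a b f, r⟩).2 *
      jonesNorm ⟨l, .cross a b f, r⟩ = 1 := by
  cases a <;> cases b <;> cases f <;>
    simp only [jonesCoef, jonesNorm, sortCoefs, beq_self_eq_true, Bool.beq_eq_decide_eq, if_true,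
      if_false, Bool.false_eq_true, reduceCtorEq, decide_false, mul_neg, neg_mul, neg_neg,
      ← T_add] <;> norm_num

/-- For sign ε this is q^(-2ε) + q^(-4ε) - q^(-3ε)(q + q⁻¹) = 0. It is symmetric in the two
coefficients, so it does not matter which smoothing is vertical. -/
theorem jonesCoef_rel (l r : List Bool) (a b f : Bool) :
    (jonesCoef ⟨l, .cross a b f, r⟩).1 * (jonesCoef ⟨l, .cross a b f, r⟩).1 +
    (jonesCoef ⟨l, .cross a b f, r⟩).2 * (jonesCoef ⟨l, .cross a b f, r⟩).2 +
    (jonesCoef ⟨l, .cross a b f, r⟩).1 * (jonesCoef ⟨l, .cross a b f, r⟩).2 * circ = 0 := by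
  cases a <;> cases b <;> cases f <;>
    simp only [jonesCoef, sortCoefs, beq_self_eq_true, Bool.beq_eq_decide_eq, if_true,
      if_false, Bool.false_eq_true, reduceCtorEq, decide_false, mul_neg, neg_mul, neg_neg,
      circ, mul_add, ← T_add] <;> norm_num <;> ring

/-- The normalized operator of a cabled piece, with `b` or `b + 2` strands parallel to each of the
strands. -/
noncomputable def slidePiece (b : ℕ) (L : Layer) (m n : Bool) (t : ℕ) : Op :=
  jonesNorm L ^ normExp b m n • L.piece.cableOp (jonesCoef L) (mb b m) (mb b n) t

/-- The number of strands at the bottom of a cabled piece. -/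
def Piece.bot (b : ℕ) (m n : Bool) : Piece → ℕ
  | .cup _ => 0
  | .cap _ => 2 * mb b m
  | .cross _ _ _ => mb b m + mb b n

/-- The number of strands at the top of a cabled piece. -/
def Piece.top (b : ℕ) (m n : Bool) : Piece → ℕ
  | .cup _ => 2 * mb b m
  | .cap _ => 0
  | .cross _ _ _ => mb b m + mb b n

/-! ### Normalized cabled pieces away from the arc -/

section Far

variable (b : ℕ) (L : Layer) (m n : Bool)

theorem cap_mul_slidePiece_left {j t : ℕ} (h : j ≤ t) :
    cap j * slidePiece b L m n (t + 2) = slidePiece b L m n t * cap j := by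
  rw [slidePiece, slidePiece, mul_smul_comm, smul_mul_assoc]
  congr 1
  obtain ⟨l, p, r⟩ := L
  cases p
  · exact cap_mul_cupsOp_left _ (by omega)
  · exact cap_mul_capsOp_left _ h
  · exact cap_mul_blockOp_left _ _ _ _ h

theorem slidePiece_mul_cup_left {j t : ℕ} (h : j ≤ t) :
    slidePiece b L m n (t + 2) * cup j = cup j * slidePiece b L m n t := by
  rw [slidePiece, slidePiece, mul_smul_comm, smul_mul_assoc]
  congr 1
  obtain ⟨l, p, r⟩ := L
  cases p
  · exact cupsOp_mul_cup_left _ h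
  · exact capsOp_mul_cup_left _ h
  · exact blockOp_mul_cup_left _ _ _ _ h

theorem cap_mul_slidePiece_right {j t : ℕ} (h : t ≤ j) :
    cap (j + L.piece.top b m n) * slidePiece b L m n t =
      slidePiece b L m n t * cap (j + L.piece.bot b m n) := by
  rw [slidePiece, mul_smul_comm, smul_mul_assoc]
  congr 1
  obtain ⟨l, p, r⟩ := L
  cases p
  · exact cap_mul_cupsOp_right h
  · exact cap_mul_capsOp_right h
  · exact cap_mul_blockOp_right _ _ (by simp only [Piece.top]; omega)

theorem slidePiece_mul_cup_right {j t : ℕ} (h : t ≤ j) :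
    slidePiece b L m n t * cup (j + L.piece.bot b m n) =
      cup (j + L.piece.top b m n) * slidePiece b L m n t := by
  rw [slidePiece, mul_smul_comm, smul_mul_assoc]
  congr 1
  obtain ⟨l, p, r⟩ := L
  cases p
  · exact cupsOp_mul_cup_right h
  · exact capsOp_mul_cup_right h
  · exact blockOp_mul_cup_right _ _ (by simp only [Piece.bot]; omega)

/-- This and its companion dictate the values of `normExp`: removing a pair of strands from one
bundle costs one factor xy for each strand of the other bundle. -/
theorem normExp_true_left (b : ℕ) (n : Bool) :
    normExp b true n = normExp b false n + mb b n := by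
  cases n <;> simp [normExp, mb]
  omega

theorem normExp_true_right (b : ℕ) (m : Bool) :
    normExp b m true = normExp b m false + mb b m := by
  cases m <;> simp [normExp, mb]
  omega

end Far

theorem pow_norm_smul {κ ν : ℤ[T;T⁻¹]} (h : κ * ν = 1) (e n : ℕ) (x : Op) :
    ν ^ (e + n) • κ ^ n • x = ν ^ e • x := by
  rw [smul_smul, pow_add, mul_assoc, ← mul_pow, mul_comm ν, h, one_pow, mul_one]

/-! ### Arcs slide through normalized blocks without any factor -/

section Cross

variable {b c : ℕ} (hc : c ≤ b) (l r : List Bool) (a a' f : Bool)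
include hc

theorem cap_mul_slidePiece_fst (n : Bool) {t N : ℕ} (hN : t + b + mb b n + 2 ≤ N) :
    cap (t + mb b n + c) * slidePiece b ⟨l, .cross a a' f, r⟩ true n t * long N =
      slidePiece b ⟨l, .cross a a' f, r⟩ false n t * cap (t + c) * long N := by
  simp only [slidePiece, mul_smul_comm, smul_mul_assoc, Piece.cableOp, mb, if_true]
  have := cap_mul_blockOp_fst (jonesCoef_rel l r a a' f) hc hN
  simp only [mb] at this
  rw [this, normExp_true_left]
  exact pow_norm_smul (jonesCoef_mul_jonesNorm l r a a' f) _ _ _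

theorem slidePiece_mul_cup_fst (n : Bool) (t : ℕ) :
    slidePiece b ⟨l, .cross a a' f, r⟩ true n t * cup (t + c) =
      cup (t + mb b n + c) * slidePiece b ⟨l, .cross a a' f, r⟩ false n t := by
  simp only [slidePiece, mul_smul_comm, smul_mul_assoc, Piece.cableOp, mb, if_true]
  have := blockOp_mul_cup_fst (jonesCoef_rel l r a a' f) hc (n := mb b n) (t := t)
  simp only [mb] at this
  rw [this, normExp_true_left]
  exact pow_norm_smul (jonesCoef_mul_jonesNorm l r a a' f) _ _ _

theorem cap_mul_slidePiece_snd (m : Bool) (t : ℕ) :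
    cap (t + c) * slidePiece b ⟨l, .cross a a' f, r⟩ m true t =
      slidePiece b ⟨l, .cross a a' f, r⟩ m false t * cap (t + mb b m + c) := by
  simp only [slidePiece, mul_smul_comm, smul_mul_assoc, Piece.cableOp, mb, if_true]
  have := cap_mul_blockOp_snd (jonesCoef_rel l r a a' f) hc (m := mb b m) (t := t)
  simp only [mb] at this
  rw [this, normExp_true_right]
  exact pow_norm_smul (jonesCoef_mul_jonesNorm l r a a' f) _ _ _

theorem slidePiece_mul_cup_snd (m : Bool) {t N : ℕ} (hN : t + mb b m + b ≤ N) :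
    slidePiece b ⟨l, .cross a a' f, r⟩ m true t * (cup (t + mb b m + c) * long N) =
      cup (t + c) * (slidePiece b ⟨l, .cross a a' f, r⟩ m false t * long N) := by
  simp only [slidePiece, mul_smul_comm, smul_mul_assoc, Piece.cableOp, mb, if_true]
  have := blockOp_mul_cup_snd (jonesCoef_rel l r a a' f) hc hN
  simp only [mb] at this
  rw [this, normExp_true_right]
  exact pow_norm_smul (jonesCoef_mul_jonesNorm l r a a' f) _ _ _

end Cross

end

section
open Diagram

/-! ### Sliding a coupon through a layer -/

/-- The strands of a piece, the crossing strands being followed straight on. -/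
def Layer.pieceStrands (L : Layer) (k : ℕ) : List (Pt × Pt) :=
  match L.piece with
  | .cup o => [orient o (k + 1, L.left.length + 1, !o) (k + 1, L.left.length, o)]
  | .cap o => [orient o (k, L.left.length, o) (k, L.left.length + 1, !o)]
  | .cross a b _ => [orient a (k, L.left.length, a) (k + 1, L.left.length + 1, a),
      orient b (k, L.left.length + 1, b) (k + 1, L.left.length, b)]

/-- The vertical strands to the right of the piece. -/
def Layer.rightStrands (L : Layer) (k : ℕ) : List (Pt × Pt) :=
  vert k (L.left.length + L.piece.dom.length) (L.left.length + L.piece.cod.length) L.right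

def Layer.strands (L : Layer) (k : ℕ) : List (Pt × Pt) :=
  vert k 0 0 L.left ++ L.rightStrands k ++ L.pieceStrands k

/-- The source of the first strand of a piece. -/
def Layer.fstSource (L : Layer) (k : ℕ) : Pt := ((L.pieceStrands k).map Prod.fst).headD (0, 0, true)

/-- The source of the last strand of a piece. -/
def Layer.sndSource (L : Layer) (k : ℕ) : Pt := ((L.pieceStrands k).map Prod.fst).getLastD (0, 0, true)

theorem Layer.fstSource_mem (L : Layer) (k : ℕ) :
    L.fstSource k ∈ (L.pieceStrands k).map Prod.fst := by
  obtain ⟨l, p, r⟩ := L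
  cases p <;> simp [Layer.fstSource, Layer.pieceStrands]

theorem Layer.sndSource_mem (L : Layer) (k : ℕ) :
    L.sndSource k ∈ (L.pieceStrands k).map Prod.fst := by
  obtain ⟨l, p, r⟩ := L
  cases p <;> simp [Layer.sndSource, Layer.pieceStrands]

theorem Layer.strands_fst (L : Layer) (k : ℕ) : ((L.strands k).map Prod.fst : Multiset Pt) =
    insOf (L.links k) (L.crossings k) := by
  rw [insOf, L.links_eq]
  obtain ⟨l, p, r⟩ := L
  rcases p with o | o | ⟨a, b, f⟩
  · simp [Layer.strands, Layer.rightStrands, Layer.pieceStrands, Layer.pieceLinks, Layer.crossings]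
  · simp [Layer.strands, Layer.rightStrands, Layer.pieceStrands, Layer.pieceLinks, Layer.crossings]
  · cases f <;> simp [Layer.strands, Layer.rightStrands, Layer.pieceStrands, Layer.pieceLinks,
      Layer.crossings, List.perm_append_left_iff, List.Perm.swap]

theorem Layer.mem_strands_iff (L : Layer) (k : ℕ) (z : Pt × Pt) : z ∈ L.strands k ↔
    z ∈ L.links k ∨ ∃ x ∈ L.crossings k, z = (x.overIn, x.overOut) ∨ z = (x.underIn, x.underOut) := by
  rw [L.links_eq]
  obtain ⟨l, p, r⟩ := L
  rcases p with o | o | ⟨a, b, f⟩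
  · simp [Layer.strands, Layer.rightStrands, Layer.pieceStrands, Layer.pieceLinks, Layer.crossings]
  · simp [Layer.strands, Layer.rightStrands, Layer.pieceStrands, Layer.pieceLinks, Layer.crossings]
  · cases f <;> simp [Layer.strands, Layer.rightStrands, Layer.pieceStrands, Layer.pieceLinks,
      Layer.crossings] <;> tauto

/-- Changing the multiplicity label at one source affects one strand only. The sliding lemmas rest
on this. -/
theorem Layer.nodup_strands (L : Layer) (k : ℕ) : ((L.strands k).map Prod.fst).Nodup := by
  rw [← Multiset.coe_nodup, L.strands_fst, L.insOf_eq]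
  refine Multiset.nodup_of_le (t := (ptsFrom k [L.dom, L.cod] : Multiset Pt)) ?_
    (Multiset.coe_nodup.mpr (nodup_ptsFrom _ _))
  simp only [ptsFrom, List.append_nil, ← Multiset.coe_add]
  exact add_le_add (Multiset.coe_le.mpr (List.filter_sublist).subperm)
    (Multiset.coe_le.mpr (List.filter_sublist).subperm)

/-- The number of strands parallel to the given ones. -/
def vcount (b : ℕ) (A : Pt → Bool) (zs : List (Pt × Pt)) : ℕ := (zs.map fun z => mb b (A z.1)).sum

/-- The number of points parallel to the points on a part of a line. -/
def lcount (b : ℕ) (A : Pt → Bool) (k j : ℕ) (a : List Bool) : ℕ :=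
  ((linePts k j a).map fun p => mb b (A p)).sum

section Counts

variable {b : ℕ} {A : Pt → Bool}

theorem vcount_append (zs zs' : List (Pt × Pt)) :
    vcount b A (zs ++ zs') = vcount b A zs + vcount b A zs' := by simp [vcount]

theorem vcount_cons (z : Pt × Pt) (zs : List (Pt × Pt)) :
    vcount b A (z :: zs) = mb b (A z.1) + vcount b A zs := by simp [vcount]

theorem lcount_append (k j : ℕ) (a a' : List Bool) :
    lcount b A k j (a ++ a') = lcount b A k j a + lcount b A k (j + a.length) a' := by
  simp [lcount, linePts_append]

theorem vcount_congr {A' : Pt → Bool} {zs : List (Pt × Pt)} (h : ∀ z ∈ zs, A z.1 = A' z.1) :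
    vcount b A zs = vcount b A' zs :=
  congrArg List.sum (List.map_congr_left fun z hz => by rw [h z hz])

theorem lcount_congr {A' : Pt → Bool} {k j : ℕ} {a : List Bool}
    (h : ∀ q ∈ linePts k j a, A q = A' q) : lcount b A k j a = lcount b A' k j a :=
  congrArg List.sum (List.map_congr_left fun z hz => by rw [h z hz])

theorem lcount_eq_vcount {k j j' : ℕ} {a : List Bool} (h : ∀ z ∈ vert k j j' a, A z.1 = A z.2) :
    lcount b A k j a = vcount b A (vert k j j' a) ∧
      lcount b A (k + 1) j' a = vcount b A (vert k j j' a) := by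
  induction a generalizing j j' with
  | nil => exact ⟨rfl, rfl⟩
  | cons o a ih =>
    rw [vert_cons] at h ⊢
    obtain ⟨h1, h2⟩ := ih fun z hz => h z (List.mem_cons_of_mem _ hz)
    have h3 := h _ List.mem_cons_self
    simp only [lcount, linePts_cons, List.map_cons, List.sum_cons, vcount_cons] at h1 h2 ⊢
    rw [h1, h2]
    cases o <;> simp only [orient, if_true, if_false, Bool.false_eq_true] at h3 ⊢ <;>
      simp [h3]

theorem lcount_pair (k j : ℕ) (o o' : Bool) :
    lcount b A k j [o, o'] = mb b (A (k, j, o)) + mb b (A (k, j + 1, o')) := by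
  simp [lcount, linePts_cons, linePts_nil]

theorem lcount_dom_cod {L : Layer} {k : ℕ} (h : ∀ z ∈ L.pieceStrands k, A z.1 = A z.2) :
    lcount b A k L.left.length L.piece.dom =
      L.piece.bot b (A (L.fstSource k)) (A (L.sndSource k)) ∧
    lcount b A (k + 1) L.left.length L.piece.cod =
      L.piece.top b (A (L.fstSource k)) (A (L.sndSource k)) := by
  obtain ⟨l, p, r⟩ := L
  rcases p with o | o | ⟨a, a', f⟩
  · have h1 := h _ List.mem_cons_self
    cases o <;> simp [Layer.fstSource, Layer.pieceStrands, orient, Piece.bot, Piece.top, Piece.dom,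
      Piece.cod, lcount_pair] at h1 ⊢ <;> simp [lcount, linePts_nil, h1] <;> ring
  · have h1 := h _ List.mem_cons_self
    cases o <;> simp [Layer.fstSource, Layer.pieceStrands, orient, Piece.bot, Piece.top, Piece.dom,
      Piece.cod, lcount_pair] at h1 ⊢ <;> simp [lcount, linePts_nil, h1] <;> ring
  · have h1 := h _ List.mem_cons_self
    have h2 := h _ (List.mem_cons_of_mem _ List.mem_cons_self)
    cases a <;> cases a' <;> simp [Layer.fstSource, Layer.sndSource, Layer.pieceStrands, orient,
      Piece.bot, Piece.top, Piece.dom, Piece.cod, lcount_pair] at h1 h2 ⊢ <;> simp [h1, h2, add_comm]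

end Counts

/-- The normalized operator of a layer of a diagram whose strands are replaced by `b` or `b + 2`
parallel strands, the latter being the case if `A` holds at the source. -/
noncomputable def slideLayer (b : ℕ) (A : Pt → Bool) (k : ℕ) (L : Layer) : Op :=
  slidePiece b L (A (L.fstSource k)) (A (L.sndSource k)) (vcount b A (vert k 0 0 L.left)) *
    long (vcount b A (vert k 0 0 L.left) +
      L.piece.bot b (A (L.fstSource k)) (A (L.sndSource k)) + vcount b A (L.rightStrands k))

theorem slideLayer_congr {b : ℕ} {A A' : Pt → Bool} {k : ℕ} {L : Layer}
    (h : ∀ q ∈ (L.strands k).map Prod.fst, A q = A' q) : slideLayer b A k L = slideLayer b A' k L := by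
  have h' : ∀ z ∈ L.strands k, A z.1 = A' z.1 := fun z hz => h _ (List.mem_map_of_mem hz)
  have hp : ∀ q ∈ (L.pieceStrands k).map Prod.fst, A q = A' q := fun q hq => h q (by
    rw [Layer.strands, List.map_append]; exact List.mem_append_right _ hq)
  simp only [Layer.strands, List.mem_append] at h'
  rw [slideLayer, slideLayer, hp _ (L.fstSource_mem k), hp _ (L.sndSource_mem k),
    vcount_congr fun z hz => h' z (Or.inl (Or.inl hz)),
    vcount_congr fun z hz => h' z (Or.inl (Or.inr hz))]

/-- The operator joining two of `b + 2` strands. -/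
noncomputable def coupon (b c : ℕ) (p : Pt) (s : ℕ) : Op :=
  -- Behind the coupon, in the direction of travel, there are `b + 2` strands and ahead of it `b`.
  -- On an upward strand it is a maximum; on a downward strand the picture is turned around, so it
  -- is a minimum, and the pair `c, c + 1` counted from the other side starts at `b - c`.
  if p.2.2 then cap (s + c) else cup (s + (b - c))

/-- The line below or above a layer. -/
def Layer.line (L : Layer) (k j : ℕ) : List Bool := if j = k then L.dom else L.cod

/-- A layer with a coupon below or above it. -/
noncomputable def place (b c : ℕ) (A : Pt → Bool) (k : ℕ) (L : Layer) (p : Pt) : Op :=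
  if p.1 = k then slideLayer b A k L * coupon b c p (lcount b A p.1 0 ((L.line k p.1).take p.2.1))
  else coupon b c p (lcount b A p.1 0 ((L.line k p.1).take p.2.1)) * slideLayer b A k L

theorem lt_of_mem_linePts {k j : ℕ} {a : List Bool} {p : Pt} (h : p ∈ linePts k j a) :
    p.2.1 < j + a.length := by
  induction a generalizing j with
  | nil => simp [linePts] at h
  | cons o a ih =>
    rw [linePts_cons, List.mem_cons] at h
    rcases h with rfl | h
    · simp
    · have := ih h
      rw [List.length_cons]
      omega

theorem vert_append (k j j' : ℕ) (a a' : List Bool) :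
    vert k j j' (a ++ a') = vert k j j' a ++ vert k (j + a.length) (j' + a.length) a' := by
  induction a generalizing j j' with
  | nil => rfl
  | cons o a ih =>
    rw [List.cons_append, vert_cons, ih, vert_cons, List.cons_append, List.length_cons,
      add_assoc, add_assoc, add_comm 1]

/-! ### Changing the multiplicity of one strand -/

section Update

variable {b : ℕ} {A : Pt → Bool} {p : Pt} {v : Bool}

theorem lcount_update_of_ne {k j : ℕ} {a : List Bool} (h : p.1 ≠ k) :
    lcount b (Function.update A p v) k j a = lcount b A k j a :=
  lcount_congr fun _ hq => Function.update_of_ne (by rintro rfl; exact h (fst_of_mem_linePts hq)) ..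

theorem lcount_update_of_le {k j : ℕ} {a : List Bool} (h : j + a.length ≤ p.2.1) :
    lcount b (Function.update A p v) k j a = lcount b A k j a :=
  lcount_congr fun _ hq => Function.update_of_ne
    (fun e => absurd (lt_of_mem_linePts hq) (by rw [e]; omega)) ..

theorem vcount_update {zs : List (Pt × Pt)} (h : p ∉ zs.map Prod.fst) :
    vcount b (Function.update A p v) zs = vcount b A zs :=
  vcount_congr fun _ hz => Function.update_of_ne (ne_of_mem_of_not_mem (List.mem_map_of_mem hz) h) ..

end Update

/-! ### The coupon on a vertical strand -/

section Place

variable {b c : ℕ} (hc : c ≤ b) {A : Pt → Bool} {k : ℕ}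
include hc

/-- Moving the coupon across the layer turns `b` parallel strands to the left of the piece into `b +
2`, so the piece is shifted by two positions; this is the commutation with a generator far to the
left. -/
theorem place_left (l l' r : List Bool) (P : Piece) (o : Bool) {p y : Pt}
    (hz : (p, y) = orient o (k, l.length, o) (k + 1, l.length, o))
    (hA : ∀ z ∈ Layer.strands ⟨l ++ o :: l', P, r⟩ k, A z.1 = A z.2) (hp : A p = false) :
    place b c (Function.update A p true) k ⟨l ++ o :: l', P, r⟩ y =
      place b c A k ⟨l ++ o :: l', P, r⟩ p := by
  set L : Layer := ⟨l ++ o :: l', P, r⟩ with hL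
  have hv : vert k 0 0 L.left =
      vert k 0 0 l ++ (p, y) :: vert k (l.length + 1) (l.length + 1) l' := by
    rw [vert_append, vert_cons, hz, zero_add]
  have hn : p ∉ (vert k 0 0 l ++ vert k (l.length + 1) (l.length + 1) l' ++ L.rightStrands k ++
      L.pieceStrands k).map Prod.fst := by
    have h1 := L.nodup_strands k
    rw [Layer.strands, hv] at h1
    have h2 : ((p, y) :: (vert k 0 0 l ++ vert k (l.length + 1) (l.length + 1) l' ++
        L.rightStrands k ++ L.pieceStrands k)).Perm (vert k 0 0 l ++ (p, y) ::
        vert k (l.length + 1) (l.length + 1) l' ++ L.rightStrands k ++ L.pieceStrands k) := by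
      simp [List.perm_middle.symm]
    exact (List.nodup_cons.mp ((h2.map Prod.fst).nodup_iff.mpr h1)).1
  simp only [List.map_append, List.mem_append, not_or] at hn
  obtain ⟨⟨⟨n1, n2⟩, n3⟩, n4⟩ := hn
  have hf : Function.update A p true (L.fstSource k) = A (L.fstSource k) :=
    Function.update_of_ne (ne_of_mem_of_not_mem (L.fstSource_mem k) n4) ..
  have hs : Function.update A p true (L.sndSource k) = A (L.sndSource k) :=
    Function.update_of_ne (ne_of_mem_of_not_mem (L.sndSource_mem k) n4) ..
  have hA1 : ∀ z ∈ vert k 0 0 l, A z.1 = A z.2 := fun z h => hA z (by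
    rw [Layer.strands, hv]; simp [h])
  obtain ⟨c1, c2⟩ := lcount_eq_vcount (b := b) hA1
  have hd : L.dom.take l.length = l := by simp [hL, Layer.dom]
  have hcd : L.cod.take l.length = l := by simp [hL, Layer.cod]
  generalize h1 : vcount b A (vert k 0 0 l) = s at *
  generalize h2 : vcount b A (vert k (l.length + 1) (l.length + 1) l') = s' at *
  have e1 : slideLayer b A k L = slidePiece b L (A (L.fstSource k)) (A (L.sndSource k)) (s + b + s') *
      long (s + b + s' + L.piece.bot b (A (L.fstSource k)) (A (L.sndSource k)) +
        vcount b A (L.rightStrands k)) := by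
    rw [slideLayer, hv, vcount_append, vcount_cons, hp, h1, h2, ← add_assoc]
    rfl
  have e2 : slideLayer b (Function.update A p true) k L =
      slidePiece b L (A (L.fstSource k)) (A (L.sndSource k)) (s + b + s' + 2) *
      long (s + b + s' + L.piece.bot b (A (L.fstSource k)) (A (L.sndSource k)) +
        vcount b A (L.rightStrands k) + 2) := by
    rw [slideLayer, hv, vcount_append, vcount_cons, vcount_update n1, vcount_update n2,
      vcount_update n3, hf, hs, Function.update_self, h1, h2, mb, if_pos rfl,
      show s + (b + 2 + s') = s + b + s' + 2 by omega]
    congr 2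
    omega
  have hN : s + b + s' ≤ s + b + s' + L.piece.bot b (A (L.fstSource k)) (A (L.sndSource k)) +
        vcount b A (L.rightStrands k) := by omega
  generalize s + b + s' + L.piece.bot b (A (L.fstSource k)) (A (L.sndSource k)) +
        vcount b A (L.rightStrands k) = N at *
  cases o
  · obtain ⟨rfl, rfl⟩ := Prod.mk.inj hz
    have d1 : lcount b (Function.update A (k + 1, l.length, false) true) k 0 l = s := by
      rw [lcount_update_of_ne (by simp), c1]
    simp only [place, coupon, Layer.line, Nat.succ_ne_self, if_true, if_false, e1, e2, hd, hcd, d1,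
      c2, Bool.false_eq_true]
    rw [mul_assoc, long_mul_cup (by omega), ← mul_assoc, slidePiece_mul_cup_left _ _ _ _ (by omega),
      mul_assoc]
  · obtain ⟨rfl, rfl⟩ := Prod.mk.inj hz
    have d1 : lcount b (Function.update A (k, l.length, true) true) (k + 1) 0 l = s := by
      rw [lcount_update_of_ne (by simp), c2]
    simp only [place, coupon, Layer.line, Nat.succ_ne_self, if_true, if_false, e1, e2, hd, hcd, d1,
      c1]
    rw [← mul_assoc, cap_mul_slidePiece_left _ _ _ _ (by omega), mul_assoc,
      cap_mul_long (by omega), mul_assoc]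

/-- The position of a coupon to the right of the piece depends on how many strands the piece has at
its bottom and at its top, which is what `lcount_dom_cod` provides. -/
theorem place_right (l r r' : List Bool) (P : Piece) (o : Bool) {p y : Pt}
    (hz : (p, y) = orient o (k, l.length + P.dom.length + r.length, o)
      (k + 1, l.length + P.cod.length + r.length, o))
    (hA : ∀ z ∈ Layer.strands ⟨l, P, r ++ o :: r'⟩ k, A z.1 = A z.2) (hp : A p = false) :
    place b c (Function.update A p true) k ⟨l, P, r ++ o :: r'⟩ y =
      place b c A k ⟨l, P, r ++ o :: r'⟩ p := by
  set L : Layer := ⟨l, P, r ++ o :: r'⟩ with hL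
  set V := vert k (l.length + P.dom.length) (l.length + P.cod.length) r with hV
  set V' := vert k (l.length + P.dom.length + r.length + 1) (l.length + P.cod.length + r.length + 1)
    r' with hV'
  have hv : L.rightStrands k = V ++ (p, y) :: V' := by
    rw [Layer.rightStrands, vert_append, vert_cons, hz]
  have hn : p ∉ (vert k 0 0 l ++ V ++ V' ++ L.pieceStrands k).map Prod.fst := by
    have h1 := L.nodup_strands k
    rw [Layer.strands, hv] at h1
    have h2 : ((p, y) :: (vert k 0 0 l ++ V ++ V' ++ L.pieceStrands k)).Perm
        (vert k 0 0 l ++ (V ++ (p, y) :: V') ++ L.pieceStrands k) := by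
      rw [← Multiset.coe_eq_coe]
      simp only [← Multiset.cons_coe, ← Multiset.coe_add, ← Multiset.singleton_add]
      abel
    exact (List.nodup_cons.mp ((h2.map Prod.fst).nodup_iff.mpr h1)).1
  simp only [List.map_append, List.mem_append, not_or] at hn
  obtain ⟨⟨⟨n1, n2⟩, n3⟩, n4⟩ := hn
  have hf : Function.update A p true (L.fstSource k) = A (L.fstSource k) :=
    Function.update_of_ne (ne_of_mem_of_not_mem (L.fstSource_mem k) n4) ..
  have hs : Function.update A p true (L.sndSource k) = A (L.sndSource k) :=
    Function.update_of_ne (ne_of_mem_of_not_mem (L.sndSource_mem k) n4) ..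
  have hA1 : ∀ z ∈ vert k 0 0 l, A z.1 = A z.2 := fun z h => hA z (by
    rw [Layer.strands]; simp [hL, h])
  have hA2 : ∀ z ∈ V, A z.1 = A z.2 := fun z h => hA z (by
    rw [Layer.strands, hv]; simp [h])
  have hA3 : ∀ z ∈ L.pieceStrands k, A z.1 = A z.2 := fun z h => hA z (by
    rw [Layer.strands]; simp [h])
  obtain ⟨c1, c2⟩ := lcount_eq_vcount (b := b) hA1
  obtain ⟨c3, c4⟩ := lcount_eq_vcount (b := b) hA2
  obtain ⟨c5, c6⟩ := lcount_dom_cod (b := b) hA3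
  have hd : L.dom.take (l.length + P.dom.length + r.length) = l ++ P.dom ++ r := by
    rw [show L.dom = (l ++ P.dom ++ r) ++ (o :: r') by simp [hL, Layer.dom],
      List.take_left' (by simp [add_assoc])]
  have hcd : L.cod.take (l.length + P.cod.length + r.length) = l ++ P.cod ++ r := by
    rw [show L.cod = (l ++ P.cod ++ r) ++ (o :: r') by simp [hL, Layer.cod],
      List.take_left' (by simp [add_assoc])]
  generalize h1 : vcount b A (vert k 0 0 l) = s at *
  generalize h2 : vcount b A V = u at *
  generalize h3 : vcount b A V' = u' at *
  have c7 : lcount b A k 0 (l ++ P.dom ++ r) =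
      s + u + L.piece.bot b (A (L.fstSource k)) (A (L.sndSource k)) := by
    have c5' : lcount b A k l.length P.dom = _ := c5
    simp only [lcount_append, zero_add, List.length_append, c1, c5', c3]
    omega
  have c8 : lcount b A (k + 1) 0 (l ++ P.cod ++ r) =
      s + u + L.piece.top b (A (L.fstSource k)) (A (L.sndSource k)) := by
    have c6' : lcount b A (k + 1) l.length P.cod = _ := c6
    simp only [lcount_append, zero_add, List.length_append, c2, c6', c4]
    omega
  have e1 : slideLayer b A k L = slidePiece b L (A (L.fstSource k)) (A (L.sndSource k)) s *
      long (s + L.piece.bot b (A (L.fstSource k)) (A (L.sndSource k)) + (u + (b + u'))) := by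
    rw [slideLayer, hv, vcount_append, vcount_cons, hp, h1, h2, h3]
    rfl
  have e2 : slideLayer b (Function.update A p true) k L =
      slidePiece b L (A (L.fstSource k)) (A (L.sndSource k)) s *
      long (s + L.piece.bot b (A (L.fstSource k)) (A (L.sndSource k)) + (u + (b + u')) + 2) := by
    rw [slideLayer, hv, vcount_append, vcount_cons, vcount_update n1, vcount_update n2,
      vcount_update n3, hf, hs, Function.update_self, h1, h2, h3, mb, if_pos rfl]
    congr 2
    omega
  cases o
  · obtain ⟨rfl, rfl⟩ := Prod.mk.inj hz
    simp only [place, coupon, Layer.line, Nat.succ_ne_self, if_true, if_false, e1, e2, hd, hcd,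
      lcount_update_of_ne (p := (k + 1, _, _)) (k := k) (Nat.succ_ne_self k), c7, c8,
      Bool.false_eq_true]
    generalize hB : L.piece.bot b (A (L.fstSource k)) (A (L.sndSource k)) = B at *
    generalize hT : L.piece.top b (A (L.fstSource k)) (A (L.sndSource k)) = B' at *
    rw [show s + u + B + (b - c) = s + u + (b - c) + B by omega,
      show s + u + B' + (b - c) = s + u + (b - c) + B' by omega, mul_assoc, long_mul_cup (by omega), ← mul_assoc, ← hB, ← hT, slidePiece_mul_cup_right _ _ _ _ (by omega),
      mul_assoc]
  · obtain ⟨rfl, rfl⟩ := Prod.mk.inj hz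
    simp only [place, coupon, Layer.line, Nat.succ_ne_self, if_true, if_false, e1, e2, hd, hcd,
      lcount_update_of_ne (p := (k, _, _)) (k := k + 1) (Nat.succ_ne_self k).symm, c7, c8]
    generalize hB : L.piece.bot b (A (L.fstSource k)) (A (L.sndSource k)) = B at *
    generalize hT : L.piece.top b (A (L.fstSource k)) (A (L.sndSource k)) = B' at *
    rw [show s + u + B + c = s + u + c + B by omega,
      show s + u + B' + c = s + u + c + B' by omega, ← mul_assoc, ← hB,
      ← hT, cap_mul_slidePiece_right _ _ _ _ (by omega), mul_assoc, cap_mul_long (by omega), mul_assoc]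

end Place

end

section
open Diagram

/-! ### Sliding a coupon through a piece -/

variable {b c : ℕ} {A : Pt → Bool} {k : ℕ}

theorem slideLayer_update {L : Layer} {p : Pt} {v : Bool}
    (hp : p ∈ (L.pieceStrands k).map Prod.fst) : slideLayer b (Function.update A p v) k L =
      slidePiece b L (Function.update A p v (L.fstSource k)) (Function.update A p v (L.sndSource k))
        (vcount b A (vert k 0 0 L.left)) *
      long (vcount b A (vert k 0 0 L.left) +
        L.piece.bot b (Function.update A p v (L.fstSource k))
          (Function.update A p v (L.sndSource k)) + vcount b A (L.rightStrands k)) := by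
  have h1 := L.nodup_strands k
  rw [Layer.strands, List.map_append, List.nodup_append] at h1
  have h2 : p ∉ (vert k 0 0 L.left ++ L.rightStrands k).map Prod.fst := fun h =>
    h1.2.2 p h p hp rfl
  rw [List.map_append, List.mem_append, not_or] at h2
  rw [slideLayer, vcount_update h2.1, vcount_update h2.2]

theorem lcount_append_singleton (k : ℕ) (l : List Bool) (o : Bool) :
    lcount b A k 0 (l ++ [o]) = lcount b A k 0 l + mb b (A (k, l.length, o)) := by
  rw [lcount_append, zero_add]
  simp [lcount, linePts_cons, linePts_nil]

theorem slidePiece_cup (l r : List Bool) (o m n : Bool) (t : ℕ) :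
    slidePiece b ⟨l, .cup o, r⟩ m n t = cupsOp t (mb b m) := by
  simp [slidePiece, jonesNorm, Piece.cableOp]

theorem slidePiece_cap (l r : List Bool) (o m n : Bool) (t : ℕ) :
    slidePiece b ⟨l, .cap o, r⟩ m n t = capsOp t (mb b m) := by
  simp [slidePiece, jonesNorm, Piece.cableOp]

theorem take_left (l x r : List Bool) : (l ++ x ++ r).take l.length = l := by simp

theorem take_left_succ (l r : List Bool) (x y : Bool) :
    (l ++ [x, y] ++ r).take (l.length + 1) = l ++ [x] := by
  rw [show l ++ [x, y] ++ r = (l ++ [x]) ++ (y :: r) by simp]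
  exact List.take_left' (by simp)

/-! ### The coupon on a strand of the piece -/

section Piece

variable (hc : c ≤ b)
include hc

/-- Travelling down one leg and up the other turns the minimum of the coupon into a maximum; in the
operators this is a zigzag with one of the nested minima. -/
theorem place_cup (l r : List Bool) (o : Bool) {p y : Pt}
    (hz : (p, y) ∈ Layer.pieceStrands ⟨l, .cup o, r⟩ k)
    (hA : ∀ z ∈ Layer.strands ⟨l, .cup o, r⟩ k, A z.1 = A z.2) (hp : A p = false) :
    place b c (Function.update A p true) k ⟨l, .cup o, r⟩ y = place b c A k ⟨l, .cup o, r⟩ p := by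
  set L : Layer := ⟨l, .cup o, r⟩ with hL
  have hy : A y = false := (hA (p, y) (by rw [Layer.strands]; simp [hz])).symm.trans hp
  obtain ⟨c1, c2⟩ := lcount_eq_vcount (b := b) (A := A) (a := l) (k := k) (j := 0) (j' := 0)
    fun z h => hA z (by rw [Layer.strands]; simp [hL, h])
  have f1 : L.fstSource k = (orient o (k + 1, l.length + 1, !o) (k + 1, l.length, o)).1 := rfl
  have f2 : L.sndSource k = (orient o (k + 1, l.length + 1, !o) (k + 1, l.length, o)).1 := rfl
  rw [place, place, slideLayer_update (List.mem_map_of_mem (f := Prod.fst) hz), slideLayer, f1, f2]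
  have d3 : L.cod.take l.length = l := take_left ..
  have d4 : L.cod.take (l.length + 1) = l ++ [o] := take_left_succ ..
  have hb : ∀ m n, L.piece.bot b m n = 0 := fun _ _ => rfl
  have hl : L.left = l := rfl
  have hmt : mb b true = b + 2 := rfl
  have hmf : mb b false = b := rfl
  have hs : ∀ m n t, slidePiece b L m n t = cupsOp t (mb b m) := slidePiece_cup l r o
  simp only [hL, Layer.pieceStrands, List.mem_singleton] at hz
  generalize hN : vcount b A (L.rightStrands k) = N
  cases o
  · simp only [orient, Bool.false_eq_true, if_false, Bool.not_false, Prod.mk.injEq] at hz ⊢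
    obtain ⟨rfl, rfl⟩ : p = (k + 1, l.length, false) ∧ y = (k + 1, l.length + 1, true) := hz
    simp only [hs, Function.update_self, hp, Layer.line, Nat.succ_ne_self, if_false, d3, d4,
      lcount_append_singleton, c2, coupon, Bool.false_eq_true, hb, hl, hmf, hmt, if_true]
    rw [lcount_update_of_le (by simp), c2, ← mul_assoc, ← mul_assoc]
    -- The coupon arrives on the right legs, where pair `c` faces pair `b - c` of the left legs.
    have := cap_mul_cupsOp_snd (t := vcount b A (vert k 0 0 l)) (Nat.sub_le b c)
    rw [Nat.sub_sub_self hc] at this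
    rw [this]
  · simp only [orient, if_true, Bool.not_true, Prod.mk.injEq] at hz ⊢
    obtain ⟨rfl, rfl⟩ : p = (k + 1, l.length + 1, false) ∧ y = (k + 1, l.length, true) := hz
    simp only [hs, Function.update_self, hp, hy, Layer.line, Nat.succ_ne_self, if_false, d3, d4,
      lcount_append_singleton, c2, coupon, Bool.false_eq_true, hb, hl, hmf, hmt, if_true]
    rw [lcount_update_of_le (by simp), c2, ← mul_assoc, ← mul_assoc, cap_mul_cupsOp_fst hc]

theorem place_cap (l r : List Bool) (o : Bool) {p y : Pt}
    (hz : (p, y) ∈ Layer.pieceStrands ⟨l, .cap o, r⟩ k)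
    (hA : ∀ z ∈ Layer.strands ⟨l, .cap o, r⟩ k, A z.1 = A z.2) (hp : A p = false) :
    place b c (Function.update A p true) k ⟨l, .cap o, r⟩ y = place b c A k ⟨l, .cap o, r⟩ p := by
  set L : Layer := ⟨l, .cap o, r⟩ with hL
  have hy : A y = false := (hA (p, y) (by rw [Layer.strands]; simp [hz])).symm.trans hp
  obtain ⟨c1, c2⟩ := lcount_eq_vcount (b := b) (A := A) (a := l) (k := k) (j := 0) (j' := 0)
    fun z h => hA z (by rw [Layer.strands]; simp [hL, h])
  have f1 : L.fstSource k = (orient o (k, l.length, o) (k, l.length + 1, !o)).1 := rfl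
  have f2 : L.sndSource k = (orient o (k, l.length, o) (k, l.length + 1, !o)).1 := rfl
  rw [place, place, slideLayer_update (List.mem_map_of_mem (f := Prod.fst) hz), slideLayer, f1, f2]
  have d1 : L.dom.take l.length = l := take_left ..
  have d2 : L.dom.take (l.length + 1) = l ++ [o] := take_left_succ ..
  have hb : ∀ m n, L.piece.bot b m n = 2 * mb b m := fun _ _ => rfl
  have hl : L.left = l := rfl
  have hmt : mb b true = b + 2 := rfl
  have hmf : mb b false = b := rfl
  have hs : ∀ m n t, slidePiece b L m n t = capsOp t (mb b m) := slidePiece_cap l r o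
  simp only [hL, Layer.pieceStrands, List.mem_singleton] at hz
  generalize hN : vcount b A (L.rightStrands k) = N
  cases o
  · simp only [orient, Bool.false_eq_true, if_false, Bool.not_false, Prod.mk.injEq] at hz ⊢
    obtain ⟨rfl, rfl⟩ : p = (k, l.length + 1, true) ∧ y = (k, l.length, false) := hz
    simp only [hs, Function.update_self, hp, hy, Layer.line, if_false, d1, d2,
      lcount_append_singleton, c1, coupon, Bool.false_eq_true, hb, hl, hmf, hmt, if_true]
    rw [lcount_update_of_le (by simp), c1]
    generalize vcount b A (vert k 0 0 l) = s
    have := capsOp_mul_cup_fst (t := s) (Nat.sub_le b c)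
    rw [Nat.sub_sub_self hc] at this
    rw [show s + 2 * (b + 2) + N = s + 2 * b + N + 2 + 2 by omega, mul_assoc,
      long_mul_cup (by omega), ← mul_assoc, this, mul_assoc, mul_assoc, cap_mul_long (by omega)]
  · simp only [orient, if_true, Bool.not_true, Prod.mk.injEq] at hz ⊢
    obtain ⟨rfl, rfl⟩ : p = (k, l.length, true) ∧ y = (k, l.length + 1, false) := hz
    simp only [hs, Function.update_self, hp, Layer.line, if_false, d1, d2,
      lcount_append_singleton, c1, coupon, Bool.false_eq_true, hb, hl, hmf, hmt, if_true]
    rw [lcount_update_of_le (by simp), c1]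
    generalize vcount b A (vert k 0 0 l) = s
    rw [show s + 2 * (b + 2) + N = s + 2 * b + N + 2 + 2 by omega, mul_assoc,
      long_mul_cup (by omega), ← mul_assoc, capsOp_mul_cup_snd hc, mul_assoc, mul_assoc,
      cap_mul_long (by omega)]

/-- There are four cases, for the strand carrying the coupon and its direction. Upward strands use
the contraction form of the slide and downward strands the insertion form; the other strand keeps
its multiplicity. -/
theorem place_cross (l r : List Bool) (a a' f : Bool) {p y : Pt}
    (hz : (p, y) ∈ Layer.pieceStrands ⟨l, .cross a a' f, r⟩ k)
    (hA : ∀ z ∈ Layer.strands ⟨l, .cross a a' f, r⟩ k, A z.1 = A z.2) (hp : A p = false) :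
    place b c (Function.update A p true) k ⟨l, .cross a a' f, r⟩ y =
      place b c A k ⟨l, .cross a a' f, r⟩ p := by
  set L : Layer := ⟨l, .cross a a' f, r⟩ with hL
  have hy : A y = false := (hA (p, y) (by rw [Layer.strands]; simp [hz])).symm.trans hp
  obtain ⟨c1, c2⟩ := lcount_eq_vcount (b := b) (A := A) (a := l) (k := k) (j := 0) (j' := 0)
    fun z h => hA z (by rw [Layer.strands]; simp [hL, h])
  have h1 := hA (orient a (k, l.length, a) (k + 1, l.length + 1, a)) (by
    rw [Layer.strands]; simp [hL, Layer.pieceStrands])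
  have h2 := hA (orient a' (k, l.length + 1, a') (k + 1, l.length, a')) (by
    rw [Layer.strands]; simp [hL, Layer.pieceStrands])
  have f1 : L.fstSource k = (orient a (k, l.length, a) (k + 1, l.length + 1, a)).1 := rfl
  have f2 : L.sndSource k = (orient a' (k, l.length + 1, a') (k + 1, l.length, a')).1 := rfl
  rw [place, place, slideLayer_update (List.mem_map_of_mem (f := Prod.fst) hz), slideLayer, f1, f2]
  have d1 : L.dom.take l.length = l := take_left ..
  have d2 : L.dom.take (l.length + 1) = l ++ [a] := take_left_succ ..
  have d3 : L.cod.take l.length = l := take_left ..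
  have d4 : L.cod.take (l.length + 1) = l ++ [a'] := take_left_succ ..
  have hb : ∀ m n, L.piece.bot b m n = mb b m + mb b n := fun _ _ => rfl
  have hl : L.left = l := rfl
  have hmt : mb b true = b + 2 := rfl
  have hmf : mb b false = b := rfl
  simp only [hL, Layer.pieceStrands, List.mem_cons, List.not_mem_nil, or_false] at hz
  generalize hN : vcount b A (L.rightStrands k) = N
  rcases hz with hz | hz
  · cases a
    · obtain ⟨rfl, rfl⟩ := Prod.mk.inj hz
      have e1 : Function.update A (k + 1, l.length + 1, false) true
          (orient a' (k, l.length + 1, a') (k + 1, l.length, a')).1 =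
          A (orient a' (k, l.length + 1, a') (k + 1, l.length, a')).1 :=
        Function.update_of_ne (by cases a' <;> simp [orient]) ..
      have e2 : A (orient a' (k, l.length + 1, a') (k + 1, l.length, a')).1 =
          A (k + 1, l.length, a') := by
        cases a'
        · rfl
        · exact h2
      simp only [orient, Bool.false_eq_true, if_false] at e1 e2 hp ⊢
      simp only [e1, Function.update_self, hp, Layer.line, Nat.succ_ne_self, if_true, if_false, d1,
        d4, lcount_append_singleton, e2, coupon, Bool.false_eq_true, hb, hl, hmf, hmt, c2]
      rw [lcount_update_of_ne (by simp), c1]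
      generalize vcount b A (vert k 0 0 l) = s
      generalize A (k + 1, l.length, a') = n
      rw [show s + (b + 2 + mb b n) + N = s + (b + mb b n) + N + 2 by omega, mul_assoc,
        long_mul_cup (by omega), ← mul_assoc, hL, slidePiece_mul_cup_fst (Nat.sub_le b c), mul_assoc]
    · obtain ⟨rfl, rfl⟩ := Prod.mk.inj hz
      have e1 : Function.update A (k, l.length, true) true
          (orient a' (k, l.length + 1, a') (k + 1, l.length, a')).1 =
          A (orient a' (k, l.length + 1, a') (k + 1, l.length, a')).1 :=
        Function.update_of_ne (by cases a' <;> simp [orient]) ..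
      have e2 : A (orient a' (k, l.length + 1, a') (k + 1, l.length, a')).1 =
          A (k + 1, l.length, a') := by
        cases a'
        · rfl
        · exact h2
      simp only [orient, if_true] at e1 e2 hp ⊢
      simp only [e1, Function.update_self, hp, Layer.line, Nat.succ_ne_self, if_true, if_false, d1,
        d4, lcount_append_singleton, e2, coupon, hb, hl, hmf, hmt, c1]
      rw [lcount_update_of_ne (by simp), Function.update_of_ne (by simp), c2]
      generalize vcount b A (vert k 0 0 l) = s
      generalize A (k + 1, l.length, a') = n
      rw [show s + (b + 2 + mb b n) + N = s + (b + mb b n) + N + 2 by omega, ← mul_assoc, hL,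
        cap_mul_slidePiece_fst hc _ _ _ _ _ _ (by omega), mul_assoc, mul_assoc,
        cap_mul_long (by omega)]
  · cases a'
    · obtain ⟨rfl, rfl⟩ := Prod.mk.inj hz
      have e1 : Function.update A (k + 1, l.length, false) true
          (orient a (k, l.length, a) (k + 1, l.length + 1, a)).1 =
          A (orient a (k, l.length, a) (k + 1, l.length + 1, a)).1 :=
        Function.update_of_ne (by cases a <;> simp [orient]) ..
      have e2 : A (orient a (k, l.length, a) (k + 1, l.length + 1, a)).1 = A (k, l.length, a) := by
        cases a
        · exact h1
        · rfl
      simp only [orient, Bool.false_eq_true, if_false] at e1 e2 hp ⊢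
      simp only [e1, Function.update_self, hp, Layer.line, Nat.succ_ne_self, if_true, if_false, d2,
        d3, lcount_append_singleton, e2, coupon, Bool.false_eq_true, hb, hl, hmf, hmt, c2]
      rw [lcount_update_of_ne (by simp), Function.update_of_ne (by simp), c1]
      generalize vcount b A (vert k 0 0 l) = s
      generalize A (k, l.length, a) = m
      rw [show s + (mb b m + (b + 2)) + N = s + (mb b m + b) + N + 2 by omega, mul_assoc,
        long_mul_cup (by omega), hL, slidePiece_mul_cup_snd (Nat.sub_le b c) _ _ _ _ _ _ (by omega)]
    · obtain ⟨rfl, rfl⟩ := Prod.mk.inj hz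
      have e1 : Function.update A (k, l.length + 1, true) true
          (orient a (k, l.length, a) (k + 1, l.length + 1, a)).1 =
          A (orient a (k, l.length, a) (k + 1, l.length + 1, a)).1 :=
        Function.update_of_ne (by cases a <;> simp [orient]) ..
      have e2 : A (orient a (k, l.length, a) (k + 1, l.length + 1, a)).1 = A (k, l.length, a) := by
        cases a
        · exact h1
        · rfl
      simp only [orient, if_true] at e1 e2 hp ⊢
      simp only [e1, Function.update_self, hp, Layer.line, Nat.succ_ne_self, if_true, if_false, d2,
        d3, lcount_append_singleton, e2, coupon, hb, hl, hmf, hmt, c1]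
      rw [lcount_update_of_ne (by simp), c2]
      generalize vcount b A (vert k 0 0 l) = s
      generalize A (k, l.length, a) = m
      rw [show s + (mb b m + (b + 2)) + N = s + (mb b m + b) + N + 2 by omega, ← mul_assoc, hL,
        cap_mul_slidePiece_snd hc, mul_assoc, mul_assoc, cap_mul_long (by omega)]

end Piece

theorem exists_of_mem_vert {k j j' : ℕ} {a : List Bool} {z : Pt × Pt} (h : z ∈ vert k j j' a) :
    ∃ a₁ o a₂, a = a₁ ++ o :: a₂ ∧ z = orient o (k, j + a₁.length, o) (k + 1, j' + a₁.length, o) := by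
  induction a generalizing j j' with
  | nil => simp [vert] at h
  | cons o a ih =>
    rw [vert_cons, List.mem_cons] at h
    rcases h with rfl | h
    · exact ⟨[], o, a, rfl, rfl⟩
    · obtain ⟨a₁, o', a₂, rfl, h2⟩ := ih h
      refine ⟨o :: a₁, o', a₂, rfl, ?_⟩
      rw [h2, List.length_cons, add_assoc, add_assoc, add_comm 1]

/-- A coupon can be slid along a strand of a layer. -/
theorem place_update (hc : c ≤ b) {L : Layer} {p y : Pt} (hz : (p, y) ∈ L.strands k)
    (hA : ∀ z ∈ L.strands k, A z.1 = A z.2) (hp : A p = false) :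
    place b c (Function.update A p true) k L y = place b c A k L p := by
  obtain ⟨l, P, r⟩ := L
  have hz' := hz
  rw [Layer.strands, List.mem_append, List.mem_append] at hz'
  rcases hz' with (h | h) | h
  · obtain ⟨l1, o, l2, rfl, he⟩ := exists_of_mem_vert h
    rw [zero_add] at he
    exact place_left hc l1 l2 r P o he hA hp
  · obtain ⟨r1, o, r2, rfl, he⟩ := exists_of_mem_vert h
    exact place_right hc l r1 r2 P o he hA hp
  · cases P
    · exact place_cup hc _ _ _ h hA hp
    · exact place_cap hc _ _ _ h hA hp
    · exact place_cross hc _ _ _ _ _ h hA hp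

end

section
open Diagram

/-! ### Sliding a coupon along a string link -/

noncomputable def slideOps (b : ℕ) (A : Pt → Bool) : ℕ → List Layer → Op
  | _, [] => 1
  | k, L :: Ls => slideOps b A (k + 1) Ls * slideLayer b A k L

variable {b c : ℕ} {A : Pt → Bool}

theorem slideOps_append (k : ℕ) (Ls Ls' : List Layer) : slideOps b A k (Ls ++ Ls') =
    slideOps b A (k + Ls.length) Ls' * slideOps b A k Ls := by
  induction Ls generalizing k with
  | nil => simp [slideOps]
  | cons L Ls ih =>
    rw [List.cons_append, slideOps, ih, slideOps, List.length_cons, mul_assoc,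
      show k + 1 + Ls.length = k + (Ls.length + 1) by omega]

theorem slideOps_congr {A' : Pt → Bool} {k : ℕ} {Ls : List Layer}
    (h : ∀ pre L post, Ls = pre ++ L :: post → ∀ z ∈ L.strands (k + pre.length), A z.1 = A' z.1) :
    slideOps b A k Ls = slideOps b A' k Ls := by
  induction Ls generalizing k with
  | nil => rfl
  | cons L Ls ih =>
    rw [slideOps, slideOps, ih fun pre L' post e z hz => h (L :: pre) L' post (by rw [e]; rfl) z (by
        rw [List.length_cons, show k + (pre.length + 1) = k + 1 + pre.length by omega]
        exact hz),
      slideLayer_congr]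
    intro q hq
    obtain ⟨z, hz, rfl⟩ := List.mem_map.mp hq
    exact h [] L Ls rfl z hz

theorem Layer.line_of_mem_strands {L : Layer} {k : ℕ} {z : Pt × Pt} (h : z ∈ L.strands k) :
    (z.1.2.2 = true ∧ z.1.1 = k ∨ z.1.2.2 = false ∧ z.1.1 = k + 1) ∧
      (z.2.2.2 = true ∧ z.2.1 = k + 1 ∨ z.2.2.2 = false ∧ z.2.1 = k) := by
  have hv : ∀ {j j' : ℕ} {a : List Bool}, z ∈ vert k j j' a →
      (z.1.2.2 = true ∧ z.1.1 = k ∨ z.1.2.2 = false ∧ z.1.1 = k + 1) ∧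
      (z.2.2.2 = true ∧ z.2.1 = k + 1 ∨ z.2.2.2 = false ∧ z.2.1 = k) := by
    intro j j' a h
    obtain ⟨a₁, o, a₂, -, rfl⟩ := exists_of_mem_vert h
    cases o <;> simp [orient]
  rw [Layer.strands, List.mem_append, List.mem_append] at h
  rcases h with (h | h) | h
  · exact hv h
  · exact hv h
  · obtain ⟨l, p, r⟩ := L
    rcases p with o | o | ⟨a, a', f⟩
    · obtain rfl := List.mem_singleton.mp h
      cases o <;> simp [orient]
    · obtain rfl := List.mem_singleton.mp h
      cases o <;> simp [orient]
    · simp only [Layer.pieceStrands, List.mem_cons, List.not_mem_nil, or_false] at h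
      rcases h with rfl | rfl
      · cases a <;> simp [orient]
      · cases a' <;> simp [orient]

theorem mem_steps_iff (k : ℕ) (Ls : List Layer) (z : Pt × Pt) :
    (z ∈ linksFrom k Ls ∨ ∃ x ∈ crossingsFrom k Ls,
      z = (x.overIn, x.overOut) ∨ z = (x.underIn, x.underOut)) ↔
    ∃ pre L post, Ls = pre ++ L :: post ∧ z ∈ L.strands (k + pre.length) := by
  induction Ls generalizing k with
  | nil => simp [linksFrom, crossingsFrom]
  | cons L Ls ih =>
    have h1 := L.mem_strands_iff k z
    have h2 := ih (k + 1)
    rw [linksFrom_cons, crossingsFrom_cons]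
    have h3 : (∃ pre L' post, L :: Ls = pre ++ L' :: post ∧ z ∈ L'.strands (k + pre.length)) ↔
        z ∈ L.strands k ∨ ∃ pre L' post, Ls = pre ++ L' :: post ∧
          z ∈ L'.strands (k + 1 + pre.length) := by
      constructor
      · rintro ⟨_ | ⟨L₁, pre⟩, L', post, e, hz⟩
        · obtain ⟨rfl, rfl⟩ := List.cons.inj e
          exact Or.inl hz
        · obtain ⟨rfl, rfl⟩ := List.cons.inj e
          refine Or.inr ⟨pre, L', post, rfl, ?_⟩
          rwa [List.length_cons, show k + (pre.length + 1) = k + 1 + pre.length by omega] at hz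
      · rintro (hz | ⟨pre, L', post, rfl, hz⟩)
        · exact ⟨[], L, Ls, rfl, hz⟩
        · refine ⟨L :: pre, L', post, rfl, ?_⟩
          rwa [List.length_cons, show k + (pre.length + 1) = k + 1 + pre.length by omega]
    rw [h3, ← h2, h1]
    simp only [List.mem_append, or_and_right, exists_or]
    exact or_or_or_comm ..

theorem strandStep_iff {D : Diagram} {x y : Pt} : D.StrandStep x y ↔
    ∃ pre L post, D.layers = pre ++ L :: post ∧ (x, y) ∈ L.strands pre.length := by
  have := mem_steps_iff 0 D.layers (x, y)
  simp only [zero_add] at this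
  exact this

/-- The directions of the strands on a line. -/
def lineAt (D : Diagram) (j : ℕ) : List Bool := ((D.bottom :: D.layers.map Layer.cod)[j]?).getD []

theorem lineAt_eq {D : Diagram} {e : List Bool} (h : Composable D.bottom D.layers e)
    {pre post : List Layer} {L : Layer} (hD : D.layers = pre ++ L :: post) :
    lineAt D pre.length = L.dom ∧ lineAt D (pre.length + 1) = L.cod := by
  obtain ⟨a, Ls⟩ := D
  simp only at h hD
  subst hD
  refine ⟨?_, by simp [lineAt]⟩
  induction pre generalizing a with
  | nil => simpa [lineAt] using h.1.symm
  | cons L' pre ih =>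
    have := ih _ h.2
    simpa [lineAt] using this

/-- The operator of a string link with a coupon at the point `p`. -/
noncomputable def couponOp (b c : ℕ) (D : Diagram) (A : Pt → Bool) (p : Pt) : Op :=
  slideOps b A p.1 (D.layers.drop p.1) *
    coupon b c p (lcount b A p.1 0 ((lineAt D p.1).take p.2.1)) *
    slideOps b A 0 (D.layers.take p.1)

theorem couponOp_eq_place {D : Diagram} {e : List Bool} (h : Composable D.bottom D.layers e)
    {pre post : List Layer} {L : Layer} (hD : D.layers = pre ++ L :: post) {p : Pt}
    (hp : p.1 = pre.length ∨ p.1 = pre.length + 1) : couponOp b c D A p =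
      slideOps b A (pre.length + 1) post * place b c A pre.length L p * slideOps b A 0 pre := by
  obtain ⟨h1, h2⟩ := lineAt_eq h hD
  rw [couponOp, hD, place, Layer.line]
  rcases hp with hp | hp
  · rw [hp, if_pos rfl, if_pos rfl, h1, List.drop_left, List.take_left, slideOps, mul_assoc,
      mul_assoc, mul_assoc, mul_assoc]
  · rw [hp, if_neg (Nat.succ_ne_self _), if_neg (Nat.succ_ne_self _), h2,
      show pre ++ L :: post = (pre ++ [L]) ++ post by simp, List.drop_left' (by simp),
      List.take_left' (by simp), slideOps_append, zero_add, slideOps, slideOps, one_mul, mul_assoc,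
      mul_assoc, mul_assoc]

/-- A point is a source in one layer only, so the operators of the layers below and above are
unaffected. -/
theorem slideOps_update {k : ℕ} {Ls : List Layer} {p : Pt} {v : Bool} {j : ℕ}
    (hp : p.2.2 = true ∧ p.1 = j ∨ p.2.2 = false ∧ p.1 = j + 1) (hj : j < k ∨ k + Ls.length ≤ j) :
    slideOps b (Function.update A p v) k Ls = slideOps b A k Ls := by
  refine slideOps_congr fun pre L post e z hz => Function.update_of_ne ?_ ..
  rintro rfl
  have h1 := (Layer.line_of_mem_strands hz).1
  have h2 : Ls.length = pre.length + (post.length + 1) := by rw [e]; simp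
  have : j = k + pre.length := by
    rcases hp with ⟨hp, hp'⟩ | ⟨hp, hp'⟩ <;> rcases h1 with ⟨h1, h1'⟩ | ⟨h1, h1'⟩ <;> simp_all
  omega

/-- One step of the journey: the layer containing the step changes by `place_update`, everything
else stays. -/
theorem couponOp_update (hc : c ≤ b) {D : Diagram} {e : List Bool}
    (h : Composable D.bottom D.layers e) {pre post : List Layer} {L : Layer}
    (hD : D.layers = pre ++ L :: post) {p y : Pt} (hz : (p, y) ∈ L.strands pre.length)
    (hA : ∀ z ∈ L.strands pre.length, A z.1 = A z.2) (hp : A p = false) :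
    couponOp b c D (Function.update A p true) y = couponOp b c D A p := by
  obtain ⟨h1, h2⟩ := Layer.line_of_mem_strands hz
  rw [couponOp_eq_place h hD (by tauto), couponOp_eq_place h hD (by tauto),
    place_update hc hz hA hp, slideOps_update h1 (Or.inl (Nat.lt_succ_self _)),
    slideOps_update h1 (Or.inr (by rw [zero_add]))]

/-- Successors and predecessors along the strand are unique, since sources and targets are distinct.
-/
theorem strandStep_unique {D : Diagram} {e : List Bool} (h : Composable D.bottom D.layers e)
    {x x' y y' : Pt} (h1 : D.StrandStep x y) (h2 : D.StrandStep x' y') : x = x' ↔ y = y' := by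
  obtain ⟨i1, i2, i3⟩ := unique_of_nodup (nodup_ins h)
  obtain ⟨o1, o2, o3⟩ := unique_of_nodup (nodup_outs h)
  rcases h1 with h1 | ⟨z, hz, h1 | h1⟩ <;> rcases h2 with h2 | ⟨z', hz', h2 | h2⟩
  all_goals try simp only [Prod.mk.injEq] at h1
  all_goals try simp only [Prod.mk.injEq] at h2
  · exact ⟨fun e => (Prod.mk.inj (i1 _ h1 _ h2 e)).2, fun e => (Prod.mk.inj (o1 _ h1 _ h2 e)).1⟩
  · rw [h2.1, h2.2]
    exact iff_of_false (i2 _ h1 _ hz').1 (o2 _ h1 _ hz').1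
  · rw [h2.1, h2.2]
    exact iff_of_false (i2 _ h1 _ hz').2 (o2 _ h1 _ hz').2
  · rw [h1.1, h1.2]
    exact iff_of_false (i2 _ h2 _ hz).1.symm (o2 _ h2 _ hz).1.symm
  · rw [h1.1, h1.2, h2.1, h2.2]
    exact ⟨fun e => by rw [(i3 z hz z' hz').1 e], fun e => by rw [(o3 z hz z' hz').1 e]⟩
  · rw [h1.1, h1.2, h2.1, h2.2]
    exact iff_of_false (i3 z hz z' hz').2.2 (o3 z hz z' hz').2.2
  · rw [h1.1, h1.2]
    exact iff_of_false (i2 _ h2 _ hz).2.symm (o2 _ h2 _ hz).2.symm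
  · rw [h1.1, h1.2, h2.1, h2.2]
    exact iff_of_false (i3 z' hz' z hz).2.2.symm (o3 z' hz' z hz).2.2.symm
  · rw [h1.1, h1.2, h2.1, h2.2]
    exact ⟨fun e => by rw [(i3 z hz z' hz').2.1 e], fun e => by rw [(o3 z hz z' hz').2.1 e]⟩

theorem strandStep_mem {D : Diagram} {x y : Pt} (h : D.StrandStep x y) :
    x ∈ insOf D.links D.crossings ∧ y ∈ outsOf D.links D.crossings := by
  rcases h with h | ⟨z, hz, h | h⟩
  · exact ⟨List.mem_append_left _ (List.mem_map_of_mem h),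
      List.mem_append_left _ (List.mem_map_of_mem h)⟩
  all_goals
    obtain ⟨rfl, rfl⟩ := Prod.mk.inj h
    exact ⟨List.mem_append_right _ (List.mem_flatMap.mpr ⟨z, hz, by simp⟩),
      List.mem_append_right _ (List.mem_flatMap.mpr ⟨z, hz, by simp⟩)⟩

/-! ### The coupon travels from the bottom to the top -/

section StringLink

variable {D : Diagram} (hD : D.IsStringLink)
include hD

theorem not_strandStep_bottom (x : Pt) : ¬ D.StrandStep x (0, 0, true) := by
  intro h
  have ho := (strandStep_mem h).2
  refine (mem_outs_iff (d := 1) (d' := 1) hD.1 hD.2.1 (mem_points_of_mem_outs hD.2.1 ho)).mp ho ?_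
  rw [hD.1]
  simp [linePts]

theorem not_strandStep_top (x : Pt) : ¬ D.StrandStep (D.layers.length, 0, true) x := by
  intro h
  have ho := (strandStep_mem h).1
  refine (mem_ins_iff (d := 1) (d' := 1) hD.1 hD.2.1 (mem_points_of_mem_ins hD.2.1 ho)).mp ho ?_
  simp [linePts]

/-- Induction along the strand, with `A` marking the points already passed. The last three clauses
say that the marked points together with `p` are closed under predecessors, that a marked point is
followed by a marked point or by `p`, and that the start is covered; they ensure that `A` is
constant along each strand of the layer about to be crossed. -/
theorem exists_couponOp_eq (hc : c ≤ b) {p : Pt}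
    (hp : Relation.ReflTransGen D.StrandStep (0, 0, true) p) :
    ∃ A : Pt → Bool, A p = false ∧
      couponOp b c D A p = couponOp b c D (fun _ => false) (0, 0, true) ∧
      (∀ x y, D.StrandStep x y → A y = true ∨ y = p → A x = true) ∧
      (∀ x y, D.StrandStep x y → A x = true → A y = true ∨ y = p) ∧
      (A (0, 0, true) = true ∨ (0, 0, true) = p) := by
  induction hp with
  | refl =>
    refine ⟨fun _ => false, rfl, rfl, ?_, by simp, Or.inr rfl⟩
    rintro x y h (h' | rfl)
    · simp at h'
    · exact absurd h (not_strandStep_bottom hD x)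
  | @tail p y _ hpy ih =>
    obtain ⟨A, h1, h2, h3, h4, h5⟩ := ih
    obtain ⟨pre, L, post, e, hz⟩ := strandStep_iff.mp hpy
    have hl := Layer.line_of_mem_strands hz
    have hne : y ≠ p := by
      rintro rfl
      rcases hl with ⟨⟨h, h'⟩ | ⟨h, h'⟩, ⟨h'', h'''⟩ | ⟨h'', h'''⟩⟩ <;> simp_all
    have hAy : A y = false := by
      by_contra h
      rw [Bool.not_eq_false] at h
      rw [h3 p y hpy (Or.inl h)] at h1
      simp at h1
    have hcon : ∀ z ∈ L.strands pre.length, A z.1 = A z.2 := by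
      rintro ⟨x, w⟩ hxw
      have hs : D.StrandStep x w := strandStep_iff.mpr ⟨pre, L, post, e, hxw⟩
      have hw : w ≠ p := by
        rintro rfl
        have := (Layer.line_of_mem_strands hxw).2
        rcases hl.1 with ⟨h, h'⟩ | ⟨h, h'⟩ <;> rcases this with ⟨h'', h'''⟩ | ⟨h'', h'''⟩ <;>
          simp_all
      rw [Bool.eq_iff_iff]
      exact ⟨fun h => (h4 x w hs h).resolve_right hw, fun h => h3 x w hs (Or.inl h)⟩
    have hup : ∀ q, Function.update A p true q = true ↔ A q = true ∨ q = p := by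
      intro q
      by_cases hq : q = p
      · simp [hq]
      · simp [hq]
    refine ⟨Function.update A p true, ?_, ?_, ?_, ?_, ?_⟩
    · rw [Function.update_of_ne hne, hAy]
    · rw [couponOp_update hc hD.2.1 e hz hcon h1, h2]
    · rintro x w hs (h | rfl)
      · rw [hup] at h ⊢
        exact Or.inl (h3 x w hs h)
      · rw [hup]
        exact Or.inr ((strandStep_unique hD.2.1 hs hpy).mpr rfl)
    · intro x w hs h
      rw [hup] at h ⊢
      rcases h with h | rfl
      · exact Or.inl (h4 x w hs h)
      · exact Or.inr ((strandStep_unique hD.2.1 hs hpy).mp rfl)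
    · rw [hup]
      exact Or.inl h5

/-- The coupon starts as a contraction below the diagram with all strands `b`-fold and arrives as
the same contraction above it. Since the diagram is a single strand, all strands are then `(b +
2)`-fold. -/
theorem cap_mul_slideOps (hc : c ≤ b) :
    cap c * slideOps b (fun _ => true) 0 D.layers =
      slideOps b (fun _ => false) 0 D.layers * cap c := by
  have ht : (D.layers.length, 0, true) ∈ D.points :=
    linePts_subset_points (d := 1) (d' := 1) hD.1 hD.2.1 (Or.inr (by simp [linePts]))
  obtain ⟨A, h1, h2, h3, h4, h5⟩ := exists_couponOp_eq hD hc (hD.2.2 _ ht)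
  -- Every point reachable from the bottom has been passed, except for the final one, where no
  -- strand starts.
  have hA : ∀ q, Relation.ReflTransGen D.StrandStep (0, 0, true) q →
      A q = true ∨ q = (D.layers.length, 0, true) := by
    intro q hq
    induction hq with
    | refl => exact h5
    | tail _ hs ih =>
      rcases ih with ih | rfl
      · exact h4 _ _ hs ih
      · exact absurd hs (not_strandStep_top hD _)
  have hs : slideOps b A 0 D.layers = slideOps b (fun _ => true) 0 D.layers := by
    refine slideOps_congr fun pre L post e z hz => ?_
    have hst : D.StrandStep z.1 z.2 := strandStep_iff.mpr ⟨pre, L, post, e, by simpa using hz⟩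
    refine (hA _ (hD.2.2 _ (mem_points_of_mem_ins hD.2.1 (strandStep_mem hst).1))).resolve_right ?_
    intro h
    rw [h] at hst
    exact not_strandStep_top hD _ hst
  simp only [couponOp, List.drop_length, List.take_length, slideOps, List.take_zero, one_mul,
    List.drop_zero, mul_one, hs, coupon, if_true, lcount, linePts_nil, List.map_nil, List.sum_nil,
    zero_add] at h2
  exact h2

end StringLink

end

section
open Diagram

/-! ### Cables of string links commute with contractions -/

theorem length_vert (k j j' : ℕ) (a : List Bool) : (vert k j j' a).length = a.length := by
  simp [vert]

theorem vcount_const (b : ℕ) (x : Bool) (zs : List (Pt × Pt)) :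
    vcount b (fun _ => x) zs = mb b x * zs.length := by
  simp [vcount, mul_comm]

theorem jonesOp_mem_homog {a e : List Bool} {Ls : List Layer} (h : Composable a Ls e) {v : Vec}
    (hv : v ∈ homog a.length) : jonesOp Ls v ∈ homog e.length :=
  (genChain_of_composable h (by simp)).mem_homog hv

theorem slideLayer_const (b : ℕ) (x : Bool) (k : ℕ) (L : Layer) {v : Vec}
    (hv : v ∈ homog (mb b x * L.dom.length)) : slideLayer b (fun _ => x) k L v =
      jonesNorm L ^ normExp b x x • jonesOp (cableLayer (mb b x) L) v := by
  have h : vcount b (fun _ => x) (vert k 0 0 L.left) + L.piece.bot b x x +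
      vcount b (fun _ => x) (L.rightStrands k) = mb b x * L.dom.length := by
    rw [vcount_const, vcount_const, length_vert, Layer.rightStrands, length_vert]
    obtain ⟨l, p, r⟩ := L
    cases p <;> simp [Layer.dom, Piece.dom, Piece.bot] <;> ring
  rw [slideLayer, h, Module.End.mul_apply, long_eq_self hv le_rfl, vcount_const, length_vert,
    jonesOp_cableLayer, slidePiece, LinearMap.smul_apply]

theorem slideOps_const {b : ℕ} {x : Bool} {a e : List Bool} {Ls : List Layer}
    (h : Composable a Ls e) (k : ℕ) {v : Vec} (hv : v ∈ homog (mb b x * a.length)) :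
    slideOps b (fun _ => x) k Ls v = (Ls.map fun L => jonesNorm L ^ normExp b x x).prod •
      jonesOp (Ls.flatMap (cableLayer (mb b x))) v := by
  induction Ls generalizing a k v with
  | nil => simp [slideOps, jonesOp_nil]
  | cons L Ls ih =>
    obtain ⟨rfl, h⟩ := h
    rw [← length_cableBoundary] at hv
    have hv' := jonesOp_mem_homog (composable_cableLayer (mb b x) L) hv
    rw [length_cableBoundary] at hv hv'
    rw [slideOps, Module.End.mul_apply, slideLayer_const b x k L hv, map_smul, ih h _ hv',
      List.flatMap_cons, jonesOp_append, Module.End.mul_apply, List.map_cons, List.prod_cons,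
      smul_smul]

/-- The total cost of the journey. This is the framing factor, and the only place where writhe zero
matters. -/
theorem prod_jonesNorm (b k : ℕ) (Ls : List Layer) :
    (Ls.map fun L => jonesNorm L ^ normExp b true true).prod =
      T (6 * (b + 1) * ((crossingsFrom k Ls).map Crossing.sign).sum) := by
  induction Ls generalizing k with
  | nil => simp [crossingsFrom]
  | cons L Ls ih =>
    have h : jonesNorm L ^ normExp b true true =
        T (6 * (b + 1) * ((L.crossings k).map Crossing.sign).sum) := by
      obtain ⟨l, p, r⟩ := L
      rcases p with o | o | ⟨a, a', f⟩
      · simp [jonesNorm, Layer.crossings]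
      · simp [jonesNorm, Layer.crossings]
      · simp only [jonesNorm, Layer.crossings, normExp, List.map_cons, List.map_nil, List.sum_cons,
          List.sum_nil, add_zero, Crossing.sign]
        rw [Even.neg_pow ⟨b + 1, by ring⟩, T_pow]
        congr 1
        push_cast
        ring
    rw [List.map_cons, List.prod_cons, ih (k + 1), h, crossingsFrom_cons, List.map_append,
      List.sum_append, ← T_add, ← mul_add]

/-- For writhe zero, the operators of the cables are compatible with contractions. -/
theorem cap_jonesOp_cable {D : Diagram} (hD : D.IsStringLink) (hw : D.writhe = 0) {n i : ℕ}
    (hi : i ≤ n) {v : Vec} (hv : v ∈ homog (n + 2)) :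
    cap i (jonesOp (cable (n + 2) D).layers v) = jonesOp (cable n D).layers (cap i v) := by
  have h := LinearMap.congr_fun (cap_mul_slideOps hD hi) v
  have hl : D.bottom.length = 1 := by rw [hD.1]; rfl
  have hw' : ((crossingsFrom 0 D.layers).map Crossing.sign).sum = 0 := hw
  simp only [Module.End.mul_apply] at h
  rw [slideOps_const hD.2.1 0 (by simpa [mb, hl] using hv), prod_jonesNorm n 0, hw', mul_zero,
    T_zero, one_smul, slideOps_const hD.2.1 0 (by simpa [mb, hl] using cap_mem_homog hv i)] at h
  simpa [mb, normExp, cable] using h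

end

section
open Diagram

/-! ### Closures as traces -/

/-- The coordinates of a vector with a given end of the word. -/
def sect (y : List Bool) (v : Vec) : Vec := fun u => v (u ++ y)

theorem sect_mem_homog {n : ℕ} {y : List Bool} {v : Vec} (hv : v ∈ homog (n + y.length)) :
    sect y v ∈ homog n := fun u hu => hv _ (by simpa using hu)

theorem exists_append_of_le {i : ℕ} {u : List Bool} (h : i ≤ u.length) :
    ∃ l r, u = l ++ r ∧ i = l.length :=
  ⟨u.take i, u.drop i, (List.take_append_drop i u).symm, by simpa using h⟩

theorem sect_cap {n i : ℕ} {y : List Bool} {v : Vec} (hv : v ∈ homog (n + 2 + y.length))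
    (hi : i ≤ n) : sect y (cap i v) = cap i (sect y v) := by
  have h1 : sect y (cap i v) ∈ homog n := sect_mem_homog (cap_mem_homog (by
    rwa [add_right_comm] at hv) i)
  have h2 : cap i (sect y v) ∈ homog n := cap_mem_homog (sect_mem_homog hv) i
  ext1 u
  by_cases hu : u.length = n
  · obtain ⟨l, r, rfl, rfl⟩ := exists_append_of_le (hi.trans_eq hu.symm)
    rw [cap_apply_append, sect, List.append_assoc, cap_apply_append]
    simp [sect]
  · rw [h1 u hu, h2 u hu]

theorem sect_cup {n i : ℕ} {y : List Bool} {v : Vec} (hv : v ∈ homog (n + y.length))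
    (hi : i ≤ n) : sect y (cup i v) = cup i (sect y v) := by
  have h1 : sect y (cup i v) ∈ homog (n + 2) := sect_mem_homog (by
    rw [add_right_comm]; exact cup_mem_homog hv i)
  have h2 : cup i (sect y v) ∈ homog (n + 2) := cup_mem_homog (sect_mem_homog hv) i
  ext1 u
  by_cases hu : u.length = n + 2
  · obtain ⟨l, r, rfl, rfl⟩ := exists_append_of_le (i := i) (u := u) (by omega)
    rcases r with _ | ⟨a, _ | ⟨b, r⟩⟩
    · simp at hu; omega
    · simp at hu; omega
    · rw [cup_apply_append, sect, List.append_assoc, List.cons_append, List.cons_append,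
        cup_apply_append]
      simp [sect]
  · rw [h1 u hu, h2 u hu]

theorem sect_gen {g : Gen} {n n' : ℕ} (h : g.Maps n n') {y : List Bool} {v : Vec}
    (hv : v ∈ homog (n + y.length)) : sect y (g.op v) = g.op (sect y v) := by
  cases g with
  | cup i => exact sect_cup hv h.1
  | cap i =>
    obtain ⟨hi, rfl⟩ := h
    exact sect_cap hv (by omega)
  | cross a b i =>
    obtain ⟨hi, rfl⟩ := h
    obtain ⟨m, rfl⟩ : ∃ m, n' = m + 2 := ⟨n' - 2, by omega⟩
    have hc : cap i v ∈ homog (m + y.length) := cap_mem_homog (by rwa [add_right_comm] at hv) i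
    have h1 := sect_cup hc (Nat.le_of_add_le_add_right hi)
    rw [sect_cap hv (by omega)] at h1
    simp only [Gen.op, crossOp, LinearMap.add_apply, LinearMap.smul_apply, Module.End.mul_apply]
    rw [← h1, long_eq_self hv (by omega), long_eq_self (sect_mem_homog hv) hi]
    rfl

theorem Gen.Maps.add_right {g : Gen} {n n' : ℕ} (h : g.Maps n n') (k : ℕ) :
    g.Maps (n + k) (n' + k) := by
  cases g <;> simp only [Gen.Maps] at h ⊢ <;> omega

/-- Operators applied to the first `n` factors do not touch the final letters, so these may be fixed
beforehand. This isolates the diagram from the closing strands on its right. -/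
theorem sect_opList {gs : List Gen} {n n' : ℕ} (h : GenChain n gs n') {y : List Bool} {v : Vec}
    (hv : v ∈ homog (n + y.length)) : sect y (opList gs v) = opList gs (sect y v) := by
  induction gs generalizing n v with
  | nil => rfl
  | cons g gs ih =>
    obtain ⟨m, hm, h⟩ := h
    rw [opList, Module.End.mul_apply, Module.End.mul_apply,
      ih h ((hm.add_right _).mem_homog hv), sect_gen hm hv]

/-- Vertical strands are added on both sides of a layer. -/
def Layer.pad (l r : List Bool) (L : Layer) : Layer := ⟨l ++ L.left, L.piece, L.right ++ r⟩

theorem cableLayer_pad (d : ℕ) (l r : List Bool) (L : Layer) : cableLayer d (L.pad l r) =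
    (cableLayer d L).map (Layer.pad (cableBoundary d l) (cableBoundary d r)) := by
  obtain ⟨l', p, r'⟩ := L
  cases p <;> simp [cableLayer, Layer.pad, cableBoundary_append, List.map_flatMap,
    Function.comp_def]

theorem flatMap_cableLayer_pad (d : ℕ) (l r : List Bool) (Ls : List Layer) :
    (Ls.map (Layer.pad l r)).flatMap (cableLayer d) =
      (Ls.flatMap (cableLayer d)).map (Layer.pad (cableBoundary d l) (cableBoundary d r)) := by
  simp only [List.flatMap_map, List.map_flatMap, cableLayer_pad]

theorem jonesOp_cons (L : Layer) (Ls : List Layer) :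
    jonesOp (L :: Ls) = jonesOp Ls * (L.gen (jonesCoef L)).op := rfl

theorem jonesOp_pad_right (r : List Bool) (Ls : List Layer) :
    jonesOp (Ls.map (Layer.pad [] r)) = jonesOp Ls := by
  induction Ls with
  | nil => rfl
  | cons L Ls ih =>
    rw [List.map_cons, jonesOp_cons, jonesOp_cons, ih]
    rfl

theorem cap_add (x u : List Bool) (i : ℕ) (v : Vec) :
    cap (x.length + i) v (x ++ u) = cap i (fun w => v (x ++ w)) u := by
  induction x generalizing v with
  | nil => simp
  | cons a x ih =>
    rw [List.length_cons, Nat.succ_add]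
    exact ih fun w => v (a :: w)

theorem cup_add (x u : List Bool) (i : ℕ) (v : Vec) :
    cup (x.length + i) v (x ++ u) = cup i (fun w => v (x ++ w)) u := by
  induction x generalizing v with
  | nil => simp
  | cons a x ih =>
    rw [List.length_cons, Nat.succ_add]
    exact ih fun w => v (a :: w)

theorem gen_pad (x l r : List Bool) (h : x.length = l.length) (L : Layer) (v : Vec) (u : List Bool) :
    ((L.pad l r).gen (jonesCoef (L.pad l r))).op v (x ++ u) =
      (L.gen (jonesCoef L)).op (fun w => v (x ++ w)) u := by
  obtain ⟨l', p, r'⟩ := L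
  rcases p with o | o | ⟨a, b, f⟩
  · simp only [Layer.gen, Layer.pad, Gen.op, List.length_append, ← h, cup_add]
  · simp only [Layer.gen, Layer.pad, Gen.op, List.length_append, ← h, cap_add]
  · simp only [Layer.gen, Layer.pad, Gen.op, List.length_append, ← h, crossOp, LinearMap.add_apply,
      LinearMap.smul_apply, Module.End.mul_apply, Pi.add_apply, Pi.smul_apply, cup_add, cap_add,
      long_apply, add_assoc, add_le_add_iff_left]
    rfl

/-- The counterpart for closing strands on the left: their spins are a fixed prefix `x`, and all
positions are shifted by its length. -/
theorem jonesOp_pad (x l r : List Bool) (h : x.length = l.length) (Ls : List Layer) (v : Vec)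
    (u : List Bool) : jonesOp (Ls.map (Layer.pad l r)) v (x ++ u) =
      jonesOp Ls (fun w => v (x ++ w)) u := by
  induction Ls generalizing v with
  | nil => rfl
  | cons L Ls ih =>
    rw [List.map_cons, jonesOp_cons, jonesOp_cons, Module.End.mul_apply, Module.End.mul_apply, ih]
    exact congrArg (fun V => jonesOp Ls V u) (funext fun w => gen_pad x l r h L v w)

theorem sum_words_succ' {A : Type*} [AddCommMonoid A] (k : ℕ) (g : List Bool → A) :
    ∑ w ∈ words (k + 1), g w = ∑ w ∈ words k, (g (w ++ [false]) + g (w ++ [true])) := by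
  induction k generalizing g with
  | zero => simp [words]
  | succ k ih =>
    rw [sum_words_succ, ih, sum_words_succ]
    refine Finset.sum_congr rfl fun w _ => ?_
    simp only [List.cons_append]
    abel

/-- The spins at the other ends of nested arcs. -/
def mirror (w : List Bool) : List Bool := (w.map not).reverse

@[simp] theorem mirror_mirror (w : List Bool) : mirror (mirror w) = w := by
  simp [mirror, List.map_reverse, Function.comp_def]

@[simp] theorem length_mirror (w : List Bool) : (mirror w).length = w.length := by simp [mirror]

theorem mirror_append_singleton (w : List Bool) (a : Bool) : mirror (w ++ [a]) = (!a) :: mirror w := by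
  simp [mirror]

theorem wt_mirror (w : List Bool) : wt (mirror w) = -wt w := by
  induction w with
  | nil => rfl
  | cons a w ih =>
    have h1 : mirror (a :: w) = mirror w ++ [!a] := by simp [mirror]
    have h2 : wt (a :: w) = wt [a] + wt w := wt_append [a] w
    rw [h1, wt_append, ih, h2]
    cases a <;> simp [wt]

/-- Nested maxima pair each spin with the opposite spin in the mirrored position; every arc whose
left end is down contributes T (-1). -/
theorem capsOp_zero_apply (d : ℕ) (v : Vec) : capsOp 0 d v [] =
    ∑ x ∈ words d, T (-(x.count false : ℤ)) * v (x ++ mirror x) := by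
  induction d generalizing v with
  | zero => simp [words, capsOp, mirror]
  | succ d ih =>
    rw [capsOp, Module.End.mul_apply, ih, sum_words_succ']
    refine Finset.sum_congr rfl fun x hx => ?_
    rw [zero_add, ← mem_words.mp hx, cap_apply_append, mul_add, ← mul_assoc, ← T_add,
      mirror_append_singleton, mirror_append_singleton]
    simp only [List.append_assoc, List.singleton_append, Bool.not_true, Bool.not_false,
      List.count_append, List.count_singleton]
    congr 3
    simp
    ring

theorem cupsOp_zero_apply (d : ℕ) {x y : List Bool} (hx : x.length = d) (hy : y.length = d) :
    cupsOp 0 d (basisVec []) (x ++ y) = if x = mirror y then T (x.count true) else 0 := by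
  induction d generalizing x y with
  | zero =>
    obtain rfl := List.eq_nil_of_length_eq_zero hx
    obtain rfl := List.eq_nil_of_length_eq_zero hy
    simp [cupsOp, basisVec, mirror]
  | succ d ih =>
    obtain ⟨x, a, rfl⟩ : ∃ z a, x = z ++ [a] :=
      (List.eq_nil_or_concat' x).resolve_left (by rintro rfl; simp at hx)
    rcases y with _ | ⟨b, y⟩
    · simp at hy
    replace hx : x.length = d := by simpa using hx
    replace hy : y.length = d := by simpa using hy
    have h : x ++ [a] = mirror (b :: y) ↔ x = mirror y ∧ a = !b := by
      have : mirror (b :: y) = mirror y ++ [!b] := by simp [mirror]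
      rw [this]
      simp
    rw [cupsOp, Module.End.mul_apply, zero_add, List.append_assoc, List.singleton_append,
      ← hx, cup_apply_append, hx, ih hx hy]
    simp only [h]
    by_cases hm : x = mirror y
    · rw [if_pos hm]
      have h1 : (T 1 * T ((mirror y).count true : ℤ) : ℤ[T;T⁻¹]) =
          T (((mirror y).count true : ℤ) + 1) := by rw [T_add, mul_comm]
      cases a <;> cases b <;> simp [cupCoef, hm, h1]
    · simp [hm]

theorem cupsOp_mem_homog (d : ℕ) : cupsOp 0 d (basisVec []) ∈ homog (d + d) := by
  induction d with
  | zero =>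
    intro w hw
    have : w ≠ [] := by rintro rfl; simp at hw
    simp [cupsOp, basisVec, this]
  | succ d ih =>
    rw [cupsOp, Module.End.mul_apply, show d + 1 + (d + 1) = d + d + 2 by ring]
    exact cup_mem_homog ih _

theorem sect_cupsOp (x : List Bool) : sect (mirror x) (cupsOp 0 x.length (basisVec [])) =
    (T (x.count true : ℤ) : ℤ[T;T⁻¹]) • basisVec x := by
  ext1 u
  by_cases hu : u.length = x.length
  · rw [sect, cupsOp_zero_apply _ hu (length_mirror x), mirror_mirror, Pi.smul_apply, basisVec,
      smul_eq_mul, mul_ite, mul_one, mul_zero]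
    split_ifs with h
    · rw [h]
    · rfl
  · have : u ≠ x := by rintro rfl; exact hu rfl
    rw [sect, cupsOp_mem_homog _ _ (by simpa using hu), Pi.smul_apply, basisVec, if_neg this,
      smul_zero]

theorem cupsOp_apply_append (x : List Bool) :
    (fun w => cupsOp 0 x.length (basisVec []) (x ++ w)) =
      (T (x.count true : ℤ) : ℤ[T;T⁻¹]) • basisVec (mirror x) := by
  ext1 u
  by_cases hu : u.length = x.length
  · have h : x = mirror u ↔ u = mirror x :=
      ⟨fun h => by rw [h, mirror_mirror], fun h => by rw [h, mirror_mirror]⟩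
    rw [cupsOp_zero_apply _ rfl hu, Pi.smul_apply, basisVec, smul_eq_mul, mul_ite, mul_one, mul_zero]
    simp only [h]
  · have : u ≠ mirror x := by rintro rfl; exact hu (length_mirror x)
    rw [cupsOp_mem_homog _ _ (by simpa using hu), Pi.smul_apply, basisVec, if_neg this,
      smul_zero]

/-- The sign of the exponents in the trace that belongs to a closure. -/
def sideSign : Side → ℤ
  | .left => -1
  | .right => 1

theorem sum_words_mirror (d : ℕ) (g : List Bool → ℤ[T;T⁻¹]) :
    ∑ w ∈ words d, g (mirror w) = ∑ w ∈ words d, g w :=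
  Finset.sum_nbij' mirror mirror (fun w hw => by simpa [mem_words] using hw)
    (fun w hw => by simpa [mem_words] using hw) (fun w _ => mirror_mirror w)
    (fun w _ => mirror_mirror w) fun w _ => rfl

theorem composable_pad {a b : List Bool} {Ls : List Layer} (h : Composable a Ls b)
    (l r : List Bool) : Composable (l ++ a ++ r) (Ls.map (Layer.pad l r)) (l ++ b ++ r) := by
  induction Ls generalizing a with
  | nil =>
    obtain rfl : a = b := h
    rfl
  | cons L Ls ih =>
    obtain ⟨rfl, h⟩ := h
    refine ⟨by simp [Layer.pad, Layer.dom], ?_⟩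
    have := ih h
    simpa [Layer.pad, Layer.cod] using this

/-- The vertical strands added by a closure. -/
def sidePad : Side → Layer → Layer
  | .left => Layer.pad [false] []
  | .right => Layer.pad [] [false]

/-- The direction of the left leg of the minimum of a closure. -/
def sideDir : Side → Bool
  | .left => false
  | .right => true

theorem closure_eq (D : Diagram) (s : Side) : D.closure s = ⟨[], [⟨[], .cup (sideDir s), []⟩] ++
    D.layers.map (sidePad s) ++ [⟨[], .cap (sideDir s), []⟩]⟩ := by
  cases s
  · simp [Diagram.closure, sidePad, sideDir, Layer.pad]
  · simp [Diagram.closure, sidePad, sideDir, Layer.pad]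

variable {D : Diagram} (hb : D.bottom = [true]) (hL : Composable D.bottom D.layers [true])
include hb hL

theorem composable_closure (s : Side) :
    Composable (D.closure s).bottom (D.closure s).layers [] := by
  rw [closure_eq]
  rw [hb] at hL
  cases s
  · refine Composable.append (b := [false, true]) ?_ (by simp [Composable, Layer.dom, Layer.cod,
      Piece.dom, Piece.cod, sideDir])
    exact Composable.append (b := [false, true]) (by simp [Composable, Layer.dom, Layer.cod,
      Piece.dom, Piece.cod, sideDir]) (composable_pad hL [false] [])
  · refine Composable.append (b := [true, false]) ?_ (by simp [Composable, Layer.dom, Layer.cod,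
      Piece.dom, Piece.cod, sideDir])
    exact Composable.append (b := [true, false]) (by simp [Composable, Layer.dom, Layer.cod,
      Piece.dom, Piece.cod, sideDir]) (composable_pad hL [] [false])

/-- Nested minima contribute q to the number of spins up and nested maxima q⁻¹ to the number of
spins down among the left legs, so together q to the weight of the left word. If the closing strands
are on the right, that word belongs to the diagram and the weight is that of the traced word. -/
theorem jones_cable_closure (d : ℕ) (s : Side) : jones (cable d (D.closure s)) =
    wordTrace (sideSign s) (jonesOp (cable d D).layers) d := by
  have h1 := (composable_closure hb hL s).cable d
  have hc : GenChain d (gensOf (((cable d D).layers).map jonesCoef) (cable d D).layers) d := by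
    have := genChain_of_composable (hL.cable d) (Xs := ((cable d D).layers).map jonesCoef) (by
      simp [cable])
    rw [hb] at this
    simpa [length_cableBoundary, cable] using this
  rw [jones_eq (by rw [closure_eq]; rfl) h1]
  have h2 : jonesOp (cable d (D.closure s)).layers = capsOp 0 d *
      jonesOp ((D.layers.map (sidePad s)).flatMap (cableLayer d)) * cupsOp 0 d := by
    rw [closure_eq, cable]
    simp only [List.flatMap_append, jonesOp_append, List.flatMap_singleton, jonesOp_cableLayer]
    simp [Piece.cableOp, mul_assoc]
  rw [h2, Module.End.mul_apply, Module.End.mul_apply, capsOp_zero_apply]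
  cases s
  -- For the closure on the left, the left word belongs to the closing strands and the diagram
  -- carries its mirror image, which reverses the sign of the weight.
  · refine Eq.trans ?_ (sum_words_mirror d fun w =>
      T (sideSign .left * wt w) * jonesOp (cable d D).layers (basisVec w) w)
    refine Finset.sum_congr rfl fun x hx => ?_
    have hx := mem_words.mp hx
    simp only [sidePad, flatMap_cableLayer_pad]
    rw [jonesOp_pad x _ _ (by simp [length_cableBoundary, hx]), ← hx, cupsOp_apply_append, map_smul,
      Pi.smul_apply, smul_eq_mul, ← mul_assoc, ← T_add, wt_mirror, hx]
    congr 2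
    simp [sideSign, wt]
    ring
  · rw [wordTrace]
    refine Finset.sum_congr rfl fun x hx => ?_
    have hx := mem_words.mp hx
    simp only [sidePad, flatMap_cableLayer_pad]
    have h3 := sect_opList hc (y := mirror x) (v := cupsOp 0 d (basisVec []))
      (by rw [length_mirror, hx]; exact cupsOp_mem_homog d)
    have h4 := congrFun h3 x
    have h5 := sect_cupsOp x
    rw [hx] at h5
    rw [h5, map_smul, Pi.smul_apply, smul_eq_mul] at h4
    have h6 : jonesOp ((D.layers.flatMap (cableLayer d)).map
        (Layer.pad (cableBoundary d []) (cableBoundary d [false]))) =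
        jonesOp (cable d D).layers := jonesOp_pad_right _ _
    rw [h6]
    refine (congrArg _ h4).trans ?_
    rw [← mul_assoc, ← T_add]
    congr 2
    simp [sideSign, wt]
    ring

end

section
open Diagram

/-! ### The scalar of a 1-string link -/

/-- The normalized sum over the simple families of cycles. -/
noncomputable def walkInvariant (D : Diagram) (m : Model) : ℤ[T;T⁻¹] :=
  tHalfPow (D.writhe - modelSign m * D.rot) *
    (1 + ∑ c ∈ D.simpleFamilies m, tPow (modelSign m * rotFamily c - beta c) * weight m c)

section Scalar

variable {D : Diagram} (hb : D.bottom = [true]) (hL : Composable D.bottom D.layers [true])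

include hb in
theorem cable_bottom (d : ℕ) : (cable d D).bottom = List.replicate d true := by
  simp [cable, cableBoundary, hb]

include hL in
theorem composable_cable (d : ℕ) :
    Composable (cable d D).bottom (cable d D).layers (List.replicate d true) := by
  simpa [cable, cableBoundary] using hL.cable d

include hb hL

/-- The scalar is read off at the constant word belonging to the model, where it is the normalized
walk sum. Both models therefore give the same value. -/
theorem jonesOp_cable_eq_smul (d : ℕ) (m : Model) {v : Vec} (hv : v ∈ symm d) :
    jonesOp (cable d D).layers v = walkInvariant (cable d D) m • v := by
  have hc := composable_cable hL d
  have hg := genChain_of_composable hc (Xs := (cable d D).layers.map jonesCoef) (by simp)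
  rw [cable_bottom hb, List.length_replicate] at hg
  obtain ⟨c, h⟩ := hg.exists_scalar
  rw [walkInvariant, tHalfPow_mul_walkSum (cable_bottom hb d) hc]
  have h1 := h _ (basisVec_replicate_mem_symm d (restLabel m))
  have h2 : jonesOp (cable d D).layers (basisVec (List.replicate d (restLabel m)))
      (List.replicate d (restLabel m)) = c := by
    rw [jonesOp, h1]
    simp [basisVec]
  rw [h2]
  exact h v hv

/-- On a single strand there is nothing to contract, so both basis vectors lie in `symm 1` and the
weighted trace is q + q⁻¹ times the scalar. No assumption on the writhe or on the number of
components is needed here. -/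
theorem jones_closure (s : Side) (m : Model) : jones (D.closure s) = 
    (T 1 + T (-1)) * walkInvariant D m := by
  have h1 := jones_cable_closure hb hL 1 s
  have h2 := fun o => jonesOp_cable_eq_smul hb hL 1 m (basisVec_replicate_mem_symm 1 o)
  rw [cable_one] at h1
  simp only [cable_one, List.replicate_one] at h1 h2
  rw [h1, wordTrace, sum_words_succ]
  simp only [words, Finset.sum_singleton, h2, Pi.smul_apply, smul_eq_mul]
  cases s <;> simp [basisVec, wt, sideSign] <;> ring

end Scalar

/-- The cables of the closure are closures of cables, so the colored polynomial is an alternating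
sum of weighted traces. That sum is the trace on the symmetric power, where the operator is scalar
and the weights add up to the quantum integer. -/
theorem coloredJones_closure {D : Diagram} (hD : D.IsStringLink) (hw : D.writhe = 0) (s : Side)
    (d : ℕ) (m : Model) : coloredJones d (D.closure s) = quantumInt (d + 1) *
    walkInvariant (cable d D) m := by
  have h := sum_wordTrace (M := fun n => jonesOp (cable n D).layers)
    (fun n i hi v hv => cap_jonesOp_cable hD hw hi hv) (sideSign s) d
    (fun v hv => jonesOp_cable_eq_smul hD.1 hD.2.1 d m hv)
  rw [sum_T_eq_quantumInt d (by cases s <;> simp [sideSign]), mul_comm] at h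
  rw [← h, coloredJones]
  simp only [jones_cable_closure hD.1 hD.2.1]

end

end KnotWalk

open KnotWalk KnotWalk.Diagram LaurentPolynomial in
theorem theorem2p6 (D : Diagram) (hD : D.IsStringLink) (s : Side) :
    (jones (D.closure s) = (T 1 + T (-1)) * (tHalfPow (D.writhe - D.rot) *
        (1 + ∑ c ∈ D.simpleFamilies .up, tPow (rotFamily c - beta c) * weight .up c)) ∧
      jones (D.closure s) = (T 1 + T (-1)) * (tHalfPow (D.writhe + D.rot) *
        (1 + ∑ c ∈ D.simpleFamilies .down, tPow (-(rotFamily c + beta c)) * weight .down c))) ∧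
    (D.writhe = 0 → ∀ d : ℕ,
      coloredJones d (D.closure s) = quantumInt (d + 1) *
        (tHalfPow ((cable d D).writhe - (cable d D).rot) *
          (1 + ∑ c ∈ (cable d D).simpleFamilies .up,
            tPow (rotFamily c - beta c) * weight .up c)) ∧
      coloredJones d (D.closure s) = quantumInt (d + 1) *
        (tHalfPow ((cable d D).writhe + (cable d D).rot) *
          (1 + ∑ c ∈ (cable d D).simpleFamilies .down,
            tPow (-(rotFamily c + beta c)) * weight .down c))) := by
  have h1 := fun m => jones_closure hD.1 hD.2.1 s m
  have h2 := fun hw d m => coloredJones_closure hD hw s d m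
  have e : ∀ a b : ℤ, -1 * a - b = -(a + b) := fun a b => by ring
  have e' : ∀ a b : ℤ, a - -1 * b = a + b := fun a b => by ring
  refine ⟨⟨?_, ?_⟩, fun hw d => ⟨?_, ?_⟩⟩
  · simpa only [walkInvariant, modelSign, one_mul] using h1 .up
  · simpa only [walkInvariant, modelSign, e, e'] using h1 .down
  · simpa only [walkInvariant, modelSign, one_mul] using h2 hw d .up
  · simpa only [walkInvariant, modelSign, e, e'] using h2 hw d .down
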